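/- **Setting.** Let $V$ be a real polynomial with $V''\ge c_u>0$ on $\mathbb R$, let $\beta>0$, $0<\varepsilon<1$ and $0<\delta<1/2$. Let $(A,B)=(A_1,\dots,A_n,B_1,\dots,B_{n-1})$, $B_k>0$, be random with law $\mu$ whose density is proportional to $e^{-n\beta H(a,b)}$, where $$H(a,b)=\operatorname{tr}V(T(a,b))-\sum_{k=1}^{n-1}\Big(1-\frac kn-\frac1{n\beta}\Big)\log b_k$$ and $T(a,b)$ is the symmetric tridiagonal matrix with diagonal $a$ and off-diagonal $b$. Let $(a^\dagger(x),b^\dagger(x))$ be the minimizer over $a\in\mathbb R$, $b>0$ of $[1]V(a+b(z+1/z))-(1-x)\log b$, where $[1]$ denotes the constant term of a Laurent polynomial in $z$, and put $(a_k^\dagger,b_k^\dagger)=(a^\dagger,b^\dagger)\big(\tfrac kn+\tfrac1{n\beta}\big)$. For an interval $I$ of indices let $\partial I$ be the union of the stretches of $(\deg V)/2$ indices immediately before and after $I$, and let $Q=(A_i,B_i)_{i\in\partial I}$. For a value $q$ of $Q$ let $H_q$ be the Hamiltonian as a function of $(a_i,b_i)_{i\in I}$ given the boundary values $q$ (defined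 up to an additive constant), let $(a^{(q)},b^{(q)})$ be its minimizer, i.e. the maximizer of the conditional density of $(A_i,B_i)_{i\in I}$ given $Q=q$, and let $\nu_q$ be the Gaussian measure with mean $(a^{(q)},b^{(q)})$ and inverse covariance matrix $n\beta\operatorname{Hess}H_q(a^{(q)},b^{(q)})$. For $K>0$ let $\mathcal Q_K$ be the set of $q$ with $|a_i-a_i^\dagger|+|b_i-b_i^\dagger|\le Kn^{\delta-1/2}$ for all $i\in\partial I$. Fix any $q_0\in\mathcal Q_K$, let $Q'=Q$ if $Q\in\mathcal Q_K$ and $Q'=q_0$ otherwise, and put $\nu_I=\mathbf E\,\nu_{Q'}$. Let $\mu_I$ be the marginal law of $(A_i,B_i)_{i\in I}$. **Proposition.** There is a constant $c_0>0$ such that the following holds for nonempty intervals $I\subset\{c_0\log n,\dots,(1-\varepsilon)n\}$ with at most $n^{1/2-\varepsilon}$ elements. All constants depend only on $V,\beta,\varepsilon,\delta$. 1. For every $K>0$, as $n\to\infty$, $\operatorname{dist}_{TV}(\mu_I,\nu_I)=o(1)$, uniformly in $I$ and in $q_0\in\mathcal Q_K$. 2. If moreover $\delta<\varepsilon/3$,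 there are constants $c,C,c_1,\delta'>0$ such that, for the event $$S=\Big\{|A_i|\le c,\ \tfrac1c\le B_i\le c\ \ (1\le i\le(1-\varepsilon)n)\Big\}\cap\big\{Q\in\mathcal Q_c\big\}\cap\Big\{\max_{i\in I}\big(|A_i-a_i^{(Q)}|+|B_i-b_i^{(Q)}|\big)<cn^{\delta-1/2}\Big\},$$ (a) $\mu(S)\ge1-Ce^{-n^{\delta'}/C}$ for all $n$ and $I$; (b) on $S$, for all $n$, $I$ and all $j\in I$, $$|a_j^{(Q)}-a_j^\dagger|+|b_j^{(Q)}-b_j^\dagger|\le C\max\Big(n^{\delta-1/2}e^{-c_1\operatorname{dist}(j,\partial I)},\frac{(\log n)^2}n\Big);$$ (c) for every sufficiently large constant $K$, as $n\to\infty$, $\nu_I$ is absolutely continuous with respect to $\mu_I$ on the set of values that $(A_i,B_i)_{i\in I}$ takes on $S$, and for $\mu$-almost every point of $S$ the Radon–Nikodym derivative $\frac{d\nu_I}{d\mu_I}$ at $(A_i,B_i)_{i\in I}$ is $1+o(1)$, uniformly in $I$ and in $q_0\in\mathcal Q_K$. -/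

import Mathlib

open MeasureTheory Filter Topology Polynomial
open scoped ENNReal

noncomputable section

namespace DysonBeta

/-! ### General notions -/

/-- The probability measure whose density with respect to Lebesgue measure is proportional
to `f` (when `f` has a finite positive integral). -/
def normalized {E : Type*} [MeasureSpace E] (f : E → ℝ≥0∞) : Measure E :=
  (∫⁻ x, f x)⁻¹ • (volume : Measure E).withDensity f

/-- Total variation distance of two probability measures: the supremum of `|μ D - ν D|`
over all measurable sets `D`. -/
def tvDist {E : Type*} [MeasurableSpace E] (μ ν : Measure E) : ℝ :=
  ⨆ D : {D : Set E // MeasurableSet D}, |μ.real D.1 - ν.real D.1|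

/-! ### The tridiagonal model -/

/-- The symmetric tridiagonal `n × n` matrix with diagonal `a 1, …, a n` and
off-diagonal `b 1, …, b (n-1)`. -/
def jacobi (n : ℕ) (a b : ℕ → ℝ) : Matrix (Fin n) (Fin n) ℝ :=
  Matrix.of fun i j =>
    if i = j then a (i + 1)
    else if (i : ℕ) + 1 = j then b (i + 1)
    else if (j : ℕ) + 1 = i then b (j + 1)
    else 0

/-- The coefficient `1 - k/n - 1/(nβ)`. -/
def logCoeff (β : ℝ) (n k : ℕ) : ℝ := 1 - (k : ℝ) / n - 1 / (n * β)

/-- The Hamiltonian `H(a,b) = tr V(T(a,b)) - ∑_{k=1}^{n-1} (1 - k/n - 1/(nβ)) log b_k`. -/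
def hamiltonian (V : ℝ[X]) (β : ℝ) (n : ℕ) (a b : ℕ → ℝ) : ℝ :=
  (aeval (jacobi n a b) V).trace
    - ∑ k ∈ Finset.Icc 1 (n - 1), logCoeff β n k * Real.log (b k)

/-- The space of entries `((a_1,…,a_n), (b_1,…,b_{n-1}))`. -/
abbrev Field (n : ℕ) : Type := (Fin n → ℝ) × (Fin (n - 1) → ℝ)

/-- The entry `a_k`, for `1 ≤ k ≤ n` (and `0` for other indices). -/
def entA {n : ℕ} (ω : Field n) (k : ℕ) : ℝ :=
  if h : 1 ≤ k ∧ k ≤ n then ω.1 ⟨k - 1, by omega⟩ else 0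

/-- The entry `b_k`, for `1 ≤ k ≤ n - 1` (and `0` for other indices). -/
def entB {n : ℕ} (ω : Field n) (k : ℕ) : ℝ :=
  if h : 1 ≤ k ∧ k ≤ n - 1 then ω.2 ⟨k - 1, by omega⟩ else 0

open Classical in
/-- The law of `(A,B)`: density proportional to `exp (-nβ H(a,b))` on
`{b_1 > 0, …, b_{n-1} > 0}`. -/
def law (V : ℝ[X]) (β : ℝ) (n : ℕ) : Measure (Field n) :=
  normalized fun ω =>
    if ∀ k, 0 < ω.2 k then
      ENNReal.ofReal (Real.exp (-(n * β * hamiltonian V β n (entA ω) (entB ω))))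
    else 0

/-! ### Intervals, boundaries, restrictions -/

/-- Configurations `(a_i, b_i)_{i ∈ J}` on a set `J` of indices. -/
abbrev Config (J : Finset ℕ) : Type := J → ℝ × ℝ

/-- The configuration `(a_i, b_i)_{i ∈ J}` of a field. -/
def restr {n : ℕ} (J : Finset ℕ) (ω : Field n) : Config J := fun i => (entA ω i, entB ω i)

/-- `∂I` for `I = {l, …, r}`: the stretches of length `(deg V)/2` immediately before and
after `I`. -/
def bdry (V : ℝ[X]) (n l r : ℕ) : Finset ℕ :=
  (Finset.Icc 1 n).filter fun k =>
    k ∉ Finset.Icc l r ∧ l ≤ k + V.natDegree / 2 ∧ k ≤ r + V.natDegree / 2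

/-- The intervals `I = {l, …, r} ⊂ {c₀ log n, …, (1-ε)n}` with at most `n^{1/2-ε}` elements. -/
def Admissible (c₀ ε : ℝ) (n l r : ℕ) : Prop :=
  1 ≤ l ∧ l ≤ r ∧ c₀ * Real.log n ≤ l ∧ (r : ℝ) ≤ (1 - ε) * n ∧
    ((Finset.Icc l r).card : ℝ) ≤ (n : ℝ) ^ (1 / 2 - ε)

/-! ### Local minimizers -/

/-- `W(a,b)`: the constant term of the Laurent polynomial `V(a + b(z + 1/z))`. -/
def localW (V : ℝ[X]) (a b : ℝ) : ℝ :=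
  (aeval (LaurentPolynomial.C a + LaurentPolynomial.C b *
    (LaurentPolynomial.T 1 + LaurentPolynomial.T (-1))) V : LaurentPolynomial ℝ).coeff 0

/-- `(a†(x), b†(x))`: the minimizer of `W(a,b) - (1-x) log b` over `a ∈ ℝ`, `b > 0`. -/
def localMin (V : ℝ[X]) (x : ℝ) : ℝ × ℝ :=
  Classical.epsilon fun p : ℝ × ℝ => 0 < p.2 ∧ ∀ p' : ℝ × ℝ, 0 < p'.2 →
    localW V p.1 p.2 - (1 - x) * Real.log p.2 ≤ localW V p'.1 p'.2 - (1 - x) * Real.log p'.2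

/-- `(a†_k, b†_k) = (a†, b†)(k/n + 1/(nβ))`. -/
def dagger (V : ℝ[X]) (β : ℝ) (n k : ℕ) : ℝ × ℝ :=
  localMin V ((k : ℝ) / n + 1 / (n * β))

/-! ### The conditional Hamiltonian and its Gaussian approximation -/

/-- The conditional Hamiltonian `H_q` on `I = {l, …, r}` given boundary values `q` on `∂I`:
the Hamiltonian evaluated with the values `x` on `I` and `q` on `∂I`.  The values elsewhere
(here `a = 0`, `b = 1`) only enter through an additive constant, because every monomial of
`tr V(T)` containing a variable with index in `I` involves only indices in `I ∪ ∂I`. -/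
def condH (V : ℝ[X]) (β : ℝ) (n l r : ℕ) (q : Config (bdry V n l r))
    (x : Config (Finset.Icc l r)) : ℝ :=
  let v : ℕ → ℝ × ℝ := fun k =>
    if h : k ∈ Finset.Icc l r then x ⟨k, h⟩
    else if h' : k ∈ bdry V n l r then q ⟨k, h'⟩
    else (0, 1)
  hamiltonian V β n (fun k => (v k).1) (fun k => (v k).2)

/-- The conditional minimizer `(a^{(q)}, b^{(q)})`: the minimizer of `H_q` over
`a_i ∈ ℝ`, `b_i > 0`, `i ∈ I`; equivalently the maximizer of the conditional density, which is
proportional to `exp (-nβ H_q)`. -/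
def condMin (V : ℝ[X]) (β : ℝ) (n l r : ℕ) (q : Config (bdry V n l r)) :
    Config (Finset.Icc l r) :=
  Classical.epsilon fun x => (∀ i, 0 < (x i).2) ∧
    ∀ x' : Config (Finset.Icc l r), (∀ i, 0 < (x' i).2) →
      condH V β n l r q x ≤ condH V β n l r q x'

/-- The Gaussian measure `ν_q` on `(a_i, b_i)_{i ∈ I}` with mean `m = (a^{(q)}, b^{(q)})` and
inverse covariance `nβ Hess H_q (m)`, given by its density, proportional to
`exp (-(nβ/2) ⟨x - m, Hess H_q (m) (x - m)⟩)`. -/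
def nuCond (V : ℝ[X]) (β : ℝ) (n l r : ℕ) (q : Config (bdry V n l r)) :
    Measure (Config (Finset.Icc l r)) :=
  let m := condMin V β n l r q
  normalized fun x => ENNReal.ofReal (Real.exp
    (-(n * β / 2 * iteratedFDeriv ℝ 2 (condH V β n l r q) m fun _ => x - m)))

/-- The set `𝒬` of boundary conditions that are `K n^{δ-1/2}`-close to the local minimizers. -/
def goodBdry (V : ℝ[X]) (β δ K : ℝ) (n l r : ℕ) : Set (Config (bdry V n l r)) :=
  {q | ∀ i, |(q i).1 - (dagger V β n i).1| + |(q i).2 - (dagger V β n i).2|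
    ≤ K * (n : ℝ) ^ (δ - 1 / 2)}

/-- `μ_I`: the marginal law of `(A_i, B_i)_{i ∈ I}`. -/
def muI (V : ℝ[X]) (β : ℝ) (n l r : ℕ) : Measure (Config (Finset.Icc l r)) :=
  (law V β n).map (restr (Finset.Icc l r))

open Classical in
/-- `ν_I = E ν_{Q'}`: here `Q = (A_i, B_i)_{i ∈ ∂I}` is random with its marginal law,
and `Q' = Q` if `Q ∈ 𝒬` and `Q' = q₀` otherwise. -/
def nuI (V : ℝ[X]) (β δ K : ℝ) (n l r : ℕ) (q₀ : Config (bdry V n l r)) :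
    Measure (Config (Finset.Icc l r)) :=
  ((law V β n).map (restr (bdry V n l r))).bind fun q =>
    nuCond V β n l r (if q ∈ goodBdry V β δ K n l r then q else q₀)

/-- The event `S` with constant `c`, for `I = {l, …, r}`: the entries with indices in
`1, …, (1-ε)n` are bounded, the `b`'s among them are bounded below, the boundary values `Q`
on `∂I` are `c n^{δ-1/2}`-close to the local minimizers, and the entries on `I` are
`c n^{δ-1/2}`-close to the conditional minimizers. -/
def eventS (V : ℝ[X]) (β ε δ c : ℝ) (n l r : ℕ) : Set (Field n) :=
  {ω | (∀ i : ℕ, 1 ≤ i → (i : ℝ) ≤ (1 - ε) * n →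
          |entA ω i| ≤ c ∧ 1 / c ≤ entB ω i ∧ entB ω i ≤ c) ∧
       restr (bdry V n l r) ω ∈ goodBdry V β δ c n l r ∧
       ∀ i : Finset.Icc l r,
          |entA ω i - (condMin V β n l r (restr (bdry V n l r) ω) i).1|
            + |entB ω i - (condMin V β n l r (restr (bdry V n l r) ω) i).2|
          < c * (n : ℝ) ^ (δ - 1 / 2)}

end DysonBeta

end

set_option linter.unusedSectionVars false
set_option linter.unusedSimpArgs false

namespace DysonBeta

open Finset (Icc sum_congr mem_Icc mul_sum sum_le_sum range sum_add_distrib Ioc sum_nonneg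
  mem_filter single_le_sum sum_mul mem_Ioc mem_univ sum_sub_distrib sum_comm sum_const Ico
  mem_range sum_eq_zero mem_union sum_le_card_nsmul sum_coe_sort card_le_card
  Icc_subset_Icc_right sum_neg_distrib sum_sdiff sum_filter abs_sum_le_sum_abs mem_Ico card_univ
  sum_insert sum_singleton mem_singleton sum_div sum_ite_eq' subset_univ prod_nonneg
  card_union_le prod_eq_single measurableSet_biInter sum_pair sum_range
  sum_le_sum_of_subset_of_nonneg sum_image sum_subset coe_filter card_range univ_unique
  prod_eq_one card_le_one range_eq_Ico)
open ENNReal (ofReal ofReal_le_ofReal ofReal_mul ofReal_add ofReal_ne_top ofReal_natCast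
  ofReal_one toReal_mono toReal_ofReal mul_ne_top one_ne_top add_ne_top ofReal_prod_of_nonneg
  le_of_add_le_add_right inv_mul_le_one)
open Real (exp log exp_pos exp_add exp_le_exp cos rpow_one sqrt_nonneg abs_le_sqrt exp_sum
  norm_eq_abs rpow_mul rpow_add measurable_exp exp_le_one_iff add_one_le_exp exp_nat_mul log_mul
  exp_zero)
open Matrix (diagonal trace_mul_comm trace_sum trace_smul trace_sub smul_mul trace trace_diagonal
  trace_add diagonal_mul_diagonal single diag_apply mul_diagonal transpose_apply of_apply
  isSymm_diagonal trace_mul_single diag single_apply diagonal_mul)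
open Set (univ ofPred_forall inter_subset_left Ioi mem_iUnion indicator_of_mem inter_comm)

local postfix:max "ᵈ" => Polynomial.derivative
local notation "𝔪[" β "]" => condMin _ β _ _ _
local notation "ℋ[" β "]" => condH _ β _ _ _
local notation "γ[" β "]" => nuCond _ β _ _ _

/-! ### Divided differences of matrix polynomials -/

section MatrixCalculus

variable {ι : Type*} [Fintype ι] [DecidableEq ι]

/-- The divided difference of the polynomial `U` at the matrices `A`, `B` in the direction `Y`. -/
noncomputable def ddMat (U : ℝ[X]) (A B Y : Matrix ι ι ℝ) : Matrix ι ι ℝ :=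
  ∑ m ∈ range (U.natDegree + 1), U.coeff m • ∑ s ∈ range m, A ^ s * Y * B ^ (m - 1 - s)

/-- The divided difference of the polynomial `U` at two real numbers. -/
noncomputable def ddNum (U : ℝ[X]) (x y : ℝ) : ℝ := ∑ m ∈ range (U.natDegree + 1),
    U.coeff m * ∑ s ∈ range m, x ^ s * y ^ (m - 1 - s)

lemma pow_sub_pow_telescope (A B : Matrix ι ι ℝ) (m : ℕ) :
    A ^ m - B ^ m = ∑ s ∈ range m, A ^ s * (A - B) * B ^ (m - 1 - s) := by
  induction m with
  | zero => simp
  | succ m ih =>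
    rw [Finset.sum_range_succ]
    have : ∑ s ∈ range m, A ^ s * (A - B) * B ^ (m + 1 - 1 - s)
        = (∑ s ∈ range m, A ^ s * (A - B) * B ^ (m - 1 - s)) * B := by
      rw [sum_mul]
      refine sum_congr rfl fun s hs => ?_
      rw [mem_range] at hs
      rw [mul_assoc _ (B ^ _) B, ← pow_succ]
      congr 2
      omega
    rw [this, ← ih]
    simp only [pow_succ, add_tsub_cancel_right, tsub_self, pow_zero, mul_one]
    noncomm_ring

lemma aeval_eq_sum (U : ℝ[X]) (A : Matrix ι ι ℝ) :
    aeval A U = ∑ m ∈ range (U.natDegree + 1), U.coeff m • A ^ m :=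
  aeval_eq_sum_range A

lemma aeval_sub_aeval (U : ℝ[X]) (A B : Matrix ι ι ℝ) :
    aeval A U - aeval B U = ddMat U A B (A - B) := by
  simp only [aeval_eq_sum, ddMat, ← sum_sub_distrib, ← smul_sub, pow_sub_pow_telescope]

lemma ddMat_smul (U : ℝ[X]) (A B Y : Matrix ι ι ℝ) (t : ℝ) :
    ddMat U A B (t • Y) = t • ddMat U A B Y := by
  simp only [ddMat, Finset.smul_sum, smul_comm t, Matrix.mul_smul, smul_mul]

lemma ddMat_add (U : ℝ[X]) (A B Y Y' : Matrix ι ι ℝ) :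
    ddMat U A B (Y + Y') = ddMat U A B Y + ddMat U A B Y' := by
  simp only [ddMat, ← sum_add_distrib, ← smul_add, mul_add, add_mul]

lemma ddMat_sum {κ : Type*} (U : ℝ[X]) (A B : Matrix ι ι ℝ) (s : Finset κ) (Y : κ → Matrix ι ι ℝ) :
    ddMat U A B (∑ k ∈ s, Y k) = ∑ k ∈ s, ddMat U A B (Y k) := by
  classical
  induction s using Finset.induction_on with
  | empty => simp [ddMat]
  | insert a s ha ih => rw [sum_insert ha, sum_insert ha, ddMat_add, ih]

lemma trace_mul_ddMat (U : ℝ[X]) (A B X Y : Matrix ι ι ℝ) :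
    (X * ddMat U A B Y).trace = ∑ m ∈ range (U.natDegree + 1),
      U.coeff m * ∑ s ∈ range m, (X * (A ^ s * Y * B ^ (m - 1 - s))).trace := by
  simp only [ddMat, mul_sum, trace_sum, Matrix.mul_smul, trace_smul, smul_eq_mul]

lemma trace_mul_ddMat_comm (U : ℝ[X]) {A B X Y : Matrix ι ι ℝ} (hA : A.IsSymm) (hB : B.IsSymm)
    (hX : X.IsSymm) (hY : Y.IsSymm) :
    (X * ddMat U A B Y).trace = (Y * ddMat U A B X).trace := by
  rw [trace_mul_ddMat, trace_mul_ddMat]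
  refine sum_congr rfl fun m _ => ?_
  congr 1
  refine sum_congr rfl fun s _ => ?_
  rw [← Matrix.trace_transpose]
  simp only [Matrix.transpose_mul, Matrix.transpose_pow, hA.eq, hB.eq, hX.eq, hY.eq]
  rw [trace_mul_comm, ← trace_mul_comm (A ^ s * X * B ^ _) Y]
  simp only [← mul_assoc]
  rw [trace_mul_comm, ← mul_assoc, ← mul_assoc, trace_mul_comm, ← mul_assoc, ← mul_assoc]

lemma ddNum_mul (U : ℝ[X]) (x y : ℝ) : ddNum U x y * (x - y) = U.eval x - U.eval y := by
  simp only [ddNum, eval_eq_sum_range, ← sum_sub_distrib, sum_mul, ← mul_sub]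
  refine sum_congr rfl fun m _ => ?_
  rw [mul_assoc, Commute.geom_sum₂_mul (Commute.all x y)]

lemma ddNum_self (U : ℝ[X]) (x : ℝ) : ddNum U x x = Uᵈ.eval x := by
  rw [ddNum, derivative_eval, Polynomial.sum_over_range _ (by simp)]
  refine sum_congr rfl fun m _ => ?_
  rw [mul_assoc]
  congr 1
  rw [sum_congr rfl (g := fun _ => x ^ (m - 1)), sum_const, card_range, nsmul_eq_mul]
  intro s hs
  rw [mem_range] at hs
  rw [← pow_add]
  congr 1
  omega

lemma le_ddNum {U : ℝ[X]} {c : ℝ} (hU : ∀ x, c ≤ Uᵈ.eval x) (x y : ℝ) : c ≤ ddNum U x y := by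
  rcases eq_or_ne x y with rfl | hxy
  · rw [ddNum_self]; exact hU x
  have key : ∀ x y : ℝ, x < y → c * (y - x) ≤ U.eval y - U.eval x := fun x y h =>
    Convex.mul_sub_le_image_sub_of_le_deriv (D := univ) convex_univ
      U.continuous.continuousOn U.differentiable.differentiableOn
      (fun z _ => by rw [Polynomial.deriv]; exact hU z) x trivial y trivial h.le
  have h := ddNum_mul U x y
  rcases lt_or_gt_of_ne hxy with h' | h'
  · have := key x y h'
    nlinarith
  · have := key y x h'
    nlinarith

lemma exists_spectral {A : Matrix ι ι ℝ} (hA : A.IsSymm) :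
    ∃ (P : Matrix ι ι ℝ) (d : ι → ℝ), P * P.transpose = 1 ∧ P.transpose * P = 1 ∧
      A = P * diagonal d * P.transpose := by
  have hH : A.IsHermitian := by
    rw [Matrix.IsHermitian, Matrix.conjTranspose_eq_transpose_of_trivial]; exact hA
  have hU := hH.eigenvectorUnitary.2
  rw [Matrix.mem_unitaryGroup_iff] at hU
  have hU' := Matrix.mem_unitaryGroup_iff'.1 hH.eigenvectorUnitary.2
  refine ⟨hH.eigenvectorUnitary, hH.eigenvalues, ?_, ?_, ?_⟩
  · rwa [Matrix.star_eq_conjTranspose, Matrix.conjTranspose_eq_transpose_of_trivial] at hU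
  · rwa [Matrix.star_eq_conjTranspose, Matrix.conjTranspose_eq_transpose_of_trivial] at hU'
  · have := hH.spectral_theorem
    rw [Unitary.conjStarAlgAut_apply] at this
    rw [Matrix.star_eq_conjTranspose, Matrix.conjTranspose_eq_transpose_of_trivial] at this
    exact this

lemma spectral_pow {P : Matrix ι ι ℝ} (h : P.transpose * P = 1) (h' : P * P.transpose = 1)
    (d : ι → ℝ) (s : ℕ) : (P * diagonal d * P.transpose) ^ s
      = P * diagonal (fun i => d i ^ s) * P.transpose := by
  induction s with
  | zero => simp [h']
  | succ s ih =>
    rw [pow_succ, ih]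
    calc _ = P * diagonal (fun i => d i ^ s) * (P.transpose * P) * diagonal d
          * P.transpose := by simp only [mul_assoc]
      _ = _ := by rw [h, mul_one, mul_assoc P, diagonal_mul_diagonal]; simp [pow_succ]

lemma trace_mul_ddMat_self_ge {U : ℝ[X]} {c : ℝ} (hU : ∀ x, c ≤ Uᵈ.eval x)
    {A B X : Matrix ι ι ℝ} (hA : A.IsSymm) (hB : B.IsSymm) (hX : X.IsSymm) :
    c * (X * X).trace ≤ (X * ddMat U A B X).trace := by
  obtain ⟨P, a, hP, hP', rfl⟩ := exists_spectral hA
  obtain ⟨Q, b, hQ, hQ', rfl⟩ := exists_spectral hB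
  set W := P.transpose * X * Q with hW
  have hWt : W.transpose = Q.transpose * X * P := by
    simp [hW, Matrix.transpose_mul, hX.eq, mul_assoc]
  have key : ∀ s t : ℕ, (X * ((P * diagonal a * P.transpose) ^ s * X *
      (Q * diagonal b * Q.transpose) ^ t)).trace
      = ∑ i, ∑ j, a i ^ s * b j ^ t * W i j ^ 2 := fun s t => by
    rw [spectral_pow hP' hP, spectral_pow hQ' hQ]
    have : (X * (P * diagonal (fun i => a i ^ s) * P.transpose * X *
        (Q * diagonal (fun i => b i ^ t) * Q.transpose))).trace
        = (W.transpose * (diagonal (fun i => a i ^ s) * W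
          * diagonal (fun i => b i ^ t))).trace := by
      rw [hWt, hW]
      rw [show X * (P * diagonal (fun i => a i ^ s) * P.transpose * X *
        (Q * diagonal (fun i => b i ^ t) * Q.transpose)) = (X * P * diagonal (fun i => a i ^ s) * P.transpose * X *
        Q * diagonal (fun i => b i ^ t)) * Q.transpose by simp only [mul_assoc],
        trace_mul_comm]
      simp only [mul_assoc]
    rw [this, trace, sum_comm]
    refine sum_congr rfl fun j _ => ?_
    rw [diag_apply, Matrix.mul_apply]
    refine sum_congr rfl fun i _ => ?_
    rw [mul_diagonal, diagonal_mul, transpose_apply]; ring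
  have h0 : (X * X).trace = ∑ i, ∑ j, W i j ^ 2 := by
    have := key 0 0
    simpa using this
  rw [trace_mul_ddMat]
  simp only [key]
  have : ∑ m ∈ range (U.natDegree + 1), U.coeff m * ∑ s ∈ range m,
      ∑ i, ∑ j, a i ^ s * b j ^ (m - 1 - s) * W i j ^ 2
      = ∑ i, ∑ j, ddNum U (a i) (b j) * W i j ^ 2 := by
    simp only [ddNum, mul_sum, sum_mul]
    rw [sum_congr rfl (fun m _ => sum_comm), sum_comm]
    refine sum_congr rfl fun i _ => ?_
    rw [sum_congr rfl (fun m _ => sum_comm), sum_comm]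
    refine sum_congr rfl fun j _ => ?_
    refine sum_congr rfl fun m _ => sum_congr rfl fun s _ => ?_
    ring
  rw [this, h0, mul_sum]
  refine sum_le_sum fun i _ => ?_
  rw [mul_sum]
  exact sum_le_sum fun j _ => mul_le_mul_of_nonneg_right (le_ddNum hU _ _) (sq_nonneg _)

lemma aeval_diag_nonneg {U : ℝ[X]} (hU : ∀ x, 0 ≤ U.eval x) {A : Matrix ι ι ℝ}
    (hA : A.IsSymm) (k : ι) : 0 ≤ (aeval A U) k k := by
  obtain ⟨P, a, hP, hP', rfl⟩ := exists_spectral hA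
  have : (aeval (P * diagonal a * P.transpose) U) k k = ∑ i, P k i ^ 2 * U.eval (a i) := by
    rw [aeval_eq_sum]
    simp only [spectral_pow hP' hP, Matrix.sum_apply, Matrix.smul_apply, Matrix.mul_apply,
      mul_diagonal, transpose_apply, smul_eq_mul, mul_sum]
    rw [sum_comm]
    refine sum_congr rfl fun i _ => ?_
    rw [eval_eq_sum_range, mul_sum]
    refine sum_congr rfl fun m _ => ?_
    simp only [Matrix.diagonal_apply, mul_ite, mul_zero, sum_ite_eq', mem_univ, if_true]; ring
  rw [this]
  exact sum_nonneg fun i _ => mul_nonneg (sq_nonneg _) (hU _)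

lemma aeval_diag_le {U W : ℝ[X]} (h : ∀ x, U.eval x ≤ W.eval x) {A : Matrix ι ι ℝ}
    (hA : A.IsSymm) (k : ι) : (aeval A U) k k ≤ (aeval A W) k k := by
  have := aeval_diag_nonneg (U := W - U) (fun x => by simpa using h x) hA k
  rw [map_sub, Matrix.sub_apply] at this; linarith

/-- All absolute row sums of `A` are at most `c`. -/
def RowBdd (A : Matrix ι ι ℝ) (c : ℝ) : Prop := ∀ i, ∑ j, |A i j| ≤ c

lemma RowBdd.mono {A : Matrix ι ι ℝ} {c c' : ℝ} (h : RowBdd A c) (hc : c ≤ c') : RowBdd A c' :=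
  fun i => (h i).trans hc

lemma RowBdd.abs_le {A : Matrix ι ι ℝ} {c : ℝ} (h : RowBdd A c) (i j : ι) : |A i j| ≤ c :=
  (single_le_sum (f := fun j => |A i j|) (fun _ _ => abs_nonneg _) (mem_univ j)).trans (h i)

lemma RowBdd.mul {A B : Matrix ι ι ℝ} {a b : ℝ} (hA : RowBdd A a) (hB : RowBdd B b)
    (hb : 0 ≤ b) : RowBdd (A * B) (a * b) := fun i => by
  calc ∑ j, |(A * B) i j| ≤ ∑ j, ∑ k, |A i k| * |B k j| := by
        refine sum_le_sum fun j _ => ?_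
        rw [Matrix.mul_apply]
        refine (abs_sum_le_sum_abs _ _).trans ?_
        simp only [abs_mul, le_refl]
    _ = ∑ k, |A i k| * ∑ j, |B k j| := by rw [sum_comm]; simp only [mul_sum]
    _ ≤ ∑ k, |A i k| * b := sum_le_sum fun k _ => mul_le_mul_of_nonneg_left (hB k) (abs_nonneg _)
    _ ≤ a * b := by rw [← sum_mul]; exact mul_le_mul_of_nonneg_right (hA i) hb

lemma rowBdd_one : RowBdd (1 : Matrix ι ι ℝ) 1 := fun i => by simp [Matrix.one_apply, apply_ite abs]

lemma RowBdd.pow {A : Matrix ι ι ℝ} {a : ℝ} (hA : RowBdd A a) (ha : 0 ≤ a) (s : ℕ) :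
    RowBdd (A ^ s) (a ^ s) := by
  induction s with
  | zero => simpa using rowBdd_one
  | succ s ih => rw [pow_succ, pow_succ]; exact ih.mul hA ha

lemma rowBdd_sum {κ : Type*} (s : Finset κ) (A : κ → Matrix ι ι ℝ) (a : κ → ℝ)
    (h : ∀ k ∈ s, RowBdd (A k) (a k)) : RowBdd (∑ k ∈ s, A k) (∑ k ∈ s, a k) := fun i => by
  calc ∑ j, |(∑ k ∈ s, A k) i j| ≤ ∑ j, ∑ k ∈ s, |A k i j| := by
        refine sum_le_sum fun j _ => ?_
        rw [Matrix.sum_apply]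
        exact abs_sum_le_sum_abs _ _
    _ = ∑ k ∈ s, ∑ j, |A k i j| := sum_comm
    _ ≤ _ := sum_le_sum fun k hk => h k hk i

lemma RowBdd.smul {A : Matrix ι ι ℝ} {a : ℝ} (hA : RowBdd A a) (t : ℝ) :
    RowBdd (t • A) (|t| * a) := fun i => by
  simp only [Matrix.smul_apply, smul_eq_mul, abs_mul, ← mul_sum]
  exact mul_le_mul_of_nonneg_left (hA i) (abs_nonneg _)

/-- A bound for the divided differences of `U` at matrices with row sums at most `c`. -/
noncomputable def ddBound (U : ℝ[X]) (c : ℝ) : ℝ :=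
  ∑ m ∈ range (U.natDegree + 1), |U.coeff m| * ∑ s ∈ range m, c ^ s * c ^ (m - 1 - s)

lemma ddBound_nonneg (U : ℝ[X]) {c : ℝ} (hc : 0 ≤ c) : 0 ≤ ddBound U c := by
  unfold ddBound; positivity

lemma rowBdd_ddMat (U : ℝ[X]) {A B Y : Matrix ι ι ℝ} {c y : ℝ} (hA : RowBdd A c)
    (hB : RowBdd B c) (hY : RowBdd Y y) (hc : 0 ≤ c) (hy : 0 ≤ y) :
    RowBdd (ddMat U A B Y) (ddBound U c * y) := by
  have : ddBound U c * y = ∑ m ∈ range (U.natDegree + 1),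
      |U.coeff m| * ∑ s ∈ range m, c ^ s * y * c ^ (m - 1 - s) := by
    simp only [ddBound, sum_mul, mul_sum]
    refine sum_congr rfl fun _ _ => sum_congr rfl fun _ _ => by ring
  rw [this]
  refine rowBdd_sum _ _ _ fun m _ => (rowBdd_sum _ _ _ fun s _ => ?_).smul _
  exact ((hA.pow hc s).mul hY hy).mul (hB.pow hc _) (by positivity)

lemma abs_trace_mul_le {Y M : Matrix ι ι ℝ} {σ m : ℝ} (hY : ∑ i, ∑ j, |Y i j| ≤ σ)
    (hM : ∀ i j, |M i j| ≤ m) (hm : 0 ≤ m) : |(Y * M).trace| ≤ σ * m := by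
  calc |(Y * M).trace| ≤ ∑ i, ∑ j, |Y i j| * |M j i| := by
        rw [trace]
        refine (abs_sum_le_sum_abs _ _).trans (sum_le_sum fun i _ => ?_)
        rw [diag_apply, Matrix.mul_apply]
        refine (abs_sum_le_sum_abs _ _).trans ?_
        simp only [abs_mul, le_refl]
    _ ≤ ∑ i, ∑ j, |Y i j| * m := sum_le_sum fun i _ => sum_le_sum fun j _ =>
        mul_le_mul_of_nonneg_left (hM _ _) (abs_nonneg _)
    _ ≤ σ * m := by simp only [← sum_mul]; exact mul_le_mul_of_nonneg_right hY hm

lemma trace_ddMat_self (V : ℝ[X]) (A Y : Matrix ι ι ℝ) :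
    (ddMat V A A Y).trace = (aeval A Vᵈ * Y).trace := by
  have h1 := trace_mul_ddMat V A A 1 Y
  rw [one_mul] at h1
  rw [h1, derivative_eq_sum_range_aux V A Y]
where
  derivative_eq_sum_range_aux (V : ℝ[X]) (A Y : Matrix ι ι ℝ) :
    ∑ m ∈ range (V.natDegree + 1), V.coeff m * ∑ s ∈ range m,
      ((1 : Matrix ι ι ℝ) * (A ^ s * Y * A ^ (m - 1 - s))).trace
      = (aeval A Vᵈ * Y).trace := by
    rw [derivative_apply, Polynomial.sum_over_range _ (by simp), map_sum, sum_mul,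
      trace_sum]
    refine sum_congr rfl fun m _ => ?_
    have : ∀ s ∈ range m, ((1 : Matrix ι ι ℝ) * (A ^ s * Y * A ^ (m - 1 - s))).trace
        = (A ^ (m - 1) * Y).trace := fun s hs => by
      rw [mem_range] at hs
      rw [one_mul, trace_mul_comm, ← mul_assoc, ← pow_add]
      congr 3
      omega
    rw [sum_congr rfl this, sum_const, card_range, nsmul_eq_mul]
    rw [map_mul, aeval_C, map_pow, aeval_X, mul_assoc, Algebra.algebraMap_eq_smul_one,
      smul_mul, one_mul, trace_smul, smul_eq_mul]
    ring

lemma continuous_ddMat (U : ℝ[X]) (B Y Y' : Matrix ι ι ℝ) (C : Matrix ι ι ℝ) :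
    Continuous fun t : ℝ => (ddMat U (B + t • Y) C Y').trace := by
  unfold ddMat
  fun_prop

lemma hasDerivAt_trace_aeval (V : ℝ[X]) (B Y : Matrix ι ι ℝ) (t : ℝ) :
    HasDerivAt (fun t : ℝ => (aeval (B + t • Y) V).trace) (aeval (B + t • Y) Vᵈ * Y).trace t := by
  rw [hasDerivAt_iff_tendsto_slope, ← trace_ddMat_self]
  have h := ((continuous_ddMat V B Y Y (B + t • Y)).tendsto t).mono_left
    (nhdsWithin_le_nhds (s := {t}ᶜ))
  refine h.congr' ?_
  filter_upwards [self_mem_nhdsWithin] with t' ht'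
  rw [slope_def_field, ← trace_sub, aeval_sub_aeval]
  have : B + t' • Y - (B + t • Y) = (t' - t) • Y := by rw [sub_smul]; abel
  have ht : t' - t ≠ 0 := sub_ne_zero.2 ht'
  rw [this, ddMat_smul, trace_smul, smul_eq_mul]; field_simp

lemma trace_aeval_ge {V : ℝ[X]} {c : ℝ}
    (hV : ∀ x, c ≤ Vᵈᵈ.eval x) {A B : Matrix ι ι ℝ} (hA : A.IsSymm)
    (hB : B.IsSymm) :
    (aeval B V).trace + (aeval B Vᵈ * (A - B)).trace
      + c / 2 * ((A - B) * (A - B)).trace ≤ (aeval A V).trace := by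
  set Y := A - B with hY
  have hYs : Y.IsSymm := hA.sub hB
  set ψ : ℝ → ℝ := fun t => (aeval (B + t • Y) V).trace
    - t * (aeval B Vᵈ * Y).trace - c / 2 * t ^ 2 * (Y * Y).trace with hψ
  have hd : ∀ t, HasDerivAt ψ ((aeval (B + t • Y) Vᵈ * Y).trace
      - (aeval B Vᵈ * Y).trace - c * t * (Y * Y).trace) t := fun t => by
    have h1 := hasDerivAt_trace_aeval V B Y t
    have h2 := (hasDerivAt_id t).mul_const (aeval B Vᵈ * Y).trace
    have h3 := (((hasDerivAt_id t).pow 2).const_mul (c / 2)).mul_const (Y * Y).trace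
    refine ((h1.sub h2).sub h3).congr_deriv ?_
    simp only [id_eq, one_mul, mul_one, Nat.cast_ofNat, pow_one, Nat.add_one_sub_one]; ring
  have hmono : MonotoneOn ψ (Set.Ici 0) := by
    refine monotoneOn_of_deriv_nonneg (convex_Ici 0)
      (fun t _ => (hd t).continuousAt.continuousWithinAt)
      (fun t _ => (hd t).differentiableAt.differentiableWithinAt) fun t ht => ?_
    rw [interior_Ici] at ht
    have ht' : 0 < t := ht
    rw [(hd t).deriv, ← trace_sub, ← sub_mul, aeval_sub_aeval, add_sub_cancel_left,
      ddMat_smul, smul_mul, trace_smul, trace_mul_comm, smul_eq_mul]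
    have hs : (B + t • Y).IsSymm := hB.add (hYs.smul t)
    have := trace_mul_ddMat_self_ge (U := Vᵈ) hV hs hB hYs
    nlinarith
  have := hmono (a := 0) (b := 1) (by simp) (by simp) zero_le_one
  simp only [hψ, zero_smul, add_zero, one_smul, hY, add_sub_cancel] at this
  rw [← hY] at this; linarith

lemma rowBdd_pow_sub_pow {A B : Matrix ι ι ℝ} {c y : ℝ} (hA : RowBdd A c)
    (hB : RowBdd B c) (hY : RowBdd (A - B) y) (hc : 0 ≤ c) (hy : 0 ≤ y) (s : ℕ) :
    RowBdd (A ^ s - B ^ s) (∑ i ∈ range s, c ^ i * y * c ^ (s - 1 - i)) := by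
  rw [pow_sub_pow_telescope]
  exact rowBdd_sum _ _ _ fun i _ => ((hA.pow hc i).mul hY hy).mul (hB.pow hc _) (by positivity)

/-- A bound for the second divided differences of `U` at matrices with row sums at most `c`. -/
noncomputable def ddBound₂ (U : ℝ[X]) (c : ℝ) : ℝ :=
  ∑ m ∈ range (U.natDegree + 1), |U.coeff m| * ∑ s ∈ range m,
    (∑ i ∈ range s, c ^ i * c ^ (s - 1 - i)) * c ^ (m - 1 - s)

lemma ddBound₂_nonneg (U : ℝ[X]) {c : ℝ} (hc : 0 ≤ c) : 0 ≤ ddBound₂ U c := by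
  unfold ddBound₂; positivity

lemma rowBdd_ddMat_sub (U : ℝ[X]) {A B Z : Matrix ι ι ℝ} {c y z : ℝ} (hA : RowBdd A c)
    (hB : RowBdd B c) (hY : RowBdd (A - B) y) (hZ : RowBdd Z z) (hc : 0 ≤ c) (hy : 0 ≤ y)
    (hz : 0 ≤ z) :
    RowBdd (ddMat U A B Z - ddMat U B B Z) (ddBound₂ U c * y * z) := by
  have e1 : ddBound₂ U c * y * z = ∑ m ∈ range (U.natDegree + 1),
      |U.coeff m| * ∑ s ∈ range m,
        (∑ i ∈ range s, c ^ i * y * c ^ (s - 1 - i)) * z * c ^ (m - 1 - s) := by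
    simp only [ddBound₂, sum_mul, mul_sum]
    refine sum_congr rfl fun _ _ => sum_congr rfl fun _ _ => sum_congr rfl fun _ _ => by ring
  have e2 : ddMat U A B Z - ddMat U B B Z = ∑ m ∈ range (U.natDegree + 1),
      U.coeff m • ∑ s ∈ range m, (A ^ s - B ^ s) * Z * B ^ (m - 1 - s) := by
    simp only [ddMat, ← sum_sub_distrib, ← smul_sub, sub_mul]
  rw [e1, e2]
  refine rowBdd_sum _ _ _ fun m _ => (rowBdd_sum _ _ _ fun s _ => ?_).smul _
  exact ((rowBdd_pow_sub_pow hA hB hY hc hy s).mul hZ hz).mul (hB.pow hc _) (by positivity)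

/-- Second order Taylor expansion of `tr V`. -/
lemma abs_trace_aeval_taylor_le (V : ℝ[X]) {B Y : Matrix ι ι ℝ} {c y σ : ℝ}
    (hB : RowBdd B c) (hBY : RowBdd (B + Y) c) (hY : RowBdd Y y) (hσ : ∑ i, ∑ j, |Y i j| ≤ σ)
    (hc : 0 ≤ c) (hy : 0 ≤ y) :
    |(aeval (B + Y) V).trace - (aeval B V).trace - (aeval B Vᵈ * Y).trace
      - 1 / 2 * (Y * ddMat Vᵈ B B Y).trace|
      ≤ σ * (ddBound₂ Vᵈ c * y * y) := by
  set U := Vᵈ with hU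
  have hK := ddBound₂_nonneg U hc
  set ψ : ℝ → ℝ := fun t => (aeval (B + t • Y) V).trace
    - t * (aeval B U * Y).trace - 1 / 2 * t ^ 2 * (Y * ddMat U B B Y).trace with hψ
  have hd : ∀ t, HasDerivAt ψ ((aeval (B + t • Y) U * Y).trace
      - (aeval B U * Y).trace - t * (Y * ddMat U B B Y).trace) t := fun t => by
    have h1 := hasDerivAt_trace_aeval V B Y t
    have h2 := (hasDerivAt_id t).mul_const (aeval B U * Y).trace
    have h3 := (((hasDerivAt_id t).pow 2).const_mul (1 / 2 : ℝ)).mul_const (Y * ddMat U B B Y).trace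
    refine ((h1.sub h2).sub h3).congr_deriv ?_
    simp [hU]
  have hb : ∀ t ∈ Set.Icc (0 : ℝ) 1, ‖deriv ψ t‖ ≤ σ * (ddBound₂ U c * y * y) := by
    rintro t ⟨ht0, ht1⟩
    have hrow : RowBdd (B + t • Y) c := fun i => by
      have : ∀ j, |(B + t • Y) i j| ≤ (1 - t) * |B i j| + t * |(B + Y) i j| := fun j => by
        have e : (B + t • Y) i j = (1 - t) * B i j + t * (B + Y) i j := by
          simp [Matrix.add_apply]; ring
        rw [e]
        refine (abs_add_le _ _).trans ?_
        rw [abs_mul, abs_mul, abs_of_nonneg ht0, abs_of_nonneg (by linarith : 0 ≤ 1 - t)]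
      calc ∑ j, |(B + t • Y) i j| ≤ ∑ j, ((1 - t) * |B i j| + t * |(B + Y) i j|) :=
            sum_le_sum fun j _ => this j
        _ = (1 - t) * ∑ j, |B i j| + t * ∑ j, |(B + Y) i j| := by
            rw [sum_add_distrib, mul_sum, mul_sum]
        _ ≤ (1 - t) * c + t * c := by
            have h1 : 0 ≤ 1 - t := by linarith
            exact add_le_add (mul_le_mul_of_nonneg_left (hB i) h1)
              (mul_le_mul_of_nonneg_left (hBY i) ht0)
        _ = c := by ring
    rw [(hd t).deriv, ← trace_sub, ← sub_mul, aeval_sub_aeval, add_sub_cancel_left,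
      ddMat_smul, smul_mul, trace_smul, trace_mul_comm, smul_eq_mul,
      ← mul_sub, ← trace_sub, ← mul_sub, norm_eq_abs, abs_mul, abs_of_nonneg ht0]
    have hY' : RowBdd (B + t • Y - B) y := by
      rw [add_sub_cancel_left]
      refine (hY.smul t).mono ?_
      rw [abs_of_nonneg ht0]
      exact mul_le_of_le_one_left hy ht1
    have h1 := abs_trace_mul_le hσ
      (fun i j => (rowBdd_ddMat_sub U hrow hB hY' hY hc hy hy).abs_le i j) (by positivity)
    calc _ ≤ 1 * (σ * (ddBound₂ U c * y * y)) :=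
          mul_le_mul ht1 h1 (abs_nonneg _) zero_le_one
      _ = _ := one_mul _
  have := (convex_Icc (0 : ℝ) 1).norm_image_sub_le_of_norm_deriv_le
    (fun t _ => (hd t).differentiableAt) hb (x := 0) (y := 1) (by simp) (by simp)
  simp only [hψ, zero_smul, add_zero, one_smul, norm_eq_abs, sub_zero, abs_one, mul_one] at this
  convert this using 2
  ring

end MatrixCalculus

/-! ### Tridiagonal matrices of configurations -/

/-- The tridiagonal matrix of a configuration `k ↦ (a_k, b_k)`, linear in the configuration. -/
noncomputable def jac (n : ℕ) : (ℕ → ℝ × ℝ) →ₗ[ℝ] Matrix (Fin n) (Fin n) ℝ where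
  toFun v := jacobi n (fun k => (v k).1) (fun k => (v k).2)
  map_add' v v' := by
    ext i j
    simp only [jacobi, of_apply, Matrix.add_apply, Pi.add_apply, Prod.fst_add, Prod.snd_add]
    split_ifs <;> simp
  map_smul' t v := by
    ext i j
    simp only [jacobi, of_apply, Matrix.smul_apply, Pi.smul_apply, Prod.smul_fst,
      Prod.smul_snd, RingHom.id_apply]
    split_ifs <;> simp

lemma jac_apply (n : ℕ) (v : ℕ → ℝ × ℝ) (i j : Fin n) : jac n v i j = if i = j then (v (i + 1)).1
      else if (i : ℕ) + 1 = j then (v (i + 1)).2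
      else if (j : ℕ) + 1 = i then (v (j + 1)).2
      else 0 := rfl

lemma jac_isSymm (n : ℕ) (v : ℕ → ℝ × ℝ) : (jac n v).IsSymm := by
  ext i j
  simp only [transpose_apply, jac_apply, Fin.ext_iff]
  split_ifs <;> first | rfl | omega | simp_all

lemma jac_congr {n : ℕ} {v v' : ℕ → ℝ × ℝ} (h : ∀ k ∈ Icc 1 (n - 1), v k = v' k)
    (h' : (v n).1 = (v' n).1) : jac n v = jac n v' := by
  have h1 : ∀ k, 1 ≤ k → k ≤ n → (v k).1 = (v' k).1 := fun k h1 h2 => by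
    rcases eq_or_ne k n with rfl | hk
    · exact h'
    · rw [h k (mem_Icc.2 ⟨h1, by omega⟩)]
  ext i j
  have hi := i.2
  have hj := j.2
  simp only [jac_apply]
  split_ifs with h2 h3 h4
  · exact h1 _ (by omega) (by omega)
  · rw [h _ (mem_Icc.2 ⟨by omega, by omega⟩)]
  · rw [h _ (mem_Icc.2 ⟨by omega, by omega⟩)]
  · rfl

lemma jac_single {n p : ℕ} (hp : p + 1 < n) (u : ℝ × ℝ) :
    jac n (Pi.single (p + 1) u) = single ⟨p, by omega⟩ ⟨p, by omega⟩ u.1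
      + (single ⟨p, by omega⟩ ⟨p + 1, hp⟩ u.2
        + single ⟨p + 1, hp⟩ ⟨p, by omega⟩ u.2) := by
  ext i j
  simp only [jac_apply, Matrix.add_apply, single_apply, Pi.single_apply, Fin.ext_iff,
    apply_ite Prod.fst, apply_ite Prod.snd, Prod.fst_zero, Prod.snd_zero]
  split_ifs <;> first | omega | simp_all

lemma jac_eq_sum_single {n : ℕ} {v : ℕ → ℝ × ℝ} {E : Finset ℕ} (hv : ∀ k ∉ E, v k = 0) :
    jac n v = ∑ k ∈ E, jac n (Pi.single k (v k)) := by
  rw [← map_sum]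
  congr 1
  ext k : 1
  rw [Finset.sum_apply]
  simp only [Pi.single_apply]
  rw [Finset.sum_ite_eq]
  split_ifs with h
  · rfl
  · exact hv k h

lemma trace_mul_jac_single {n p : ℕ} (hp : p + 1 < n) (P : Matrix (Fin n) (Fin n) ℝ) (u : ℝ × ℝ) :
    (P * jac n (Pi.single (p + 1) u)).trace = u.1 * P ⟨p, by omega⟩ ⟨p, by omega⟩
      + u.2 * (P ⟨p, by omega⟩ ⟨p + 1, hp⟩ + P ⟨p + 1, hp⟩ ⟨p, by omega⟩) := by
  rw [jac_single hp, mul_add, mul_add, trace_add, trace_add,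
    trace_mul_single, trace_mul_single, trace_mul_single]
  simp only [MulOpposite.smul_eq_mul_unop, MulOpposite.unop_op]; ring

lemma abs_trace_mul_jac_single_le {n k : ℕ} (hk : k ∈ Icc 1 (n - 1))
    {P : Matrix (Fin n) (Fin n) ℝ} {m : ℝ} (hP : ∀ i j, |P i j| ≤ m) (u : ℝ × ℝ) :
    |(P * jac n (Pi.single k u)).trace| ≤ (|u.1| + 2 * |u.2|) * m := by
  rw [mem_Icc] at hk
  obtain ⟨p, rfl⟩ : ∃ p, k = p + 1 := ⟨k - 1, by omega⟩
  rw [trace_mul_jac_single (by omega)]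
  refine (abs_add_le _ _).trans ?_
  rw [abs_mul, abs_mul]
  have h1 := hP ⟨p, by omega⟩ ⟨p, by omega⟩
  have h2 := abs_add_le (P ⟨p, by omega⟩ ⟨p + 1, by omega⟩) (P ⟨p + 1, by omega⟩ ⟨p, by omega⟩)
  have h3 := hP ⟨p, by omega⟩ ⟨p + 1, by omega⟩
  have h4 := hP ⟨p + 1, by omega⟩ ⟨p, by omega⟩
  have h5 := mul_le_mul_of_nonneg_left h1 (abs_nonneg u.1)
  have h6 := mul_le_mul_of_nonneg_left (h2.trans (add_le_add h3 h4)) (abs_nonneg u.2)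
  linarith

lemma jac_diag {n p : ℕ} (hp : p < n) (v : ℕ → ℝ × ℝ) :
    jac n v ⟨p, hp⟩ ⟨p, hp⟩ = (v (p + 1)).1 := by simp [jac_apply]

lemma jac_offdiag {n p : ℕ} (hp : p + 1 < n) (v : ℕ → ℝ × ℝ) :
    jac n v ⟨p, by omega⟩ ⟨p + 1, hp⟩ = (v (p + 1)).2 := by
  simp [jac_apply]

lemma jac_offdiag' {n p : ℕ} (hp : p + 1 < n) (v : ℕ → ℝ × ℝ) :
    jac n v ⟨p + 1, hp⟩ ⟨p, by omega⟩ = (v (p + 1)).2 := by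
  simp only [jac_apply, Fin.ext_iff]
  rw [if_neg (by omega), if_neg (by omega), if_pos trivial]

lemma trace_jac_mul_self {n : ℕ} {v : ℕ → ℝ × ℝ} {E : Finset ℕ} (hE : E ⊆ Icc 1 (n - 1))
    (hv : ∀ k ∉ E, v k = 0) :
    (jac n v * jac n v).trace = ∑ k ∈ E, ((v k).1 ^ 2 + 2 * (v k).2 ^ 2) := by
  nth_rewrite 2 [jac_eq_sum_single hv]
  rw [mul_sum, trace_sum]
  refine sum_congr rfl fun k hk => ?_
  have := mem_Icc.1 (hE hk)
  obtain ⟨p, rfl⟩ : ∃ p, k = p + 1 := ⟨k - 1, by omega⟩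
  rw [trace_mul_jac_single (by omega), jac_diag, jac_offdiag, jac_offdiag']; ring

lemma sum_abs_single {n : ℕ} (p q : Fin n) (x : ℝ) : ∑ i, ∑ j, |single p q x i j| = |x| := by
  simp only [single_apply, apply_ite abs, abs_zero]
  rw [Finset.sum_eq_single p]
  · simp
  · intro b _ hb
    simp [Ne.symm hb]
  · simp

lemma sum_abs_jac_le {n : ℕ} {v : ℕ → ℝ × ℝ} {E : Finset ℕ} (hE : E ⊆ Icc 1 (n - 1))
    (hv : ∀ k ∉ E, v k = 0) :
    ∑ i, ∑ j, |jac n v i j| ≤ ∑ k ∈ E, (|(v k).1| + 2 * |(v k).2|) := by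
  rw [jac_eq_sum_single hv]
  calc _ ≤ ∑ i, ∑ j, ∑ k ∈ E, |jac n (Pi.single k (v k)) i j| := by
        refine sum_le_sum fun i _ => sum_le_sum fun j _ => ?_
        rw [Matrix.sum_apply]
        exact abs_sum_le_sum_abs _ _
    _ = ∑ k ∈ E, ∑ i, ∑ j, |jac n (Pi.single k (v k)) i j| := by
        rw [sum_congr rfl (fun i _ => sum_comm), sum_comm]
    _ ≤ _ := by
        refine sum_le_sum fun k hk => ?_
        have := mem_Icc.1 (hE hk)
        obtain ⟨p, rfl⟩ : ∃ p, k = p + 1 := ⟨k - 1, by omega⟩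
        rw [jac_single (by omega)]
        have h : ∀ A B C : Matrix (Fin n) (Fin n) ℝ, ∑ i, ∑ j, |(A + (B + C)) i j|
            ≤ ∑ i, ∑ j, |A i j| + (∑ i, ∑ j, |B i j| + ∑ i, ∑ j, |C i j|) := fun A B C => by
          simp only [← sum_add_distrib]
          refine sum_le_sum fun i _ => sum_le_sum fun j _ => ?_
          exact (abs_add_le _ _).trans (add_le_add le_rfl (abs_add_le _ _))
        refine (h _ _ _).trans ?_
        rw [sum_abs_single, sum_abs_single, sum_abs_single]; linarith

lemma rowBdd_jac {n : ℕ} {v : ℕ → ℝ × ℝ} {τ : ℝ} (hτ : 0 ≤ τ)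
    (ha : ∀ k ∈ Icc 1 n, |(v k).1| ≤ τ) (hb : ∀ k ∈ Icc 1 (n - 1), |(v k).2| ≤ τ) :
    RowBdd (jac n v) (3 * τ) := fun i => by
  have hi := i.2
  have h : ∀ j : Fin n, |jac n v i j| ≤ (if j = i then τ else 0)
      + ((if (i : ℕ) + 1 = j then τ else 0) + (if (j : ℕ) + 1 = i then τ else 0)) := fun j => by
    have hj := j.2
    rw [jac_apply]
    by_cases h1 : i = j
    · subst h1
      simp [ha (i + 1) (mem_Icc.2 ⟨by omega, by omega⟩)]
    by_cases h2 : (i : ℕ) + 1 = j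
    · rw [if_neg h1, if_pos h2, if_neg (Ne.symm h1), if_pos h2, if_neg (by omega)]
      simpa using hb (i + 1) (mem_Icc.2 ⟨by omega, by omega⟩)
    by_cases h3 : (j : ℕ) + 1 = i
    · rw [if_neg h1, if_neg h2, if_pos h3, if_neg (Ne.symm h1), if_neg h2, if_pos h3]
      simpa using hb (j + 1) (mem_Icc.2 ⟨by omega, by omega⟩)
    · simp [h1, h2, h3, Ne.symm h1]
  refine (sum_le_sum fun j _ => h j).trans ?_
  rw [sum_add_distrib, sum_add_distrib]
  have e1 : ∑ j : Fin n, (if j = i then τ else 0) = τ := by simp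
  have e2 : ∑ j : Fin n, (if (i : ℕ) + 1 = j then τ else 0) ≤ τ := by
    rw [← sum_filter, sum_const, nsmul_eq_mul]
    have : (Finset.univ.filter fun j : Fin n => (i : ℕ) + 1 = j).card ≤ 1 := by
      rw [card_le_one]
      intro a ha b hb
      simp only [mem_filter, mem_univ, true_and] at ha hb
      exact Fin.ext (by omega)
    have : ((Finset.univ.filter fun j : Fin n => (i : ℕ) + 1 = j).card : ℝ) ≤ 1 := by
      exact_mod_cast this
    nlinarith
  have e3 : ∑ j : Fin n, (if (j : ℕ) + 1 = i then τ else 0) ≤ τ := by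
    rw [← sum_filter, sum_const, nsmul_eq_mul]
    have : (Finset.univ.filter fun j : Fin n => (j : ℕ) + 1 = i).card ≤ 1 := by
      rw [card_le_one]
      intro a ha b hb
      simp only [mem_filter, mem_univ, true_and] at ha hb
      exact Fin.ext (by omega)
    have : ((Finset.univ.filter fun j : Fin n => (j : ℕ) + 1 = i).card : ℝ) ≤ 1 := by
      exact_mod_cast this
    nlinarith
  linarith

/-! ### Finite range -/

/-- The distance of two natural numbers. -/
def nd (i j : ℕ) : ℕ := (i - j) + (j - i)

lemma jac_eq_zero_of_lt {n : ℕ} (v : ℕ → ℝ × ℝ) {i j : Fin n} (h : 1 < nd i j) :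
    jac n v i j = 0 := by
  unfold nd at h
  rw [jac_apply, if_neg, if_neg, if_neg]
  · omega
  · omega
  · rintro rfl; omega

lemma jac_pow_eq_zero {n : ℕ} (v : ℕ → ℝ × ℝ) (s : ℕ) {i j : Fin n} (h : s < nd i j) :
    (jac n v ^ s) i j = 0 := by
  induction s generalizing i with
  | zero =>
    rw [pow_zero, Matrix.one_apply_ne]
    rintro rfl
    simp [nd] at h
  | succ s ih =>
    rw [pow_succ', Matrix.mul_apply]
    refine sum_eq_zero fun u _ => ?_
    by_cases hu : 1 < nd i u
    · rw [jac_eq_zero_of_lt v hu, zero_mul]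
    · rw [ih (by unfold nd at *; omega), mul_zero]

lemma jac_pow_congr {n : ℕ} {v v' : ℕ → ℝ × ℝ} (s : ℕ) {i j : Fin n}
    (h : ∀ u w : Fin n, nd u i + 1 + nd w j ≤ s → jac n v u w = jac n v' u w) :
    (jac n v ^ s) i j = (jac n v' ^ s) i j := by
  induction s generalizing i with
  | zero => simp
  | succ s ih =>
    rw [pow_succ', pow_succ', Matrix.mul_apply, Matrix.mul_apply]
    refine sum_congr rfl fun u _ => ?_
    by_cases h1 : 1 < nd i u
    · rw [jac_eq_zero_of_lt v h1, jac_eq_zero_of_lt v' h1, zero_mul, zero_mul]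
    by_cases h2 : s < nd u j
    · rw [jac_pow_eq_zero v s h2, jac_pow_eq_zero v' s h2, mul_zero, mul_zero]
    rw [h i u (by unfold nd at *; omega), ih]
    intro u' w hw
    exact h u' w (by unfold nd at *; omega)

lemma aeval_jac_congr {n : ℕ} {v v' : ℕ → ℝ × ℝ} (U : ℝ[X]) {i j : Fin n}
    (h : ∀ u w : Fin n, nd u i + 1 + nd w j ≤ U.natDegree → jac n v u w = jac n v' u w) :
    (aeval (jac n v) U) i j = (aeval (jac n v') U) i j := by
  rw [aeval_eq_sum, aeval_eq_sum, Matrix.sum_apply, Matrix.sum_apply]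
  refine sum_congr rfl fun m hm => ?_
  rw [mem_range] at hm
  rw [Matrix.smul_apply, Matrix.smul_apply, jac_pow_congr m]
  intro u w huw
  exact h u w (by omega)

/-- The gradient of `tr V(T)` at site `k` only involves sites within distance `(deg V)/2`. -/
lemma trace_aeval_derivative_jac_congr {n : ℕ} {v v' : ℕ → ℝ × ℝ} (V : ℝ[X]) {k : ℕ}
    (hk : k ∈ Icc 1 (n - 1))
    (h : ∀ e, e ∈ Icc 1 n → nd e k ≤ V.natDegree / 2 → v e = v' e) (u : ℝ × ℝ) :
    (aeval (jac n v) Vᵈ * jac n (Pi.single k u)).trace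
      = (aeval (jac n v') Vᵈ * jac n (Pi.single k u)).trace := by
  rw [mem_Icc] at hk
  obtain ⟨p, rfl⟩ : ∃ p, k = p + 1 := ⟨k - 1, by omega⟩
  have hd := natDegree_derivative_le V
  have key : ∀ (e : ℕ) (he : e + 1 ≤ n), nd (e + 1) (p + 1) ≤ V.natDegree / 2 →
      v (e + 1) = v' (e + 1) := fun e he h' => h (e + 1) (mem_Icc.2 ⟨by omega, he⟩) h'
  have gen : ∀ i j : Fin n, ((i : ℕ) = p ∧ (j : ℕ) = p ∨ (i : ℕ) = p ∧ (j : ℕ) = p + 1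
      ∨ (i : ℕ) = p + 1 ∧ (j : ℕ) = p) → (aeval (jac n v) Vᵈ) i j
        = (aeval (jac n v') Vᵈ) i j := fun i j hij => by
    refine aeval_jac_congr _ fun u w huw => ?_
    have hu := u.2
    have hw := w.2
    unfold nd at huw key
    rw [jac_apply, jac_apply]
    split_ifs with h1 h2 h3
    · subst h1
      rw [key _ (by omega) (by omega)]
    · rw [key _ (by omega) (by omega)]
    · rw [key _ (by omega) (by omega)]
    · rfl
  rw [trace_mul_jac_single (by omega), trace_mul_jac_single (by omega), gen, gen, gen]
  · exact Or.inr (Or.inr ⟨rfl, rfl⟩)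
  · exact Or.inr (Or.inl ⟨rfl, rfl⟩)
  · exact Or.inl ⟨rfl, rfl⟩

/-- Divided differences at distant sites do not interact. -/
lemma trace_single_ddMat_single_eq_zero {n : ℕ} (v v' : ℕ → ℝ × ℝ) (U : ℝ[X]) {k l : ℕ}
    (hk : k ∈ Icc 1 (n - 1)) (hl : l ∈ Icc 1 (n - 1))
    (h : U.natDegree + 2 < nd k l) (x y : ℝ × ℝ) :
    (jac n (Pi.single k x) * ddMat U (jac n v) (jac n v') (jac n (Pi.single l y))).trace = 0 := by
  rw [mem_Icc] at hk hl
  obtain ⟨p, rfl⟩ : ∃ p, k = p + 1 := ⟨k - 1, by omega⟩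
  obtain ⟨q, rfl⟩ : ∃ q, l = q + 1 := ⟨l - 1, by omega⟩
  rw [trace_mul_ddMat]
  refine sum_eq_zero fun m hm => ?_
  rw [sum_eq_zero, mul_zero]
  intro s hs
  rw [mem_range] at hm hs
  have gen : ∀ i j : Fin n, ((i : ℕ) = p ∨ (i : ℕ) = p + 1) →
      (jac n v ^ s * jac n (Pi.single (q + 1) y) * jac n v' ^ (m - 1 - s)) i j = 0 := fun i j hi => by
    rw [Matrix.mul_apply]
    refine sum_eq_zero fun u _ => ?_
    rw [Matrix.mul_apply, sum_eq_zero, zero_mul]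
    intro w _
    by_cases hw : s < nd i w
    · rw [jac_pow_eq_zero v s hw, zero_mul]
    · have : jac n (Pi.single (q + 1) y) w u = 0 := by
        unfold nd at *
        rw [jac_apply]
        have e : ∀ r : ℕ, r ≠ q → (Pi.single (q + 1) y : ℕ → ℝ × ℝ) (r + 1) = 0 := fun r hr =>
          Pi.single_eq_of_ne (by omega) _
        split_ifs
        · rw [e _ (by omega)]; rfl
        · rw [e _ (by omega)]; rfl
        · rw [e _ (by omega)]; rfl
        · rfl
      rw [this, mul_zero]
  rw [trace_mul_comm, trace_mul_jac_single (by omega), gen _ _ (Or.inl rfl),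
    gen _ _ (Or.inl rfl), gen _ _ (Or.inr rfl)]
  ring

variable {V : ℝ[X]} {c β ε : ℝ} {n l r j k N : ℕ}
  {c₀ c₁ C K δ η κ τ ξ h : ℝ} {v v' p y : ℕ → ℝ × ℝ} {w : ℕ → ℝ}
  {J E : Finset ℕ} {A : Set (Config (Icc l r))} (hc : 0 < c)
  (hV : ∀ x, c ≤ Vᵈᵈ.eval x) (hβ : 0 < β) (hε0 : 0 < ε) (hε1 : ε < 1)
  (hl : 1 ≤ l) (hr : r + 1 ≤ n) (hco : ∀ k ∈ Icc l r, 0 < logCoeff β n k)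

/-! ### The Hamiltonian along configurations -/

/-- The Hamiltonian of a configuration `k ↦ (a_k, b_k)`. -/
noncomputable def ham (V : ℝ[X]) (β : ℝ) (n : ℕ) (v : ℕ → ℝ × ℝ) : ℝ :=
  hamiltonian V β n (fun k => (v k).1) (fun k => (v k).2)

lemma ham_eq (V : ℝ[X]) (β : ℝ) (n : ℕ) (v : ℕ → ℝ × ℝ) : ham V β n v = (aeval (jac n v) V).trace
      - ∑ k ∈ Icc 1 (n - 1), logCoeff β n k * log (v k).2 := rfl

/-- The derivative of the Hamiltonian at the site `k` in the direction `u`. -/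
noncomputable def grad (V : ℝ[X]) (β : ℝ) (n : ℕ) (v : ℕ → ℝ × ℝ) (k : ℕ) (u : ℝ × ℝ) : ℝ :=
  (aeval (jac n v) Vᵈ * jac n (Pi.single k u)).trace - logCoeff β n k * (u.2 / (v k).2)

/-- The squared Euclidean norm of a pair. -/
def sq2 (u : ℝ × ℝ) : ℝ := u.1 ^ 2 + u.2 ^ 2

/-- The sum norm of a pair. -/
def ab2 (u : ℝ × ℝ) : ℝ := |u.1| + |u.2|

lemma sq2_nonneg (u : ℝ × ℝ) : 0 ≤ sq2 u := by unfold sq2; positivity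

lemma ab2_nonneg (u : ℝ × ℝ) : 0 ≤ ab2 u := by unfold ab2; positivity

lemma ab2_sq_le (u : ℝ × ℝ) : ab2 u ^ 2 ≤ 2 * sq2 u := by
  unfold ab2 sq2
  nlinarith [sq_nonneg (|u.1| - |u.2|), sq_abs u.1, sq_abs u.2]

lemma sq2_le_ab2_sq (u : ℝ × ℝ) : sq2 u ≤ ab2 u ^ 2 := by
  unfold ab2 sq2
  nlinarith [sq_abs u.1, sq_abs u.2, mul_nonneg (abs_nonneg u.1) (abs_nonneg u.2)]

lemma single_smul_site (k : ℕ) (t : ℝ) (u : ℝ × ℝ) :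
    (Pi.single k (t • u) : ℕ → ℝ × ℝ) = t • Pi.single k u :=
  Pi.single_smul' k t u

lemma grad_smul (V : ℝ[X]) (β : ℝ) (n : ℕ) (v : ℕ → ℝ × ℝ) (k : ℕ) (t : ℝ) (u : ℝ × ℝ) :
    grad V β n v k (t • u) = t * grad V β n v k u := by
  unfold grad
  rw [single_smul_site, map_smul, Matrix.mul_smul, trace_smul, Prod.smul_snd, smul_eq_mul,
    smul_eq_mul]
  ring

lemma log_le_log_add {b b' : ℝ} (hb : 0 < b) (hb' : 0 < b') : log b ≤ log b' + (b - b') / b' := by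
  have := Real.log_le_sub_one_of_pos (div_pos hb hb')
  rw [Real.log_div hb.ne' hb'.ne'] at this
  have e : (b - b') / b' = b / b' - 1 := by field_simp
  linarith

/-- First order strong convexity of the Hamiltonian. -/
lemma ham_ge_of_grad (hV : ∀ x, c ≤ Vᵈᵈ.eval x)
    (hE : E ⊆ Icc 1 (n - 1)) (hc : ∀ k ∈ E, 0 ≤ logCoeff β n k)
    (hvv : ∀ k ∉ E, v k = v' k) (hv : ∀ k ∈ E, 0 < (v k).2)
    (hv' : ∀ k ∈ E, 0 < (v' k).2) :
    ham V β n v' + ∑ k ∈ E, grad V β n v' k (v k - v' k)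
      + c / 2 * ∑ k ∈ E, ((v k - v' k).1 ^ 2 + 2 * (v k - v' k).2 ^ 2) ≤ ham V β n v := by
  have h1 := trace_aeval_ge hV (jac_isSymm n v) (jac_isSymm n v')
  have hsupp : ∀ k ∉ E, (v - v') k = 0 := fun k hk => by simp [hvv k hk]
  rw [← map_sub, trace_jac_mul_self hE hsupp] at h1
  have h2 : (aeval (jac n v') Vᵈ * jac n (v - v')).trace
      = ∑ k ∈ E, (aeval (jac n v') Vᵈ * jac n (Pi.single k (v k - v' k))).trace := by
    rw [jac_eq_sum_single hsupp, mul_sum, trace_sum]; rfl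
  have h3 : ∑ k ∈ Icc 1 (n - 1), logCoeff β n k * log (v k).2
      ≤ ∑ k ∈ Icc 1 (n - 1), logCoeff β n k * log (v' k).2
        + ∑ k ∈ E, logCoeff β n k * ((v k - v' k).2 / (v' k).2) := by
    rw [← sum_sdiff hE, ← sum_sdiff hE (f := fun k => logCoeff β n k
      * log (v' k).2), add_assoc, ← sum_add_distrib]
    refine add_le_add (le_of_eq (sum_congr rfl fun k hk => ?_)) (sum_le_sum fun k hk => ?_)
    · rw [hvv k (Finset.mem_sdiff.1 hk).2]
    · rw [← mul_add]
      exact mul_le_mul_of_nonneg_left (log_le_log_add (hv k hk) (hv' k hk)) (hc k hk)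
  rw [ham_eq, ham_eq]
  simp only [grad, sum_sub_distrib]
  rw [h2] at h1
  simp only [Pi.sub_apply] at h1; linarith

/-! ### Weighted monotonicity of the gradient -/

lemma weighted_form_ge {f : ℕ → ℕ → ℝ} {ρ e : ℕ → ℝ} {L ξ : ℝ} {D : ℕ}
    (hsymm : ∀ k ∈ E, ∀ l ∈ E, f k l = f l k) (hL : ∀ k ∈ E, ∀ l ∈ E, |f k l| ≤ L * (ρ k * ρ l))
    (hD : ∀ k ∈ E, ∀ l ∈ E, D < nd k l → f k l = 0)
    (he : ∀ k l, nd k l ≤ D → (e k - e l) ^ 2 ≤ ξ * (e k * e l))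
    (he0 : ∀ k, 0 ≤ e k) (hL0 : 0 ≤ L) (hξ : 0 ≤ ξ) :
    ∑ k ∈ E, ∑ l ∈ E, e k * e l * f k l - L * ξ * (2 * D + 1) / 2 * ∑ k ∈ E, e k ^ 2 * ρ k ^ 2
      ≤ ∑ k ∈ E, ∑ l ∈ E, e k ^ 2 * f k l := by
  have h1 : ∑ k ∈ E, ∑ l ∈ E, e k ^ 2 * f k l
      = ∑ k ∈ E, ∑ l ∈ E, (e k ^ 2 + e l ^ 2) / 2 * f k l := by
    have : ∑ k ∈ E, ∑ l ∈ E, e k ^ 2 * f k l = ∑ k ∈ E, ∑ l ∈ E, e l ^ 2 * f k l := by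
      rw [sum_comm]
      refine sum_congr rfl fun k hk => sum_congr rfl fun l hl => ?_
      rw [hsymm l hl k hk]
    have h2 : ∑ k ∈ E, ∑ l ∈ E, (e k ^ 2 + e l ^ 2) / 2 * f k l
        = (∑ k ∈ E, ∑ l ∈ E, e k ^ 2 * f k l + ∑ k ∈ E, ∑ l ∈ E, e l ^ 2 * f k l) / 2 := by
      rw [← sum_add_distrib, sum_div]
      refine sum_congr rfl fun k hk => ?_
      rw [← sum_add_distrib, sum_div]
      refine sum_congr rfl fun l hl => ?_
      ring
    rw [h2, ← this]; ring
  have hterm : ∀ k ∈ E, ∀ l ∈ E, e k * e l * f k l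
      - (if nd k l ≤ D then L * ξ / 4 * (e k ^ 2 * ρ k ^ 2 + e l ^ 2 * ρ l ^ 2) else 0)
      ≤ (e k ^ 2 + e l ^ 2) / 2 * f k l := fun k hk l hl => by
    split_ifs with h
    · have a1 := he k l h
      have a2 := hL k hk l hl
      have a3 : (e k - e l) ^ 2 * |f k l| ≤ ξ * (e k * e l) * (L * (ρ k * ρ l)) :=
        mul_le_mul a1 a2 (abs_nonneg _) (by have := he0 k; have := he0 l; positivity)
      have a4 : -((e k - e l) ^ 2 * |f k l|) ≤ (e k - e l) ^ 2 * f k l := by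
        have := neg_abs_le (f k l)
        nlinarith [sq_nonneg (e k - e l)]
      have a5 : e k * e l * (ρ k * ρ l) ≤ (e k ^ 2 * ρ k ^ 2 + e l ^ 2 * ρ l ^ 2) / 2 := by
        nlinarith [sq_nonneg (e k * ρ k - e l * ρ l)]
      have a6 := mul_le_mul_of_nonneg_left a5 (mul_nonneg hL0 hξ)
      nlinarith
    · rw [hD k hk l hl (not_le.1 h)]; simp
  have hcount : ∀ k, ((E.filter fun l => nd k l ≤ D).card : ℝ) ≤ 2 * D + 1 := fun k => by
    have : (E.filter fun l => nd k l ≤ D) ⊆ Icc (k - D) (k + D) := fun l hl => by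
      rw [mem_filter] at hl
      unfold nd at hl
      rw [mem_Icc]; omega
    have h := card_le_card this
    rw [Nat.card_Icc] at h
    have : (E.filter fun l => nd k l ≤ D).card ≤ 2 * D + 1 := by omega
    exact_mod_cast this
  have hnd : ∀ k l, nd k l = nd l k := fun k l => by unfold nd; omega
  have hsum : ∑ k ∈ E, ∑ l ∈ E,
      (if nd k l ≤ D then L * ξ / 4 * (e k ^ 2 * ρ k ^ 2 + e l ^ 2 * ρ l ^ 2) else 0)
      ≤ L * ξ * (2 * D + 1) / 2 * ∑ k ∈ E, e k ^ 2 * ρ k ^ 2 := by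
    have e1 : ∑ k ∈ E, ∑ l ∈ E, (if nd k l ≤ D then e k ^ 2 * ρ k ^ 2 else 0)
        ≤ (2 * D + 1) * ∑ k ∈ E, e k ^ 2 * ρ k ^ 2 := by
      rw [mul_sum]
      refine sum_le_sum fun k hk => ?_
      rw [← sum_filter, sum_const, nsmul_eq_mul]
      exact mul_le_mul_of_nonneg_right (hcount k) (by positivity)
    have e2 : ∑ k ∈ E, ∑ l ∈ E, (if nd k l ≤ D then e l ^ 2 * ρ l ^ 2 else 0)
        ≤ (2 * D + 1) * ∑ k ∈ E, e k ^ 2 * ρ k ^ 2 := by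
      rw [sum_comm]
      refine le_of_eq_of_le ?_ e1
      refine sum_congr rfl fun k hk => sum_congr rfl fun l hl => ?_
      rw [hnd]
    have e3 : ∑ k ∈ E, ∑ l ∈ E,
      (if nd k l ≤ D then L * ξ / 4 * (e k ^ 2 * ρ k ^ 2 + e l ^ 2 * ρ l ^ 2) else 0)
      = L * ξ / 4 * (∑ k ∈ E, ∑ l ∈ E, (if nd k l ≤ D then e k ^ 2 * ρ k ^ 2 else 0)
        + ∑ k ∈ E, ∑ l ∈ E, (if nd k l ≤ D then e l ^ 2 * ρ l ^ 2 else 0)) := by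
      rw [← sum_add_distrib, mul_sum]
      refine sum_congr rfl fun k hk => ?_
      rw [← sum_add_distrib, mul_sum]
      refine sum_congr rfl fun l hl => ?_
      split_ifs <;> ring
    rw [e3]
    have : 0 ≤ L * ξ / 4 := by positivity
    nlinarith [mul_le_mul_of_nonneg_left (add_le_add e1 e2) this]
  have := sum_le_sum fun k hk => sum_le_sum fun l hl => hterm k hk l hl
  simp only [sum_sub_distrib] at this
  rw [h1]; linarith

lemma rowBdd_jac_single (n k : ℕ) (u : ℝ × ℝ) : RowBdd (jac n (Pi.single k u)) (3 * ab2 u) := by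
  refine rowBdd_jac (ab2_nonneg u) (fun l _ => ?_) fun l _ => ?_
  · rw [Pi.single_apply]
    split_ifs
    · unfold ab2; linarith [abs_nonneg u.2]
    · simpa using ab2_nonneg u
  · rw [Pi.single_apply]
    split_ifs
    · unfold ab2; linarith [abs_nonneg u.1]
    · simpa using ab2_nonneg u

lemma grad_sub_grad_ge_log {b b' g : ℝ} (hb : 0 < b) (hb' : 0 < b') (hg : 0 ≤ g) :
    0 ≤ -(g * ((b - b') / b)) + g * ((b - b') / b') := by
  have : -(g * ((b - b') / b)) + g * ((b - b') / b') = g * ((b - b') ^ 2 / (b * b')) := by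
    field_simp; ring
  rw [this]; positivity

/-- The increment of the gradient of `tr V(T)` as a sum of site interactions. -/
lemma trace_aeval_derivative_sub (V : ℝ[X]) (hvv : ∀ k ∉ E, v k = v' k) (k : ℕ) :
    (aeval (jac n v) Vᵈ * jac n (Pi.single k (v k - v' k))).trace
      - (aeval (jac n v') Vᵈ * jac n (Pi.single k (v k - v' k))).trace
      = ∑ l ∈ E, (jac n (Pi.single k (v k - v' k)) * ddMat Vᵈ (jac n v) (jac n v')
          (jac n (Pi.single l (v l - v' l)))).trace := by
  have hsupp : ∀ k ∉ E, (v - v') k = 0 := fun k hk => by simp [hvv k hk]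
  rw [← trace_sub, ← sub_mul, aeval_sub_aeval, ← map_sub, jac_eq_sum_single hsupp,
    ddMat_sum, sum_mul, trace_sum]
  refine sum_congr rfl fun l _ => ?_
  rw [trace_mul_comm]; rfl

lemma sum_grad_sub_ge (hV : ∀ x, c ≤ Vᵈᵈ.eval x) (hc0 : 0 ≤ c)
    (hE : E ⊆ Icc 1 (n - 1)) (hc : ∀ k ∈ E, 0 ≤ logCoeff β n k)
    (hvv : ∀ k ∉ E, v k = v' k) (hv : ∀ k ∈ E, 0 < (v k).2)
    (hv' : ∀ k ∈ E, 0 < (v' k).2) :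
    c * ∑ k ∈ E, sq2 (v k - v' k)
      ≤ ∑ k ∈ E, (grad V β n v k (v k - v' k) - grad V β n v' k (v k - v' k)) := by
  have h1 := ham_ge_of_grad hV hE hc hvv hv hv'
  have h2 := ham_ge_of_grad hV hE hc (fun k hk => (hvv k hk).symm) hv' hv
  have h3 : ∀ k, grad V β n v k (v' k - v k) = - grad V β n v k (v k - v' k) := fun k => by
    rw [← neg_sub (v k), ← neg_one_smul ℝ, grad_smul]; ring
  simp only [h3, sum_neg_distrib] at h2
  have h4 : ∀ k, (v' k - v k).1 ^ 2 + 2 * (v' k - v k).2 ^ 2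
      = (v k - v' k).1 ^ 2 + 2 * (v k - v' k).2 ^ 2 := by
    intro k; simp only [Prod.fst_sub, Prod.snd_sub]; ring
  simp only [h4] at h2
  have h5 : c * ∑ k ∈ E, sq2 (v k - v' k)
      ≤ c * ∑ k ∈ E, ((v k - v' k).1 ^ 2 + 2 * (v k - v' k).2 ^ 2) := by
    refine mul_le_mul_of_nonneg_left (sum_le_sum fun k _ => ?_) hc0
    unfold sq2; nlinarith [sq_nonneg (v k - v' k).2]
  rw [sum_sub_distrib]; linarith

/-- Weighted quadratic form bound for divided differences at tridiagonal matrices. -/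
lemma sum_weighted_ddMat_ge (hV : ∀ x, c ≤ Vᵈᵈ.eval x) (hc0 : 0 ≤ c)
    (hE : E ⊆ Icc 1 (n - 1)) (v v' y : ℕ → ℝ × ℝ) (hτ : 0 ≤ τ)
    (hA : RowBdd (jac n v) τ) (hB : RowBdd (jac n v') τ)
    {e : ℕ → ℝ} (he0 : ∀ k, 0 ≤ e k) (hξ : 0 ≤ ξ)
    (he : ∀ k l, nd k l ≤ V.natDegree + 2 → (e k - e l) ^ 2 ≤ ξ * (e k * e l))
    (hsmall : 6 * ddBound Vᵈ τ * ξ * (2 * (V.natDegree + 2 : ℕ) + 1) ≤ c / 2) :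
    c / 2 * ∑ k ∈ E, e k ^ 2 * sq2 (y k)
      ≤ ∑ k ∈ E, ∑ l ∈ E, e k ^ 2 * (jac n (Pi.single k (y k)) * ddMat Vᵈ
        (jac n v) (jac n v') (jac n (Pi.single l (y l)))).trace := by
  set f : ℕ → ℕ → ℝ := fun k l => (jac n (Pi.single k (y k)) * ddMat Vᵈ
        (jac n v) (jac n v') (jac n (Pi.single l (y l)))).trace with hf
  have hdd := ddBound_nonneg Vᵈ hτ
  have h1 := weighted_form_ge (E := E) (f := f) (ρ := fun k => ab2 (y k)) (e := e)
    (L := 6 * ddBound Vᵈ τ) (ξ := ξ) (D := V.natDegree + 2)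
    (fun k _ l _ => trace_mul_ddMat_comm _ (jac_isSymm _ _) (jac_isSymm _ _) (jac_isSymm _ _)
      (jac_isSymm _ _))
    (by
      intro k hk l hl
      have hr := rowBdd_ddMat Vᵈ hA hB (rowBdd_jac_single n l (y l)) hτ
        (by have := ab2_nonneg (y l); positivity)
      have := abs_trace_mul_jac_single_le (hE hk) (fun i j => hr.abs_le i j) (y k)
      rw [hf]
      simp only
      rw [trace_mul_comm]
      refine this.trans ?_
      have h2 : |(y k).1| + 2 * |(y k).2| ≤ 2 * ab2 (y k) := by
        unfold ab2; linarith [abs_nonneg (y k).1]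
      have := mul_le_mul_of_nonneg_right h2 (mul_nonneg hdd
        (mul_nonneg zero_le_three (ab2_nonneg (y l))))
      linarith)
    (by
      intro k hk l hl h
      have := natDegree_derivative_le V
      exact trace_single_ddMat_single_eq_zero v v' _ (hE hk) (hE hl) (by omega) _ _)
    he he0 (by positivity) hξ
  have h2 : ∑ k ∈ E, ∑ l ∈ E, e k * e l * f k l ≥ c * ∑ k ∈ E, e k ^ 2 * sq2 (y k) := by
    classical
    set z : ℕ → ℝ × ℝ := fun k => if k ∈ E then e k • y k else 0 with hz
    have hzs : ∀ k ∉ E, z k = 0 := fun k hk => by simp [hz, hk]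
    have h3 := trace_mul_ddMat_self_ge (U := Vᵈ) hV (jac_isSymm n v) (jac_isSymm n v')
      (jac_isSymm n z)
    rw [trace_jac_mul_self hE hzs] at h3
    have h4 : (jac n z * ddMat Vᵈ (jac n v) (jac n v') (jac n z)).trace
        = ∑ k ∈ E, ∑ l ∈ E, e k * e l * f k l := by
      rw [jac_eq_sum_single hzs, ddMat_sum, sum_mul, trace_sum]
      refine sum_congr rfl fun k hk => ?_
      rw [mul_sum, trace_sum]
      refine sum_congr rfl fun l hl => ?_
      simp only [hz, hk, hl, if_true, single_smul_site, map_smul, ddMat_smul, smul_mul,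
        Matrix.mul_smul, trace_smul, smul_eq_mul, hf]
      ring
    rw [h4] at h3
    refine le_trans (mul_le_mul_of_nonneg_left (sum_le_sum fun k hk => ?_) hc0) h3
    simp only [hz, hk, if_true, Prod.smul_fst, Prod.smul_snd, smul_eq_mul, sq2]
    nlinarith [sq_nonneg (e k * (y k).2)]
  have h5 : 6 * ddBound Vᵈ τ * ξ * (2 * (V.natDegree + 2 : ℕ) + 1) / 2
      * ∑ k ∈ E, e k ^ 2 * ab2 (y k) ^ 2 ≤ c / 2 * ∑ k ∈ E, e k ^ 2 * sq2 (y k) := by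
    have h6 : ∑ k ∈ E, e k ^ 2 * ab2 (y k) ^ 2 ≤ 2 * ∑ k ∈ E, e k ^ 2 * sq2 (y k) := by
      rw [mul_sum]
      refine sum_le_sum fun k _ => ?_
      have := mul_le_mul_of_nonneg_left (ab2_sq_le (y k)) (sq_nonneg (e k))
      linarith
    have h7 : 0 ≤ ∑ k ∈ E, e k ^ 2 * ab2 (y k) ^ 2 := sum_nonneg fun k _ => by positivity
    nlinarith [mul_le_mul_of_nonneg_right hsmall h7]
  linarith

/-- Weighted strong monotonicity of the gradient of the Hamiltonian. -/
lemma sum_weighted_grad_sub_ge (hV : ∀ x, c ≤ Vᵈᵈ.eval x) (hc0 : 0 ≤ c)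
    (hE : E ⊆ Icc 1 (n - 1)) (hc : ∀ k ∈ E, 0 ≤ logCoeff β n k)
    (hvv : ∀ k ∉ E, v k = v' k) (hv : ∀ k ∈ E, 0 < (v k).2)
    (hv' : ∀ k ∈ E, 0 < (v' k).2) (hτ : 0 ≤ τ)
    (hA : RowBdd (jac n v) τ) (hB : RowBdd (jac n v') τ)
    {e : ℕ → ℝ} (he0 : ∀ k, 0 ≤ e k) (hξ : 0 ≤ ξ)
    (he : ∀ k l, nd k l ≤ V.natDegree + 2 → (e k - e l) ^ 2 ≤ ξ * (e k * e l))
    (hsmall : 6 * ddBound Vᵈ τ * ξ * (2 * (V.natDegree + 2 : ℕ) + 1) ≤ c / 2) :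
    c / 2 * ∑ k ∈ E, e k ^ 2 * sq2 (v k - v' k)
      ≤ ∑ k ∈ E, e k ^ 2 * (grad V β n v k (v k - v' k) - grad V β n v' k (v k - v' k)) := by
  refine (sum_weighted_ddMat_ge hV hc0 hE v v' (fun k => v k - v' k) hτ hA hB he0 hξ he
    hsmall).trans (sum_le_sum fun k hk => ?_)
  rw [← mul_sum, ← trace_aeval_derivative_sub V hvv k]
  refine mul_le_mul_of_nonneg_left ?_ (sq_nonneg _)
  have := grad_sub_grad_ge_log (hv k hk) (hv' k hk) (hc k hk)
  simp only [grad, Prod.snd_sub]; linarith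

/-! ### Decrease of the Hamiltonian under contractions -/

/-- The contraction of the configuration `v` towards `p`, by the factor `1 / (1 + w_k)` at the
site `k`. -/
noncomputable def shrink (p : ℕ → ℝ × ℝ) (w : ℕ → ℝ) (v : ℕ → ℝ × ℝ) : ℕ → ℝ × ℝ :=
  fun k => p k + (1 + w k)⁻¹ • (v k - p k)

lemma sum_mul_grad_ge {g : ℕ → ℝ} {w γ ρ : ℕ → ℝ} (hc : 0 < c)
    (hw : ∀ k, 0 ≤ w k) (hg : ∀ k ∈ E, |g k| ≤ γ k * ρ k) :
    -(c / 8 * ∑ k ∈ E, w k * ρ k ^ 2) - 2 / c * ∑ k ∈ E, w k * γ k ^ 2 ≤ ∑ k ∈ E, w k * g k := by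
  rw [mul_sum, mul_sum, ← sum_neg_distrib, ← sum_sub_distrib]
  refine sum_le_sum fun k hk => ?_
  have h1 := (abs_le.1 (hg k hk)).1
  have h2 : γ k * ρ k ≤ c / 8 * ρ k ^ 2 + 2 / c * γ k ^ 2 := by
    have h3 : 0 ≤ (c * ρ k - 4 * γ k) ^ 2 / (8 * c) := by positivity
    have h4 : (c * ρ k - 4 * γ k) ^ 2 / (8 * c)
        = c / 8 * ρ k ^ 2 + 2 / c * γ k ^ 2 - γ k * ρ k := by field_simp; ring
    linarith
  have := mul_le_mul_of_nonneg_left (show -(c / 8 * ρ k ^ 2 + 2 / c * γ k ^ 2) ≤ g k by linarith)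
    (hw k)
  linarith

lemma ham_sub_shrink_ge (hV : ∀ x, c ≤ Vᵈᵈ.eval x) (hc0 : 0 < c)
    (hE : E ⊆ Icc 1 (n - 1)) (hc : ∀ k ∈ E, 0 ≤ logCoeff β n k)
    {v p pt : ℕ → ℝ × ℝ} {w γ : ℕ → ℝ} (hw : ∀ k, 0 ≤ w k) (hwE : ∀ k ∉ E, w k = 0)
    (hv : ∀ k ∈ E, 0 < (v k).2) (hp : ∀ k ∈ E, 0 < (p k).2)
    (hγ : ∀ k ∈ E, ∀ u, |grad V β n pt k u| ≤ γ k * ab2 u)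
    (hmono : c / 2 * ∑ k ∈ E, w k * sq2 (shrink p w v k - p k)
      ≤ ∑ k ∈ E, w k * (grad V β n (shrink p w v) k (shrink p w v k - p k)
        - grad V β n pt k (shrink p w v k - p k))) :
    c / 4 * ∑ k ∈ E, w k * sq2 (shrink p w v k - p k) - 2 / c * ∑ k ∈ E, w k * γ k ^ 2
      ≤ ham V β n v - ham V β n (shrink p w v) := by
  set S := shrink p w v with hS
  have hw1 : ∀ k, (1 + w k) ≠ 0 := fun k => by have := hw k; positivity
  have hSoff : ∀ k ∉ E, v k = S k := fun k hk => by simp [hS, shrink, hwE k hk]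
  have hdiff : ∀ k, v k - S k = w k • (S k - p k) := fun k => by
    have : v k - p k = (1 + w k) • (S k - p k) := by
      simp only [hS, shrink, add_sub_cancel_left, smul_smul, mul_inv_cancel₀ (hw1 k), one_smul]
    have h2 : v k - S k = (v k - p k) - (S k - p k) := by abel
    rw [h2, this, add_smul, one_smul]; abel
  have hSpos : ∀ k ∈ E, 0 < (S k).2 := fun k hk => by
    have h1 := hw k
    have h2 : (S k).2 = (1 + w k)⁻¹ * (w k * (p k).2 + (v k).2) := by
      simp only [hS, shrink, Prod.snd_add, Prod.smul_snd, Prod.snd_sub, smul_eq_mul]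
      field_simp [hw1 k]; ring
    rw [h2]
    have := hv k hk
    have := hp k hk
    positivity
  have h1 := ham_ge_of_grad hV hE hc hSoff hv hSpos
  have h2 : 0 ≤ c / 2 * ∑ k ∈ E, ((v k - S k).1 ^ 2 + 2 * (v k - S k).2 ^ 2) := by
    have : 0 ≤ ∑ k ∈ E, ((v k - S k).1 ^ 2 + 2 * (v k - S k).2 ^ 2) :=
      sum_nonneg fun k _ => by positivity
    positivity
  simp only [hdiff, grad_smul] at h1
  simp only [hdiff] at h2
  have h3 := sum_mul_grad_ge (E := E) (g := fun k => grad V β n pt k (S k - p k)) (w := w)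
    (γ := γ) (ρ := fun k => ab2 (S k - p k)) hc0 hw (fun k hk => hγ k hk _)
  have h4 : ∑ k ∈ E, w k * ab2 (S k - p k) ^ 2 ≤ 2 * ∑ k ∈ E, w k * sq2 (S k - p k) := by
    rw [mul_sum]
    refine sum_le_sum fun k _ => ?_
    have := mul_le_mul_of_nonneg_left (ab2_sq_le (S k - p k)) (hw k)
    linarith
  simp only [mul_sub, sum_sub_distrib] at hmono
  have h5 := mul_le_mul_of_nonneg_left h4 (show 0 ≤ c / 8 by positivity)
  linarith

/-! ### The symbol of a constant tridiagonal matrix, sampled at roots of unity -/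

/-- The `t`-th node `2πt/N`, with `N = deg V + 3`. -/
noncomputable def node (D : ℕ) (t : Fin (D + 3)) : ℝ := 2 * Real.pi * t / (D + 3 : ℕ)

/-- The diagonal matrix with entries `a + 2 b cos θ_t`. -/
noncomputable def symb (D : ℕ) (u : ℝ × ℝ) : Matrix (Fin (D + 3)) (Fin (D + 3)) ℝ :=
  diagonal fun t => u.1 + 2 * u.2 * cos (node D t)

lemma symb_add (D : ℕ) (u u' : ℝ × ℝ) : symb D (u + u') = symb D u + symb D u' := by
  simp only [symb, Matrix.diagonal_add, Prod.fst_add, Prod.snd_add]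
  congr 1; ext t; ring

lemma symb_smul (D : ℕ) (r : ℝ) (u : ℝ × ℝ) : symb D (r • u) = r • symb D u := by
  simp only [symb, ← Matrix.diagonal_smul, Prod.smul_fst, Prod.smul_snd, smul_eq_mul]
  congr 1; ext t; simp only [Pi.smul_apply, smul_eq_mul]; ring

lemma symb_sub (D : ℕ) (u u' : ℝ × ℝ) : symb D (u - u') = symb D u - symb D u' := by
  rw [sub_eq_add_neg, symb_add, ← neg_one_smul ℝ u', symb_smul, neg_one_smul, ← sub_eq_add_neg]

lemma symb_isSymm (D : ℕ) (u : ℝ × ℝ) : (symb D u).IsSymm := isSymm_diagonal _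

lemma mean_cos_node (D : ℕ) {i : ℤ} (hi : i.natAbs < D + 3) :
    ∑ t, cos (i * node D t) = if i = 0 then ((D + 3 : ℕ) : ℝ) else 0 := by
  split_ifs with h
  · simp [h]
  have hN : ((D + 3 : ℕ) : ℂ) ≠ 0 := mod_cast (by omega : D + 3 ≠ 0)
  set z : ℂ := Complex.exp (2 * Real.pi * Complex.I * i / (D + 3 : ℕ)) with hz
  have hzN : z ^ (D + 3) = 1 := by
    rw [hz, ← Complex.exp_nat_mul, mul_div_cancel₀ _ hN, Complex.exp_eq_one_iff]
    exact ⟨i, by ring⟩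
  have hz1 : z ≠ 1 := by
    rw [hz, Ne, Complex.exp_eq_one_iff]
    rintro ⟨k, hk⟩
    have h2 : (i : ℂ) = k * (D + 3 : ℕ) := by
      field_simp at hk
      linear_combination hk
    have h3 : i = k * (D + 3 : ℕ) := mod_cast h2
    rw [h3, Int.natAbs_mul, Int.natAbs_natCast] at hi
    have : k.natAbs < 1 := by
      by_contra hk1
      nlinarith
    have : k = 0 := by omega
    simp [this] at h3
    exact h h3
  have hs := geom_sum_eq hz1 (D + 3)
  rw [hzN, sub_self, zero_div] at hs
  have hre := congrArg Complex.re hs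
  rw [Complex.re_sum, sum_range] at hre
  rw [Complex.zero_re] at hre
  rw [← hre]
  refine sum_congr rfl fun t _ => ?_
  rw [hz, ← Complex.exp_nat_mul]
  have : ((t : ℕ) : ℂ) * (2 * Real.pi * Complex.I * i / (D + 3 : ℕ))
      = ((i * node D t : ℝ) : ℂ) * Complex.I := by
    rw [node]; push_cast; ring
  rw [this, Complex.exp_ofReal_mul_I_re]

/-- The `i`-th Fourier coefficient of `U(a + 2 b cos θ)`, sampled. -/
noncomputable def fcoef (D : ℕ) (U : ℝ[X]) (u : ℝ × ℝ) (i : ℤ) : ℝ :=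
  (∑ t, U.eval (u.1 + 2 * u.2 * cos (node D t)) * cos (i * node D t)) / (D + 3 : ℕ)

lemma fcoef_X_pow_succ (D m : ℕ) (u : ℝ × ℝ) (i : ℤ) :
    fcoef D (X ^ (m + 1)) u i = u.1 * fcoef D (X ^ m) u i
      + u.2 * (fcoef D (X ^ m) u (i - 1) + fcoef D (X ^ m) u (i + 1)) := by
  simp only [fcoef, eval_pow, eval_X]
  rw [← add_div, mul_div_assoc', mul_div_assoc', ← add_div, mul_sum,
    ← sum_add_distrib, mul_sum, ← sum_add_distrib]
  congr 1
  refine sum_congr rfl fun t _ => ?_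
  have h1 : cos (((i - 1 : ℤ) : ℝ) * node D t) + cos (((i + 1 : ℤ) : ℝ) * node D t)
      = 2 * cos (node D t) * cos (i * node D t) := by
    push_cast
    rw [sub_mul, add_mul, one_mul, Real.cos_sub, Real.cos_add]; ring
  rw [← mul_add, h1, pow_succ]; ring

lemma fcoef_one (D : ℕ) (u : ℝ × ℝ) {i : ℤ} (hi : i.natAbs < D + 3) :
    fcoef D (X ^ 0) u i = if i = 0 then 1 else 0 := by
  simp only [fcoef, pow_zero, eval_one, one_mul]
  rw [mean_cos_node D hi]
  have : ((D + 3 : ℕ) : ℝ) ≠ 0 := by positivity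
  split_ifs
  · exact div_self this
  · exact zero_div _

lemma fcoef_eq_sum (D : ℕ) (U : ℝ[X]) (u : ℝ × ℝ) (i : ℤ) :
    fcoef D U u i = ∑ m ∈ range (U.natDegree + 1), U.coeff m * fcoef D (X ^ m) u i := by
  simp only [fcoef, eval_eq_sum_range (p := U), eval_pow, eval_X, mul_sum, sum_mul,
    mul_div_assoc', sum_div]
  rw [sum_comm]
  refine sum_congr rfl fun m _ => sum_congr rfl fun t _ => ?_
  ring

lemma laurent_pow_coeff (D m : ℕ) (u : ℝ × ℝ) {i : ℤ} (hi : i.natAbs + m < D + 3) :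
    ((LaurentPolynomial.C u.1 + LaurentPolynomial.C u.2 * (LaurentPolynomial.T 1
      + LaurentPolynomial.T (-1)) : LaurentPolynomial ℝ) ^ m).coeff i = fcoef D (X ^ m) u i := by
  induction m generalizing i with
  | zero =>
    rw [fcoef_one D u (by omega), pow_zero, ← LaurentPolynomial.T_zero,
      LaurentPolynomial.T_apply]
    simp only [eq_comm]
  | succ m ih =>
    rw [fcoef_X_pow_succ, ← ih (by omega), ← ih (by omega), ← ih (by omega), pow_succ']
    set f := (LaurentPolynomial.C u.1 + LaurentPolynomial.C u.2 * (LaurentPolynomial.T 1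
      + LaurentPolynomial.T (-1)) : LaurentPolynomial ℝ) ^ m
    have e : (LaurentPolynomial.C u.1 : LaurentPolynomial ℝ) = AddMonoidAlgebra.single 0 u.1 := rfl
    rw [mul_add (LaurentPolynomial.C u.2), ← LaurentPolynomial.single_eq_C_mul_T,
      ← LaurentPolynomial.single_eq_C_mul_T, e, add_mul, add_mul]
    simp only [AddMonoidAlgebra.coeff_add, Finsupp.add_apply,
      AddMonoidAlgebra.coeff_single_mul_apply]
    rw [show -0 + i = i by ring, show -1 + i = i - 1 by ring, show - -1 + i = i + 1 by ring]; ring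

lemma localW_eq (V : ℝ[X]) (u : ℝ × ℝ) : localW V u.1 u.2 = fcoef V.natDegree V u 0 := by
  rw [localW, aeval_eq_sum_range, fcoef_eq_sum, AddMonoidAlgebra.coeff_sum, Finsupp.finsetSum_apply]
  refine sum_congr rfl fun m hm => ?_
  rw [mem_range] at hm
  rw [AddMonoidAlgebra.coeff_smul_apply, laurent_pow_coeff V.natDegree m u (by simp; omega),
    smul_eq_mul]

lemma jac_pow_const {u : ℝ × ℝ} (D : ℕ) (s : ℕ) {i j : Fin n}
    (h : ∀ e, nd e (i + 1) ≤ s → v e = u) (hi : s ≤ i) (hi' : i + s < n)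
    (hs : nd i j + s < D + 3) :
    (jac n v ^ s) i j = fcoef D (X ^ s) u ((i : ℤ) - j) := by
  unfold nd at h hs
  induction s generalizing i with
  | zero =>
    rw [fcoef_one D u (by omega), pow_zero, Matrix.one_apply]
    simp only [Fin.ext_iff, sub_eq_zero, Nat.cast_inj]
  | succ s ih =>
    obtain ⟨p, hp⟩ : ∃ p, (i : ℕ) = p + 1 := ⟨i - 1, by omega⟩
    rw [pow_succ', Matrix.mul_apply]
    have h0 : i ≠ ⟨p, by omega⟩ := by simp [Fin.ext_iff, hp]
    have h2 : i ≠ ⟨p + 2, by omega⟩ := by simp [Fin.ext_iff, hp]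
    have h02 : (⟨p, by omega⟩ : Fin n) ≠ ⟨p + 2, by omega⟩ := by simp [Fin.ext_iff]
    rw [← sum_subset (subset_univ {i, (⟨p, by omega⟩ : Fin n), ⟨p + 2, by omega⟩})]
    · rw [sum_insert (by simp [h0, h2]), sum_insert (by simp [h02]),
        sum_singleton]
      have e1 : jac n v i i = u.1 := by rw [jac_apply, if_pos rfl, h (i + 1) (by omega)]
      have e2 : jac n v i ⟨p, by omega⟩ = u.2 := by
        rw [jac_apply, if_neg h0, if_neg (by simp only; omega), if_pos (by simp only; omega),
          h _ (by simp only; omega)]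
      have e3 : jac n v i ⟨p + 2, by omega⟩ = u.2 := by
        rw [jac_apply, if_neg h2, if_pos (by simp only; omega), h _ (by omega)]
      rw [e1, e2, e3, ih (fun e he => h e (by omega)) (by omega) (by omega) (by omega),
        ih (fun e he => h e (by simp only at he; omega)) (by simp only; omega) (by simp only; omega)
          (by simp only; omega),
        ih (fun e he => h e (by simp only at he; omega)) (by simp only; omega) (by simp only; omega)
          (by simp only; omega), fcoef_X_pow_succ]
      have c1 : (i : ℤ) - j - 1 = ((⟨p, by omega⟩ : Fin n) : ℕ) - j := by simp only; omega
      have c2 : (i : ℤ) - j + 1 = ((⟨p + 2, by omega⟩ : Fin n) : ℕ) - j := by simp only; omega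
      rw [c1, c2]; ring
    · intro x _ hx
      simp only [Finset.mem_insert, mem_singleton, not_or, Fin.ext_iff] at hx
      rw [jac_eq_zero_of_lt v (by unfold nd; omega), zero_mul]

lemma aeval_jac_const {u : ℝ × ℝ} (U : ℝ[X]) {D : ℕ} (hU : U.natDegree ≤ D) {i j : Fin n}
    (h : ∀ e, nd e (i + 1) ≤ D → v e = u) (hi : D ≤ i) (hi' : i + D < n)
    (hs : nd i j ≤ 1) :
    (aeval (jac n v) U) i j = fcoef D U u ((i : ℤ) - j) := by
  rw [aeval_eq_sum, fcoef_eq_sum, Matrix.sum_apply]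
  refine sum_congr rfl fun m hm => ?_
  rw [mem_range] at hm
  rw [Matrix.smul_apply, smul_eq_mul, jac_pow_const D m (fun e he => h e (by omega)) (by omega)
    (by omega) (by omega)]

lemma fcoef_neg (D : ℕ) (U : ℝ[X]) (u : ℝ × ℝ) (i : ℤ) : fcoef D U u (-i) = fcoef D U u i := by
  simp [fcoef, Real.cos_neg]

/-- The derivative of the local energy `W` at `u` in the direction `x`. -/
noncomputable def gradW (V : ℝ[X]) (u x : ℝ × ℝ) : ℝ :=
  (aeval (symb V.natDegree u) Vᵈ * symb V.natDegree x).trace / (V.natDegree + 3 : ℕ)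

lemma aeval_diagonal {ι : Type*} [Fintype ι] [DecidableEq ι] (U : ℝ[X]) (d : ι → ℝ) :
    aeval (diagonal d) U = diagonal fun i => U.eval (d i) := by
  rw [aeval_eq_sum]
  ext i j
  rw [Matrix.sum_apply]
  simp only [Matrix.diagonal_pow, Matrix.smul_apply, Matrix.diagonal_apply, smul_eq_mul,
    eval_eq_sum_range, Pi.pow_apply]
  split_ifs <;> simp

lemma localW_eq_trace (V : ℝ[X]) (u : ℝ × ℝ) : localW V u.1 u.2
    = (aeval (symb V.natDegree u) V).trace / (V.natDegree + 3 : ℕ) := by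
  rw [localW_eq, fcoef, symb, aeval_diagonal, trace_diagonal]; simp

lemma gradW_eq (V : ℝ[X]) (u x : ℝ × ℝ) : gradW V u x = x.1 * fcoef V.natDegree Vᵈ u 0
      + x.2 * (2 * fcoef V.natDegree Vᵈ u 1) := by
  rw [gradW, symb, aeval_diagonal, symb, diagonal_mul_diagonal, trace_diagonal]
  simp only [fcoef, mul_div_assoc', ← add_div, mul_sum, ← sum_add_distrib]
  congr 1
  refine sum_congr rfl fun t _ => ?_
  simp
  ring

/-- The gradient of `tr V(T)` at a site near which the configuration is constant. -/
lemma trace_aeval_derivative_jac_const {u : ℝ × ℝ} (V : ℝ[X])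
    (h : ∀ e, nd e k ≤ V.natDegree + 1 → v e = u) (hk : V.natDegree + 1 ≤ k)
    (hk' : k + V.natDegree + 1 ≤ n) (x : ℝ × ℝ) :
    (aeval (jac n v) Vᵈ * jac n (Pi.single k x)).trace = gradW V u x := by
  obtain ⟨p, rfl⟩ : ∃ p, k = p + 1 := ⟨k - 1, by omega⟩
  have hd : Vᵈ.natDegree ≤ V.natDegree := (natDegree_derivative_le V).trans (Nat.sub_le _ _)
  rw [trace_mul_jac_single (by omega), gradW_eq,
    aeval_jac_const Vᵈ hd (u := u), aeval_jac_const Vᵈ hd (u := u),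
    aeval_jac_const Vᵈ hd (u := u)]
  · rw [show ((⟨p, by omega⟩ : Fin n) : ℤ) - ((⟨p, by omega⟩ : Fin n) : ℕ) = 0 by simp,
      show (((⟨p, by omega⟩ : Fin n) : ℕ) : ℤ) - ((⟨p + 1, by omega⟩ : Fin n) : ℕ) = -1 by simp,
      show (((⟨p + 1, by omega⟩ : Fin n) : ℕ) : ℤ) - ((⟨p, by omega⟩ : Fin n) : ℕ) = 1 by simp,
      fcoef_neg]
    ring
  all_goals first
    | (intro e he; apply h; unfold nd at *; simp only at he; omega)
    | (unfold nd; simp only; omega)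
    | (simp only; omega)

lemma symb_trace_mul_self (D : ℕ) (u : ℝ × ℝ) :
    (symb D u * symb D u).trace = (D + 3 : ℕ) * (u.1 ^ 2 + 2 * u.2 ^ 2) := by
  rw [symb, diagonal_mul_diagonal, trace_diagonal]
  have h1 := mean_cos_node D (i := 1) (by simp)
  have h2 := mean_cos_node D (i := 2) (by simp)
  simp only [Int.cast_one, one_mul, one_ne_zero, if_false] at h1
  rw [if_neg (by norm_num)] at h2
  simp only [Int.cast_ofNat, Real.cos_two_mul] at h2
  have h3 : ∀ t, (u.1 + 2 * u.2 * cos (node D t)) * (u.1 + 2 * u.2 * cos (node D t))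
      = (u.1 ^ 2 + 2 * u.2 ^ 2) + 4 * u.1 * u.2 * cos (node D t)
        + 2 * u.2 ^ 2 * (2 * cos (node D t) ^ 2 - 1) := by intro t; ring
  simp only [h3]
  rw [sum_add_distrib, sum_add_distrib, ← mul_sum, ← mul_sum, h1, h2]; simp; ring

/-! ### Existence of minimizers -/

lemma exists_min_sub_log {ι : Type*} [Fintype ι] {F : (ι → ℝ × ℝ) → ℝ} (hF : Continuous F)
    {κ R : ℝ} (hκ : 0 < κ) (hlow : ∀ x, κ * ∑ i, sq2 (x i) - R ≤ F x) {c : ι → ℝ}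
    (hc : ∀ i, 0 < c i) :
    ∃ m : ι → ℝ × ℝ, (∀ i, 0 < (m i).2) ∧ ∀ x : ι → ℝ × ℝ, (∀ i, 0 < (x i).2) →
      F m - ∑ i, c i * log (m i).2 ≤ F x - ∑ i, c i * log (x i).2 := by
  classical
  set G : (ι → ℝ × ℝ) → ℝ := fun x => F x - ∑ i, c i * log (x i).2
  set x₀ : ι → ℝ × ℝ := fun _ => (0, 1)
  set T : ℝ := |G x₀ + R + ∑ i, c i ^ 2 / (2 * κ)|
  set ρ : ℝ := 1 + 2 * T / κ
  have hρ1 : 1 ≤ ρ := by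
    have : 0 ≤ 2 * T / κ := by positivity
    linarith
  set Q : ℝ := R + G x₀ + ∑ j, c j * ρ
  set K : Set (ι → ℝ × ℝ) := Set.pi univ
    fun i => Set.Icc (-ρ) ρ ×ˢ Set.Icc (exp (-Q / c i)) ρ with hK
  have hsub : ∀ x : ι → ℝ × ℝ, (∀ i, 0 < (x i).2) → G x ≤ G x₀ → x ∈ K := fun x hx hGx => by
    have h1 : ∑ i, c i * log (x i).2 ≤ κ / 2 * ∑ i, sq2 (x i) + ∑ i, c i ^ 2 / (2 * κ) := by
      rw [mul_sum, ← sum_add_distrib]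
      refine sum_le_sum fun i _ => ?_
      have h2 : log (x i).2 ≤ (x i).2 := (Real.log_le_sub_one_of_pos (hx i)).trans (by linarith)
      have h3 := mul_le_mul_of_nonneg_left h2 (hc i).le
      have h4 : 0 ≤ (κ * (x i).2 - c i) ^ 2 / (2 * κ) := by positivity
      have h5 : (κ * (x i).2 - c i) ^ 2 / (2 * κ)
          = κ / 2 * (x i).2 ^ 2 + c i ^ 2 / (2 * κ) - c i * (x i).2 := by field_simp; ring
      unfold sq2
      nlinarith [sq_nonneg (x i).1]
    have h2 := hlow x
    have h3 : κ / 2 * ∑ i, sq2 (x i) ≤ T := by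
      have : G x = F x - ∑ i, c i * log (x i).2 := rfl
      exact le_trans (by linarith) (le_abs_self _)
    have h4 : ∀ i, sq2 (x i) ≤ ρ ^ 2 := fun i => by
      have h5 : sq2 (x i) ≤ ∑ i, sq2 (x i) :=
        single_le_sum (f := fun i => sq2 (x i)) (fun i _ => sq2_nonneg _) (mem_univ i)
      have h6 : ∑ i, sq2 (x i) ≤ 2 * T / κ := by rw [le_div_iff₀ hκ]; linarith
      nlinarith
    have h5 : ∀ i, |(x i).1| ≤ ρ := fun i => abs_le_of_sq_le_sq (by
      have := h4 i; unfold sq2 at this; nlinarith [sq_nonneg (x i).2]) (by linarith)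
    have h6 : ∀ i, |(x i).2| ≤ ρ := fun i => abs_le_of_sq_le_sq (by
      have := h4 i; unfold sq2 at this; nlinarith [sq_nonneg (x i).1]) (by linarith)
    have hcl : ∀ i, c i * log (x i).2 ≤ c i * ρ := fun i =>
      mul_le_mul_of_nonneg_left (((Real.log_le_sub_one_of_pos (hx i)).trans (by linarith)).trans
        ((le_abs_self _).trans (h6 i))) (hc i).le
    rw [hK, Set.mem_univ_pi]
    intro i
    refine ⟨abs_le.1 (h5 i), ?_, (abs_le.1 (h6 i)).2⟩
    rw [← Real.le_log_iff_exp_le (hx i), div_le_iff₀ (hc i)]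
    have h7 : ∑ j, c j * log (x j).2 ≤ c i * log (x i).2 + ∑ j, c j * ρ := by
      rw [← Finset.add_sum_erase _ _ (mem_univ i)]
      refine add_le_add le_rfl ((sum_le_sum fun j _ => hcl j).trans
        (sum_le_sum_of_subset_of_nonneg (Finset.erase_subset _ _) fun j _ _ => ?_))
      have := hc j
      positivity
    have h8 : -R ≤ F x := by
      have : 0 ≤ κ * ∑ i, sq2 (x i) := mul_nonneg hκ.le (sum_nonneg fun i _ => sq2_nonneg _)
      linarith
    have : G x = F x - ∑ i, c i * log (x i).2 := rfl
    linarith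
  have hKc : IsCompact K := isCompact_univ_pi fun i => isCompact_Icc.prod isCompact_Icc
  have hx₀K : x₀ ∈ K := hsub x₀ (fun i => one_pos) le_rfl
  have hKpos : ∀ x ∈ K, ∀ i, 0 < (x i).2 := fun x hx i => by
    have := (Set.mem_univ_pi.1 hx i).2.1
    exact (exp_pos _).trans_le this
  have hGc : ContinuousOn G K := by
    refine hF.continuousOn.sub (continuousOn_finsetSum _ fun i _ => ?_)
    refine ContinuousOn.mul continuousOn_const (ContinuousOn.log ?_ fun x hx => (hKpos x hx i).ne')
    exact ((continuous_snd.comp (continuous_apply i))).continuousOn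
  obtain ⟨m, hmK, hm⟩ := hKc.exists_isMinOn ⟨x₀, hx₀K⟩ hGc
  refine ⟨m, hKpos m hmK, fun x hx => ?_⟩
  by_cases h : G x ≤ G x₀
  · exact hm (hsub x hx h)
  · exact (hm hx₀K).trans (not_le.1 h).le

/-! ### The local minimizers -/

lemma mul_derivative_ge (hV : ∀ x, c ≤ Vᵈᵈ.eval x) (x : ℝ) :
    c * x ^ 2 + Vᵈ.eval 0 * x ≤ x * Vᵈ.eval x := by
  have h1 := le_ddNum hV x 0
  have h2 := ddNum_mul Vᵈ x 0
  rw [sub_zero] at h2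
  have h3 : ddNum Vᵈ x 0 * x ^ 2 = x * Vᵈ.eval x - Vᵈ.eval 0 * x := by linear_combination x * h2
  linarith [mul_le_mul_of_nonneg_right h1 (sq_nonneg x)]

lemma eval_ge_quadratic (hV : ∀ x, c ≤ Vᵈᵈ.eval x) (x : ℝ) :
    V.eval 0 + Vᵈ.eval 0 * x + c / 2 * x ^ 2 ≤ V.eval x := by
  have h := trace_aeval_ge hV (A := diagonal fun _ : Fin 1 => x)
    (B := diagonal fun _ : Fin 1 => (0 : ℝ)) (isSymm_diagonal _)
    (isSymm_diagonal _)
  rw [aeval_diagonal, aeval_diagonal, aeval_diagonal, Matrix.diagonal_sub,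
    diagonal_mul_diagonal, diagonal_mul_diagonal] at h
  simp only [trace_diagonal, univ_unique, sum_const, Finset.card_singleton, one_smul, sub_zero] at h
  nlinarith

include hc hV in
/-- A quadratic lower bound for `V`. -/
lemma exists_quadratic_le : ∃ R, ∀ x, c / 4 * x ^ 2 - R ≤ V.eval x := by
  refine ⟨Vᵈ.eval 0 ^ 2 / c - V.eval 0, fun x => ?_⟩
  have h1 := eval_ge_quadratic hV x
  have h2 : 0 ≤ (c * x / 2 + Vᵈ.eval 0) ^ 2 / c := by positivity
  have h3 : (c * x / 2 + Vᵈ.eval 0) ^ 2 / c = c / 4 * x ^ 2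
    + Vᵈ.eval 0 * x + Vᵈ.eval 0 ^ 2 / c := by field_simp; ring
  linarith

lemma trace_aeval_ge_quadratic {R : ℝ} (hR : ∀ x, c / 4 * x ^ 2 - R ≤ V.eval x)
    {ι : Type*} [Fintype ι] [DecidableEq ι] {A : Matrix ι ι ℝ} (hA : A.IsSymm) :
    c / 4 * (A * A).trace - R * Fintype.card ι ≤ (aeval A V).trace := by
  have h := fun k => aeval_diag_le (U := C (c / 4) * X ^ 2 - C R) (W := V)
    (fun x => by simpa using hR x) hA k
  have h2 := sum_le_sum fun k (_ : k ∈ Finset.univ) => h k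
  refine le_of_eq_of_le ?_ h2
  change _ = trace _
  rw [map_sub, map_mul, aeval_C, aeval_C, map_pow, aeval_X, trace_sub,
    Algebra.algebraMap_eq_smul_one, Algebra.algebraMap_eq_smul_one, smul_mul,
    trace_smul, trace_smul, one_mul, Matrix.trace_one, pow_two]
  simp

include hc hV in
lemma exists_localMin {x : ℝ} (hx : x < 1) : 0 < (localMin V x).2 ∧ ∀ p' : ℝ × ℝ, 0 < p'.2 →
      localW V (localMin V x).1 (localMin V x).2 - (1 - x) * log (localMin V x).2
        ≤ localW V p'.1 p'.2 - (1 - x) * log p'.2 := by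
  refine Classical.epsilon_spec (p := fun p : ℝ × ℝ => 0 < p.2 ∧ ∀ p' : ℝ × ℝ, 0 < p'.2 →
    localW V p.1 p.2 - (1 - x) * log p.2 ≤ localW V p'.1 p'.2 - (1 - x) * log p'.2) ?_
  obtain ⟨R, hR⟩ := exists_quadratic_le hc hV
  have hN : (0 : ℝ) < (V.natDegree + 3 : ℕ) := by positivity
  obtain ⟨m, hm, hm'⟩ := exists_min_sub_log (ι := Unit)
    (F := fun y => localW V (y ()).1 (y ()).2) (κ := c / 4) (R := R) (c := fun _ => 1 - x)
    (by
      simp only [localW_eq, fcoef]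
      fun_prop) (by positivity)
    (by
      intro y
      have := trace_aeval_ge_quadratic hR (symb_isSymm V.natDegree (y ()))
      rw [symb_trace_mul_self, Fintype.card_fin] at this
      rw [localW_eq_trace, le_div_iff₀ hN]
      refine le_trans ?_ this
      simp only [univ_unique, sum_singleton, sq2]
      have h2 : 0 ≤ c / 4 * (y ()).2 ^ 2 * (V.natDegree + 3 : ℕ) := by positivity
      have : (default : Unit) = () := rfl
      rw [this]
      linarith) (fun _ => by linarith)
  refine ⟨m (), hm (), fun p' hp' => ?_⟩
  have := hm' (fun _ => p') (fun _ => hp')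
  simpa using this

lemma hasDerivAt_localW (V : ℝ[X]) (u x : ℝ × ℝ) :
    HasDerivAt (fun t : ℝ => localW V (u + t • x).1 (u + t • x).2) (gradW V u x) 0 := by
  have h := (hasDerivAt_trace_aeval V (symb V.natDegree u) (symb V.natDegree x) 0).div_const
    ((V.natDegree + 3 : ℕ) : ℝ)
  rw [zero_smul, add_zero] at h
  refine h.congr_of_eventuallyEq (Eventually.of_forall fun t => ?_)
  simp only [localW_eq_trace, symb_add, symb_smul]

include hc hV in
/-- The critical equations of the local minimizer. -/
lemma gradW_localMin {x : ℝ} (hx : x < 1) (u : ℝ × ℝ) :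
    gradW V (localMin V x) u = (1 - x) * (u.2 / (localMin V x).2) := by
  obtain ⟨hpos, hmin⟩ := exists_localMin hc hV hx
  set p := localMin V x
  have hlin : HasDerivAt (fun t : ℝ => (p + t • u).2) u.2 0 := by
    simp only [Prod.snd_add, Prod.smul_snd, smul_eq_mul]
    simpa using ((hasDerivAt_id (0 : ℝ)).mul_const u.2).const_add p.2
  have h0 : (p + (0 : ℝ) • u).2 = p.2 := by simp
  have h2 := (hlin.log (by rw [h0]; exact hpos.ne')).const_mul (1 - x)
  have h3 := (hasDerivAt_localW V p u).sub h2
  have hloc : IsLocalMin (fun t : ℝ => localW V (p + t • u).1 (p + t • u).2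
      - (1 - x) * log (p + t • u).2) 0 := by
    have hev : ∀ᶠ t in 𝓝 (0 : ℝ), 0 < (p + t • u).2 :=
      hlin.continuousAt.eventually (lt_mem_nhds (show 0 < (p + (0 : ℝ) • u).2 by rw [h0]; exact hpos))
    filter_upwards [hev] with t ht
    have := hmin _ ht
    simpa using this
  have := hloc.hasDerivAt_eq_zero h3
  rw [h0] at this; linarith

lemma gradW_self_ge (hV : ∀ x, c ≤ Vᵈᵈ.eval x) (u : ℝ × ℝ) :
    c * (u.1 ^ 2 + 2 * u.2 ^ 2) + Vᵈ.eval 0 * u.1 ≤ gradW V u u := by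
  have hN : (0 : ℝ) < (V.natDegree + 3 : ℕ) := by positivity
  rw [gradW, le_div_iff₀ hN]
  have h1 := symb_trace_mul_self V.natDegree u
  have h2 : (symb V.natDegree u).trace = (V.natDegree + 3 : ℕ) * u.1 := by
    rw [symb, trace_diagonal, sum_add_distrib, ← mul_sum]
    have h1 := mean_cos_node V.natDegree (i := 1) (by simp)
    simp only [Int.cast_one, one_mul, one_ne_zero, if_false] at h1
    rw [h1]; simp
  have h3 : c * (symb V.natDegree u * symb V.natDegree u).trace
      + Vᵈ.eval 0 * (symb V.natDegree u).trace
      ≤ (aeval (symb V.natDegree u) Vᵈ * symb V.natDegree u).trace := by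
    rw [symb, aeval_diagonal, diagonal_mul_diagonal, diagonal_mul_diagonal,
      trace_diagonal, trace_diagonal, trace_diagonal, mul_sum,
      mul_sum, ← sum_add_distrib]
    refine sum_le_sum fun t _ => ?_
    have := mul_derivative_ge hV (u.1 + 2 * u.2 * cos (node V.natDegree t))
    nlinarith
  rw [h1, h2] at h3; linarith

include hc hV in
/-- The local minimizers are bounded. -/
lemma exists_localMin_le : ∃ M : ℝ, 0 < M ∧ ∀ x : ℝ, 0 ≤ x → x < 1 →
      |(localMin V x).1| ≤ M ∧ |(localMin V x).2| ≤ M := by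
  set g := Vᵈ.eval 0 with hg
  refine ⟨1 + (2 + g ^ 2 / c) / c, by positivity, fun x hx0 hx1 => ?_⟩
  have h1 := gradW_localMin hc hV hx1 (localMin V x)
  have hpos := (exists_localMin hc hV hx1).1
  rw [div_self hpos.ne', mul_one] at h1
  have h2 := gradW_self_ge hV (localMin V x)
  rw [h1, ← hg] at h2
  set p := localMin V x
  set M := 1 + (2 + g ^ 2 / c) / c
  have h3 : c / 2 * (p.1 ^ 2 + p.2 ^ 2) ≤ 1 + g ^ 2 / (2 * c) := by
    have h4 : 0 ≤ (c * p.1 + g) ^ 2 / (2 * c) := by positivity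
    have h5 : (c * p.1 + g) ^ 2 / (2 * c) = c / 2 * p.1 ^ 2 + g * p.1 + g ^ 2 / (2 * c) := by
      field_simp; ring
    nlinarith [sq_nonneg p.2]
  have h4 : p.1 ^ 2 + p.2 ^ 2 ≤ (2 + g ^ 2 / c) / c := by
    rw [le_div_iff₀ hc]
    have : g ^ 2 / (2 * c) = g ^ 2 / c / 2 := by field_simp
    linarith
  have hM1 : 1 ≤ M := by
    have : 0 ≤ (2 + g ^ 2 / c) / c := by positivity
    linarith
  have h5 : p.1 ^ 2 + p.2 ^ 2 ≤ M ^ 2 := by nlinarith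
  exact ⟨abs_le_of_sq_le_sq (by nlinarith [sq_nonneg p.2]) (by linarith),
    abs_le_of_sq_le_sq (by nlinarith [sq_nonneg p.1]) (by linarith)⟩

include hc hV in
lemma exists_le_localMin
    (hη : 0 < η) : ∃ r : ℝ, 0 < r ∧ ∀ x : ℝ, 0 ≤ x → x ≤ 1 - η → r ≤ (localMin V x).2 := by
  obtain ⟨M, hM, hb⟩ := exists_localMin_le hc hV
  have hcont : Continuous fun u : ℝ × ℝ => gradW V u (0, 1) := by
    simp only [gradW_eq, fcoef]
    fun_prop
  obtain ⟨L, hL⟩ := (isCompact_Icc (a := ((-M, -M) : ℝ × ℝ)) (b := (M, M))).exists_bound_of_continuousOn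
    hcont.continuousOn
  refine ⟨η / (1 + |L|), by positivity, fun x hx0 hx1 => ?_⟩
  have hx1' : x < 1 := by linarith
  have hpos := (exists_localMin hc hV hx1').1
  have h1 := gradW_localMin hc hV hx1' (0, 1)
  obtain ⟨ha, hb'⟩ := hb x hx0 hx1'
  have h2 := hL (localMin V x) ⟨⟨(abs_le.1 ha).1, (abs_le.1 hb').1⟩,
    ⟨(abs_le.1 ha).2, (abs_le.1 hb').2⟩⟩
  simp only at h1
  rw [h1, norm_eq_abs, abs_of_nonneg (mul_nonneg (by linarith) (by positivity)),
    mul_one_div, div_le_iff₀ hpos] at h2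
  rw [div_le_iff₀ (by positivity)]
  nlinarith [le_abs_self L]

include hc hV in
/-- The local minimizers depend on `x` in a Lipschitz way. -/
lemma exists_lipschitz_localMin (hη : 0 < η) : ∃ Λ : ℝ, 0 < Λ ∧ ∀ x y : ℝ, 0 ≤ x → x ≤ 1 - η → 0 ≤ y → y ≤ 1 - η →
      ab2 (localMin V x - localMin V y) ≤ Λ * |x - y| := by
  obtain ⟨r, hr, hrb⟩ := exists_le_localMin hc hV hη
  refine ⟨2 / (r * c), by positivity, fun x y hx0 hx1 hy0 hy1 => ?_⟩
  have hx1' : x < 1 := by linarith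
  have hy1' : y < 1 := by linarith
  have hN : (0 : ℝ) < (V.natDegree + 3 : ℕ) := by positivity
  set p := localMin V x with hp
  set q := localMin V y with hq
  have hpr := hrb x hx0 hx1
  have hqr := hrb y hy0 hy1
  rw [← hp] at hpr
  rw [← hq] at hqr
  set u := p - q with hu
  have h1 : gradW V p u = _ := gradW_localMin hc hV hx1' u
  have h2 : gradW V q u = _ := gradW_localMin hc hV hy1' u
  rw [← hp] at h1
  rw [← hq] at h2
  have h3 : c * sq2 u ≤ gradW V p u - gradW V q u := by
    have h4 := trace_mul_ddMat_self_ge hV (symb_isSymm V.natDegree p) (symb_isSymm V.natDegree q)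
      (symb_isSymm V.natDegree u)
    rw [symb_trace_mul_self] at h4
    rw [show ddMat Vᵈ (symb V.natDegree p) (symb V.natDegree q) (symb V.natDegree u)
      = aeval (symb V.natDegree p) Vᵈ - aeval (symb V.natDegree q) Vᵈ by
        rw [aeval_sub_aeval, hu, symb_sub], trace_mul_comm, sub_mul, trace_sub] at h4
    rw [gradW, gradW, ← sub_div, le_div_iff₀ hN]
    refine le_trans ?_ h4
    unfold sq2
    have : 0 ≤ c * u.2 ^ 2 * (V.natDegree + 3 : ℕ) := by positivity
    linarith
  have hub : u.2 = p.2 - q.2 := rfl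
  have h5 : gradW V p u - gradW V q u ≤ |x - y| * ab2 u / r := by
    rw [h1, h2]
    have e : (1 - x) * (u.2 / p.2) - (1 - y) * (u.2 / q.2)
        = (y - x) * u.2 / p.2 - (1 - y) * (u.2 ^ 2 / (p.2 * q.2)) := by
      have : p.2 ≠ 0 := by linarith
      have : q.2 ≠ 0 := by linarith
      field_simp
      rw [hub]; ring
    have hp2 : 0 < p.2 := by linarith
    have hq2 : 0 < q.2 := by linarith
    have h6 : 0 ≤ (1 - y) * (u.2 ^ 2 / (p.2 * q.2)) := mul_nonneg (by linarith) (by positivity)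
    have h7 : (y - x) * u.2 / p.2 ≤ |x - y| * ab2 u / r := by
      have h8 : (y - x) * u.2 ≤ |x - y| * ab2 u := by
        refine (le_abs_self _).trans ?_
        rw [abs_mul, abs_sub_comm]
        refine mul_le_mul_of_nonneg_left ?_ (abs_nonneg _)
        unfold ab2; linarith [abs_nonneg u.1]
      calc (y - x) * u.2 / p.2 ≤ |x - y| * ab2 u / p.2 := by gcongr
        _ ≤ |x - y| * ab2 u / r := by
          have := ab2_nonneg u
          gcongr
    rw [e]; linarith
  have h9 := ab2_sq_le u
  have h10 : ab2 u ^ 2 ≤ 2 / (r * c) * |x - y| * ab2 u := by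
    have : sq2 u ≤ |x - y| * ab2 u / r / c := by rw [le_div_iff₀ hc]; linarith
    have e : 2 / (r * c) * |x - y| * ab2 u = 2 * (|x - y| * ab2 u / r / c) := by field_simp
    rw [e]; linarith
  rcases (ab2_nonneg u).eq_or_lt with h | h
  · rw [← h]; positivity
  · nlinarith

/-! ### Exponential weights -/

/-- The weight `exp (-c₁ |k - j|)`. -/
noncomputable def expw (c₁ : ℝ) (j k : ℕ) : ℝ := exp (-(c₁ * nd k j))

lemma expw_pos (c₁ : ℝ) (j k : ℕ) : 0 < expw c₁ j k := exp_pos _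

lemma expw_self (c₁ : ℝ) (j : ℕ) : expw c₁ j j = 1 := by simp [expw, nd]

lemma expw_le_of_le (hc₁ : 0 ≤ c₁) {d : ℝ} (h : d ≤ nd k j) :
    expw c₁ j k ≤ exp (-(c₁ * d)) := by
  rw [expw, exp_le_exp]
  nlinarith

lemma expw_sq (c₁ : ℝ) (j k : ℕ) : expw c₁ j k ^ 2 = expw (2 * c₁) j k := by
  rw [expw, expw, ← exp_nat_mul]; congr 1; push_cast; ring

lemma exp_sub_exp_sq_le {x y h : ℝ} (hxy : |x - y| ≤ h) (h1 : h ≤ 1) :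
    (exp x - exp y) ^ 2 ≤ 4 * h ^ 2 * (exp x * exp y) := by
  wlog hle : y ≤ x generalizing x y with H
  · have := H (x := y) (y := x) (by rwa [abs_sub_comm]) (le_of_not_ge hle)
    linarith
  rw [abs_of_nonneg (by linarith)] at hxy
  set z := x - y
  have hz0 : 0 ≤ z := by linarith
  have e : exp x = exp y * exp z := by rw [← exp_add]; congr 1; ring
  have h2 : |exp z - 1 - z| ≤ z ^ 2 := Real.abs_exp_sub_one_sub_id_le (by
    rw [abs_of_nonneg hz0]; linarith)
  have h3 : exp z - 1 ≤ 2 * h := by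
    have := (abs_le.1 h2).2
    nlinarith
  have h4 : 0 ≤ exp z - 1 := by linarith [add_one_le_exp z]
  have h5 : (exp z - 1) ^ 2 ≤ 4 * h ^ 2 := by nlinarith
  have h6 : 1 ≤ exp z := by linarith
  rw [e]
  have h7 : (exp y * exp z - exp y) ^ 2 = exp y ^ 2 * (exp z - 1) ^ 2 := by ring
  rw [h7]
  have h8 : exp y ^ 2 * (exp z - 1) ^ 2 ≤ exp y ^ 2 * (4 * h ^ 2) :=
    mul_le_mul_of_nonneg_left h5 (sq_nonneg _)
  have h9 : exp y ^ 2 * (4 * h ^ 2) * 1 ≤ exp y ^ 2 * (4 * h ^ 2) * exp z :=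
    mul_le_mul_of_nonneg_left h6 (by positivity)
  nlinarith

/-- For small decay rates the exponential weights vary slowly. -/
lemma exists_weight_rate (V : ℝ[X]) (hc : 0 < c) (hτ : 0 ≤ τ) :
    ∃ c₁ ξ : ℝ, 0 < c₁ ∧ 0 ≤ ξ ∧ (∀ j k l, nd k l ≤ V.natDegree + 2 →
        (expw c₁ j k - expw c₁ j l) ^ 2 ≤ ξ * (expw c₁ j k * expw c₁ j l)) ∧
      6 * ddBound Vᵈ τ * ξ * (2 * (V.natDegree + 2 : ℕ) + 1) ≤ c / 2 := by
  set D := V.natDegree + 2 with hD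
  set B := 6 * ddBound Vᵈ τ * 4 * (2 * (D : ℝ) + 1) with hB
  have hB0 : 0 ≤ B := by
    have := ddBound_nonneg Vᵈ hτ
    positivity
  set h := min 1 (c / (2 * (B + 1)))
  have hh0 : 0 < h := lt_min one_pos (by positivity)
  have hD0 : (0 : ℝ) < D := by rw [hD]; positivity
  refine ⟨h / D, 4 * h ^ 2, by positivity, by positivity, fun j k l hkl => ?_, ?_⟩
  · refine exp_sub_exp_sq_le ?_ (min_le_left _ _)
    have h1 : |(nd l j : ℝ) - nd k j| ≤ D := by
      have h2 : (nd l j : ℝ) ≤ nd k j + D := by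
        have : nd l j ≤ nd k j + D := by unfold nd at *; omega
        exact_mod_cast this
      have h3 : (nd k j : ℝ) ≤ nd l j + D := by
        have : nd k j ≤ nd l j + D := by unfold nd at *; omega
        exact_mod_cast this
      rw [abs_le]; constructor <;> linarith
    rw [show -(h / D * (nd k j : ℝ)) - -(h / D * (nd l j : ℝ))
      = h / D * ((nd l j : ℝ) - nd k j) by ring, abs_mul, abs_of_pos (by positivity)]
    calc h / D * |(nd l j : ℝ) - nd k j| ≤ h / D * D :=
          mul_le_mul_of_nonneg_left h1 (by positivity)
      _ = h := by field_simp
  · have h1 : h ^ 2 ≤ h := by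
      have : h ≤ 1 := min_le_left _ _
      nlinarith
    have h2 : h ≤ c / (2 * (B + 1)) := min_le_right _ _
    have h3 : B * h ≤ c / 2 := by
      have h4 : (B + 1) * h ≤ (B + 1) * (c / (2 * (B + 1))) :=
        mul_le_mul_of_nonneg_left h2 (by positivity)
      have h5 : (B + 1) * (c / (2 * (B + 1))) = c / 2 := by field_simp
      linarith
    calc _ = B * h ^ 2 := by rw [hB]; ring
      _ ≤ B * h := mul_le_mul_of_nonneg_left h1 hB0
      _ ≤ c / 2 := h3

/-- A bound for the total weight. -/
lemma exists_sum_expw_le (hc₁ : 0 < c₁) :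
    ∃ C : ℝ, 1 ≤ C ∧ ∀ (E : Finset ℕ) (j : ℕ), ∑ k ∈ E, expw c₁ j k ≤ C := by
  set x := exp (-c₁) with hx
  have hx0 : 0 < x := exp_pos _
  have hx1 : x < 1 := by rw [hx, Real.exp_lt_one_iff]; linarith
  refine ⟨2 * (1 - x)⁻¹, ?_, fun E j => ?_⟩
  · have : 1 ≤ (1 - x)⁻¹ := (one_le_inv₀ (by linarith)).2 (by linarith)
    linarith
  have hgeo : ∀ s : Finset ℕ, ∑ d ∈ s, x ^ d ≤ (1 - x)⁻¹ := fun s => by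
    rw [← tsum_geometric_of_lt_one hx0.le hx1]
    exact (summable_geometric_of_lt_one hx0.le hx1).sum_le_tsum _ (fun i _ => by positivity)
  have hxd : ∀ k, expw c₁ j k = x ^ (nd k j) := fun k => by
    rw [hx, ← exp_nat_mul, expw]; congr 1; ring
  simp only [hxd]
  rw [← Finset.sum_filter_add_sum_filter_not E (fun k => k ≤ j)]
  have h1 : ∑ k ∈ E.filter (fun k => k ≤ j), x ^ (nd k j) ≤ (1 - x)⁻¹ := by
    rw [← sum_image (s := E.filter (fun k => k ≤ j)) (g := fun k => nd k j) (f := fun d => x ^ d)]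
    · exact hgeo _
    · intro a ha b hb hab
      simp only [coe_filter, Set.mem_ofPred_eq] at ha hb
      unfold nd at hab
      simp only at hab; omega
  have h2 : ∑ k ∈ E.filter (fun k => ¬ k ≤ j), x ^ (nd k j) ≤ (1 - x)⁻¹ := by
    rw [← sum_image (s := E.filter (fun k => ¬ k ≤ j)) (g := fun k => nd k j) (f := fun d => x ^ d)]
    · exact hgeo _
    · intro a ha b hb hab
      simp only [coe_filter, Set.mem_ofPred_eq] at ha hb
      unfold nd at hab
      simp only at hab; omega
  linarith

/-! ### The gradient of the Hamiltonian near the local minimizers -/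

/-- A bound for the entries of `U(A)` when the row sums of `A` are at most `c`. -/
noncomputable def polBound (U : ℝ[X]) (c : ℝ) : ℝ :=
  ∑ m ∈ range (U.natDegree + 1), |U.coeff m| * c ^ m

lemma polBound_nonneg (U : ℝ[X]) (hc : 0 ≤ c) : 0 ≤ polBound U c := by
  unfold polBound; positivity

lemma rowBdd_aeval {ι : Type*} [Fintype ι] [DecidableEq ι] (U : ℝ[X]) {A : Matrix ι ι ℝ}
    (hA : RowBdd A c) (hc : 0 ≤ c) : RowBdd (aeval A U) (polBound U c) := by
  rw [aeval_eq_sum]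
  exact rowBdd_sum _ _ _ fun m _ => (hA.pow hc m).smul _

lemma abs_fst_le_ab2 (u : ℝ × ℝ) : |u.1| ≤ ab2 u := by unfold ab2; linarith [abs_nonneg u.2]

lemma abs_snd_le_ab2 (u : ℝ × ℝ) : |u.2| ≤ ab2 u := by unfold ab2; linarith [abs_nonneg u.1]

lemma ab2_add_le (u u' : ℝ × ℝ) : ab2 (u + u') ≤ ab2 u + ab2 u' := by
  unfold ab2
  have := abs_add_le u.1 u'.1
  have := abs_add_le u.2 u'.2
  simp only [Prod.fst_add, Prod.snd_add]; linarith

lemma ab2_neg (u : ℝ × ℝ) : ab2 (-u) = ab2 u := by simp [ab2]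

lemma ab2_sub_comm (u u' : ℝ × ℝ) : ab2 (u - u') = ab2 (u' - u) := by rw [← ab2_neg, neg_sub]

lemma ab2_sub_le (u x u' : ℝ × ℝ) : ab2 (u - u') ≤ ab2 (u - x) + ab2 (x - u') := by
  have := ab2_add_le (u - x) (x - u')
  rwa [sub_add_sub_cancel] at this

lemma ab2_smul (t : ℝ) (u : ℝ × ℝ) : ab2 (t • u) = |t| * ab2 u := by simp [ab2, abs_mul, mul_add]

lemma sq2_smul (t : ℝ) (u : ℝ × ℝ) : sq2 (t • u) = t ^ 2 * sq2 u := by simp [sq2]; ring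

/-- Crude bound for the gradient at bounded configurations. -/
lemma abs_grad_le (V : ℝ[X]) (hk : k ∈ Icc 1 (n - 1))
    {τ r L : ℝ} (hτ : 0 ≤ τ) (hr : 0 < r) (hv : RowBdd (jac n v) τ)
    (hb : r ≤ (v k).2) (hL : |logCoeff β n k| ≤ L) (u : ℝ × ℝ) :
    |grad V β n v k u| ≤ (2 * polBound Vᵈ τ + L / r) * ab2 u := by
  have h1 := abs_trace_mul_jac_single_le hk (fun i j => (rowBdd_aeval Vᵈ hv hτ).abs_le i j) u
  have h2 : |logCoeff β n k * (u.2 / (v k).2)| ≤ L / r * ab2 u := by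
    rw [abs_mul, abs_div, abs_of_pos (lt_of_lt_of_le hr hb), div_mul_eq_mul_div, mul_div_assoc]
    have : |u.2| / (v k).2 ≤ ab2 u / r := div_le_div₀ (ab2_nonneg u) (abs_snd_le_ab2 u) hr hb
    exact mul_le_mul hL this (by have := lt_of_lt_of_le hr hb; positivity) ((abs_nonneg _).trans hL)
  have h3 : (|u.1| + 2 * |u.2|) * polBound Vᵈ τ ≤ 2 * polBound Vᵈ τ * ab2 u := by
    have := polBound_nonneg Vᵈ hτ
    have h4 : |u.1| + 2 * |u.2| ≤ 2 * ab2 u := by unfold ab2; linarith [abs_nonneg u.1]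
    nlinarith
  unfold grad
  refine (abs_sub _ _).trans ?_
  rw [add_mul]; linarith

lemma logCoeff_eq (β : ℝ) (n k : ℕ) : logCoeff β n k = 1 - ((k : ℝ) / n + 1 / (n * β)) := by
  unfold logCoeff; ring

include hc hV in
/-- The gradient at a site near which the configuration is close to the local minimizer. -/
lemma abs_grad_le_of_near {s M : ℝ} (hk : V.natDegree + 1 ≤ k) (hk' : k + V.natDegree + 1 ≤ n)
    (hx : (k : ℝ) / n + 1 / (n * β) < 1) (hvk : (v k).2 = (dagger V β n k).2)
    (hM : ab2 (dagger V β n k) ≤ M) (hs : s ≤ 1) (hs0 : 0 ≤ s)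
    (hnear : ∀ e ∈ Icc 1 n, nd e k ≤ V.natDegree / 2 → ab2 (v e - dagger V β n k) ≤ s)
    (u : ℝ × ℝ) :
    |grad V β n v k u| ≤ 6 * ddBound Vᵈ (3 * (M + 1)) * s * ab2 u := by
  have hM0 : 0 ≤ M := (ab2_nonneg _).trans hM
  have hkI : k ∈ Icc 1 (n - 1) := mem_Icc.2 ⟨by omega, by omega⟩
  set p := dagger V β n k
  set v' : ℕ → ℝ × ℝ := fun e => if e ∈ Icc 1 n ∧ nd e k ≤ V.natDegree / 2 then v e else p
    with hv'
  have h1 := trace_aeval_derivative_jac_congr V hkI (v := v) (v' := v')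
    (fun e he he' => by simp only [hv']; rw [if_pos ⟨he, he'⟩]) u
  have h2 := trace_aeval_derivative_jac_const (n := n) (v := fun _ => p) (u := p) V (k := k)
    (fun _ _ => rfl) hk hk' u
  have h3 : gradW V p u = logCoeff β n k * (u.2 / (v k).2) := by
    rw [hvk, logCoeff_eq]
    exact gradW_localMin hc hV hx u
  have hclose : ∀ e, ab2 (v' e - p) ≤ s := fun e => by
    simp only [hv']
    split_ifs with h
    · exact hnear e h.1 h.2
    · simpa [ab2] using hs0
  have hbd : ∀ e, ab2 (v' e) ≤ M + 1 := fun e => by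
    have := ab2_add_le (v' e - p) p
    rw [sub_add_cancel] at this
    linarith [hclose e]
  have hA : RowBdd (jac n v') (3 * (M + 1)) := rowBdd_jac (by linarith)
    (fun e _ => (abs_fst_le_ab2 _).trans (hbd e)) (fun e _ => (abs_snd_le_ab2 _).trans (hbd e))
  have hB : RowBdd (jac n fun _ => p) (3 * (M + 1)) := rowBdd_jac (by linarith)
    (fun e _ => (abs_fst_le_ab2 _).trans (by linarith))
    (fun e _ => (abs_snd_le_ab2 _).trans (by linarith))
  have hY : RowBdd (jac n (v' - fun _ => p)) (3 * s) := rowBdd_jac hs0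
    (fun e _ => (abs_fst_le_ab2 _).trans (hclose e))
    (fun e _ => (abs_snd_le_ab2 _).trans (hclose e))
  have hdd := rowBdd_ddMat Vᵈ hA hB hY (by linarith) (by linarith)
  have h4 := abs_trace_mul_jac_single_le hkI (fun i j => hdd.abs_le i j) u
  rw [map_sub, ← aeval_sub_aeval, sub_mul, trace_sub, ← h1, h2, h3] at h4
  refine h4.trans ?_
  have := ddBound_nonneg Vᵈ (show 0 ≤ 3 * (M + 1) by linarith)
  have h5 : |u.1| + 2 * |u.2| ≤ 2 * ab2 u := by unfold ab2; linarith [abs_nonneg u.1]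
  calc (|u.1| + 2 * |u.2|) * (ddBound Vᵈ (3 * (M + 1)) * (3 * s))
      ≤ 2 * ab2 u * (ddBound Vᵈ (3 * (M + 1)) * (3 * s)) :=
        mul_le_mul_of_nonneg_right h5 (by positivity)
    _ = _ := by ring

include hc hV in
/-- Uniform properties of the local minimizers `dagger V β n k` in the bulk. -/
lemma exists_dagger_bounds (hβ : 0 < β) (hη : 0 < η) :
    ∃ M r Λ : ℝ, 0 < M ∧ 0 < r ∧ 0 < Λ ∧ ∀ n k : ℕ, 0 < n → (k : ℝ) / n + 1 / (n * β) ≤ 1 - η →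
      ab2 (dagger V β n k) ≤ M ∧ r ≤ (dagger V β n k).2 ∧ ∀ l : ℕ,
        (l : ℝ) / n + 1 / (n * β) ≤ 1 - η →
        ab2 (dagger V β n k - dagger V β n l) ≤ Λ * (nd k l / n) := by
  obtain ⟨M, hM, hMb⟩ := exists_localMin_le hc hV
  obtain ⟨r, hr, hrb⟩ := exists_le_localMin hc hV hη
  obtain ⟨Λ, hΛ, hΛb⟩ := exists_lipschitz_localMin hc hV hη
  refine ⟨2 * M, r, Λ, by linarith, hr, hΛ, fun n k hn hk => ?_⟩
  have hn' : (0 : ℝ) < n := mod_cast hn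
  have hx : ∀ k : ℕ, 0 ≤ (k : ℝ) / n + 1 / (n * β) := fun k => by positivity
  refine ⟨?_, hrb _ (hx k) hk, fun l hl => ?_⟩
  · obtain ⟨h1, h2⟩ := hMb _ (hx k) (by linarith)
    unfold ab2 dagger; linarith
  · refine (hΛb _ _ (hx k) hk (hx l) hl).trans ?_
    refine mul_le_mul_of_nonneg_left ?_ hΛ.le
    rw [add_sub_add_right_eq_sub, ← sub_div, abs_div, abs_of_pos hn']
    refine div_le_div_of_nonneg_right ?_ hn'.le
    unfold nd
    rcases le_total k l with h | h
    · rw [abs_of_nonpos (by have : (k : ℝ) ≤ l := mod_cast h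
                            linarith), Nat.sub_eq_zero_of_le h, zero_add, Nat.cast_sub h]
      linarith
    · rw [abs_of_nonneg (by have : (l : ℝ) ≤ k := mod_cast h
                            linarith), Nat.sub_eq_zero_of_le h, add_zero, Nat.cast_sub h]

/-! ### Linear changes of variables -/

lemma map_affine_volume (p : ℝ) {w : ℝ} (hw : 0 < 1 + w) :
    (volume : Measure ℝ).map (fun x => p + (1 + w)⁻¹ * (x - p)) = ofReal (1 + w) • volume := by
  have h1 : (volume : Measure ℝ).map (fun x => x - p) = volume :=
    (measurePreserving_sub_right volume p).map_eq
  have h2 : (volume : Measure ℝ).map (fun x => p + x) = volume :=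
    (measurePreserving_add_left volume p).map_eq
  have h3 := Real.map_volume_mul_left (a := (1 + w)⁻¹) (inv_ne_zero hw.ne')
  rw [inv_inv, abs_of_pos hw] at h3
  calc (volume : Measure ℝ).map (fun x => p + (1 + w)⁻¹ * (x - p))
      = (((volume : Measure ℝ).map (fun x => x - p)).map (fun x => (1 + w)⁻¹ * x)).map
          (fun x => p + x) := by
        rw [Measure.map_map (by fun_prop) (by fun_prop), Measure.map_map (by fun_prop) (by fun_prop)]
        rfl
    _ = _ := by rw [h1, h3, Measure.map_smul, h2]

lemma map_pi_smul {ι : Type*} [Fintype ι] {X : ι → Type*} [∀ i, MeasurableSpace (X i)]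
    {μ : ∀ i, Measure (X i)} [∀ i, SigmaFinite (μ i)] {T : ∀ i, X i → X i}
    (hT : ∀ i, Measurable (T i)) {c : ι → ℝ≥0∞} (hc : ∀ i, c i ≠ 0) (hc' : ∀ i, c i ≠ ∞)
    (h : ∀ i, (μ i).map (T i) = c i • μ i) :
    (Measure.pi μ).map (fun x i => T i (x i)) = (∏ i, c i) • Measure.pi μ := by
  have hP0 : ∏ i, c i ≠ 0 := Finset.prod_ne_zero_iff.2 fun i _ => hc i
  have hP1 : ∏ i, c i ≠ ∞ := ENNReal.prod_ne_top fun i _ => hc' i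
  have hmeas : Measurable fun (x : ∀ i, X i) i => T i (x i) :=
    measurable_pi_lambda _ fun i => (hT i).comp (measurable_pi_apply i)
  have key : Measure.pi μ = (∏ i, c i)⁻¹ • (Measure.pi μ).map (fun x i => T i (x i)) := by
    refine Measure.pi_eq fun s hs => ?_
    rw [Measure.smul_apply, Measure.map_apply hmeas (MeasurableSet.univ_pi hs)]
    have : (fun (x : ∀ i, X i) i => T i (x i)) ⁻¹' Set.pi univ s
        = Set.pi univ fun i => T i ⁻¹' s i := by ext x; simp
    rw [this, Measure.pi_pi]
    have h2 : ∀ i, μ i (T i ⁻¹' s i) = c i * μ i (s i) := fun i => by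
      rw [← Measure.map_apply (hT i) (hs i), h i, Measure.smul_apply, smul_eq_mul]
    simp only [h2, Finset.prod_mul_distrib, smul_eq_mul]
    rw [← mul_assoc, ENNReal.inv_mul_cancel hP0 hP1, one_mul]
  conv_rhs => rw [key]
  rw [smul_smul, ENNReal.mul_inv_cancel hP0 hP1, one_smul]

lemma map_prod_smul {X Y : Type*} [MeasurableSpace X] [MeasurableSpace Y] {μ : Measure X}
    {ν : Measure Y} [SFinite μ] [SFinite ν] {T : X → X} {S : Y → Y} (hT : Measurable T)
    (hS : Measurable S) {c d : ℝ≥0∞} (hμ : μ.map T = c • μ) (hν : ν.map S = d • ν) :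
    (μ.prod ν).map (Prod.map T S) = (c * d) • μ.prod ν := by
  rw [← Measure.map_prod_map _ _ hT hS, hμ, hν, Measure.prod_smul_left, Measure.prod_smul_right,
    smul_smul]

lemma lintegral_comp_of_map_smul {X : Type*} [MeasurableSpace X] {μ : Measure X} {T : X → X}
    (hT : Measurable T) {c : ℝ≥0∞} (h : μ.map T = c • μ) {f : X → ℝ≥0∞} (hf : Measurable f) :
    ∫⁻ x, f (T x) ∂μ = c * ∫⁻ x, f x ∂μ := by
  rw [← lintegral_map hf hT, h, lintegral_smul_measure, smul_eq_mul]

/-! ### The law as a measure on sequences -/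

/-- The configuration `k ↦ (a_k, b_k)` of a field. -/
noncomputable def seq {n : ℕ} (ω : Field n) : ℕ → ℝ × ℝ := fun k => (entA ω k, entB ω k)

lemma measurable_entA (k : ℕ) : Measurable fun ω : Field n => entA ω k := by
  unfold entA
  split_ifs
  · exact (measurable_pi_apply _).comp measurable_fst
  · exact measurable_const

lemma measurable_entB (k : ℕ) : Measurable fun ω : Field n => entB ω k := by
  unfold entB
  split_ifs
  · exact (measurable_pi_apply _).comp measurable_snd
  · exact measurable_const

lemma measurable_seq : Measurable (seq (n := n)) :=
  measurable_pi_lambda _ fun k => (measurable_entA k).prodMk (measurable_entB k)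

lemma entA_succ (ω : Field n) (i : Fin n) : entA ω (i + 1) = ω.1 i := by
  unfold entA
  rw [dif_pos ⟨by omega, by omega⟩]; rfl

lemma entB_succ (ω : Field n) (i : Fin (n - 1)) : entB ω (i + 1) = ω.2 i := by
  unfold entB
  rw [dif_pos ⟨by omega, by omega⟩]; rfl

lemma entA_eq_zero (ω : Field n) (h : k ∉ Icc 1 n) : entA ω k = 0 := by
  unfold entA
  rw [dif_neg (by rwa [mem_Icc] at h)]

lemma entB_eq_zero (ω : Field n) (h : k ∉ Icc 1 (n - 1)) : entB ω k = 0 := by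
  unfold entB
  rw [dif_neg (by rwa [mem_Icc] at h)]

open Classical in
/-- The unnormalized density on sequences. -/
noncomputable def dens (V : ℝ[X]) (β : ℝ) (n : ℕ) (v : ℕ → ℝ × ℝ) : ℝ≥0∞ :=
  if ∀ k ∈ Icc 1 (n - 1), 0 < (v k).2 then
    ofReal (exp (-(n * β * ham V β n v))) else 0

lemma continuous_jac (n : ℕ) : Continuous fun v : ℕ → ℝ × ℝ => jac n v := by
  refine continuous_matrix fun i j => ?_
  simp only [jac_apply]
  split_ifs <;> fun_prop

lemma continuous_trace_aeval_jac (V : ℝ[X]) (n : ℕ) :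
    Continuous fun v : ℕ → ℝ × ℝ => (aeval (jac n v) V).trace := by
  simp only [aeval_eq_sum]
  have := continuous_jac n
  fun_prop

lemma measurable_ham (V : ℝ[X]) (β : ℝ) (n : ℕ) : Measurable (ham V β n) := by
  have h : ham V β n = fun v => (aeval (jac n v) V).trace
      - ∑ k ∈ Icc 1 (n - 1), logCoeff β n k * log (v k).2 := rfl
  rw [h]
  exact (continuous_trace_aeval_jac V n).measurable.sub (Finset.measurable_fun_sum _ fun k _ =>
    (Real.measurable_log.comp (measurable_snd.comp (measurable_pi_apply k))).const_mul _)

lemma measurableSet_pos (s : Finset ℕ) : MeasurableSet {v : ℕ → ℝ × ℝ | ∀ k ∈ s, 0 < (v k).2} := by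
  simp only [ofPred_forall]
  exact measurableSet_biInter _ fun k _ =>
    measurableSet_lt measurable_const (measurable_snd.comp (measurable_pi_apply k))

lemma measurable_dens (V : ℝ[X]) (β : ℝ) (n : ℕ) : Measurable (dens V β n) := by
  unfold dens
  refine Measurable.ite (measurableSet_pos _) ?_ measurable_const
  exact (measurable_exp.comp ((measurable_ham V β n).const_mul _).neg).ennreal_ofReal

/-- The unnormalized law of the field, as a measure on sequences. -/
noncomputable def Lam (V : ℝ[X]) (β : ℝ) (n : ℕ) : Measure (ℕ → ℝ × ℝ) :=
  ((volume : Measure (Field n)).withDensity fun ω => dens V β n (seq ω)).map seq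

lemma lintegral_Lam (V : ℝ[X]) (β : ℝ) (n : ℕ) {g : (ℕ → ℝ × ℝ) → ℝ≥0∞} (hg : Measurable g) :
    ∫⁻ v, g v ∂(Lam V β n) = ∫⁻ ω : Field n, dens V β n (seq ω) * g (seq ω) := by
  rw [Lam, lintegral_map hg measurable_seq]
  exact lintegral_withDensity_eq_lintegral_mul volume
    ((measurable_dens V β n).comp measurable_seq) (hg.comp measurable_seq)

lemma Lam_apply (V : ℝ[X]) (β : ℝ) (n : ℕ) {X : Set (ℕ → ℝ × ℝ)} (hX : MeasurableSet X) :
    Lam V β n X = ∫⁻ ω : Field n, dens V β n (seq ω) * X.indicator 1 (seq ω) := by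
  rw [← lintegral_indicator_one hX, lintegral_Lam _ _ _ (measurable_one.indicator hX)]

lemma law_density_eq (V : ℝ[X]) (β : ℝ) (n : ℕ) :
    law V β n = normalized fun ω : Field n => dens V β n (seq ω) := by
  unfold law dens
  congr 1
  ext ω
  have : (∀ k, 0 < ω.2 k) ↔ ∀ k ∈ Icc 1 (n - 1), 0 < (seq ω k).2 := by
    constructor
    · intro h k hk
      rw [mem_Icc] at hk
      obtain ⟨p, rfl⟩ : ∃ p, k = p + 1 := ⟨k - 1, by omega⟩
      have := entB_succ ω ⟨p, by omega⟩
      simp only [seq]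
      rw [this]
      exact h _
    · intro h k
      have := h (k + 1) (mem_Icc.2 ⟨by omega, by omega⟩)
      simp only [seq] at this
      rwa [entB_succ] at this
  by_cases h : ∀ k, 0 < ω.2 k
  · rw [if_pos h, if_pos (this.1 h)]; rfl
  · rw [if_neg h, if_neg (fun h' => h (this.2 h'))]

lemma Lam_univ (V : ℝ[X]) (β : ℝ) (n : ℕ) :
    Lam V β n univ = ∫⁻ ω : Field n, dens V β n (seq ω) := by
  rw [Lam_apply _ _ _ MeasurableSet.univ]; simp

lemma law_map_seq (V : ℝ[X]) (β : ℝ) (n : ℕ) :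
    (law V β n).map seq = (Lam V β n univ)⁻¹ • Lam V β n := by
  rw [law_density_eq, normalized, Measure.map_smul, Lam_univ]; rfl

/-! ### Contractions of the law -/

/-- The map contracting the configuration towards `p` by factors `1 / (1 + wa_k)`,
`1 / (1 + wb_k)`. -/
noncomputable def shrink₂ (p : ℕ → ℝ × ℝ) (wa wb : ℕ → ℝ) (v : ℕ → ℝ × ℝ) : ℕ → ℝ × ℝ :=
  fun k => ((p k).1 + (1 + wa k)⁻¹ * ((v k).1 - (p k).1),
    (p k).2 + (1 + wb k)⁻¹ * ((v k).2 - (p k).2))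

lemma shrink₂_self (p : ℕ → ℝ × ℝ) (w : ℕ → ℝ) (v : ℕ → ℝ × ℝ) :
    shrink₂ p w w v = shrink p w v := rfl

lemma measurable_shrink₂ (p : ℕ → ℝ × ℝ) (wa wb : ℕ → ℝ) : Measurable (shrink₂ p wa wb) := by
  refine measurable_pi_lambda _ fun k => ?_
  unfold shrink₂
  fun_prop

/-- The Jacobian of a contraction. -/
noncomputable def jacFactor (n : ℕ) (wa wb : ℕ → ℝ) : ℝ :=
  (∏ k ∈ Icc 1 n, (1 + wa k)) * ∏ k ∈ Icc 1 (n - 1), (1 + wb k)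

lemma prod_Icc_eq_prod_fin (n : ℕ) (f : ℕ → ℝ) : ∏ k ∈ Icc 1 n, f k = ∏ i : Fin n, f (i + 1) := by
  rw [← Finset.prod_range (fun i => f (i + 1)), range_eq_Ico, Finset.prod_Ico_add' f 0 n 1]; rfl

lemma lintegral_shrink₂ (p : ℕ → ℝ × ℝ) {wa wb : ℕ → ℝ} (hwa : ∀ k, 0 < 1 + wa k)
    (hwb : ∀ k, 0 < 1 + wb k) (hwa' : ∀ k ∉ Icc 1 n, wa k = 0)
    (hwb' : ∀ k ∉ Icc 1 (n - 1), wb k = 0) {h : (ℕ → ℝ × ℝ) → ℝ≥0∞} (hh : Measurable h) :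
    ∫⁻ ω : Field n, h (shrink₂ p wa wb (seq ω))
      = ofReal (jacFactor n wa wb) * ∫⁻ ω : Field n, h (seq ω) := by
  set T : Field n → Field n := Prod.map
    (fun x i => (p (i + 1)).1 + (1 + wa (i + 1))⁻¹ * (x i - (p (i + 1)).1))
    (fun x i => (p (i + 1)).2 + (1 + wb (i + 1))⁻¹ * (x i - (p (i + 1)).2))
  have hTm : Measurable T := by
    refine Measurable.prodMap ?_ ?_ <;> exact measurable_pi_lambda _ fun i => by fun_prop
  have hmap : (volume : Measure (Field n)).map T = ofReal (jacFactor n wa wb) • volume := by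
    have h1 := map_pi_smul (μ := fun _ : Fin n => (volume : Measure ℝ))
      (T := fun i x => (p (i + 1)).1 + (1 + wa (i + 1))⁻¹ * (x - (p (i + 1)).1))
      (fun i => by fun_prop) (c := fun i => ofReal (1 + wa (i + 1)))
      (fun i => by simpa using hwa _) (fun i => ofReal_ne_top)
      (fun i => map_affine_volume _ (hwa _))
    have h2 := map_pi_smul (μ := fun _ : Fin (n - 1) => (volume : Measure ℝ))
      (T := fun i x => (p (i + 1)).2 + (1 + wb (i + 1))⁻¹ * (x - (p (i + 1)).2))
      (fun i => by fun_prop) (c := fun i => ofReal (1 + wb (i + 1)))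
      (fun i => by simpa using hwb _) (fun i => ofReal_ne_top)
      (fun i => map_affine_volume _ (hwb _))
    have h3 := map_prod_smul (measurable_pi_lambda _ fun i => by fun_prop)
      (measurable_pi_lambda _ fun i => by fun_prop) h1 h2
    rw [jacFactor, prod_Icc_eq_prod_fin n fun k => 1 + wa k,
      prod_Icc_eq_prod_fin (n - 1) fun k => 1 + wb k,
      ofReal_mul (prod_nonneg fun i _ => (hwa _).le),
      ofReal_prod_of_nonneg (fun i _ => (hwa _).le),
      ofReal_prod_of_nonneg (fun i _ => (hwb _).le)]
    exact h3
  have hcomp : ∀ ω : Field n, shrink₂ p wa wb (seq ω) = seq (T ω) := fun ω => by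
    ext k
    · simp only [shrink₂, seq]
      by_cases hk : k ∈ Icc 1 n
      · have hk' := mem_Icc.1 hk
        obtain ⟨q, rfl⟩ : ∃ q, k = q + 1 := ⟨k - 1, by omega⟩
        have e1 := entA_succ ω ⟨q, by omega⟩
        have e2 := entA_succ (T ω) ⟨q, by omega⟩
        simp only at e1 e2
        rw [e1, e2]; rfl
      · rw [entA_eq_zero _ hk, entA_eq_zero _ hk, hwa' k hk]; ring
    · simp only [shrink₂, seq]
      by_cases hk : k ∈ Icc 1 (n - 1)
      · have hk' := mem_Icc.1 hk
        obtain ⟨q, rfl⟩ : ∃ q, k = q + 1 := ⟨k - 1, by omega⟩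
        have e1 := entB_succ ω ⟨q, by omega⟩
        have e2 := entB_succ (T ω) ⟨q, by omega⟩
        simp only at e1 e2
        rw [e1, e2]; rfl
      · rw [entB_eq_zero _ hk, entB_eq_zero _ hk, hwb' k hk]; ring
  simp only [hcomp]
  exact lintegral_comp_of_map_smul hTm hmap (hh.comp measurable_seq)

/-- If contracting increases the density on `D` by a factor `1 / K`, then `D` has small mass. -/
lemma Lam_le_of_shrink (V : ℝ[X]) (β : ℝ) (p : ℕ → ℝ × ℝ) {wa wb : ℕ → ℝ}
    (hwa : ∀ k, 0 < 1 + wa k) (hwb : ∀ k, 0 < 1 + wb k)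
    (hwa' : ∀ k ∉ Icc 1 n, wa k = 0) (hwb' : ∀ k ∉ Icc 1 (n - 1), wb k = 0)
    {X D : Set (ℕ → ℝ × ℝ)} (hX : MeasurableSet X) (hD : MeasurableSet D) {K : ℝ≥0∞}
    (h : ∀ v ∈ D, (∀ k ∈ Icc 1 (n - 1), 0 < (v k).2) → (∀ k ∉ Icc 1 n, v k = 0) →
      (v n).2 = 0 → shrink₂ p wa wb v ∈ X ∧ dens V β n v ≤ K * dens V β n (shrink₂ p wa wb v)) :
    Lam V β n D ≤ K * ofReal (jacFactor n wa wb) * Lam V β n X := by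
  have hm : Measurable fun ω : Field n => dens V β n (shrink₂ p wa wb (seq ω)) *
      X.indicator 1 (shrink₂ p wa wb (seq ω)) := (((measurable_dens V β n).mul
      (measurable_one.indicator hX)).comp (measurable_shrink₂ p wa wb)).comp measurable_seq
  rw [Lam_apply _ _ _ hD, Lam_apply _ _ _ hX, mul_assoc,
    ← lintegral_shrink₂ p hwa hwb hwa' hwb' (h := fun v => dens V β n v * X.indicator 1 v)
      ((measurable_dens V β n).mul (measurable_one.indicator hX)),
    ← lintegral_const_mul _ hm]
  refine lintegral_mono fun ω => ?_
  by_cases hω : seq ω ∈ D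
  · rw [indicator_of_mem hω, Pi.one_apply, mul_one]
    by_cases hpos : ∀ k ∈ Icc 1 (n - 1), 0 < (seq ω k).2
    · obtain ⟨h1, h2⟩ := h _ hω hpos (fun k hk => by
          have hk' : k ∉ Icc 1 (n - 1) := fun hk' => hk (by rw [mem_Icc] at hk' ⊢; omega)
          simp [seq, entA_eq_zero ω hk, entB_eq_zero ω hk'])
        (entB_eq_zero ω (by rw [mem_Icc]; omega))
      simp only [indicator_of_mem h1, Pi.one_apply, mul_one]
      exact h2
    · rw [dens, if_neg hpos]; exact zero_le
  · rw [Set.indicator_of_notMem hω, mul_zero]; exact zero_le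

lemma dens_le_of_ham (hv : ∀ k ∈ Icc 1 (n - 1), 0 < (v' k).2) (hβ : 0 ≤ β)
    (hh : h ≤ ham V β n v - ham V β n v') :
    dens V β n v ≤ ofReal (exp (-(n * β * h))) * dens V β n v' := by
  unfold dens
  rw [if_pos hv, ← ofReal_mul (exp_pos _).le, ← exp_add]
  split_ifs
  · refine ofReal_le_ofReal (exp_le_exp.2 ?_)
    have : 0 ≤ (n : ℝ) * β := by positivity
    nlinarith
  · exact zero_le

/-! ### Finiteness of the partition function -/

lemma trace_jac_sq_ge (n : ℕ) (ω : Field n) :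
    ∑ i, ω.1 i ^ 2 + ∑ i, ω.2 i ^ 2 ≤ (jac n (seq ω) * jac n (seq ω)).trace := by
  have h1 : (jac n (seq ω) * jac n (seq ω)).trace = ∑ i, ∑ j, jac n (seq ω) i j ^ 2 := by
    rw [trace]
    refine sum_congr rfl fun i _ => ?_
    rw [diag_apply, Matrix.mul_apply]
    refine sum_congr rfl fun j _ => ?_
    rw [(jac_isSymm n (seq ω)).apply i j]; ring
  have h2 : ∑ i, ω.2 i ^ 2 = ∑ i : Fin n, if h : (i : ℕ) + 1 < n then ω.2 ⟨i, by omega⟩ ^ 2 else 0 := by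
    rcases n with _ | m
    · simp
    · rw [Fin.sum_univ_castSucc]
      simp only [Fin.val_castSucc, Fin.val_last, lt_self_iff_false, dite_false, add_zero]
      refine sum_congr rfl fun i _ => ?_
      rw [dif_pos (by omega)]
  rw [h1, h2, ← sum_add_distrib]
  refine sum_le_sum fun i _ => ?_
  have e1 : jac n (seq ω) i i = ω.1 i := by rw [jac_apply, if_pos rfl, seq, entA_succ]
  split_ifs with h
  · have hne : i ≠ ⟨i + 1, h⟩ := by simp [Fin.ext_iff]
    have e2 : jac n (seq ω) i ⟨i + 1, h⟩ = ω.2 ⟨i, by omega⟩ := by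
      rw [jac_apply, if_neg hne, if_pos rfl, seq]
      exact entB_succ ω ⟨i, by omega⟩
    have h3 := sum_le_sum_of_subset_of_nonneg (f := fun j => jac n (seq ω) i j ^ 2)
      (subset_univ {i, ⟨i + 1, h⟩}) fun _ _ _ => sq_nonneg _
    rwa [sum_pair hne, e1, e2] at h3
  · rw [add_zero, ← e1]
    exact single_le_sum (f := fun j => jac n (seq ω) i j ^ 2) (fun _ _ => sq_nonneg _) (mem_univ i)

lemma sum_Icc_eq_sum_fin (n : ℕ) (f : ℕ → ℝ) : ∑ k ∈ Icc 1 n, f k = ∑ i : Fin n, f (i + 1) := by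
  rw [← sum_range (fun i => f (i + 1)), range_eq_Ico, Finset.sum_Ico_add' f 0 n 1]; rfl

include hc hV hβ in
lemma Lam_univ_ne_top (hn : 0 < n) : Lam V β n univ ≠ ∞ := by
  obtain ⟨R, hR⟩ := exists_quadratic_le hc hV
  set κ : ℝ := n * β * (c / 4) with hκ
  have hκ0 : 0 < κ := by positivity
  set s : Fin (n - 1) → ℝ := fun i => n * β * logCoeff β n (i + 1) with hs
  have hs1 : ∀ i, -1 < s i := fun i => by
    have hi : ((i : ℕ) : ℝ) + 1 < n := by
      have := i.2
      have : (i : ℕ) + 1 < n := by omega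
      exact_mod_cast this
    have : s i = β * (n - (i + 1)) - 1 := by
      simp only [hs, logCoeff]
      push_cast; field_simp
    rw [this]
    have : 0 < β * (n - ((i : ℕ) + 1)) := mul_pos hβ (by linarith)
    linarith
  set F : Field n → ℝ := fun ω => exp (n * β * (R * n)) *
    ((∏ i, exp (-κ * ω.1 i ^ 2)) * ∏ i, (Ioi 0).indicator
      (fun x => x ^ s i * exp (-κ * x ^ 2)) (ω.2 i)) with hF
  have hint : Integrable F := by
    refine Integrable.const_mul (Integrable.mul_prod (f := fun x : Fin n → ℝ =>
      ∏ i, exp (-κ * x i ^ 2)) (g := fun y : Fin (n - 1) → ℝ => ∏ i, (Ioi 0).indicator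
      (fun x => x ^ s i * exp (-κ * x ^ 2)) (y i)) ?_ ?_) _
    · exact Integrable.fintype_prod fun i => integrable_exp_neg_mul_sq hκ0
    · exact Integrable.fintype_prod (f := fun i => (Ioi 0).indicator
        (fun x => x ^ s i * exp (-κ * x ^ 2))) fun i =>
        (integrable_indicator_iff measurableSet_Ioi).2
          (integrableOn_rpow_mul_exp_neg_mul_sq hκ0 (hs1 i))
  have hle : ∀ ω : Field n, dens V β n (seq ω) ≤ ofReal (F ω) := fun ω => by
    unfold dens
    split_ifs with hpos
    swap
    · exact zero_le
    have hpos' : ∀ i, 0 < ω.2 i := fun i => by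
      have := hpos (i + 1) (mem_Icc.2 ⟨by omega, by omega⟩)
      simp only [seq] at this
      rwa [entB_succ] at this
    refine ofReal_le_ofReal ?_
    have h1 := trace_aeval_ge_quadratic hR (jac_isSymm n (seq ω))
    rw [Fintype.card_fin] at h1
    have h2 := trace_jac_sq_ge n ω
    have h3 : ∀ i, (Ioi 0).indicator (fun x => x ^ s i * exp (-κ * x ^ 2)) (ω.2 i)
        = exp (s i * log (ω.2 i) + -κ * ω.2 i ^ 2) := fun i => by
      rw [indicator_of_mem (Set.mem_Ioi.2 (hpos' i)), Real.rpow_def_of_pos (hpos' i), exp_add, mul_comm (log _)]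
    simp only [hF, h3]
    rw [← exp_sum, ← exp_sum, ← exp_add, ← exp_add, exp_le_exp, ham_eq,
      sum_Icc_eq_sum_fin (n - 1) fun k => logCoeff β n k * log (seq ω k).2,
      sum_add_distrib, ← mul_sum, ← mul_sum]
    have h4 : ∑ i : Fin (n - 1), s i * log (ω.2 i)
        = n * β * ∑ i : Fin (n - 1), logCoeff β n (i + 1) * log (seq ω (i + 1)).2 := by
      rw [mul_sum]
      refine sum_congr rfl fun i _ => ?_
      simp only [hs, seq]
      rw [entB_succ]; ring
    rw [h4]
    have h5 := mul_le_mul_of_nonneg_left h1 (show 0 ≤ n * β by positivity)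
    have h6 := mul_le_mul_of_nonneg_left h2 hκ0.le
    have h7 : n * β * (c / 4 * (jac n (seq ω) * jac n (seq ω)).trace - R * n)
        = κ * (jac n (seq ω) * jac n (seq ω)).trace - n * β * (R * n) := by rw [hκ]; ring
    rw [h7] at h5; linarith
  rw [Lam_univ]
  exact ((lintegral_mono hle).trans_lt hint.lintegral_lt_top).ne

lemma Lam_univ_ne_zero (V : ℝ[X]) (β : ℝ) (n : ℕ) : Lam V β n univ ≠ 0 := by
  rw [Lam_univ]
  refine ((lintegral_pos_iff_support ((measurable_dens V β n).comp measurable_seq)).2 ?_).ne'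
  have hopen : IsOpen {ω : Field n | ∀ i, 0 < ω.2 i} := by
    simp only [ofPred_forall]
    exact isOpen_iInter_of_finite fun i => isOpen_lt continuous_const (by fun_prop)
  refine lt_of_lt_of_le (hopen.measure_pos volume ⟨(fun _ => 0, fun _ => 1), fun i => one_pos⟩)
    (measure_mono fun ω hω => ?_)
  rw [Function.mem_support]
  have hpos : ∀ k ∈ Icc 1 (n - 1), 0 < (seq ω k).2 := fun k hk => by
    rw [mem_Icc] at hk
    obtain ⟨q, rfl⟩ : ∃ q, k = q + 1 := ⟨k - 1, by omega⟩
    have := entB_succ ω ⟨q, by omega⟩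
    simp only [seq]
    rw [this]
    exact hω _
  simp only [Function.comp, dens]
  rw [if_pos hpos]
  simpa using exp_pos _

/-! ### A priori bounds on single sites -/

include hc hV in
/-- Contracting row and column `p` increases `tr V` in a controlled way. -/
lemma trace_aeval_sub_ge_of_row {ι : Type*} [Fintype ι] [DecidableEq ι]
    {T Z : Matrix ι ι ℝ} (hT : T.IsSymm) (hZ : Z.IsSymm) (p : ι)
    (h : ∀ i j, T i j - Z i j = ((if i = p then 1 else 0) + (if j = p then 1 else 0)) * Z i j) :
    c * ∑ j, Z p j ^ 2 - Vᵈ.eval 0 ^ 2 / c ≤ (aeval T V).trace - (aeval Z V).trace := by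
  set E : Matrix ι ι ℝ := diagonal fun i => if i = p then 1 else 0 with hE
  have hTZ : T - Z = E * Z + Z * E := by
    ext i j
    rw [Matrix.sub_apply, h, Matrix.add_apply, hE, diagonal_mul, mul_diagonal]; ring
  have htr : ∀ P : Matrix ι ι ℝ, (P * E).trace = P p p := fun P => by simp [hE, trace, mul_diagonal]
  have hcomm : aeval Z Vᵈ * Z = Z * aeval Z Vᵈ := by
    have h := congrArg (aeval Z) (mul_comm Vᵈ (X : ℝ[X]))
    rwa [map_mul, map_mul, aeval_X] at h
  have h1 := trace_aeval_ge hV hT hZ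
  have h2 : (aeval Z Vᵈ * (T - Z)).trace = 2 * (Z * aeval Z Vᵈ) p p := by
    rw [hTZ, mul_add, trace_add, ← mul_assoc (aeval Z _) Z E, htr,
      ← mul_assoc (aeval Z _) E Z, trace_mul_comm, ← mul_assoc, htr, hcomm]
    ring
  have h3 : 0 ≤ ((T - Z) * (T - Z)).trace := by
    rw [trace]
    refine sum_nonneg fun i _ => ?_
    rw [diag_apply, Matrix.mul_apply]
    refine sum_nonneg fun j _ => ?_
    rw [(hT.sub hZ).apply i j]
    exact mul_self_nonneg _
  have h4 : (aeval Z (C c * X ^ 2 + C (Vᵈ.eval 0) * X)) p p ≤ (aeval Z (X * Vᵈ)) p p := by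
    refine aeval_diag_le (fun x => ?_) hZ p
    simpa using mul_derivative_ge hV x
  have h5 : (aeval Z (C c * X ^ 2 + C (Vᵈ.eval 0) * X)) p p
      = c * ∑ j, Z p j ^ 2 + Vᵈ.eval 0 * Z p p := by
    simp only [map_add, map_mul, map_pow, aeval_X, aeval_C, Matrix.add_apply]
    rw [Algebra.algebraMap_eq_smul_one, Algebra.algebraMap_eq_smul_one, smul_mul_assoc, one_mul,
      smul_mul_assoc, one_mul, Matrix.smul_apply, Matrix.smul_apply, smul_eq_mul, smul_eq_mul, sq,
      Matrix.mul_apply]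
    congr 2
    refine sum_congr rfl fun j _ => ?_
    rw [hZ.apply p j, sq]
  rw [map_mul, aeval_X, h5] at h4
  have h6 : Z p p ^ 2 ≤ ∑ j, Z p j ^ 2 :=
    single_le_sum (f := fun j => Z p j ^ 2) (fun _ _ => sq_nonneg _) (mem_univ p)
  set a := Vᵈ.eval 0
  have h7 : -(a ^ 2 / c) ≤ c * Z p p ^ 2 + 2 * (a * Z p p) := by
    have : c * Z p p ^ 2 + 2 * (a * Z p p) + a ^ 2 / c = (c * Z p p + a) ^ 2 / c := by
      field_simp; ring
    have h8 : 0 ≤ (c * Z p p + a) ^ 2 / c := by positivity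
    linarith
  have h8 := mul_le_mul_of_nonneg_left h6 hc.le
  have h9 : 0 ≤ c / 2 * ((T - Z) * (T - Z)).trace := by positivity
  rw [h2] at h1; linarith

include hc hV hβ in
/-- A single site of the field is unlikely to be large, even conditionally on an event that does
not involve it. -/
lemma exists_site_bound :
    ∃ τ : ℝ, 0 < τ ∧ ∀ n k : ℕ, k ∈ Icc 1 n → ∀ X : Set (ℕ → ℝ × ℝ), MeasurableSet X →
      (∀ v ∈ X, ∀ v' : ℕ → ℝ × ℝ, (∀ e, e ≠ k → e + 1 ≠ k → v' e = v e) → v' ∈ X) →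
      Lam V β n (X ∩ {v | τ < sq2 (v k)}) ≤ ofReal (12 * exp (-n)) * Lam V β n X := by
  set a := Vᵈ.eval 0
  refine ⟨9 / c * (1 / β + a ^ 2 / c + 2), by positivity, fun n k hk X hX hinv => ?_⟩
  set τ := 9 / c * (1 / β + a ^ 2 / c + 2) with hτ
  obtain ⟨hk1, hkn⟩ := mem_Icc.1 hk
  set wa : ℕ → ℝ := fun e => if e = k then 2 else 0 with hwa
  set wb : ℕ → ℝ := fun e => if e ∈ Icc 1 (n - 1) ∧ (e = k ∨ e + 1 = k) then 1 else 0
    with hwb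
  have hjac : jacFactor n wa wb ≤ 12 := by
    have h1 : ∏ e ∈ Icc 1 n, (1 + wa e) = 3 := by
      rw [prod_eq_single k]
      · simp [hwa]; norm_num
      · intro e _ he; simp [hwa, he]
      · exact fun h => absurd hk h
    have h2 : ∏ e ∈ Icc 1 (n - 1), (1 + wb e) ≤ 4 := by
      have h3 : ∀ m : ℕ, ∏ e ∈ Icc 1 (n - 1), (1 + if e = m then (1 : ℝ) else 0) ≤ 2 := fun m => by
        by_cases hm : m ∈ Icc 1 (n - 1)
        · rw [prod_eq_single m (fun e _ he => by simp [he]) fun h => absurd hm h]; norm_num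
        · rw [prod_eq_one]
          · norm_num
          · intro e he
            rw [if_neg, add_zero]
            rintro rfl
            exact hm he
      have h4 : ∏ e ∈ Icc 1 (n - 1), (1 + wb e)
          ≤ ∏ e ∈ Icc 1 (n - 1), ((1 + if e = k then (1 : ℝ) else 0) *
            (1 + if e = k - 1 then (1 : ℝ) else 0)) := by
        refine Finset.prod_le_prod (fun e _ => ?_) fun e he => ?_
        · simp only [hwb]; split_ifs <;> norm_num
        · simp only [hwb, he, true_and]; split_ifs <;> first | (exfalso; omega) | norm_num
      refine h4.trans ?_
      rw [Finset.prod_mul_distrib]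
      calc _ ≤ (2 : ℝ) * 2 := mul_le_mul (h3 _) (h3 _) (prod_nonneg fun e _ => by
              split_ifs <;> norm_num) (by norm_num)
        _ = 4 := by norm_num
    rw [jacFactor, h1]; linarith
  refine (Lam_le_of_shrink V β (fun _ => (0, 0)) (wa := wa) (wb := wb)
    (K := ofReal (exp (-n))) (fun e => ?_) (fun e => ?_) (fun e he => ?_)
    (fun e he => ?_) hX (hX.inter ?_) ?_).trans ?_
  · simp only [hwa]; split_ifs <;> norm_num
  · simp only [hwb]; split_ifs <;> norm_num
  · simp only [hwa]; rw [if_neg]; rintro rfl; exact he hk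
  · simp only [hwb]; rw [if_neg]; exact fun h => he h.1
  · refine measurableSet_lt measurable_const ?_
    unfold sq2
    exact ((measurable_fst.comp (measurable_pi_apply k)).pow_const 2).add
      ((measurable_snd.comp (measurable_pi_apply k)).pow_const 2)
  · rintro v ⟨hvX, hvk⟩ hpos hv0 hvn
    have hvk : τ < sq2 (v k) := hvk
    set Z := shrink₂ (fun _ => (0, 0)) wa wb v with hZ
    have hZ1 : ∀ e, (Z e).1 = (1 + wa e)⁻¹ * (v e).1 := by intro e; simp [hZ, shrink₂]
    have hZ2 : ∀ e, (Z e).2 = (1 + wb e)⁻¹ * (v e).2 := by intro e; simp [hZ, shrink₂]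
    have hZpos : ∀ e ∈ Icc 1 (n - 1), 0 < (Z e).2 := fun e he => by
      rw [hZ2]
      refine mul_pos (inv_pos.2 ?_) (hpos e he)
      simp only [hwb]; split_ifs <;> norm_num
    refine ⟨hinv v hvX Z fun e he he' => ?_, ?_⟩
    · ext
      · rw [hZ1]; simp [hwa, he]
      · rw [hZ2]; simp [hwb, he, he']
    refine (dens_le_of_ham (h := 1 / β) hZpos hβ.le ?_).trans_eq ?_
    swap
    · rw [mul_assoc, mul_one_div_cancel hβ.ne', mul_one]
    obtain ⟨q, rfl⟩ : ∃ q, k = q + 1 := ⟨k - 1, by omega⟩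
    have hq : q < n := by omega
    have h1 := trace_aeval_sub_ge_of_row hc hV (jac_isSymm n v) (jac_isSymm n Z) ⟨q, hq⟩ (by
      intro i j
      rw [jac_apply, jac_apply]
      by_cases hij : i = j
      · subst hij
        simp only [if_true, hZ1, hwa]
        by_cases hi : i = ⟨q, hq⟩
        · subst hi
          simp only [if_true]
          norm_num; ring
        · have : ¬ ((i : ℕ) + 1 = q + 1) := fun h => hi (Fin.ext (by simpa using h))
          rw [if_neg this, if_neg hi]; ring
      · rw [if_neg hij, if_neg hij]
        have hi : (i = ⟨q, hq⟩) ↔ (i : ℕ) = q := Fin.ext_iff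
        have hj : (j = ⟨q, hq⟩) ↔ (j : ℕ) = q := Fin.ext_iff
        simp only [hi, hj]
        by_cases h1 : (i : ℕ) + 1 = j
        · rw [if_pos h1, if_pos h1, hZ2]
          simp only [hwb]
          have hm : (i : ℕ) + 1 ∈ Icc 1 (n - 1) := mem_Icc.2 ⟨by omega, by omega⟩
          simp only [hm, true_and]
          by_cases c1 : (i : ℕ) = q
          · rw [if_pos (by omega), if_pos c1, if_neg (by omega)]; ring
          · by_cases c2 : (j : ℕ) = q
            · rw [if_pos (by omega), if_neg c1, if_pos c2]; ring
            · rw [if_neg (by omega), if_neg c1, if_neg c2]; ring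
        · rw [if_neg h1, if_neg h1]
          by_cases h2 : (j : ℕ) + 1 = i
          · rw [if_pos h2, if_pos h2, hZ2]
            simp only [hwb]
            have hm : (j : ℕ) + 1 ∈ Icc 1 (n - 1) := mem_Icc.2 ⟨by omega, by omega⟩
            simp only [hm, true_and]
            by_cases c1 : (i : ℕ) = q
            · rw [if_pos (by omega), if_pos c1, if_neg (by omega)]; ring
            · by_cases c2 : (j : ℕ) = q
              · rw [if_pos (by omega), if_neg c1, if_pos c2]; ring
              · rw [if_neg (by omega), if_neg c1, if_neg c2]; ring
          · rw [if_neg h2, if_neg h2]; ring)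
    have h2 : 1 / 9 * sq2 (v (q + 1)) ≤ ∑ j, jac n Z ⟨q, hq⟩ j ^ 2 := by
      have e1 : jac n Z ⟨q, hq⟩ ⟨q, hq⟩ = (1 / 3) * (v (q + 1)).1 := by
        rw [jac_diag, hZ1]; simp only [hwa, if_true]; norm_num
      by_cases hqn : q + 1 < n
      · have hne : (⟨q, hq⟩ : Fin n) ≠ ⟨q + 1, hqn⟩ := by simp [Fin.ext_iff]
        have h3 := sum_le_sum_of_subset_of_nonneg (f := fun j => jac n Z ⟨q, hq⟩ j ^ 2)
          (subset_univ {⟨q, hq⟩, ⟨q + 1, hqn⟩}) fun _ _ _ => sq_nonneg _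
        have e2 : jac n Z ⟨q, hq⟩ ⟨q + 1, hqn⟩ = (1 / 2) * (v (q + 1)).2 := by
          rw [jac_offdiag hqn, hZ2]
          simp only [hwb]
          rw [if_pos ⟨mem_Icc.2 ⟨by omega, by omega⟩, by simp⟩]; norm_num
        rw [sum_pair hne, e1, e2] at h3
        unfold sq2
        nlinarith [sq_nonneg (v (q + 1)).2]
      · have h3 := single_le_sum (f := fun j => jac n Z ⟨q, hq⟩ j ^ 2)
          (fun _ _ => sq_nonneg _) (mem_univ (⟨q, hq⟩ : Fin n))
        simp only [e1] at h3
        have : q + 1 = n := by omega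
        unfold sq2
        rw [this] at h3 ⊢
        rw [hvn]; linarith
    have hlog : ∑ e ∈ Icc 1 (n - 1), logCoeff β n e * log (v e).2
        - ∑ e ∈ Icc 1 (n - 1), logCoeff β n e * log (Z e).2 ≤ 2 := by
      rw [← sum_sub_distrib]
      have hb : ∀ e ∈ Icc 1 (n - 1), logCoeff β n e * log (v e).2 - logCoeff β n e * log (Z e).2
          ≤ (if e = q + 1 then (1 : ℝ) else 0) + if e = q then (1 : ℝ) else 0 := fun e he => by
        have hpe := hpos e he
        have hcoef : logCoeff β n e ≤ 1 := by
          unfold logCoeff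
          have : (0 : ℝ) ≤ (e : ℝ) / n + 1 / (n * β) := by positivity
          linarith
        rw [hZ2]
        simp only [hwb, he, true_and, add_left_inj]
        have hl2 : log 2 ≤ 1 := by linarith [Real.log_two_lt_d9]
        have hl0 : 0 ≤ log 2 := Real.log_nonneg (by norm_num)
        have hmain : ∀ w : ℝ, w = 1 → logCoeff β n e * log (v e).2
          - logCoeff β n e * log ((1 + w)⁻¹ * (v e).2) ≤ 1 := by
          rintro w rfl
          rw [log_mul (by norm_num) hpe.ne', Real.log_inv]; norm_num
          nlinarith
        by_cases c1 : e = q + 1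
        · rw [if_pos (Or.inl c1), if_pos c1, if_neg (by omega)]
          linarith [hmain 1 rfl]
        · by_cases c2 : e = q
          · rw [if_pos (Or.inr c2), if_neg c1, if_pos c2]
            linarith [hmain 1 rfl]
          · rw [if_neg (by tauto), if_neg c1, if_neg c2]; simp
      refine (sum_le_sum hb).trans ?_
      rw [sum_add_distrib, sum_ite_eq', sum_ite_eq']
      split_ifs <;> norm_num
    rw [ham_eq, ham_eq]
    have h4 := mul_le_mul_of_nonneg_left h2 hc.le
    have h5 : c * (1 / 9 * τ) = 1 / β + a ^ 2 / c + 2 := by rw [hτ]; field_simp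
    have h6 : c * (1 / 9 * τ) < c * (1 / 9 * sq2 (v (q + 1))) := by
      have : 1 / 9 * τ < 1 / 9 * sq2 (v (q + 1)) := by linarith
      exact mul_lt_mul_of_pos_left this hc
    linarith
  · rw [← ofReal_mul (exp_pos _).le]
    refine mul_le_mul_left (ofReal_le_ofReal ?_) _
    nlinarith [exp_pos (-(n : ℝ))]

/-! ### Concentration of the bulk around the local minimizers -/

/-- The last index of the bulk. -/
noncomputable def bulk (ε : ℝ) (n : ℕ) : ℕ := ⌊(1 - ε / 2) * n⌋₊

/-- The bulk indices outside `{l, …, r}`. -/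
noncomputable def bulkOut (ε : ℝ) (n l r : ℕ) : Finset ℕ := Icc 1 (bulk ε n) \ Icc l r

lemma exists_bulk_bounds (hβ : 0 < β) (hε0 : 0 < ε) (hε1 : ε < 1) (c₀ : ℝ) (D : ℕ) :
    ∃ N : ℕ, 0 < N ∧ ∀ n : ℕ, N ≤ n → bulk ε n + 1 ≤ n ∧ (1 - 3 * ε / 4) * n ≤ bulk ε n ∧
      (∀ k : ℕ, k ≤ bulk ε n → (k : ℝ) / n + 1 / (n * β) ≤ 1 - ε / 4) ∧
      (∀ k : ℕ, (k : ℝ) ≤ (1 - ε) * n + 2 * D + 2 → (k : ℝ) + D + c₀ * log n ≤ bulk ε n) := by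
  have h1 : ∀ᶠ n : ℕ in atTop, 4 / ε + 4 / (ε * β) + 1 ≤ (n : ℝ) :=
    tendsto_natCast_atTop_atTop.eventually_ge_atTop _
  have h2 : ∀ᶠ n : ℕ in atTop, |c₀| * log n + 3 * D + 2 ≤ ε / 4 * n := by
    have h3 : Tendsto (fun x : ℝ => (|c₀| * log x + (3 * D + 2)) / x) atTop (𝓝 0) := by
      have e1 := Real.isLittleO_log_id_atTop.tendsto_div_nhds_zero.const_mul |c₀|
      have e2 : Tendsto (fun x : ℝ => (3 * D + 2 : ℝ) / x) atTop (𝓝 0) :=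
        tendsto_const_nhds.div_atTop tendsto_id
      have := e1.add e2
      simp only [mul_zero, add_zero] at this
      refine this.congr fun x => ?_
      simp only [id]; ring
    have h4 := (h3.comp (tendsto_natCast_atTop_atTop (R := ℝ))).eventually_le_const
      (show (0 : ℝ) < ε / 4 by positivity)
    filter_upwards [h4, eventually_gt_atTop 0] with n hn hn0
    have hn0' : (0 : ℝ) < n := mod_cast hn0
    simp only [Function.comp] at hn
    rw [div_le_iff₀ hn0'] at hn; linarith
  obtain ⟨N, hN⟩ := eventually_atTop.1 (h1.and h2)
  refine ⟨N + 1, by omega, fun n hn => ?_⟩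
  obtain ⟨h1, h2⟩ := hN n (by omega)
  have hn0 : (0 : ℝ) < n := by
    have : 0 < n := by omega
    exact_mod_cast this
  have hε' : 0 ≤ (1 - ε / 2) * n := by
    have : 0 ≤ 1 - ε / 2 := by linarith
    positivity
  have hb1 : (bulk ε n : ℝ) ≤ (1 - ε / 2) * n := Nat.floor_le hε'
  have hb2 : (1 - ε / 2) * n < bulk ε n + 1 := Nat.lt_floor_add_one _
  have h5 : 4 ≤ ε * n := by
    have : 4 / ε ≤ n := by
      have : 0 < 4 / (ε * β) := by positivity
      linarith
    rw [div_le_iff₀ hε0] at this; linarith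
  have h6 : 1 / (n * β) ≤ ε / 4 := by
    have : 4 / (ε * β) ≤ n := by
      have : 0 < 4 / ε := by positivity
      linarith
    rw [div_le_iff₀ (by positivity)] at this
    rw [div_le_iff₀ (by positivity)]
    nlinarith
  have h7 : (1 - 3 * ε / 4) * n ≤ bulk ε n := by nlinarith
  have habs : c₀ * log n ≤ |c₀| * log n :=
    mul_le_mul_of_nonneg_right (le_abs_self _) (Real.log_natCast_nonneg n)
  refine ⟨?_, h7, fun k hk => ?_, fun k hk => ?_⟩
  · have : (bulk ε n : ℝ) + 1 ≤ n := by nlinarith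
    exact_mod_cast this
  · have hk' : (k : ℝ) ≤ bulk ε n := mod_cast hk
    have : (k : ℝ) / n ≤ 1 - ε / 2 := by rw [div_le_iff₀ hn0]; linarith
    linarith
  · nlinarith

lemma mem_bulkOut : k ∈ bulkOut ε n l r ↔ (1 ≤ k ∧ k ≤ bulk ε n) ∧ k ∉ Icc l r := by
  rw [bulkOut, Finset.mem_sdiff, mem_Icc]

lemma add_add_one_le_bulk {D : ℕ} (h : ∀ k : ℕ, (k : ℝ) ≤ (1 - ε) * n + 2 * D + 2 →
    (k : ℝ) + D + 0 * log n ≤ bulk ε n) (hr : (r : ℝ) ≤ (1 - ε) * n) : r + D + 1 ≤ bulk ε n := by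
  have h1 := h (r + 1) (by push_cast; have : (0 : ℝ) ≤ D := Nat.cast_nonneg _; linarith)
  have : ((r + D + 1 : ℕ) : ℝ) ≤ bulk ε n := by push_cast at h1 ⊢; linarith
  exact_mod_cast this

/-- The bound for the gradient of the Hamiltonian at a point that agrees with the local minimizers
in the bulk outside `{l, …, r}`. -/
noncomputable def gradBd (G ε : ℝ) (D n l r : ℕ) (t : ℝ) (k : ℕ) : ℝ :=
  (if k ∈ Icc 1 D ∪ Ioc (bulk ε n - D) (bulk ε n) then G else 0)
    + (if k ∈ Ico (l - D) l ∪ Ioc r (r + D) then G * t else 0) + G / n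

lemma gradBd_sq_le (G ε : ℝ) (D n l r : ℕ) (t : ℝ) (k : ℕ) : gradBd G ε D n l r t k ^ 2 ≤
      3 * (if k ∈ Icc 1 D ∪ Ioc (bulk ε n - D) (bulk ε n) then G ^ 2 else 0)
      + 3 * (if k ∈ Ico (l - D) l ∪ Ioc r (r + D) then G ^ 2 * t ^ 2 else 0)
      + 3 * (G ^ 2 / n ^ 2) := by
  have h : ∀ a b d : ℝ, (a + b + d) ^ 2 ≤ 3 * a ^ 2 + 3 * b ^ 2 + 3 * d ^ 2 := fun a b d => by
    nlinarith [sq_nonneg (a - b), sq_nonneg (b - d), sq_nonneg (a - d)]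
  unfold gradBd
  refine (h _ _ _).trans_eq ?_
  rw [div_pow]
  congr 2
  · split_ifs <;> simp
  · split_ifs
    · ring
    · simp

include hc hV hβ hε0 hε1 in
lemma exists_grad_bound (τ : ℝ) : ∃ (G : ℝ) (N : ℕ), 0 < G ∧ 0 < N ∧ ∀ n : ℕ, N ≤ n → ∀ l r : ℕ,
      (r : ℝ) ≤ (1 - ε) * n → ∀ t : ℝ, 0 ≤ t → t ≤ 1 / 2 → ∀ pt : ℕ → ℝ × ℝ,
      (∀ k ∈ bulkOut ε n l r, pt k = dagger V β n k) →
      (∀ k ∈ Icc l r, ab2 (pt k - dagger V β n k) ≤ t) →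
      (∀ k ∈ Ioc (bulk ε n) n, sq2 (pt k) ≤ τ) →
      ∀ k ∈ bulkOut ε n l r, ∀ u,
        |grad V β n pt k u| ≤ gradBd G ε V.natDegree n l r t k * ab2 u := by
  obtain ⟨M, r₀, Λ, hM, hr₀, hΛ, hdag⟩ := exists_dagger_bounds hc hV hβ
    (show 0 < ε / 4 by positivity)
  obtain ⟨N₁, hN₁, hbulk⟩ := exists_bulk_bounds hβ hε0 hε1 0 V.natDegree
  set D := V.natDegree
  obtain ⟨N₂, hN₂⟩ := exists_nat_ge (2 * Λ * D)
  set τ₁ := M + 1 + √τ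
  have hτ₁0 : 0 < τ₁ := by positivity
  have hp0 := polBound_nonneg Vᵈ (c := 3 * τ₁) (by positivity)
  have hd0 := ddBound_nonneg Vᵈ (c := 3 * (M + 1)) (by positivity)
  set P := polBound Vᵈ (3 * τ₁)
  set B := ddBound Vᵈ (3 * (M + 1))
  refine ⟨2 * P + 1 / r₀ + 6 * B * (1 + Λ * D), max N₁ N₂, by positivity, lt_max_of_lt_left hN₁,
    fun n hn l r hr t ht0 ht1 pt hE hI hT k hk u => ?_⟩
  set G := 2 * P + 1 / r₀ + 6 * B * (1 + Λ * D)
  obtain ⟨hb1, hb2, hb3, hb4⟩ := hbulk n (le_trans (le_max_left _ _) hn)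
  have hn2 : 2 * Λ * D ≤ n := hN₂.trans (mod_cast le_trans (le_max_right _ _) hn)
  have hn0 : 0 < n := by omega
  have hn0' : (0 : ℝ) < n := mod_cast hn0
  obtain ⟨⟨hk1, hk2⟩, hkI⟩ := mem_bulkOut.1 hk
  have hkn : k ∈ Icc 1 (n - 1) := mem_Icc.2 ⟨hk1, by omega⟩
  obtain ⟨hdk1, hdk2, hdk3⟩ := hdag n k hn0 (hb3 k hk2)
  have hab := ab2_nonneg u
  have hterm1 : 0 ≤ (if k ∈ Ico (l - D) l ∪ Ioc r (r + D) then G * t else 0) := by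
    split_ifs <;> positivity
  by_cases hA : k ∈ Icc 1 D ∪ Ioc (bulk ε n - D) (bulk ε n)
  · have hbd : ∀ e ∈ Icc 1 n, ab2 (pt e) ≤ 2 * τ₁ ∧ |(pt e).1| ≤ τ₁ ∧ |(pt e).2| ≤ τ₁ := fun e he => by
      rw [mem_Icc] at he
      by_cases h1 : e ≤ bulk ε n
      · have hs : ab2 (pt e) ≤ M + 1 := by
          have hde := (hdag n e hn0 (hb3 e h1)).1
          by_cases h2 : e ∈ Icc l r
          · have h3 := hI e h2
            have h4 := ab2_add_le (pt e - dagger V β n e) (dagger V β n e)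
            rw [sub_add_cancel] at h4; linarith
          · rw [hE e (mem_bulkOut.2 ⟨⟨he.1, h1⟩, h2⟩)]
            linarith
        have : 0 ≤ √τ := sqrt_nonneg _
        exact ⟨by linarith, by linarith [abs_fst_le_ab2 (pt e)], by linarith [abs_snd_le_ab2 (pt e)]⟩
      · have h3 := hT e (mem_Ioc.2 ⟨by omega, he.2⟩)
        unfold sq2 at h3
        have h4 : |(pt e).1| ≤ √τ := abs_le_sqrt (by nlinarith [sq_nonneg (pt e).2])
        have h5 : |(pt e).2| ≤ √τ := abs_le_sqrt (by nlinarith [sq_nonneg (pt e).1])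
        exact ⟨by unfold ab2; linarith, by linarith, by linarith⟩
    have hrow := rowBdd_jac (n := n) (v := pt) hτ₁0.le (fun e he => (hbd e he).2.1)
      fun e he => (hbd e (Icc_subset_Icc_right (Nat.sub_le n 1) he)).2.2
    have h1 := abs_grad_le V (β := β) hkn (by positivity) hr₀ hrow (by rw [hE k hk]; exact hdk2)
      (L := 1) (by
        rw [logCoeff_eq, abs_le]
        have := hb3 k hk2
        have h0 : (0 : ℝ) ≤ (k : ℝ) / n + 1 / (n * β) := by positivity
        constructor <;> linarith) u
    refine h1.trans (mul_le_mul_of_nonneg_right ?_ hab)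
    rw [gradBd, if_pos hA]
    have : 0 ≤ G / n := by positivity
    have h2 : 0 ≤ 6 * B * (1 + Λ * D) := by positivity
    linarith
  · rw [mem_union, mem_Icc, mem_Ioc] at hA
    have hkD : D + 1 ≤ k := by omega
    have hkD' : k + D ≤ bulk ε n := by omega
    set s := (if k ∈ Ico (l - D) l ∪ Ioc r (r + D) then t else 0) + Λ * D / n with hs
    have hΛD : Λ * D / n ≤ 1 / 2 := by rw [div_le_iff₀ hn0']; linarith
    have hs0 : 0 ≤ s := by rw [hs]; split_ifs <;> positivity
    have hs1 : s ≤ 1 := by rw [hs]; split_ifs <;> linarith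
    have h1 := abs_grad_le_of_near hc hV (v := pt) (s := s) hkD (by omega)
      (lt_of_le_of_lt (hb3 k hk2) (by linarith)) (by rw [hE k hk]) hdk1 hs1 hs0 (by
        intro e he hek
        rw [mem_Icc] at he
        have hek' : nd e k ≤ D := hek.trans (Nat.div_le_self _ _)
        have hnd : e ≤ k + D ∧ k ≤ e + D := by unfold nd at hek'; omega
        have he2 : e ≤ bulk ε n := by omega
        have hdd : ab2 (dagger V β n e - dagger V β n k) ≤ Λ * D / n := by
          have h2 := (hdag n e hn0 (hb3 e he2)).2.2 k (hb3 k hk2)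
          refine h2.trans ?_
          rw [mul_div_assoc]
          have : (nd e k : ℝ) ≤ D := mod_cast hek'
          gcongr
        by_cases h2 : e ∈ Icc l r
        · have h3 : k ∈ Ico (l - D) l ∪ Ioc r (r + D) := by
            rw [mem_Icc] at h2 hkI
            rw [mem_union, mem_Ico, mem_Ioc]; omega
          rw [hs, if_pos h3]
          have h4 := ab2_sub_le (pt e) (dagger V β n e) (dagger V β n k)
          linarith [hI e h2]
        · rw [hE e (mem_bulkOut.2 ⟨⟨he.1, he2⟩, h2⟩)]
          refine hdd.trans ?_
          rw [hs]
          split_ifs <;> linarith) u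
    refine h1.trans (mul_le_mul_of_nonneg_right ?_ hab)
    rw [gradBd, if_neg (by rw [mem_union, mem_Icc, mem_Ioc]; exact hA)]
    have h2 : 6 * B ≤ G := by
      have : 6 * B * (1 + Λ * D) = 6 * B + 6 * B * (Λ * D) := by ring
      have : 0 ≤ 6 * B * (Λ * D) := by positivity
      have : 0 < 1 / r₀ := by positivity
      linarith
    have h3 : 6 * B * (Λ * D) ≤ G := by
      have : 6 * B * (1 + Λ * D) = 6 * B + 6 * B * (Λ * D) := by ring
      have : 0 ≤ 6 * B := by positivity
      have : 0 < 1 / r₀ := by positivity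
      linarith
    have h4 : 6 * B * (Λ * D / n) ≤ G / n := by rw [← mul_div_assoc]; gcongr
    change 6 * B * s ≤ _
    rw [hs]
    split_ifs
    · have := mul_le_mul_of_nonneg_right h2 ht0
      linarith
    · linarith

lemma jacFactor_le_exp (hw : ∀ k, 0 ≤ w k) (hE : E ⊆ Icc 1 (n - 1)) (hwE : ∀ k ∉ E, w k = 0) :
    jacFactor n w w ≤ exp (2 * ∑ k ∈ E, w k) := by
  have h : ∀ s : Finset ℕ, E ⊆ s → ∏ k ∈ s, (1 + w k) ≤ exp (∑ k ∈ E, w k) := fun s hs => by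
    rw [sum_subset hs fun k _ hk => hwE k hk, exp_sum]
    exact Finset.prod_le_prod (fun k _ => by linarith [hw k]) fun k _ => by
      linarith [add_one_le_exp (w k)]
  rw [jacFactor, two_mul, exp_add]
  exact mul_le_mul (h _ (hE.trans (Icc_subset_Icc_right (Nat.sub_le n 1)))) (h _ hE)
    (prod_nonneg fun k _ => by linarith [hw k]) (exp_pos _).le

lemma shrink_sub (p : ℕ → ℝ × ℝ) (w : ℕ → ℝ) (v : ℕ → ℝ × ℝ) (k : ℕ) :
    shrink p w v k - p k = (1 + w k)⁻¹ • (v k - p k) := by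
  ext <;> simp [shrink]

lemma shrink_of_eq_zero (p : ℕ → ℝ × ℝ) (v : ℕ → ℝ × ℝ) (h : w k = 0) :
    shrink p w v k = v k := by
  ext <;> simp [shrink, h]

lemma shrink_pos (hw : 0 ≤ w k) (hp : 0 < (p k).2) (hv : 0 < (v k).2) : 0 < (shrink p w v k).2 := by
  have h : (shrink p w v k).2 = (1 + w k)⁻¹ * (w k * (p k).2 + (v k).2) := by
    simp only [shrink]
    have : 1 + w k ≠ 0 := by positivity
    simp only [Prod.snd_add, Prod.smul_snd, Prod.snd_sub, smul_eq_mul]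
    field_simp; ring
  rw [h]
  have : 0 ≤ w k * (p k).2 := by positivity
  positivity

lemma measurable_sq2_sub (k : ℕ) (p : ℝ × ℝ) : Measurable fun v : ℕ → ℝ × ℝ => sq2 (v k - p) := by
  unfold sq2
  have := measurable_pi_apply (X := fun _ : ℕ => ℝ × ℝ) k
  fun_prop

lemma measurable_sq2 (k : ℕ) : Measurable fun v : ℕ → ℝ × ℝ => sq2 (v k) := by
  simpa using measurable_sq2_sub k 0

lemma sum_ite_const_le {E A : Finset ℕ} {x : ℝ} (hx : 0 ≤ x) {m : ℕ} (hA : A.card ≤ m) :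
    ∑ k ∈ E, (if k ∈ A then x else 0) ≤ m * x := by
  rw [← sum_filter, sum_const, nsmul_eq_mul]
  refine mul_le_mul_of_nonneg_right ?_ hx
  have : (E.filter (· ∈ A)).card ≤ A.card := card_le_card fun k hk => (mem_filter.1 hk).2
  exact_mod_cast this.trans hA

lemma card_edge_le (D b : ℕ) : (Icc 1 D ∪ Ioc (b - D) b).card ≤ 2 * D := by
  refine (card_union_le _ _).trans ?_
  rw [Nat.card_Icc, Nat.card_Ioc]; omega

lemma card_near_le (D l r : ℕ) : (Ico (l - D) l ∪ Ioc r (r + D)).card ≤ 2 * D := by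
  refine (card_union_le _ _).trans ?_
  rw [Nat.card_Ico, Nat.card_Ioc]; omega

include hc hV hβ in
/-- The contraction estimate shared by the unweighted and the weighted bounds. -/
lemma Lam_le_of_gradBd (hE : E ⊆ Icc 1 (n - 1)) (hco : ∀ k ∈ E, 0 ≤ logCoeff β n k)
    (hp : ∀ k ∈ E, 0 < (p k).2) {w γ : ℕ → ℝ} (hw : ∀ k, 0 ≤ w k) (hwE : ∀ k ∉ E, w k = 0)
    {X D : Set (ℕ → ℝ × ℝ)} (hX : MeasurableSet X) (hD : MeasurableSet D) (hDX : D ⊆ X)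
    (hinv : ∀ v ∈ X, ∀ v' : ℕ → ℝ × ℝ, (∀ k ∉ E, v' k = v k) → v' ∈ X)
    (hgrad : ∀ v ∈ D, (∀ k ∉ Icc 1 n, v k = 0) → (v n).2 = 0 →
      ∀ k ∈ E, ∀ u, |grad V β n (fun k => if k ∈ E then p k else v k) k u| ≤ γ k * ab2 u)
    (hmono : ∀ v ∈ D, (∀ k ∉ Icc 1 n, v k = 0) → (v n).2 = 0 → (∀ k ∈ E, 0 < (shrink p w v k).2) →
      c / 2 * ∑ k ∈ E, w k * sq2 (shrink p w v k - p k)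
      ≤ ∑ k ∈ E, w k * (grad V β n (shrink p w v) k (shrink p w v k - p k)
        - grad V β n (fun k => if k ∈ E then p k else v k) k (shrink p w v k - p k)))
    (hh : ∀ v ∈ D, h ≤ c / 4 * ∑ k ∈ E, w k * sq2 (shrink p w v k - p k)
      - 2 / c * ∑ k ∈ E, w k * γ k ^ 2) :
    Lam V β n D ≤ ofReal (exp (2 * ∑ k ∈ E, w k - n * β * h)) * Lam V β n X := by
  have h1w : ∀ k, 0 < 1 + w k := fun k => by linarith [hw k]
  refine (Lam_le_of_shrink V β p (wa := w) (wb := w) (K := ofReal (exp (-(n * β * h))))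
    h1w h1w (fun k hk => hwE k fun hkE => hk ?_) (fun k hk => hwE k fun hkE => hk (hE hkE)) hX hD
    ?_).trans ?_
  · exact Icc_subset_Icc_right (Nat.sub_le n 1) (hE hkE)
  · intro v hvD hpos hv0 hvn
    rw [shrink₂_self]
    refine ⟨hinv v (hDX hvD) _ fun k hk => shrink_of_eq_zero p v (hwE k hk), ?_⟩
    have hpos' : ∀ k ∈ Icc 1 (n - 1), 0 < (shrink p w v k).2 := fun k hk => by
      by_cases hkE : k ∈ E
      · exact shrink_pos (hw k) (hp k hkE) (hpos k hk)
      · rw [shrink_of_eq_zero p v (hwE k hkE)]; exact hpos k hk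
    refine dens_le_of_ham hpos' hβ.le ((hh v hvD).trans ?_)
    exact ham_sub_shrink_ge hV hc hE hco hw hwE (fun k hk => hpos k (hE hk)) hp
      (hgrad v hvD hv0 hvn) (hmono v hvD hv0 hvn fun k hk => hpos' k (hE hk))
  · rw [← ofReal_mul (exp_pos _).le]
    refine mul_le_mul_left (ofReal_le_ofReal ?_) _
    rw [sub_eq_add_neg, exp_add, mul_comm]
    exact mul_le_mul_of_nonneg_right (jacFactor_le_exp hw hE hwE) (exp_pos _).le

include hc hV hβ hε0 hε1 in
/-- The bulk is globally close to the local minimizers, even conditionally on the values in an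
interval that are themselves close to the local minimizers. -/
lemma exists_bulk_l2_bound (τ : ℝ) : ∃ (ρ : ℝ) (N : ℕ), 0 < ρ ∧ 0 < N ∧ ∀ n : ℕ, N ≤ n → ∀ l r : ℕ,
      (r : ℝ) ≤ (1 - ε) * n → ∀ X : Set (ℕ → ℝ × ℝ), MeasurableSet X →
      (∀ v ∈ X, ∀ k ∈ Icc l r, ab2 (v k - dagger V β n k) ≤ 1 / 2) →
      (∀ v ∈ X, ∀ k ∈ Ioc (bulk ε n) n, (k = n → (v n).2 = 0) → sq2 (v k) ≤ τ) →
      (∀ v ∈ X, ∀ v' : ℕ → ℝ × ℝ, (∀ k ∉ bulkOut ε n l r, v' k = v k) → v' ∈ X) →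
      Lam V β n (X ∩ {v | ρ < ∑ k ∈ bulkOut ε n l r, sq2 (v k - dagger V β n k)})
        ≤ ofReal (exp (-n)) * Lam V β n X := by
  obtain ⟨M, r₀, Λ, hM, hr₀, hΛ, hdag⟩ := exists_dagger_bounds hc hV hβ
    (show 0 < ε / 4 by positivity)
  obtain ⟨N₁, hN₁, hbulk⟩ := exists_bulk_bounds hβ hε0 hε1 0 V.natDegree
  obtain ⟨G, N₂, hG, hN₂, hgrad⟩ := exists_grad_bound hc hV hβ hε0 hε1 τ
  set D := V.natDegree
  set Q := 2 / c * (3 * (2 * D * G ^ 2) + 3 * (2 * D * G ^ 2) + 3 * G ^ 2)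
  have hQ0 : 0 ≤ Q := by positivity
  refine ⟨16 / c * (3 / β + Q), max N₁ N₂, by positivity, lt_max_of_lt_left hN₁,
    fun n hn l r hr X hX hXI hXT hinv => ?_⟩
  obtain ⟨hb1, hb2, hb3, hb4⟩ := hbulk n (le_trans (le_max_left _ _) hn)
  have hn0 : 0 < n := by omega
  set E := bulkOut ε n l r with hEdef
  have hEb : ∀ k ∈ E, 1 ≤ k ∧ k ≤ bulk ε n := fun k hk => by
    rw [hEdef, mem_bulkOut] at hk
    exact hk.1
  have hE : E ⊆ Icc 1 (n - 1) := fun k hk => by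
    obtain ⟨h1, h2⟩ := hEb k hk
    exact mem_Icc.2 ⟨h1, by omega⟩
  have hco : ∀ k ∈ E, 0 ≤ logCoeff β n k := fun k hk => by
    rw [logCoeff_eq]
    linarith [hb3 k (hEb k hk).2]
  have hp : ∀ k ∈ E, 0 < (dagger V β n k).2 := fun k hk =>
    hr₀.trans_le (hdag n k hn0 (hb3 k (hEb k hk).2)).2.1
  have hcard : (E.card : ℝ) ≤ n := by
    have := card_le_card hE
    rw [Nat.card_Icc] at this
    have : E.card ≤ n := by omega
    exact_mod_cast this
  set w : ℕ → ℝ := fun k => if k ∈ E then 1 else 0 with hw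
  have hw1 : ∀ k ∈ E, w k = 1 := fun k hk => by simp [hw, hk]
  have hsumw : ∑ k ∈ E, w k ≤ n := by rw [sum_congr rfl hw1]; simpa using hcard
  refine (Lam_le_of_gradBd (h := 3 / β) hc hV hβ hE hco hp (w := w)
    (γ := gradBd G ε D n l r (1 / 2))
    (fun k => by simp only [hw]; split_ifs <;> norm_num) (fun k hk => by simp [hw, hk]) hX
    (hX.inter ?_) inter_subset_left hinv ?_ ?_ ?_).trans ?_
  · exact measurableSet_lt measurable_const
      (Finset.measurable_fun_sum _ fun k _ => measurable_sq2_sub k _)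
  · intro v hv hv0 hvn
    refine hgrad n (le_trans (le_max_right _ _) hn) l r hr (1 / 2) (by norm_num) le_rfl _
      (fun k hk => by simp [← hEdef] at hk ⊢; simp [hk]) (fun k hk => ?_) (fun k hk => ?_)
    · have hkE : k ∉ E := fun h => by
        rw [hEdef, bulkOut, Finset.mem_sdiff] at h
        exact h.2 hk
      simp only [hkE, if_false]
      exact hXI v hv.1 k hk
    · have hkE : k ∉ E := fun h => by
        have := (hEb k h).2
        rw [mem_Ioc] at hk; omega
      simp only [hkE, if_false]
      exact hXT v hv.1 k hk fun _ => hvn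
  · intro v hv hv0 hvn hpos
    have h1 := sum_grad_sub_ge hV hc.le hE hco (v := shrink (dagger V β n) w v)
      (v' := fun k => if k ∈ E then dagger V β n k else v k)
      (fun k hk => by rw [shrink_of_eq_zero _ _ (by simp [hw, hk])]; simp [hk]) hpos
      (fun k hk => by simp [hk, hp k hk])
    have h2 : ∀ f : ℕ → ℝ, ∑ k ∈ E, w k * f k = ∑ k ∈ E, f k := fun f =>
      sum_congr rfl fun k hk => by rw [hw1 k hk, one_mul]
    rw [h2, h2]
    have h3 : ∀ k ∈ E, shrink (dagger V β n) w v k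
        - (fun k => if k ∈ E then dagger V β n k else v k) k
        = shrink (dagger V β n) w v k - dagger V β n k := fun k hk => by simp [hk]
    rw [sum_congr rfl fun k hk => by rw [h3 k hk]] at h1
    refine le_trans ?_ (h1.trans (le_of_eq (sum_congr rfl fun k hk => by rw [h3 k hk])))
    refine mul_le_mul_of_nonneg_right (by linarith) (sum_nonneg fun k _ => sq2_nonneg _)
  · intro v hv
    have hv2 : 16 / c * (3 / β + Q) < ∑ k ∈ E, sq2 (v k - dagger V β n k) := hv.2
    have h1 : ∑ k ∈ E, w k * sq2 (shrink (dagger V β n) w v k - dagger V β n k)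
        = 1 / 4 * ∑ k ∈ E, sq2 (v k - dagger V β n k) := by
      rw [mul_sum]
      refine sum_congr rfl fun k hk => ?_
      rw [shrink_sub, sq2_smul, hw1 k hk]; norm_num
    have h2 : ∑ k ∈ E, w k * gradBd G ε D n l r (1 / 2) k ^ 2
        ≤ 3 * (2 * D * G ^ 2) + 3 * (2 * D * G ^ 2) + 3 * G ^ 2 := by
      have h3 : ∀ k ∈ E, w k * gradBd G ε D n l r (1 / 2) k ^ 2 ≤
          3 * (if k ∈ Icc 1 D ∪ Ioc (bulk ε n - D) (bulk ε n) then G ^ 2 else 0)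
          + 3 * (if k ∈ Ico (l - D) l ∪ Ioc r (r + D) then G ^ 2 * (1 / 2) ^ 2 else 0)
          + 3 * (G ^ 2 / n ^ 2) := fun k hk => by
        rw [hw1 k hk, one_mul]; exact gradBd_sq_le _ _ _ _ _ _ _ _
      refine (sum_le_sum h3).trans ?_
      rw [sum_add_distrib, sum_add_distrib, ← mul_sum, ← mul_sum, sum_const, nsmul_eq_mul]
      have e1 := sum_ite_const_le (E := E) (sq_nonneg G) (card_edge_le D (bulk ε n))
      have e2 := sum_ite_const_le (E := E) (x := G ^ 2 * (1 / 2) ^ 2) (by positivity)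
        (card_near_le D l r)
      have e3 : (E.card : ℝ) * (3 * (G ^ 2 / n ^ 2)) ≤ 3 * G ^ 2 := by
        have hn1 : (1 : ℝ) ≤ n := mod_cast hn0
        calc (E.card : ℝ) * (3 * (G ^ 2 / n ^ 2)) ≤ n * (3 * (G ^ 2 / n ^ 2)) := by gcongr
          _ = 3 * G ^ 2 / n := by field_simp
          _ ≤ 3 * G ^ 2 := div_le_self (by positivity) hn1
      push_cast at e1 e2
      have e4 : 0 ≤ (D : ℝ) * G ^ 2 := by positivity
      nlinarith
    rw [h1]
    have h3 : 2 / c * ∑ k ∈ E, w k * gradBd G ε D n l r (1 / 2) k ^ 2 ≤ Q :=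
      mul_le_mul_of_nonneg_left h2 (by positivity)
    have h4 : c / 4 * (1 / 4 * (16 / c * (3 / β + Q))) = 3 / β + Q := by field_simp; norm_num
    have h5 : c / 4 * (1 / 4 * (16 / c * (3 / β + Q)))
        ≤ c / 4 * (1 / 4 * ∑ k ∈ E, sq2 (v k - dagger V β n k)) := by gcongr
    linarith
  · refine mul_le_mul_left (ofReal_le_ofReal (exp_le_exp.2 ?_)) _
    have : (n : ℝ) * β * (3 / β) = 3 * n := by field_simp
    rw [this]; linarith

lemma ab2_le_sqrt {u : ℝ × ℝ} (h : sq2 u ≤ τ) : ab2 u ≤ 2 * √τ := by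
  unfold sq2 at h
  have h4 : |u.1| ≤ √τ := abs_le_sqrt (by nlinarith [sq_nonneg u.2])
  have h5 : |u.2| ≤ √τ := abs_le_sqrt (by nlinarith [sq_nonneg u.1])
  unfold ab2; linarith

lemma ab2_shrink_le (hw : 0 ≤ w k) :
    ab2 (shrink p w v k) ≤ 2 * ab2 (p k) + ab2 (v k) := by
  have h1 : shrink p w v k = p k + (1 + w k)⁻¹ • (v k - p k) := rfl
  rw [h1]
  refine (ab2_add_le _ _).trans ?_
  rw [ab2_smul]
  have h2 : |(1 + w k)⁻¹| ≤ 1 := by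
    rw [abs_of_nonneg (by positivity)]
    exact inv_le_one_of_one_le₀ (by linarith)
  have h3 : ab2 (v k - p k) ≤ ab2 (v k) + ab2 (p k) := by
    have := ab2_add_le (v k) (-p k)
    rwa [ab2_neg, ← sub_eq_add_neg] at this
  have h4 := mul_le_mul_of_nonneg_right h2 (ab2_nonneg (v k - p k))
  linarith

lemma rowBdd_jac_of_ab2 (hτ : 0 ≤ τ)
    (h : ∀ k ∈ Icc 1 n, ab2 (v k) ≤ τ) : RowBdd (jac n v) (3 * τ) :=
  rowBdd_jac hτ (fun k hk => (abs_fst_le_ab2 _).trans (h k hk)) fun k hk =>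
    (abs_snd_le_ab2 _).trans (h k (Icc_subset_Icc_right (Nat.sub_le n 1) hk))

include hc hV hβ hε0 hε1 in
/-- Single entries of a bounded field are close to the local minimizers. -/
lemma exists_site_conc_of_bounded (τ : ℝ) : ∃ (c₀ C κ : ℝ) (N : ℕ), 0 < c₀ ∧ 0 < C ∧ 0 < κ ∧ 0 < N ∧ ∀ n : ℕ, N ≤ n →
      ∀ l r : ℕ, (r : ℝ) ≤ (1 - ε) * n → ∀ t : ℝ, 0 ≤ t → t ≤ 1 / 2 →
      ∀ X : Set (ℕ → ℝ × ℝ), MeasurableSet X →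
      (∀ v ∈ X, ∀ k ∈ Icc l r, ab2 (v k - dagger V β n k) ≤ t) →
      (∀ v ∈ X, ∀ v' : ℕ → ℝ × ℝ, (∀ k ∉ bulkOut ε n l r, v' k = v k) → v' ∈ X) →
      ∀ j : ℕ, 1 ≤ j → j ∉ Icc l r → c₀ * log n ≤ (j : ℝ) + V.natDegree →
      (j : ℝ) ≤ (1 - ε) * n + V.natDegree + 1 → ∀ s : ℝ, 0 ≤ s →
      Lam V β n (X ∩ {v | ∀ k ∈ Icc 1 n, sq2 (v k) ≤ τ} ∩ {v | s ^ 2 < sq2 (v j - dagger V β n j)})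
        ≤ ofReal (C * exp (C * n * t ^ 2 - κ * n * s ^ 2)) * Lam V β n X := by
  obtain ⟨M, r₀, Λ, hM, hr₀, hΛ, hdag⟩ := exists_dagger_bounds hc hV hβ
    (show 0 < ε / 4 by positivity)
  obtain ⟨G, N₂, hG, hN₂, hgrad⟩ := exists_grad_bound hc hV hβ hε0 hε1 τ
  set τ₃ := 2 * M + 2 * √τ
  have hτ₃0 : 0 < τ₃ := by positivity
  obtain ⟨c₁, ξ, hc₁, hξ, he, hsmall⟩ := exists_weight_rate V hc (τ := 3 * τ₃) (by positivity)
  obtain ⟨C₀, hC₀, hsum⟩ := exists_sum_expw_le (c₁ := 2 * c₁) (by positivity)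
  set c₀ := 1 / (2 * c₁) with hc₀
  obtain ⟨N₁, hN₁, hbulk⟩ := exists_bulk_bounds hβ hε0 hε1 c₀ V.natDegree
  set D := V.natDegree
  set Q := 3 * (2 * D * (exp (4 * c₁ * D) * G ^ 2)) + 3 * (G ^ 2 * C₀) + 3 * (G ^ 2 * C₀) with hQ
  set C₂ := 2 / c * Q * β with hC₂
  have hC₂0 : 0 < C₂ := by positivity
  refine ⟨c₀, exp (2 * C₀ + C₂) + C₂, β * c / 16, max N₁ N₂, by positivity, by positivity,
    by positivity, lt_max_of_lt_left hN₁, fun n hn l r hr t ht0 ht1 X hX hXI hinv j hj1 hjI hj2 hj3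
      s hs => ?_⟩
  obtain ⟨hb1, hb2, hb3, hb4⟩ := hbulk n (le_trans (le_max_left _ _) hn)
  have hn0 : 0 < n := by omega
  have hn0' : (0 : ℝ) < n := mod_cast hn0
  have hjb := hb4 j (by linarith)
  have hjb' : j ≤ bulk ε n := by
    have : (j : ℝ) ≤ bulk ε n := by
      have : 0 ≤ c₀ * log n := by positivity
      linarith
    exact_mod_cast this
  set E := bulkOut ε n l r with hEdef
  have hEb : ∀ k ∈ E, 1 ≤ k ∧ k ≤ bulk ε n := fun k hk =>
    (mem_bulkOut.1 hk).1
  have hjE : j ∈ E := mem_bulkOut.2 ⟨⟨hj1, hjb'⟩, hjI⟩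
  have hE : E ⊆ Icc 1 (n - 1) := fun k hk => by
    obtain ⟨h1, h2⟩ := hEb k hk
    exact mem_Icc.2 ⟨h1, by omega⟩
  have hco : ∀ k ∈ E, 0 ≤ logCoeff β n k := fun k hk => by
    rw [logCoeff_eq]
    linarith [hb3 k (hEb k hk).2]
  have hp : ∀ k ∈ E, 0 < (dagger V β n k).2 := fun k hk =>
    hr₀.trans_le (hdag n k hn0 (hb3 k (hEb k hk).2)).2.1
  have hpM : ∀ k ∈ E, ab2 (dagger V β n k) ≤ M := fun k hk => (hdag n k hn0 (hb3 k (hEb k hk).2)).1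
  set w : ℕ → ℝ := fun k => if k ∈ E then expw c₁ j k ^ 2 else 0 with hw
  have hw0 : ∀ k, 0 ≤ w k := fun k => by simp only [hw]; split_ifs <;> positivity
  have hw1 : ∀ k ∈ E, w k = expw c₁ j k ^ 2 := fun k hk => by simp [hw, hk]
  have hw2 : ∀ k ∈ E, w k = expw (2 * c₁) j k := fun k hk => by rw [hw1 k hk, expw_sq]
  have hwj : w j = 1 := by rw [hw1 j hjE, expw_self]; norm_num
  have hsumw : ∑ k ∈ E, w k ≤ C₀ := by rw [sum_congr rfl hw2]; exact hsum E j
  have hsqrt : 0 ≤ √τ := sqrt_nonneg _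
  refine (Lam_le_of_gradBd (h := c / 16 * s ^ 2 - 2 / c * (Q * (1 / n + t ^ 2))) hc hV hβ hE hco hp
    (w := w) (γ := gradBd G ε D n l r t) hw0 (fun k hk => by simp [hw, hk]) hX
    ((hX.inter ?_).inter ?_) (inter_subset_left.trans inter_subset_left) hinv ?_ ?_
    ?_).trans ?_
  · simp only [ofPred_forall]
    exact measurableSet_biInter _ fun k _ => measurableSet_le (measurable_sq2 k) measurable_const
  · exact measurableSet_lt measurable_const (measurable_sq2_sub j _)
  · rintro v ⟨⟨hvX, hvb⟩, hvj⟩ hv0 hvn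
    refine hgrad n (le_trans (le_max_right _ _) hn) l r hr t ht0 ht1 _
      (fun k hk => by simp [← hEdef] at hk ⊢; simp [hk]) (fun k hk => ?_) (fun k hk => ?_)
    · have hkE : k ∉ E := fun h => by
        rw [hEdef, bulkOut, Finset.mem_sdiff] at h
        exact h.2 hk
      simp only [hkE, if_false]
      exact hXI v hvX k hk
    · have hkE : k ∉ E := fun h => by
        have := (hEb k h).2
        rw [mem_Ioc] at hk; omega
      simp only [hkE, if_false]
      rw [mem_Ioc] at hk
      exact hvb k (mem_Icc.2 ⟨by omega, hk.2⟩)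
  · rintro v ⟨⟨hvX, hvb⟩, hvj⟩ hv0 hvn hpos
    have hA : RowBdd (jac n (shrink (dagger V β n) w v)) (3 * τ₃) :=
      rowBdd_jac_of_ab2 hτ₃0.le fun k hk => by
        have hvk := ab2_le_sqrt (hvb k hk)
        by_cases hkE : k ∈ E
        · have := ab2_shrink_le (p := dagger V β n) (v := v) (hw0 k)
          linarith [hpM k hkE]
        · rw [shrink_of_eq_zero _ _ (by simp [hw, hkE])]; linarith
    have hB : RowBdd (jac n (fun k => if k ∈ E then dagger V β n k else v k)) (3 * τ₃) :=
      rowBdd_jac_of_ab2 hτ₃0.le fun k hk => by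
        have hvk := ab2_le_sqrt (hvb k hk)
        by_cases hkE : k ∈ E
        · simp only [hkE, if_true]; linarith [hpM k hkE]
        · simp only [hkE, if_false]; linarith
    have h1 := sum_weighted_grad_sub_ge hV hc.le hE hco (v := shrink (dagger V β n) w v)
      (v' := fun k => if k ∈ E then dagger V β n k else v k)
      (fun k hk => by rw [shrink_of_eq_zero _ _ (by simp [hw, hk])]; simp [hk]) hpos
      (fun k hk => by simp [hk, hp k hk]) (by positivity) hA hB (e := expw c₁ j)
      (fun k => (expw_pos _ _ _).le) hξ (he j) hsmall
    have h2 : ∀ f : ℕ → ℝ, ∑ k ∈ E, w k * f k = ∑ k ∈ E, expw c₁ j k ^ 2 * f k := fun f =>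
      sum_congr rfl fun k hk => by rw [hw1 k hk]
    rw [h2, h2]
    have h3 : ∀ k ∈ E, shrink (dagger V β n) w v k
        - (fun k => if k ∈ E then dagger V β n k else v k) k
        = shrink (dagger V β n) w v k - dagger V β n k := fun k hk => by simp [hk]
    rw [sum_congr rfl fun k hk => by rw [h3 k hk]] at h1
    exact h1.trans (le_of_eq (sum_congr rfl fun k hk => by rw [h3 k hk]))
  · rintro v ⟨⟨hvX, hvb⟩, hvj⟩
    have hvj : s ^ 2 < sq2 (v j - dagger V β n j) := hvj
    have h1 : 1 / 4 * s ^ 2 ≤ ∑ k ∈ E, w k * sq2 (shrink (dagger V β n) w v k - dagger V β n k) := by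
      have h2 := single_le_sum (f := fun k =>
        w k * sq2 (shrink (dagger V β n) w v k - dagger V β n k))
        (fun k _ => mul_nonneg (hw0 k) (sq2_nonneg _)) hjE
      refine le_trans ?_ h2
      rw [shrink_sub, sq2_smul, hwj]; linarith
    have h2 : ∑ k ∈ E, w k * gradBd G ε D n l r t k ^ 2 ≤ Q * (1 / n + t ^ 2) := by
      have h3 : ∀ k ∈ E, w k * gradBd G ε D n l r t k ^ 2 ≤
          3 * (if k ∈ Icc 1 D ∪ Ioc (bulk ε n - D) (bulk ε n) then
            exp (4 * c₁ * D) / n * G ^ 2 else 0)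
          + w k * (3 * (G ^ 2 * t ^ 2)) + w k * (3 * (G ^ 2 / n ^ 2)) := fun k hk => by
        refine (mul_le_mul_of_nonneg_left (gradBd_sq_le G ε D n l r t k) (hw0 k)).trans ?_
        rw [mul_add, mul_add]
        refine add_le_add_left (add_le_add ?_ ?_) _
        · split_ifs with hA
          · have hnd : c₀ * log n - 2 * D ≤ nd k j := by
              rw [mem_union, mem_Icc, mem_Ioc] at hA
              rcases hA with hA | hA
              · have h4 : j ≤ nd k j + D := by unfold nd; omega
                have : (j : ℝ) ≤ nd k j + D := mod_cast h4
                linarith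
              · have h4 : bulk ε n ≤ nd k j + D + j := by unfold nd; omega
                have : (bulk ε n : ℝ) ≤ nd k j + D + j := mod_cast h4
                linarith
            have h5 : w k ≤ exp (4 * c₁ * D) / n := by
              rw [hw2 k hk]
              refine (expw_le_of_le (by positivity) hnd).trans_eq ?_
              have : -(2 * c₁ * (c₀ * log n - 2 * D)) = 4 * c₁ * D - log n := by
                rw [hc₀]; field_simp; ring
              rw [this, Real.exp_sub, Real.exp_log hn0']
            have := mul_le_mul_of_nonneg_right h5 (sq_nonneg G)
            linarith
          · simp
        · refine mul_le_mul_of_nonneg_left ?_ (hw0 k)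
          split_ifs
          · exact le_rfl
          · rw [mul_zero]; positivity
      refine (sum_le_sum h3).trans ?_
      rw [sum_add_distrib, sum_add_distrib, ← mul_sum, ← sum_mul, ← sum_mul]
      have e1 := sum_ite_const_le (E := E) (x := exp (4 * c₁ * D) / n * G ^ 2) (by positivity)
        (card_edge_le D (bulk ε n))
      have e2 : (∑ k ∈ E, w k) * (3 * (G ^ 2 * t ^ 2)) ≤ C₀ * (3 * (G ^ 2 * t ^ 2)) := by gcongr
      have e3 : (∑ k ∈ E, w k) * (3 * (G ^ 2 / n ^ 2)) ≤ C₀ * (3 * (G ^ 2 / n)) := by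
        have hn1 : (1 : ℝ) ≤ n := mod_cast hn0
        have : (n : ℝ) ≤ n ^ 2 := by nlinarith
        have : G ^ 2 / (n : ℝ) ^ 2 ≤ G ^ 2 / n := by gcongr
        gcongr
      push_cast at e1
      have e4 : Q * (1 / n + t ^ 2) = 3 * (2 * D * (exp (4 * c₁ * D) / n * G ^ 2))
          + C₀ * (3 * (G ^ 2 * t ^ 2)) + C₀ * (3 * (G ^ 2 / n))
          + 3 * (2 * D * (exp (4 * c₁ * D) * G ^ 2)) * t ^ 2
          + 3 * (G ^ 2 * C₀) / n + 3 * (G ^ 2 * C₀) * t ^ 2 := by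
        rw [hQ]; field_simp; ring
      have e5 : 0 ≤ 3 * (2 * D * (exp (4 * c₁ * D) * G ^ 2)) * t ^ 2
          + 3 * (G ^ 2 * C₀) / n + 3 * (G ^ 2 * C₀) * t ^ 2 := by positivity
      linarith
    have h3 := mul_le_mul_of_nonneg_left h2 (show 0 ≤ 2 / c by positivity)
    have h4 := mul_le_mul_of_nonneg_left h1 (show 0 ≤ c / 4 by positivity)
    linarith
  · refine mul_le_mul_left (ofReal_le_ofReal ?_) _
    have h1 : 2 * ∑ k ∈ E, w k - n * β * (c / 16 * s ^ 2 - 2 / c * (Q * (1 / n + t ^ 2)))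
        ≤ (2 * C₀ + C₂) + ((exp (2 * C₀ + C₂) + C₂) * n * t ^ 2 - β * c / 16 * n * s ^ 2) := by
      have h2 : (n : ℝ) * β * (c / 16 * s ^ 2 - 2 / c * (Q * (1 / n + t ^ 2)))
          = β * c / 16 * n * s ^ 2 - C₂ - C₂ * n * t ^ 2 := by
        rw [hC₂]; field_simp; ring
      have h3 : 0 ≤ exp (2 * C₀ + C₂) * n * t ^ 2 := by positivity
      rw [h2]; linarith
    refine (exp_le_exp.2 h1).trans ?_
    rw [exp_add]
    exact mul_le_mul_of_nonneg_right (by linarith) (exp_pos _).le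

include hc hV hβ hε0 hε1 in
/-- Concentration of the field, conditionally on an event concerning the entries in an interval
that forces these to be close to the local minimizers. -/
lemma exists_concentration :
    ∃ (c₀ C κ τ : ℝ) (N : ℕ), 0 < c₀ ∧ 0 < C ∧ 0 < κ ∧ 0 < τ ∧ 0 < N ∧ ∀ n : ℕ, N ≤ n →
      ∀ l r : ℕ, (r : ℝ) ≤ (1 - ε) * n → ∀ t : ℝ, 0 ≤ t → t ≤ 1 / 2 →
      ∀ X : Set (ℕ → ℝ × ℝ), MeasurableSet X →
      (∀ v ∈ X, ∀ k ∈ Icc l r, ab2 (v k - dagger V β n k) ≤ t) →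
      (∀ v ∈ X, ∀ v' : ℕ → ℝ × ℝ, (∀ k ∈ Icc l r, v' k = v k) → v' ∈ X) →
      Lam V β n (X ∩ {v | ∃ k ∈ Icc 1 n, τ < sq2 (v k)})
        ≤ ofReal (C * exp (-(n / 2))) * Lam V β n X ∧
      ∀ j : ℕ, 1 ≤ j → j ∉ Icc l r → c₀ * log n ≤ (j : ℝ) + V.natDegree →
      (j : ℝ) ≤ (1 - ε) * n + V.natDegree + 1 → ∀ s : ℝ, 0 ≤ s →
      Lam V β n (X ∩ {v | s ^ 2 < sq2 (v j - dagger V β n j)})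
        ≤ ofReal (C * exp (-(n / 2)) + C * exp (C * n * t ^ 2 - κ * n * s ^ 2)) * Lam V β n X := by
  obtain ⟨M, r₀, Λ, hM, hr₀, hΛ, hdag⟩ := exists_dagger_bounds hc hV hβ
    (show 0 < ε / 4 by positivity)
  obtain ⟨τ₀, hτ₀, hsite⟩ := exists_site_bound hc hV hβ
  obtain ⟨ρ, N₁, hρ, hN₁, hl2⟩ := exists_bulk_l2_bound hc hV hβ hε0 hε1 τ₀
  set τ := τ₀ + 2 * ρ + 2 * M ^ 2 + (M + 1) ^ 2
  obtain ⟨c₀, C, κ, N₂, hc₀, hC, hκ, hN₂, hconc⟩ := exists_site_conc_of_bounded hc hV hβ hε0 hε1 τ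
  obtain ⟨N₃, hN₃, hbulk⟩ := exists_bulk_bounds hβ hε0 hε1 0 V.natDegree
  refine ⟨c₀, C + 25, κ, τ, max (max N₁ N₂) N₃, hc₀, by positivity, hκ, by positivity,
    lt_max_of_lt_right hN₃, fun n hn l r hr t ht0 ht1 X hX hXI hinv => ?_⟩
  obtain ⟨hb1, hb2, hb3, hb4⟩ := hbulk n (le_trans (le_max_right _ _) hn)
  have hn0 : 0 < n := by omega
  have hrb : r + 1 ≤ bulk ε n := by
    have := add_add_one_le_bulk hb4 hr; omega
  have hIE : ∀ k ∈ Icc l r, k ∉ bulkOut ε n l r := fun k hk h =>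
    (mem_bulkOut.1 h).2 hk
  set X' := X ∩ {v : ℕ → ℝ × ℝ | ∀ k ∈ Ioc (bulk ε n) n, sq2 (v k) ≤ τ₀}
  have hX'm : MeasurableSet X' := by
    refine hX.inter ?_
    simp only [ofPred_forall]
    exact measurableSet_biInter _ fun k _ => measurableSet_le (measurable_sq2 k) measurable_const
  have hbox : Lam V β n (X ∩ {v | ∃ k ∈ Icc 1 n, τ < sq2 (v k)})
      ≤ ofReal (25 * exp (-(n / 2))) * Lam V β n X := by
    have hsub : X ∩ {v | ∃ k ∈ Icc 1 n, τ < sq2 (v k)} ⊆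
        (⋃ k ∈ Ioc (bulk ε n) n, X ∩ {v | τ₀ < sq2 (v k)}) ∪
        (X' ∩ {v | ρ < ∑ k ∈ bulkOut ε n l r, sq2 (v k - dagger V β n k)}) := by
      rintro v ⟨hvX, k, hk, hvk⟩
      by_cases h1 : ∀ k ∈ Ioc (bulk ε n) n, sq2 (v k) ≤ τ₀
      swap
      · push Not at h1
        obtain ⟨e, he, hve⟩ := h1
        exact Or.inl (Set.mem_biUnion he ⟨hvX, hve⟩)
      refine Or.inr ⟨⟨hvX, h1⟩, ?_⟩
      by_contra hcon
      have hcon : ∑ k ∈ bulkOut ε n l r, sq2 (v k - dagger V β n k) ≤ ρ := not_lt.1 hcon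
      rw [mem_Icc] at hk
      by_cases h2 : k ≤ bulk ε n
      · have hdk := (hdag n k hn0 (hb3 k h2)).1
        by_cases h3 : k ∈ Icc l r
        · have h4 := hXI v hvX k h3
          have h5 := ab2_add_le (v k - dagger V β n k) (dagger V β n k)
          rw [sub_add_cancel] at h5
          have h6 : ab2 (v k) ≤ M + 1 := by linarith
          have h7 := sq2_le_ab2_sq (v k)
          have h8 : ab2 (v k) ^ 2 ≤ (M + 1) ^ 2 := pow_le_pow_left₀ (ab2_nonneg _) h6 2
          have h9 : 0 ≤ 2 * M ^ 2 := by positivity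
          linarith
        · have h4 := (single_le_sum (f := fun k => sq2 (v k - dagger V β n k))
            (fun k _ => sq2_nonneg _) (show k ∈ bulkOut ε n l r from
              mem_bulkOut.2 ⟨⟨hk.1, h2⟩, h3⟩)).trans hcon
          have h5 : sq2 (v k) ≤ 2 * sq2 (v k - dagger V β n k) + 2 * sq2 (dagger V β n k) := by
            simp only [sq2, Prod.fst_sub, Prod.snd_sub]
            nlinarith [sq_nonneg ((v k).1 - 2 * (dagger V β n k).1),
              sq_nonneg ((v k).2 - 2 * (dagger V β n k).2)]
          have h6 := sq2_le_ab2_sq (dagger V β n k)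
          have h7 : ab2 (dagger V β n k) ^ 2 ≤ M ^ 2 := pow_le_pow_left₀ (ab2_nonneg _) hdk 2
          have h8 : 0 < (M + 1) ^ 2 := by positivity
          linarith
      · have h3 := h1 k (mem_Ioc.2 ⟨by omega, hk.2⟩)
        have : 0 < 2 * ρ + 2 * M ^ 2 + (M + 1) ^ 2 := by positivity
        linarith
    have h1 : ∀ k ∈ Ioc (bulk ε n) n, Lam V β n (X ∩ {v | τ₀ < sq2 (v k)})
        ≤ ofReal (12 * exp (-n)) * Lam V β n X := fun k hk => by
      rw [mem_Ioc] at hk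
      refine hsite n k (mem_Icc.2 ⟨by omega, hk.2⟩) X hX fun v hv v' hvv =>
        hinv v hv v' fun e he => ?_
      rw [mem_Icc] at he
      exact hvv e (by omega) (by omega)
    have h2 := hl2 n (le_trans (le_max_left _ _) (le_trans (le_max_left _ _) hn)) l r hr X' hX'm
      (fun v hv k hk => (hXI v hv.1 k hk).trans ht1) (fun v hv k hk _ => hv.2 k hk)
      (fun v hv v' hvv => ⟨hinv v hv.1 v' fun k hk => hvv k (hIE k hk), fun k hk => by
        rw [hvv k]
        · exact hv.2 k hk
        · intro h
          rw [mem_bulkOut] at h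
          rw [mem_Ioc] at hk
          omega⟩)
    calc Lam V β n (X ∩ {v | ∃ k ∈ Icc 1 n, τ < sq2 (v k)})
        ≤ ∑ k ∈ Ioc (bulk ε n) n, ofReal (12 * exp (-n)) * Lam V β n X
          + ofReal (exp (-n)) * Lam V β n X :=
          (measure_mono hsub).trans ((measure_union_le _ _).trans (add_le_add
            ((measure_biUnion_finset_le _ _).trans (sum_le_sum h1))
            (h2.trans (mul_le_mul_right (measure_mono inter_subset_left) _))))
      _ ≤ ofReal (n * (12 * exp (-n))) * Lam V β n X + ofReal (exp (-n)) * Lam V β n X := by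
          refine add_le_add_left ?_ _
          rw [sum_const, nsmul_eq_mul, ofReal_mul (p := (n : ℝ)) (by positivity),
            ofReal_natCast,
            mul_assoc]
          refine mul_le_mul_left ?_ _
          rw [Nat.card_Ioc]
          exact_mod_cast Nat.sub_le _ _
      _ ≤ _ := by
          rw [← add_mul, ← ofReal_add (by positivity) (by positivity)]
          refine mul_le_mul_left (ofReal_le_ofReal ?_) _
          have e1 : exp (-(n : ℝ)) = exp (-(n / 2)) * exp (-(n / 2)) := by
            rw [← exp_add]; congr 1; ring
          have e2 : (n : ℝ) / 2 * exp (-(n / 2)) ≤ 1 := by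
            rw [Real.exp_neg, mul_inv_le_iff₀ (exp_pos _), one_mul]
            linarith [add_one_le_exp ((n : ℝ) / 2)]
          have e3 : exp (-((n : ℝ) / 2)) ≤ 1 := exp_le_one_iff.2 (by
            have : (0 : ℝ) ≤ n := Nat.cast_nonneg _
            linarith)
          have e4 := exp_pos (-((n : ℝ) / 2))
          rw [e1]
          nlinarith
  refine ⟨hbox.trans (mul_le_mul_left (ofReal_le_ofReal ?_) _), ?_⟩
  · exact mul_le_mul_of_nonneg_right (by linarith) (exp_pos _).le
  intro j hj1 hjI hj2 hj3 s hs
  have h1 := hconc n (le_trans (le_max_right _ _) (le_trans (le_max_left _ _) hn)) l r hr t ht0 ht1 X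
    hX hXI (fun v hv v' hvv => hinv v hv v' fun k hk => hvv k (hIE k hk)) j hj1 hjI hj2 hj3 s hs
  have hsub : X ∩ {v | s ^ 2 < sq2 (v j - dagger V β n j)} ⊆
      (X ∩ {v | ∃ k ∈ Icc 1 n, τ < sq2 (v k)}) ∪
      (X ∩ {v | ∀ k ∈ Icc 1 n, sq2 (v k) ≤ τ} ∩ {v | s ^ 2 < sq2 (v j - dagger V β n j)}) := by
    rintro v ⟨hvX, hvj⟩
    by_cases h : ∀ k ∈ Icc 1 n, sq2 (v k) ≤ τ
    · exact Or.inr ⟨⟨hvX, h⟩, hvj⟩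
    · push Not at h
      exact Or.inl ⟨hvX, h⟩
  refine (measure_mono hsub).trans ((measure_union_le _ _).trans ((add_le_add hbox h1).trans ?_))
  rw [← add_mul, ← ofReal_add (by positivity) (by positivity)]
  refine mul_le_mul_left (ofReal_le_ofReal (add_le_add ?_ ?_)) _
  · exact mul_le_mul_of_nonneg_right (by linarith) (exp_pos _).le
  · refine mul_le_mul (by linarith) (exp_le_exp.2 ?_) (exp_pos _).le (by positivity)
    have : 0 ≤ 25 * (n : ℝ) * t ^ 2 := by positivity
    linarith

include hc hV hβ hε0 hε1 in
/-- The off-diagonal entries of the bulk are bounded from below. -/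
lemma exists_offdiag_lower_bound :
    ∃ (r₀ C κ : ℝ) (N : ℕ), 0 < r₀ ∧ 0 < C ∧ 0 < κ ∧ 0 < N ∧ ∀ n : ℕ, N ≤ n →
      ∀ k : ℕ, 1 ≤ k → (k : ℝ) ≤ (1 - ε) * n →
      Lam V β n {v | (v k).2 < r₀} ≤ ofReal (C * exp (-(κ * n))) * Lam V β n univ := by
  obtain ⟨c₀, C, κ, τ, N₁, hc₀, hC, hκ, hτ, hN₁, hconc⟩ := exists_concentration hc hV hβ hε0 hε1
  obtain ⟨N₃, hN₃, hbulk⟩ := exists_bulk_bounds hβ hε0 hε1 0 V.natDegree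
  have hP0 := polBound_nonneg Vᵈ (c := 3 * (4 * √τ)) (by positivity)
  set P := polBound Vᵈ (3 * (4 * √τ))
  set r₀ := ε / (32 * (P + 1)) with hr₀
  refine ⟨r₀, C + 1, min (1 / 2) (β * (ε / 16)), max N₁ N₃, by positivity, by positivity,
    by positivity, lt_max_of_lt_left hN₁, fun n hn k hk1 hk2 => ?_⟩
  obtain ⟨hb1, hb2, hb3, hb4⟩ := hbulk n (le_trans (le_max_right _ _) hn)
  have hn0 : 0 < n := by omega
  have hkb : k ≤ bulk ε n := by
    have := add_add_one_le_bulk hb4 hk2; omega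
  have hkn : k ∈ Icc 1 (n - 1) := mem_Icc.2 ⟨hk1, by omega⟩
  have hco : ε / 4 ≤ logCoeff β n k := by rw [logCoeff_eq]; linarith [hb3 k hkb]
  have hbox := (hconc n (le_trans (le_max_left _ _) hn) 1 0 (by
    have : 0 ≤ 1 - ε := by linarith
    simpa using by positivity) 0 le_rfl (by norm_num) univ MeasurableSet.univ
    (fun v _ k hk => by simp at hk) (fun _ _ _ _ => trivial)).1
  rw [Set.univ_inter] at hbox
  set B : Set (ℕ → ℝ × ℝ) := {v | ∀ k ∈ Icc 1 n, sq2 (v k) ≤ τ} with hB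
  have hBm : MeasurableSet B := by
    simp only [hB, ofPred_forall]
    exact measurableSet_biInter _ fun k _ => measurableSet_le (measurable_sq2 k) measurable_const
  set wb : ℕ → ℝ := fun e => if e = k then -1 / 2 else 0 with hwb
  have h1 : Lam V β n (B ∩ {v | (v k).2 < r₀})
      ≤ ofReal (exp (-(n * β * (ε / 16)))) * ofReal (jacFactor n (fun _ => 0) wb)
        * Lam V β n univ := by
    refine Lam_le_of_shrink V β (fun _ => (0, 0)) (by norm_num) (fun e => ?_) (fun _ _ => rfl)
      (fun e he => ?_) MeasurableSet.univ (hBm.inter ?_) ?_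
    · simp only [hwb]; split_ifs <;> norm_num
    · simp only [hwb]; rw [if_neg]; rintro rfl; exact he hkn
    · exact measurableSet_lt (measurable_snd.comp (measurable_pi_apply k)) measurable_const
    · rintro v ⟨hvB, hvk⟩ hpos - -
      refine ⟨trivial, ?_⟩
      have hvk : (v k).2 < r₀ := hvk
      set Z := shrink₂ (fun _ => (0, 0)) (fun _ => 0) wb v with hZ
      have hZ1 : ∀ e, e ≠ k → Z e = v e := fun e he => by ext <;> simp [hZ, shrink₂, hwb, he]
      have hZk : Z k = ((v k).1, 2 * (v k).2) := by
        ext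
        · simp [hZ, shrink₂]
        · simp [hZ, shrink₂, hwb]; norm_num
      have hZpos : ∀ e ∈ Icc 1 (n - 1), 0 < (Z e).2 := fun e he => by
        by_cases hek : e = k
        · rw [hek, hZk]; simpa using hpos k hkn
        · rw [hZ1 e hek]; exact hpos e he
      refine dens_le_of_ham hZpos hβ.le ?_
      have h2 := ham_ge_of_grad (β := β) hV (E := {k}) (by simpa using hkn)
        (fun e he => by rw [mem_singleton.1 he]; linarith) (v := v) (v' := Z)
        (fun e he => (hZ1 e (by simpa using he)).symm)
        (fun e he => by rw [mem_singleton.1 he]; exact hpos k hkn)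
        (fun e he => by rw [mem_singleton.1 he]; exact hZpos k hkn)
      rw [sum_singleton, sum_singleton] at h2
      have hsq : 0 ≤ √τ := sqrt_nonneg _
      have hrow : RowBdd (jac n Z) (3 * (4 * √τ)) := rowBdd_jac_of_ab2 (by positivity) fun e he => by
        have h3 := ab2_le_sqrt (hvB e he)
        by_cases hek : e = k
        · subst hek
          rw [hZk]
          have : ab2 ((v e).1, 2 * (v e).2) ≤ 2 * ab2 (v e) := by
            simp only [ab2]
            rw [abs_mul, abs_two]
            linarith [abs_nonneg (v e).1]
          linarith
        · rw [hZ1 e hek]; linarith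
      have hb := hpos k hkn
      have hu : v k - Z k = (0, -(v k).2) := by
        rw [hZk]; ext
        · simp
        · simp; ring
      have htr := abs_trace_mul_jac_single_le hkn (fun i j =>
        (rowBdd_aeval Vᵈ hrow (by positivity)).abs_le i j) (v k - Z k)
      have hgr : grad V β n Z k (v k - Z k)
          = (aeval (jac n Z) Vᵈ * jac n (Pi.single k (v k - Z k))).trace
            - logCoeff β n k * ((v k - Z k).2 / (Z k).2) := rfl
      have hlog : logCoeff β n k * ((v k - Z k).2 / (Z k).2) = -(logCoeff β n k / 2) := by
        rw [hu, hZk]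
        simp only; field_simp
      rw [hgr, hlog] at h2
      have e1 : |(v k - Z k).1| + 2 * |(v k - Z k).2| = 2 * (v k).2 := by
        rw [hu]; simp [abs_of_pos hb]
      rw [e1] at htr
      have e2 := (abs_le.1 htr).1
      have e3 : 2 * (v k).2 * P ≤ ε / 16 := by
        have : (v k).2 * P ≤ r₀ * (P + 1) := mul_le_mul hvk.le (by linarith) hP0 (by positivity)
        have e4 : r₀ * (P + 1) = ε / 32 := by rw [hr₀]; field_simp
        linarith
      have e5 : 0 ≤ c / 2 * ((v k - Z k).1 ^ 2 + 2 * (v k - Z k).2 ^ 2) := by positivity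
      linarith
  have hjac : 0 ≤ jacFactor n (fun _ => 0) wb ∧ jacFactor n (fun _ => 0) wb ≤ 1 := by
    have h2 : jacFactor n (fun _ => 0) wb = 1 / 2 := by
      rw [jacFactor, prod_eq_one fun _ _ => add_zero _, one_mul, prod_eq_single k]
      · simp only [hwb, if_true]; norm_num
      · intro e _ he; simp [hwb, he]
      · exact fun h => absurd hkn h
    rw [h2]; norm_num
  have hsub : {v : ℕ → ℝ × ℝ | (v k).2 < r₀} ⊆ {v | ∃ k ∈ Icc 1 n, τ < sq2 (v k)} ∪
      (B ∩ {v | (v k).2 < r₀}) := fun v hv => by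
    by_cases h : ∀ k ∈ Icc 1 n, sq2 (v k) ≤ τ
    · exact Or.inr ⟨h, hv⟩
    · push Not at h
      exact Or.inl h
  refine (measure_mono hsub).trans ((measure_union_le _ _).trans ((add_le_add hbox h1).trans ?_))
  rw [← ofReal_mul (exp_pos _).le, ← add_mul, ← ofReal_add (by positivity)
    (mul_nonneg (exp_pos _).le hjac.1)]
  refine mul_le_mul_left (ofReal_le_ofReal ?_) _
  have e1 : exp (-((n : ℝ) / 2)) ≤ exp (-(min (1 / 2) (β * (ε / 16)) * n)) := by
    rw [exp_le_exp]
    have := mul_le_mul_of_nonneg_right (min_le_left (1 / 2) (β * (ε / 16))) (Nat.cast_nonneg (α := ℝ) n)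
    linarith
  have e2 : exp (-(n * β * (ε / 16))) ≤ exp (-(min (1 / 2) (β * (ε / 16)) * n)) := by
    rw [exp_le_exp]
    have := mul_le_mul_of_nonneg_right (min_le_right (1 / 2) (β * (ε / 16))) (Nat.cast_nonneg (α := ℝ) n)
    linarith
  have e3 := mul_le_mul_of_nonneg_left hjac.2 (exp_pos (-(n * β * (ε / 16)))).le
  have e4 := mul_le_mul_of_nonneg_left e1 hC.le
  linarith

/-! ### The Markov property -/

/-- The configuration `x` on `J`, completed by `v`. -/
noncomputable def mrg (J : Finset ℕ) (x : Config J) (v : ℕ → ℝ × ℝ) : ℕ → ℝ × ℝ :=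
  fun k => if h : k ∈ J then x ⟨k, h⟩ else v k

lemma mrg_mem (x : Config J) (v : ℕ → ℝ × ℝ) (h : k ∈ J) :
    mrg J x v k = x ⟨k, h⟩ := dif_pos h

lemma mrg_coe (x : Config J) (v : ℕ → ℝ × ℝ) (k : J) : mrg J x v k = x k :=
  dif_pos k.2

lemma mrg_notMem (x : Config J) (v : ℕ → ℝ × ℝ) (h : k ∉ J) :
    mrg J x v k = v k := dif_neg h

lemma condH_eq (V : ℝ[X]) (β : ℝ) (n l r : ℕ) (q : Config (bdry V n l r))
    (x : Config (Icc l r)) : ℋ[β] q x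
      = ham V β n (mrg _ x (mrg _ q fun _ => (0, 1))) := rfl

lemma measurable_mrg (J : Finset ℕ) :
    Measurable fun z : Config J × (ℕ → ℝ × ℝ) => mrg J z.1 z.2 := by
  refine measurable_pi_lambda _ fun k => ?_
  unfold mrg
  split_ifs <;> fun_prop

lemma mem_bdry {n l r k e : ℕ} (hk : k ∈ Icc l r) (he : e ∈ Icc 1 n)
    (h : nd e k ≤ V.natDegree / 2) (heI : e ∉ Icc l r) : e ∈ bdry V n l r := by
  rw [bdry, mem_filter]
  rw [mem_Icc] at hk
  unfold nd at h
  exact ⟨he, heI, by omega, by omega⟩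

lemma trace_aeval_mrg_sub (V : ℝ[X]) (hl : 1 ≤ l) (hr : r + 1 ≤ n)
    (hv : ∀ k ∈ bdry V n l r, v k = v' k) (x x' : Config (Icc l r)) :
    (aeval (jac n (mrg _ x v)) V).trace - (aeval (jac n (mrg _ x v')) V).trace
      = (aeval (jac n (mrg _ x' v)) V).trace - (aeval (jac n (mrg _ x' v')) V).trace := by
  set y : ℕ → ℝ × ℝ := mrg _ (x - x') 0 with hy
  have hy0 : ∀ k ∉ Icc l r, y k = 0 := fun k hk => mrg_notMem _ _ hk
  have hline : ∀ (t : ℝ) (u : ℕ → ℝ × ℝ), mrg _ x' u + t • y = mrg _ (x' + t • (x - x')) u := fun t u => by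
    ext1 k
    by_cases hk : k ∈ Icc l r
    · simp [hy, mrg_mem _ _ hk]
    · simp [hy, mrg_notMem _ _ hk]
  have hd : ∀ (u : ℕ → ℝ × ℝ) (t : ℝ),
      HasDerivAt (fun t : ℝ => (aeval (jac n (mrg _ x' u) + t • jac n y) V).trace)
        (aeval (jac n (mrg _ (x' + t • (x - x')) u)) Vᵈ * jac n y).trace t := fun u t => by
    have h := hasDerivAt_trace_aeval V (jac n (mrg _ x' u)) (jac n y) t
    rwa [← map_smul, ← map_add, hline] at h
  have hzero : ∀ t : ℝ, (aeval (jac n (mrg _ (x' + t • (x - x')) v)) Vᵈ * jac n y).trace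
      = (aeval (jac n (mrg _ (x' + t • (x - x')) v')) Vᵈ * jac n y).trace := fun t => by
    rw [jac_eq_sum_single hy0, mul_sum, mul_sum, trace_sum, trace_sum]
    refine sum_congr rfl fun k hk => trace_aeval_derivative_jac_congr V ?_ ?_ _
    · rw [mem_Icc] at hk ⊢; omega
    · intro e he hek
      by_cases heI : e ∈ Icc l r
      · rw [mrg_mem _ _ heI, mrg_mem _ _ heI]
      · rw [mrg_notMem _ _ heI, mrg_notMem _ _ heI]
        exact hv e (mem_bdry hk he hek heI)
  have hconst := is_const_of_deriv_eq_zero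
    (f := fun t : ℝ => (aeval (jac n (mrg _ x' v) + t • jac n y) V).trace
      - (aeval (jac n (mrg _ x' v') + t • jac n y) V).trace)
    (fun t => ((hd v t).sub (hd v' t)).differentiableAt)
    (fun t => (((hd v t).sub (hd v' t)).deriv).trans (by rw [hzero, sub_self])) 1 0
  simp only [← map_smul, ← map_add, hline] at hconst
  simpa using hconst

lemma ham_mrg_sub (V : ℝ[X]) (β : ℝ) (hl : 1 ≤ l) (hr : r + 1 ≤ n)
    (hv : ∀ k ∈ bdry V n l r, v k = v' k) (x x' : Config (Icc l r)) :
    ham V β n (mrg _ x v) - ham V β n (mrg _ x v')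
      = ham V β n (mrg _ x' v) - ham V β n (mrg _ x' v') := by
  have h1 := trace_aeval_mrg_sub V hl hr hv x x'
  have h2 : ∀ z : Config (Icc l r), ∑ k ∈ Icc 1 (n - 1), logCoeff β n k * log (mrg _ z v k).2
      - ∑ k ∈ Icc 1 (n - 1), logCoeff β n k * log (mrg _ z v' k).2
      = ∑ k ∈ Icc 1 (n - 1), if k ∈ Icc l r then 0 else
        (logCoeff β n k * log (v k).2 - logCoeff β n k * log (v' k).2) := fun z => by
    rw [← sum_sub_distrib]
    refine sum_congr rfl fun k _ => ?_
    split_ifs with h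
    · rw [mrg_mem _ _ h, mrg_mem _ _ h, sub_self]
    · rw [mrg_notMem _ _ h, mrg_notMem _ _ h]
  have h3 := h2 x
  have h4 := h2 x'
  rw [ham_eq, ham_eq, ham_eq, ham_eq]; linarith

/-! ### Exchanging the entries in an interval -/

/-- Exchanging the entries of a field in `J` with those of a configuration on `J`. -/
noncomputable def swapL (n : ℕ) (J : Finset ℕ) : (Field n × Config J) →ₗ[ℝ] (Field n × Config J) where
  toFun z := ((fun i => if h : (i : ℕ) + 1 ∈ J then (z.2 ⟨i + 1, h⟩).1 else z.1.1 i,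
    fun i => if h : (i : ℕ) + 1 ∈ J then (z.2 ⟨i + 1, h⟩).2 else z.1.2 i), restr J z.1)
  map_add' z z' := by
    refine Prod.ext (Prod.ext ?_ ?_) ?_
    · ext i; simp only [Prod.fst_add, Prod.snd_add, Pi.add_apply]; split_ifs <;> rfl
    · ext i; simp only [Prod.fst_add, Prod.snd_add, Pi.add_apply]; split_ifs <;> rfl
    · ext k
      · simp only [restr, entA, Prod.fst_add, Prod.snd_add, Pi.add_apply]; split_ifs <;> simp
      · simp only [restr, entB, Prod.fst_add, Prod.snd_add, Pi.add_apply]; split_ifs <;> simp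
  map_smul' t z := by
    refine Prod.ext (Prod.ext ?_ ?_) ?_
    · ext i; simp only [Prod.smul_fst, Prod.smul_snd, Pi.smul_apply, RingHom.id_apply]
      split_ifs <;> rfl
    · ext i; simp only [Prod.smul_fst, Prod.smul_snd, Pi.smul_apply, RingHom.id_apply]
      split_ifs <;> rfl
    · ext k
      · simp only [restr, entA, Prod.smul_fst, Prod.smul_snd, Pi.smul_apply, RingHom.id_apply]
        split_ifs <;> simp
      · simp only [restr, entB, Prod.smul_fst, Prod.smul_snd, Pi.smul_apply, RingHom.id_apply]
        split_ifs <;> simp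

lemma seq_swapL (hJ : J ⊆ Icc 1 (n - 1)) (z : Field n × Config J) :
    seq (swapL n J z).1 = mrg J z.2 (seq z.1) := by
  ext k
  · simp only [seq, mrg]
    by_cases hk : k ∈ Icc 1 n
    · have hk' := mem_Icc.1 hk
      obtain ⟨q, rfl⟩ : ∃ q, k = q + 1 := ⟨k - 1, by omega⟩
      have e1 := entA_succ (swapL n J z).1 ⟨q, by omega⟩
      have e2 := entA_succ z.1 ⟨q, by omega⟩
      simp only at e1 e2
      rw [e1, e2]
      simp only [swapL, LinearMap.coe_mk, AddHom.coe_mk]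
      split_ifs <;> rfl
    · have hkJ : k ∉ J := fun h => hk (Icc_subset_Icc_right (Nat.sub_le n 1) (hJ h))
      rw [entA_eq_zero _ hk, entA_eq_zero _ hk, dif_neg hkJ]
  · simp only [seq, mrg]
    by_cases hk : k ∈ Icc 1 (n - 1)
    · have hk' := mem_Icc.1 hk
      obtain ⟨q, rfl⟩ : ∃ q, k = q + 1 := ⟨k - 1, by omega⟩
      have e1 := entB_succ (swapL n J z).1 ⟨q, by omega⟩
      have e2 := entB_succ z.1 ⟨q, by omega⟩
      simp only at e1 e2
      rw [e1, e2]
      simp only [swapL, LinearMap.coe_mk, AddHom.coe_mk]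
      split_ifs <;> rfl
    · have hkJ : k ∉ J := fun h => hk (hJ h)
      rw [entB_eq_zero _ hk, entB_eq_zero _ hk, dif_neg hkJ]

lemma restr_eq (J : Finset ℕ) (ω : Field n) : restr J ω = fun k : J => seq ω k := rfl

lemma seq_injective (n : ℕ) : Function.Injective (seq (n := n)) := fun ω ω' h => by
  refine Prod.ext (funext fun i => ?_) (funext fun i => ?_)
  · rw [← entA_succ ω, ← entA_succ ω']; exact congrArg (fun f => (f (i + 1 : ℕ)).1) h
  · rw [← entB_succ ω, ← entB_succ ω']; exact congrArg (fun f => (f (i + 1 : ℕ)).2) h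

lemma swapL_comp_self (hJ : J ⊆ Icc 1 (n - 1)) : (swapL n J).comp (swapL n J) = LinearMap.id := by
  refine LinearMap.ext fun z => ?_
  simp only [LinearMap.comp_apply, LinearMap.id_apply]
  have h2 : ∀ z : Field n × Config J, (swapL n J z).2 = restr J z.1 := fun z => rfl
  refine Prod.ext (seq_injective n ?_) ?_
  · rw [seq_swapL hJ, seq_swapL hJ, h2]
    ext1 k
    by_cases hk : k ∈ J
    · rw [mrg_mem _ _ hk]; rfl
    · rw [mrg_notMem _ _ hk, mrg_notMem _ _ hk]
  · rw [h2, restr_eq, seq_swapL hJ]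
    ext1 k
    exact mrg_coe _ _ k

lemma map_swapL (hJ : J ⊆ Icc 1 (n - 1)) :
    (volume : Measure (Field n × Config J)).map (swapL n J) = volume := by
  have hdet : LinearMap.det (swapL n J) * LinearMap.det (swapL n J) = 1 := by
    rw [← LinearMap.det_comp, swapL_comp_self hJ, LinearMap.det_id]
  have hne : LinearMap.det (swapL n J) ≠ 0 := fun h => by rw [h] at hdet; simp at hdet
  have habs : |(LinearMap.det (swapL n J))⁻¹| = 1 := by
    rw [abs_inv, inv_eq_one]
    have h1 : |LinearMap.det (swapL n J)| * |LinearMap.det (swapL n J)| = 1 := by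
      rw [← abs_mul, hdet, abs_one]
    nlinarith [abs_nonneg (LinearMap.det (swapL n J))]
  have h0 : (volume : Measure (ℝ × ℝ)).IsAddHaarMeasure :=
    Measure.prod.instIsAddHaarMeasure (volume : Measure ℝ) (volume : Measure ℝ)
  have h1 : (volume : Measure (Config J)).IsAddHaarMeasure :=
    inferInstanceAs (Measure.pi fun _ : J => (volume : Measure (ℝ × ℝ))).IsAddHaarMeasure
  have h2 : (volume : Measure (Field n)).IsAddHaarMeasure :=
    Measure.prod.instIsAddHaarMeasure (volume : Measure (Fin n → ℝ))
      (volume : Measure (Fin (n - 1) → ℝ))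
  have h3 : (volume : Measure (Field n × Config J)).IsAddHaarMeasure :=
    Measure.prod.instIsAddHaarMeasure (volume : Measure (Field n)) (volume : Measure (Config J))
  rw [Measure.map_linearMap_addHaar_eq_smul_addHaar _ hne, habs, ofReal_one, one_smul]

lemma measurable_restr (J : Finset ℕ) : Measurable (restr (n := n) J) :=
  measurable_pi_lambda _ fun k => (measurable_entA k).prodMk (measurable_entB k)

lemma lintegral_swap (hJ : J ⊆ Icc 1 (n - 1))
    {G : (ℕ → ℝ × ℝ) × Config J → ℝ≥0∞} (hG : Measurable G) :
    ∫⁻ ω : Field n, ∫⁻ x : Config J, G (seq ω, x)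
      = ∫⁻ ω : Field n, ∫⁻ x : Config J, G (mrg J x (seq ω), restr J ω) := by
  have hG1 : Measurable fun z : Field n × Config J => G (seq z.1, z.2) :=
    hG.comp ((measurable_seq.comp measurable_fst).prodMk measurable_snd)
  have hG2 : Measurable fun z : Field n × Config J => G (mrg J z.2 (seq z.1), restr J z.1) :=
    hG.comp (((measurable_mrg J).comp (measurable_snd.prodMk (measurable_seq.comp
      measurable_fst))).prodMk ((measurable_restr J).comp measurable_fst))
  have hS : Measurable (swapL n J) := (LinearMap.continuous_of_finiteDimensional _).measurable
  rw [← lintegral_prod (f := fun z : Field n × Config J => G (seq z.1, z.2)) hG1.aemeasurable,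
    ← lintegral_prod (f := fun z : Field n × Config J => G (mrg J z.2 (seq z.1), restr J z.1))
      hG2.aemeasurable]
  have h := lintegral_map (μ := (volume : Measure (Field n × Config J))) hG1 hS
  rw [map_swapL hJ] at h
  refine h.trans (lintegral_congr fun z => ?_)
  rw [seq_swapL hJ]; rfl

/-! ### The conditional minimizer -/

/-- The boundary values `q`, completed by `(0, 1)`. -/
noncomputable def ext {V : ℝ[X]} {n l r : ℕ} (q : Config (bdry V n l r)) : ℕ → ℝ × ℝ :=
  mrg _ q fun _ => (0, 1)

lemma sum_sq2_le_trace (hE : E ⊆ Icc 1 (n - 1)) (v : ℕ → ℝ × ℝ) :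
    ∑ k ∈ E, sq2 (v k) ≤ (jac n v * jac n v).trace := by
  set ω : Field n := (fun i => (v (i + 1)).1, fun i => (v (i + 1)).2)
  have hA : ∀ k ∈ Icc 1 n, entA ω k = (v k).1 := fun k hk => by
    rw [mem_Icc] at hk
    obtain ⟨p, rfl⟩ : ∃ p, k = p + 1 := ⟨k - 1, by omega⟩
    exact entA_succ ω ⟨p, by omega⟩
  have hB : ∀ k ∈ Icc 1 (n - 1), entB ω k = (v k).2 := fun k hk => by
    rw [mem_Icc] at hk
    obtain ⟨p, rfl⟩ : ∃ p, k = p + 1 := ⟨k - 1, by omega⟩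
    exact entB_succ ω ⟨p, by omega⟩
  have hjac : jac n v = jac n (seq ω) := by
    rcases Nat.eq_zero_or_pos n with rfl | hn
    · ext i; exact i.elim0
    refine jac_congr (fun k hk => ?_) ?_
    · exact Prod.ext (hA k (Icc_subset_Icc_right (Nat.sub_le n 1) hk)).symm (hB k hk).symm
    · exact (hA n (mem_Icc.2 ⟨hn, le_rfl⟩)).symm
  rw [hjac]
  refine le_trans ?_ (trace_jac_sq_ge n ω)
  have h1 : ∑ i, ω.1 i ^ 2 = ∑ k ∈ Icc 1 n, (v k).1 ^ 2 :=
    (sum_Icc_eq_sum_fin n fun k => (v k).1 ^ 2).symm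
  have h2 : ∑ i, ω.2 i ^ 2 = ∑ k ∈ Icc 1 (n - 1), (v k).2 ^ 2 :=
    (sum_Icc_eq_sum_fin (n - 1) fun k => (v k).2 ^ 2).symm
  rw [h1, h2]
  simp only [sq2, sum_add_distrib]
  exact add_le_add (sum_le_sum_of_subset_of_nonneg
    (hE.trans (Icc_subset_Icc_right (Nat.sub_le n 1))) fun _ _ _ => sq_nonneg _)
    (sum_le_sum_of_subset_of_nonneg hE fun _ _ _ => sq_nonneg _)

lemma hasDerivAt_ham_line (V : ℝ[X]) (β : ℝ)
    (hE : E ⊆ Icc 1 (n - 1)) (v : ℕ → ℝ × ℝ) (hy : ∀ k ∉ E, y k = 0)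
    {t : ℝ} (hpos : ∀ k ∈ E, 0 < ((v + t • y) k).2) :
    HasDerivAt (fun t : ℝ => ham V β n (v + t • y)) ((aeval (jac n (v + t • y)) Vᵈ * jac n y).trace
        - ∑ k ∈ E, logCoeff β n k * ((y k).2 / ((v + t • y) k).2)) t := by
  have h1 : HasDerivAt (fun t : ℝ => (aeval (jac n (v + t • y)) V).trace)
      ((aeval (jac n (v + t • y)) Vᵈ * jac n y).trace) t := by
    have h := hasDerivAt_trace_aeval V (jac n v) (jac n y) t
    simpa only [← map_smul, ← map_add] using h
  have h2 : HasDerivAt (fun t : ℝ => ∑ k ∈ Icc 1 (n - 1), logCoeff β n k * log ((v + t • y) k).2)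
      (∑ k ∈ Icc 1 (n - 1), if k ∈ E then logCoeff β n k * ((y k).2 / ((v + t • y) k).2)
        else 0) t := by
    refine HasDerivAt.fun_sum fun k _ => ?_
    split_ifs with hk
    · refine HasDerivAt.const_mul _ ?_
      have h3 : HasDerivAt (fun t : ℝ => (v k).2 + t * (y k).2) (y k).2 t := by
        simpa using ((hasDerivAt_id t).mul_const (y k).2).const_add (v k).2
      exact h3.log (by simpa using (hpos k hk).ne')
    · have : (fun t : ℝ => logCoeff β n k * log ((v + t • y) k).2)
          = fun _ => logCoeff β n k * log (v k).2 := by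
        funext t; simp [hy k hk]
      rw [this]
      exact hasDerivAt_const _ _
  rw [← sum_filter, Finset.filter_mem_eq_inter, Finset.inter_eq_right.2 hE] at h2
  exact h1.sub h2

lemma sum_grad_eq (V : ℝ[X]) (β : ℝ) (v : ℕ → ℝ × ℝ) (hy : ∀ k ∉ E, y k = 0) :
    ∑ k ∈ E, grad V β n v k (y k) = (aeval (jac n v) Vᵈ * jac n y).trace
      - ∑ k ∈ E, logCoeff β n k * ((y k).2 / (v k).2) := by
  rw [jac_eq_sum_single hy, mul_sum, trace_sum, ← sum_sub_distrib]; rfl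

section

lemma Icc_subset_of_le (hl : 1 ≤ l) (hr : r + 1 ≤ n) : Icc l r ⊆ Icc 1 (n - 1) := fun k hk => by
  rw [mem_Icc] at hk ⊢; omega

lemma sum_coe_Icc (f : ℕ → ℝ) : ∑ k : Icc l r, f k = ∑ k ∈ Icc l r, f k := sum_coe_sort (Icc l r) f

include hc hV hl hr hco in
lemma exists_condMin (q : Config (bdry V n l r)) : (∀ i, 0 < (𝔪[β] q i).2) ∧
      ∀ x' : Config (Icc l r), (∀ i, 0 < (x' i).2) →
        ℋ[β] q (𝔪[β] q) ≤ ℋ[β] q x' := by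
  obtain ⟨R, hR⟩ := exists_quadratic_le hc hV
  have hcont : Continuous fun x : Config (Icc l r) =>
      (aeval (jac n (mrg _ x (ext q))) V).trace := by
    refine (continuous_trace_aeval_jac V n).comp (continuous_pi fun k => ?_)
    unfold mrg
    split_ifs <;> fun_prop
  have hlow : ∀ x : Config (Icc l r), c / 4 * ∑ i, sq2 (x i) - R * n
      ≤ (aeval (jac n (mrg _ x (ext q))) V).trace := fun x => by
    have h1 := trace_aeval_ge_quadratic hR (jac_isSymm n (mrg _ x (ext q)))
    rw [Fintype.card_fin] at h1
    have h2 := sum_sq2_le_trace (Icc_subset_of_le hl hr) (mrg _ x (ext q))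
    rw [← sum_coe_Icc] at h2
    simp only [mrg_coe] at h2
    have h3 := mul_le_mul_of_nonneg_left h2 (show 0 ≤ c / 4 by positivity)
    linarith
  obtain ⟨m, hm0, hm⟩ := exists_min_sub_log hcont (show 0 < c / 4 by positivity) hlow
    (c := fun k => logCoeff β n k) (fun k => hco k k.2)
  refine Classical.epsilon_spec (p := fun x : Config (Icc l r) => (∀ i, 0 < (x i).2) ∧
    ∀ x' : Config (Icc l r), (∀ i, 0 < (x' i).2) →
      ℋ[β] q x ≤ ℋ[β] q x') ⟨m, hm0, fun x' hx' => ?_⟩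
  have hsplit : ∀ x : Config (Icc l r), ℋ[β] q x
      = (aeval (jac n (mrg _ x (ext q))) V).trace - ∑ k : Icc l r, logCoeff β n k * log (x k).2
        - ∑ k ∈ Icc 1 (n - 1) \ Icc l r, logCoeff β n k * log (ext q k).2 := fun x => by
    rw [condH_eq, ham_eq, ← sum_sdiff (Icc_subset_of_le hl hr)]
    have e1 : ∑ k ∈ Icc l r, logCoeff β n k * log (mrg _ x (ext q) k).2
        = ∑ k : Icc l r, logCoeff β n k * log (x k).2 := by
      rw [← sum_coe_Icc]
      simp only [mrg_coe]
    have e2 : ∑ k ∈ Icc 1 (n - 1) \ Icc l r, logCoeff β n k * log (mrg _ x (ext q) k).2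
        = ∑ k ∈ Icc 1 (n - 1) \ Icc l r, logCoeff β n k * log (ext q k).2 :=
      sum_congr rfl fun k hk => by rw [mrg_notMem _ _ (Finset.mem_sdiff.1 hk).2]
    change (aeval (jac n (mrg _ x (ext q))) V).trace - (∑ k ∈ Icc 1 (n - 1) \ Icc l r,
        logCoeff β n k * log (mrg _ x (ext q) k).2
        + ∑ k ∈ Icc l r, logCoeff β n k * log (mrg _ x (ext q) k).2) = _
    rw [e1, e2]; ring
  rw [hsplit, hsplit]
  linarith [hm x' hx']

/-- The conditional minimizer, completed by the boundary values. -/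
noncomputable def mfull {V : ℝ[X]} (β : ℝ) {n l r : ℕ} (q : Config (bdry V n l r)) : ℕ → ℝ × ℝ :=
  mrg _ (𝔪[β] q) (ext q)

variable (q : Config (bdry V n l r))

include hc hV hl hr hco

lemma mfull_pos (hk : k ∈ Icc l r) : 0 < (mfull β q k).2 := by
  rw [mfull, mrg_mem _ _ hk]
  exact (exists_condMin hc hV hl hr hco q).1 _

lemma grad_mfull (hk : k ∈ Icc l r) (u : ℝ × ℝ) :
    grad V β n (mfull β q) k u = 0 := by
  obtain ⟨hpos, hmin⟩ := exists_condMin hc hV hl hr hco q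
  set m := 𝔪[β] q with hm
  set y : ℕ → ℝ × ℝ := Pi.single k u with hy
  have hy0 : ∀ e ∉ Icc l r, y e = 0 := fun e he => by
    rw [hy, Pi.single_eq_of_ne]; rintro rfl; exact he hk
  have hd := hasDerivAt_ham_line V β (Icc_subset_of_le hl hr) (mfull β q) (y := y) hy0
    (t := 0) (fun e he => by simpa using mfull_pos hc hV hl hr hco q he)
  have hline : ∀ t : ℝ, mfull β q + t • y
      = mrg _ (fun e : Icc l r => m e + t • y e) (ext q) := fun t => by
    ext1 e
    by_cases he : e ∈ Icc l r
    · simp [mfull, mrg_mem _ _ he, hm]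
    · simp [mfull, mrg_notMem _ _ he, hy0 e he]
  have hloc : IsLocalMin (fun t : ℝ => ham V β n (mfull β q + t • y)) 0 := by
    have hev : ∀ᶠ t : ℝ in 𝓝 0, ∀ e : Icc l r, 0 < (m e + t • y e).2 := by
      refine eventually_all.2 fun e => ?_
      have hcont : Continuous fun t : ℝ => (m e + t • y e).2 := by fun_prop
      exact hcont.continuousAt.eventually (lt_mem_nhds (by simpa using hpos e))
    filter_upwards [hev] with t ht
    rw [hline, hline]
    have h1 := hmin (fun e => m e + t • y e) ht
    have h2 : (fun e : Icc l r => m e + (0 : ℝ) • y e) = m := by funext e; simp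
    rw [h2]
    exact h1
  have h0 := hloc.hasDerivAt_eq_zero hd
  rw [zero_smul, add_zero, ← sum_grad_eq V β _ hy0] at h0
  rw [Finset.sum_eq_single k] at h0
  · simpa [hy] using h0
  · intro e _ he
    have h3 : y e = (0 : ℝ) • (0 : ℝ × ℝ) := by rw [hy, Pi.single_eq_of_ne he]; simp
    rw [h3, grad_smul, zero_mul]
  · exact fun h => absurd hk h

lemma condH_ge {x : Config (Icc l r)} (hx : ∀ i, 0 < (x i).2) :
    ℋ[β] q (𝔪[β] q) + c / 2 * ∑ k, sq2 (x k - 𝔪[β] q k)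
      ≤ ℋ[β] q x := by
  have h := ham_ge_of_grad (β := β) hV (Icc_subset_of_le hl hr) (fun k hk => (hco k hk).le)
    (v := mrg _ x (ext q)) (v' := mfull β q)
    (fun k hk => by rw [mfull, mrg_notMem _ _ hk, mrg_notMem _ _ hk])
    (fun k hk => by rw [mrg_mem _ _ hk]; exact hx _)
    (fun k hk => mfull_pos hc hV hl hr hco q hk)
  rw [sum_eq_zero fun k hk => grad_mfull hc hV hl hr hco q hk _, add_zero] at h
  have h1 : ∑ k, sq2 (x k - 𝔪[β] q k) ≤ ∑ k ∈ Icc l r,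
      ((mrg _ x (ext q) k - mfull β q k).1 ^ 2
        + 2 * (mrg _ x (ext q) k - mfull β q k).2 ^ 2) := by
    rw [← sum_coe_Icc]
    refine sum_le_sum fun k _ => ?_
    rw [mfull, mrg_coe, mrg_coe, sq2]
    nlinarith [sq_nonneg (x k - 𝔪[β] q k).2]
  have h2 := mul_le_mul_of_nonneg_left h1 (show 0 ≤ c / 2 by positivity)
  rw [condH_eq, condH_eq]
  change ham V β n (mfull β q) + _ ≤ ham V β n (mrg _ x (ext q))
  linarith

lemma sum_sq2_condMin_sub_le {γ : ℕ → ℝ}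
    (hpE : ∀ k ∉ Icc l r, p k = ext q k) (hp : ∀ k ∈ Icc l r, 0 < (p k).2)
    (hγ : ∀ k ∈ Icc l r, ∀ u, |grad V β n p k u| ≤ γ k * ab2 u) :
    ∑ k ∈ Icc l r, sq2 (mfull β q k - p k) ≤ 4 / c ^ 2 * ∑ k ∈ Icc l r, γ k ^ 2 := by
  have h1 := sum_grad_sub_ge (β := β) hV hc.le (Icc_subset_of_le hl hr) (fun k hk => (hco k hk).le)
    (v := mfull β q) (v' := p) (fun k hk => by rw [mfull, mrg_notMem _ _ hk, hpE k hk])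
    (fun k hk => mfull_pos hc hV hl hr hco q hk) hp
  have h2 := sum_mul_grad_ge (E := Icc l r) (w := fun _ => 1) (γ := γ) hc
    (fun _ => zero_le_one) (fun k hk => hγ k hk (mfull β q k - p k))
  simp only [one_mul] at h2
  have h0 : ∑ k ∈ Icc l r, (grad V β n (mfull β q) k (mfull β q k - p k)
      - grad V β n p k (mfull β q k - p k))
      = -∑ k ∈ Icc l r, grad V β n p k (mfull β q k - p k) := by
    rw [← sum_neg_distrib]
    exact sum_congr rfl fun k hk => by rw [grad_mfull hc hV hl hr hco q hk, zero_sub]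
  rw [h0] at h1
  have h3 : ∑ k ∈ Icc l r, ab2 (mfull β q k - p k) ^ 2
      ≤ 2 * ∑ k ∈ Icc l r, sq2 (mfull β q k - p k) := by
    rw [mul_sum]
    exact sum_le_sum fun k _ => ab2_sq_le _
  set S := ∑ k ∈ Icc l r, sq2 (mfull β q k - p k)
  set Γ := ∑ k ∈ Icc l r, γ k ^ 2
  have h4 : c * S ≤ c / 4 * S + 2 / c * Γ := by
    have := mul_le_mul_of_nonneg_left h3 (show 0 ≤ c / 8 by positivity)
    linarith
  have h5 : 4 / c ^ 2 * Γ = 2 / c * Γ / (c / 2) := by field_simp; ring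
  rw [h5, le_div_iff₀ (by positivity)]
  have hS0 : 0 ≤ S := sum_nonneg fun k _ => sq2_nonneg _
  nlinarith

lemma sum_weighted_sq2_condMin_sub_le {γ : ℕ → ℝ}
    (hpE : ∀ k ∉ Icc l r, p k = ext q k) (hp : ∀ k ∈ Icc l r, 0 < (p k).2)
    (hγ : ∀ k ∈ Icc l r, ∀ u, |grad V β n p k u| ≤ γ k * ab2 u) (hτ : 0 ≤ τ)
    (hA : RowBdd (jac n (mfull β q)) τ) (hB : RowBdd (jac n p) τ)
    {e : ℕ → ℝ} (he0 : ∀ k, 0 ≤ e k) (hξ : 0 ≤ ξ)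
    (he : ∀ k l, nd k l ≤ V.natDegree + 2 → (e k - e l) ^ 2 ≤ ξ * (e k * e l))
    (hsmall : 6 * ddBound Vᵈ τ * ξ * (2 * (V.natDegree + 2 : ℕ) + 1) ≤ c / 2) :
    ∑ k ∈ Icc l r, e k ^ 2 * sq2 (mfull β q k - p k)
      ≤ 8 / c ^ 2 * ∑ k ∈ Icc l r, e k ^ 2 * γ k ^ 2 := by
  have h1 := sum_weighted_grad_sub_ge (β := β) hV hc.le (Icc_subset_of_le hl hr)
    (fun k hk => (hco k hk).le) (v := mfull β q) (v' := p)
    (fun k hk => by rw [mfull, mrg_notMem _ _ hk, hpE k hk])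
    (fun k hk => mfull_pos hc hV hl hr hco q hk) hp hτ hA hB he0 hξ he hsmall
  have h2 := sum_mul_grad_ge (E := Icc l r) (w := fun k => e k ^ 2) (γ := γ) hc
    (fun _ => sq_nonneg _) (fun k hk => hγ k hk (mfull β q k - p k))
  have h0 : ∑ k ∈ Icc l r, e k ^ 2 * (grad V β n (mfull β q) k
      (mfull β q k - p k) - grad V β n p k (mfull β q k - p k))
      = -∑ k ∈ Icc l r, e k ^ 2 * grad V β n p k (mfull β q k - p k) := by
    rw [← sum_neg_distrib]
    exact sum_congr rfl fun k hk => by rw [grad_mfull hc hV hl hr hco q hk, zero_sub, mul_neg]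
  rw [h0] at h1
  have h3 : ∑ k ∈ Icc l r, e k ^ 2 * ab2 (mfull β q k - p k) ^ 2
      ≤ 2 * ∑ k ∈ Icc l r, e k ^ 2 * sq2 (mfull β q k - p k) := by
    rw [mul_sum]
    refine sum_le_sum fun k _ => ?_
    have := mul_le_mul_of_nonneg_left (ab2_sq_le (mfull β q k - p k)) (sq_nonneg (e k))
    linarith
  set S := ∑ k ∈ Icc l r, e k ^ 2 * sq2 (mfull β q k - p k)
  set Γ := ∑ k ∈ Icc l r, e k ^ 2 * γ k ^ 2
  have h4 : c / 2 * S ≤ c / 4 * S + 2 / c * Γ := by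
    have := mul_le_mul_of_nonneg_left h3 (show 0 ≤ c / 8 by positivity)
    linarith
  have h5 : 8 / c ^ 2 * Γ = 2 / c * Γ / (c / 4) := by field_simp; ring
  rw [h5, le_div_iff₀ (by positivity)]; linarith

end

/-! ### Normalized densities and Gaussian integrals -/

lemma lintegral_normalized {E : Type*} [MeasureSpace E] {f g : E → ℝ≥0∞} (hf : Measurable f)
    (hg : Measurable g) :
    ∫⁻ x, g x ∂(normalized f) = (∫⁻ x, f x)⁻¹ * ∫⁻ x, f x * g x := by
  rw [normalized, lintegral_smul_measure, smul_eq_mul]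
  congr 1
  exact lintegral_withDensity_eq_lintegral_mul volume hf hg

lemma normalized_apply {E : Type*} [MeasureSpace E] {f : E → ℝ≥0∞} {A : Set E}
    (hA : MeasurableSet A) : normalized f A = (∫⁻ x, f x)⁻¹ * ∫⁻ x in A, f x := by
  rw [normalized, Measure.smul_apply, withDensity_apply _ hA, smul_eq_mul]

lemma normalized_univ_le {E : Type*} [MeasureSpace E] (f : E → ℝ≥0∞) : normalized f univ ≤ 1 := by
  rw [normalized_apply MeasurableSet.univ, setLIntegral_univ]
  exact inv_mul_le_one _

lemma normalized_univ {E : Type*} [MeasureSpace E] {f : E → ℝ≥0∞} (h0 : ∫⁻ x, f x ≠ 0)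
    (h1 : ∫⁻ x, f x ≠ ∞) : normalized f univ = 1 := by
  rw [normalized_apply MeasurableSet.univ, setLIntegral_univ]
  exact ENNReal.inv_mul_cancel h0 h1

lemma measurable_sum_sq2 (m : Config J) :
    Measurable fun x : Config J => ∑ k, sq2 (x k - m k) := by
  unfold sq2
  fun_prop

lemma lintegral_gauss_ne_top (m : Config J) (hκ : 0 < κ) :
    ∫⁻ x : Config J, ofReal (exp (-(κ * ∑ k, sq2 (x k - m k)))) ≠ ∞ := by
  have h1 : ∀ a : ℝ, Integrable fun x : ℝ => exp (-κ * (x - a) ^ 2) := fun a =>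
    (integrable_exp_neg_mul_sq hκ).comp_sub_right a
  have h2 : ∀ k : J, Integrable (fun u : ℝ × ℝ =>
      exp (-κ * (u.1 - (m k).1) ^ 2) * exp (-κ * (u.2 - (m k).2) ^ 2))
      ((volume : Measure ℝ).prod volume) := fun k => (h1 _).mul_prod (h1 _)
  have h3 : Integrable fun x : Config J => ∏ k, (exp (-κ * ((x k).1 - (m k).1) ^ 2)
      * exp (-κ * ((x k).2 - (m k).2) ^ 2)) :=
    Integrable.fintype_prod (f := fun (k : J) (u : ℝ × ℝ) =>
      exp (-κ * (u.1 - (m k).1) ^ 2) * exp (-κ * (u.2 - (m k).2) ^ 2)) h2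
  have h4 : (fun x : Config J => exp (-(κ * ∑ k, sq2 (x k - m k))))
      = fun x => ∏ k, (exp (-κ * ((x k).1 - (m k).1) ^ 2)
        * exp (-κ * ((x k).2 - (m k).2) ^ 2)) := by
    funext x
    simp only [← exp_add]
    rw [← exp_sum, mul_sum, ← sum_neg_distrib]
    congr 1
    refine sum_congr rfl fun k _ => ?_
    simp only [sq2, Prod.fst_sub, Prod.snd_sub]; ring
  rw [← h4] at h3
  exact h3.lintegral_lt_top.ne

/-- Contracting a configuration towards `m`, and densities that increase under this. -/
lemma setLIntegral_le_of_shrink (m : Config J) {w : J → ℝ} (hw : ∀ k, 0 ≤ w k)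
    {f : Config J → ℝ≥0∞} (hf : Measurable f) {D : Set (Config J)} (hD : MeasurableSet D) {θ : ℝ}
    (h : ∀ x ∈ D, f x ≤ ofReal (exp (-θ)) * f (fun k => m k + (1 + w k)⁻¹ • (x k - m k))) :
    ∫⁻ x in D, f x ≤ ofReal (exp (2 * ∑ k, w k - θ)) * ∫⁻ x, f x := by
  have hw1 : ∀ k, 0 < 1 + w k := fun k => by linarith [hw k]
  have hmap1 : ∀ k, (volume : Measure (ℝ × ℝ)).map (fun u => m k + (1 + w k)⁻¹ • (u - m k))
      = (ofReal (1 + w k) * ofReal (1 + w k)) • volume := fun k =>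
    map_prod_smul (by fun_prop) (by fun_prop) (map_affine_volume (m k).1 (hw1 k))
      (map_affine_volume (m k).2 (hw1 k))
  have hmap := map_pi_smul (μ := fun _ : J => (volume : Measure (ℝ × ℝ)))
    (T := fun k u => m k + (1 + w k)⁻¹ • (u - m k)) (fun k => by fun_prop)
    (c := fun k => ofReal (1 + w k) * ofReal (1 + w k))
    (fun k => by simpa using hw1 k) (fun k => mul_ne_top ofReal_ne_top
      ofReal_ne_top) hmap1
  have hT : Measurable fun (x : Config J) => (fun k => m k + (1 + w k)⁻¹ • (x k - m k) : J → ℝ × ℝ) := by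
    exact measurable_pi_lambda _ fun k => by fun_prop
  have hint := lintegral_comp_of_map_smul hT hmap hf
  calc ∫⁻ x in D, f x
      ≤ ∫⁻ x in D, ofReal (exp (-θ)) * f (fun k => m k + (1 + w k)⁻¹ • (x k - m k)) :=
        setLIntegral_mono' hD h
    _ ≤ ∫⁻ x : Config J, ofReal (exp (-θ)) * f (fun k => m k + (1 + w k)⁻¹ • (x k - m k)) :=
        setLIntegral_le_lintegral _ _
    _ = ofReal (exp (-θ)) * ((∏ k, ofReal (1 + w k) * ofReal (1 + w k)) * ∫⁻ x, f x) := by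
        exact (lintegral_const_mul _ (hf.comp hT)).trans (congrArg _ hint)
    _ ≤ _ := by
        rw [← mul_assoc]
        refine mul_le_mul_left ?_ _
        have h1 : ∏ k, ofReal (1 + w k) * ofReal (1 + w k)
            = ofReal (∏ k, ((1 + w k) * (1 + w k))) := by
          rw [ofReal_prod_of_nonneg fun k _ => mul_nonneg (hw1 k).le (hw1 k).le]
          exact Finset.prod_congr rfl fun k _ => (ofReal_mul (hw1 k).le).symm
        rw [h1, ← ofReal_mul (exp_pos _).le]
        refine ofReal_le_ofReal ?_
        have h2 : ∏ k, ((1 + w k) * (1 + w k)) ≤ exp (2 * ∑ k, w k) := by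
          rw [mul_sum, exp_sum]
          refine Finset.prod_le_prod (fun k _ => mul_nonneg (hw1 k).le (hw1 k).le) fun k _ => ?_
          rw [two_mul, exp_add]
          have := add_one_le_exp (w k)
          exact mul_le_mul (by linarith) (by linarith) (hw1 k).le (exp_pos _).le
        rw [sub_eq_add_neg, exp_add, mul_comm]
        exact mul_le_mul_of_nonneg_right h2 (exp_pos _).le

/-! ### The conditional law -/

open Classical in
/-- The unnormalized conditional density given the boundary values `q`. -/
noncomputable def condDens {V : ℝ[X]} (β : ℝ) {n l r : ℕ} (q : Config (bdry V n l r))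
    (x : Config (Icc l r)) : ℝ≥0∞ :=
  if ∀ k, 0 < (x k).2 then ofReal (exp (-(n * β * ℋ[β] q x))) else 0

/-- The conditional law given the boundary values `q`. -/
noncomputable def condLaw {V : ℝ[X]} (β : ℝ) {n l r : ℕ} (q : Config (bdry V n l r)) :
    Measure (Config (Icc l r)) := normalized (condDens β q)

section

variable (V β n l r)

lemma measurable_condH : Measurable
    fun z : Config (bdry V n l r) × Config (Icc l r) => ℋ[β] z.1 z.2 := by
  have h : (fun z : Config (bdry V n l r) × Config (Icc l r) => ℋ[β] z.1 z.2)
      = fun z => ham V β n (mrg _ z.2 (mrg _ z.1 fun _ => (0, 1))) := rfl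
  rw [h]
  exact (measurable_ham V β n).comp ((measurable_mrg _).comp (measurable_snd.prodMk
    ((measurable_mrg _).comp (measurable_fst.prodMk measurable_const))))

instance (J : Finset ℕ) : (volume : Measure (Config J)).IsOpenPosMeasure :=
  have : (volume : Measure (ℝ × ℝ)).IsOpenPosMeasure :=
    inferInstanceAs ((volume : Measure ℝ).prod (volume : Measure ℝ)).IsOpenPosMeasure
  inferInstanceAs (Measure.pi fun _ : J => (volume : Measure (ℝ × ℝ))).IsOpenPosMeasure

lemma measurable_condDens : Measurable
    fun z : Config (bdry V n l r) × Config (Icc l r) => condDens β z.1 z.2 := by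
  unfold condDens
  refine Measurable.ite ?_ ?_ measurable_const
  · simp only [ofPred_forall]
    exact MeasurableSet.iInter fun k => measurableSet_lt measurable_const (by fun_prop)
  · exact (measurable_exp.comp ((measurable_condH V β n l r).const_mul _).neg).ennreal_ofReal

variable {V n l r}

lemma measurable_condDens_right (q : Config (bdry V n l r)) : Measurable (condDens β q) :=
  (measurable_condDens V β n l r).comp (measurable_const.prodMk measurable_id)

lemma lintegral_condDens_ne_zero (q : Config (bdry V n l r)) :
    ∫⁻ x, condDens β q x ≠ 0 := by
  refine ((lintegral_pos_iff_support (measurable_condDens_right β q)).2 ?_).ne'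
  have hopen : IsOpen {x : Config (Icc l r) | ∀ k, 0 < (x k).2} := by
    simp only [ofPred_forall]
    exact isOpen_iInter_of_finite fun i => isOpen_lt continuous_const (by fun_prop)
  refine lt_of_lt_of_le (hopen.measure_pos volume ⟨fun _ => (0, 1), fun i => one_pos⟩)
    (measure_mono fun x hx => ?_)
  have hx : ∀ k, 0 < (x k).2 := hx
  rw [Function.mem_support, condDens, if_pos hx]
  simpa using exp_pos _

variable {β}

lemma measurable_condLaw_apply (hA : MeasurableSet A) :
    Measurable fun q : Config (bdry V n l r) => condLaw β q A := by
  have hm := measurable_condDens V β n l r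
  simp only [condLaw, normalized_apply hA]
  exact hm.lintegral_prod_right'.inv.mul (hm.lintegral_prod_right' (ν := volume.restrict A))

include hc hV hβ hl hr hco

lemma condDens_le (q : Config (bdry V n l r)) (x : Config (Icc l r)) : condDens β q x
      ≤ ofReal (exp (-(n * β * ℋ[β] q (𝔪[β] q)))) *
        ofReal (exp (-(n * β * (c / 2) * ∑ k, sq2 (x k - 𝔪[β] q k)))) := by
  unfold condDens
  split_ifs with hx
  · rw [← ofReal_mul (exp_pos _).le, ← exp_add]
    refine ofReal_le_ofReal (exp_le_exp.2 ?_)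
    have h := mul_le_mul_of_nonneg_left (condH_ge hc hV hl hr hco q hx)
      (show 0 ≤ (n : ℝ) * β by positivity)
    linarith
  · exact zero_le

lemma lintegral_condDens_ne_top (q : Config (bdry V n l r)) : ∫⁻ x, condDens β q x ≠ ∞ := by
  refine ((lintegral_mono (condDens_le hc hV hβ hl hr hco q)).trans_lt ?_).ne
  have hn : (0 : ℝ) < n := by
    have : 0 < n := by omega
    exact_mod_cast this
  rw [lintegral_const_mul]
  · exact ENNReal.mul_lt_top ENNReal.ofReal_lt_top (lintegral_gauss_ne_top _ (by positivity)).lt_top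
  · exact (measurable_exp.comp ((measurable_sum_sq2 _).const_mul _).neg).ennreal_ofReal

lemma lintegral_dens_condLaw
    {F : Config (bdry V n l r) × Config (Icc l r) → ℝ≥0∞} (hF : Measurable F) :
    ∫⁻ ω : Field n, dens V β n (seq ω) * F (restr _ ω, restr _ ω)
      = ∫⁻ ω : Field n, dens V β n (seq ω) *
        ∫⁻ x, F (restr _ ω, x) ∂(condLaw β (restr (bdry V n l r) ω)) := by
  classical
  have hJ : (Icc l r) ⊆ Icc 1 (n - 1) := Icc_subset_of_le hl hr
  set Z : Config (bdry V n l r) → ℝ≥0∞ := fun q => ∫⁻ x, condDens β q x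
  have hZm : Measurable Z := (measurable_condDens V β n l r).lintegral_prod_right'
  set x₀ : Config (Icc l r) := fun _ => (0, 1)
  set rho : (ℕ → ℝ × ℝ) → ℝ≥0∞ := fun v => if ∀ k ∈ Icc 1 (n - 1) \ (Icc l r), 0 < (v k).2 then
    ofReal (exp (-(n * β * (ham V β n (mrg (Icc l r) x₀ v)
      - condH V β n l r (fun k => v k) x₀)))) else 0 with hrho
  have hfact : ∀ (v : ℕ → ℝ × ℝ) (x : Config (Icc l r)),
      dens V β n (mrg (Icc l r) x v) = @condDens V β n l r (fun k => v k) x * rho v := fun v x => by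
    have hpos : (∀ k ∈ Icc 1 (n - 1), 0 < (mrg (Icc l r) x v k).2) ↔
        (∀ k, 0 < (x k).2) ∧ ∀ k ∈ Icc 1 (n - 1) \ (Icc l r), 0 < (v k).2 := by
      constructor
      · intro h
        refine ⟨fun k => ?_, fun k hk => ?_⟩
        · have := h k (hJ k.2); rwa [mrg_coe] at this
        · rw [Finset.mem_sdiff] at hk
          have := h k hk.1; rwa [mrg_notMem _ _ hk.2] at this
      · rintro ⟨h1, h2⟩ k hk
        by_cases hkI : k ∈ (Icc l r)
        · rw [mrg_mem _ _ hkI]; exact h1 _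
        · rw [mrg_notMem _ _ hkI]; exact h2 k (Finset.mem_sdiff.2 ⟨hk, hkI⟩)
    by_cases h1 : ∀ k, 0 < (x k).2
    · by_cases h2 : ∀ k ∈ Icc 1 (n - 1) \ (Icc l r), 0 < (v k).2
      · rw [dens, if_pos (hpos.2 ⟨h1, h2⟩), condDens, if_pos h1, hrho]
        simp only
        rw [if_pos h2, ← ofReal_mul (exp_pos _).le, ← exp_add]
        have h3 := ham_mrg_sub V β hl hr (v := v) (v' := mrg (bdry V n l r) (fun k => v k) fun _ => (0, 1))
          (fun k hk => by rw [mrg_mem _ _ hk]) x x₀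
        rw [condH_eq, condH_eq]
        congr 2
        have h4 : ham V β n (mrg (Icc l r) x v) = ham V β n (mrg (Icc l r) x (mrg (bdry V n l r) (fun k => v k) fun _ => (0, 1)))
          + (ham V β n (mrg (Icc l r) x₀ v) - ham V β n (mrg (Icc l r) x₀ (mrg (bdry V n l r) (fun k => v k) fun _ => (0, 1)))) := by
          linarith
        rw [h4]; ring
      · rw [dens, if_neg fun h => h2 (hpos.1 h).2, hrho]
        simp only
        rw [if_neg h2, mul_zero]
    · rw [dens, if_neg fun h => h1 (hpos.1 h).1, condDens, if_neg h1, zero_mul]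
  have hself : ∀ ω : Field n, mrg (Icc l r) (restr (Icc l r) ω) (seq ω) = seq ω := fun ω => by
    ext1 k
    by_cases hk : k ∈ (Icc l r)
    · rw [mrg_mem _ _ hk]; rfl
    · rw [mrg_notMem _ _ hk]
  have hrq : ∀ ω : Field n, (fun k : (bdry V n l r) => seq ω k) = restr (bdry V n l r) ω := fun ω => rfl
  have hmq : ∀ (v : ℕ → ℝ × ℝ) (x : Config (Icc l r)), (fun k : (bdry V n l r) => mrg (Icc l r) x v k) = fun k : (bdry V n l r) => v k := fun v x => by
    funext k
    refine mrg_notMem _ _ fun hk => ?_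
    exact (mem_filter.1 k.2).2.1 hk
  have hv : Measurable fun v : ℕ → ℝ × ℝ => (fun k : (bdry V n l r) => v k : Config (bdry V n l r)) :=
    measurable_pi_lambda _ fun k => measurable_pi_apply _
  have hvI : Measurable fun v : ℕ → ℝ × ℝ => (fun k : (Icc l r) => v k : Config (Icc l r)) :=
    measurable_pi_lambda _ fun k => measurable_pi_apply _
  set G : (ℕ → ℝ × ℝ) × Config (Icc l r) → ℝ≥0∞ := fun z => dens V β n z.1 *
    (F (fun k => z.1 k, fun k => z.1 k) * (@condDens V β n l r (fun k => z.1 k) z.2 *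
      (Z fun k => z.1 k)⁻¹)) with hG
  have hGm : Measurable G := by
    exact ((measurable_dens V β n).comp measurable_fst).mul ((hF.comp ((hv.comp
      measurable_fst).prodMk (hvI.comp measurable_fst))).mul (((measurable_condDens V β n l r).comp
      ((hv.comp measurable_fst).prodMk measurable_snd)).mul (hZm.comp (hv.comp measurable_fst)).inv))
  have hswap := lintegral_swap hJ hGm
  have hL : ∀ ω : Field n, ∫⁻ x : Config (Icc l r), G (seq ω, x)
      = dens V β n (seq ω) * F (restr _ ω, restr _ ω) := fun ω => by
    have hm := measurable_condDens_right β (restr (bdry V n l r) ω)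
    simp only [hG, hrq]
    rw [lintegral_const_mul _ (by fun_prop), lintegral_const_mul _ (by fun_prop),
      lintegral_mul_const _ hm, ENNReal.mul_inv_cancel (lintegral_condDens_ne_zero β _)
        (lintegral_condDens_ne_top hc hV hβ hl hr hco _), mul_one]
    rfl
  have hR : ∀ ω : Field n, ∫⁻ x : Config (Icc l r), G (mrg (Icc l r) x (seq ω), restr (Icc l r) ω)
      = dens V β n (seq ω) * ∫⁻ x, F (restr _ ω, x) ∂(condLaw β (restr (bdry V n l r) ω)) := fun ω => by
    have hm := measurable_condDens_right β (restr (bdry V n l r) ω)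
    have hFm : Measurable fun x => F (restr (bdry V n l r) ω, x) := hF.comp (measurable_const.prodMk measurable_id)
    rw [condLaw, lintegral_normalized hm hFm, ← mul_assoc,
      ← lintegral_const_mul _ (show Measurable fun x => condDens β (restr (bdry V n l r) ω) x *
        F (restr _ ω, x) from hm.mul hFm)]
    refine lintegral_congr fun x => ?_
    simp only [hG]
    have e1 : (fun k : (Icc l r) => mrg (Icc l r) x (seq ω) k) = x := funext fun k => mrg_coe _ _ k
    rw [hmq, e1, hfact, hrq]
    conv_rhs => rw [← hself ω, hfact, hrq]
    ring
  simp only [hL, hR] at hswap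
  exact hswap

end

/-! ### The conditional minimizer is close to the local minimizers -/

lemma add_sq_le_two_mul (a b : ℝ) : (a + b) ^ 2 ≤ 2 * a ^ 2 + 2 * b ^ 2 := by
  nlinarith [sq_nonneg (a - b)]

lemma ab2_ext_le {M s : ℝ} (hM : 0 ≤ M) (hs : s ≤ 1) {q : Config (bdry V n l r)}
    (hq : ∀ e, ab2 (q e - dagger V β n e) ≤ s) (hd : ∀ e ∈ bdry V n l r, ab2 (dagger V β n e) ≤ M)
    (k : ℕ) : ab2 (ext q k) ≤ M + 1 := by
  by_cases hk : k ∈ bdry V n l r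
  · rw [ext, mrg_mem _ _ hk]
    have h := ab2_add_le (q ⟨k, hk⟩ - dagger V β n k) (dagger V β n k)
    rw [sub_add_cancel] at h
    linarith [hq ⟨k, hk⟩, hd k hk]
  · rw [ext, mrg_notMem _ _ hk]
    simp only [ab2, abs_zero, abs_one]; linarith

lemma le_add_one_sq {x : ℝ} (hx : 0 ≤ x) : x ≤ (x + 1) ^ 2 := by nlinarith

set_option maxHeartbeats 1000000 in
include hc hV hβ hε0 hε1 in
lemma exists_condMin_near :
    ∃ (C c₁ : ℝ) (N : ℕ), 0 < C ∧ 0 < c₁ ∧ 0 < N ∧ ∀ n : ℕ, N ≤ n → ∀ l r : ℕ,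
      V.natDegree + 1 ≤ l → (r : ℝ) ≤ (1 - ε) * n → ∀ s : ℝ, 0 ≤ s → s ≤ 1 / 2 →
      ∀ q : Config (bdry V n l r), (∀ e, ab2 (q e - dagger V β n e) ≤ s) →
      ∀ j ∈ Icc l r, ab2 (mfull β q j - dagger V β n j)
        ≤ C * (s * exp (-(c₁ * Metric.infDist j (bdry V n l r : Set ℕ))) + 1 / n) := by
  classical
  obtain ⟨M, r₀, Λ, hM, hr₀, hΛ, hdag⟩ := exists_dagger_bounds hc hV hβ
    (show 0 < ε / 4 by positivity)
  obtain ⟨N₁, hN₁, hbulk⟩ := exists_bulk_bounds hβ hε0 hε1 0 V.natDegree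
  set D := V.natDegree
  obtain ⟨N₂, hN₂⟩ := exists_nat_ge (2 * Λ * D)
  have hd0 := ddBound_nonneg Vᵈ (c := 3 * (M + 1)) (by positivity)
  set B := ddBound Vᵈ (3 * (M + 1))
  set G := 6 * B * (1 + Λ * D)
  set Q := 4 / c ^ 2 * (2 * G ^ 2 * (2 * D) + 2 * G ^ 2)
  set τ := M + 1 + 2 * √Q
  have hτ0 : 0 < τ := by positivity
  obtain ⟨c₁, ξ, hc₁, hξ, he, hsmall⟩ := exists_weight_rate V hc (τ := 3 * τ) (by positivity)
  obtain ⟨C₀, hC₀, hsum⟩ := exists_sum_expw_le (c₁ := 2 * c₁) (by positivity)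
  set T := 2 * (8 / c ^ 2 * (2 * G ^ 2 * (2 * D * exp (2 * c₁ * D)) + 2 * G ^ 2 * C₀)) with hT
  have hT0 : 0 ≤ T := by positivity
  refine ⟨T + 1, c₁, max N₁ N₂, by positivity, hc₁, lt_max_of_lt_left hN₁,
    fun n hn l r hlD hrε s hs0 hs1 q hq j hj => ?_⟩
  obtain ⟨hb1, hb2, hb3, hb4⟩ := hbulk n (le_trans (le_max_left _ _) hn)
  have hn0 : 0 < n := by omega
  have hn0' : (0 : ℝ) < n := mod_cast hn0
  have hn2 : 2 * Λ * D ≤ n := hN₂.trans (mod_cast le_trans (le_max_right _ _) hn)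
  have hrb := add_add_one_le_bulk hb4 hrε
  have hl : 1 ≤ l := by omega
  have hr : r + 1 ≤ n := by omega
  have hIb : ∀ k ∈ Icc l r, k ≤ bulk ε n := fun k hk => by rw [mem_Icc] at hk; omega
  have hco : ∀ k ∈ Icc l r, 0 < logCoeff β n k := fun k hk => by
    rw [logCoeff_eq]
    linarith [hb3 k (hIb k hk)]
  set p : ℕ → ℝ × ℝ := mrg (Icc l r) (fun k => dagger V β n k) (ext q)
  have hpI : ∀ k ∈ Icc l r, p k = dagger V β n k := fun k hk => mrg_mem _ _ hk
  have hpE : ∀ k ∉ Icc l r, p k = ext q k := fun k hk => mrg_notMem _ _ hk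
  have hpb : ∀ k, ab2 (p k) ≤ M + 1 := fun k => by
    by_cases hk : k ∈ Icc l r
    · rw [hpI k hk]
      linarith [(hdag n k hn0 (hb3 k (hIb k hk))).1]
    · rw [hpE k hk]
      exact ab2_ext_le hM.le (by linarith) hq (fun e he => (hdag n e hn0
        (hb3 e (by have := (mem_filter.1 he).2.2.2; omega))).1) k
  have hppos : ∀ k ∈ Icc l r, 0 < (p k).2 := fun k hk => by
    rw [hpI k hk]
    exact hr₀.trans_le (hdag n k hn0 (hb3 k (hIb k hk))).2.1
  set S := (Icc l r).filter fun k => ∃ e ∈ bdry V n l r, nd e k ≤ D / 2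
  set γ : ℕ → ℝ := fun k => (if k ∈ S then G * s else 0) + G / n with hγdef
  have hγ : ∀ k ∈ Icc l r, ∀ u, |grad V β n p k u| ≤ γ k * ab2 u := fun k hk u => by
    have hk' := mem_Icc.1 hk
    obtain ⟨hdk1, hdk2, hdk3⟩ := hdag n k hn0 (hb3 k (hIb k hk))
    set s' := (if k ∈ S then s else 0) + Λ * D / n with hs'
    have hΛD : Λ * D / n ≤ 1 / 2 := by rw [div_le_iff₀ hn0']; linarith
    have hs'0 : 0 ≤ s' := by rw [hs']; split_ifs <;> positivity
    have hs'1 : s' ≤ 1 := by rw [hs']; split_ifs <;> linarith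
    have h1 := abs_grad_le_of_near hc hV (v := p) (s := s') (show D + 1 ≤ k by omega) (by omega)
      (lt_of_le_of_lt (hb3 k (hIb k hk)) (by linarith)) (by rw [hpI k hk]) hdk1 hs'1 hs'0 (by
        intro e he hek
        have hek' : nd e k ≤ D := hek.trans (Nat.div_le_self _ _)
        have he2 : e ≤ bulk ε n := by unfold nd at hek'; omega
        have hdd : ab2 (dagger V β n e - dagger V β n k) ≤ Λ * D / n := by
          have h2 := (hdag n e hn0 (hb3 e he2)).2.2 k (hb3 k (hIb k hk))
          refine h2.trans ?_
          rw [mul_div_assoc]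
          have : (nd e k : ℝ) ≤ D := mod_cast hek'
          gcongr
        by_cases h2 : e ∈ Icc l r
        · rw [hpI e h2]
          refine hdd.trans ?_
          rw [hs']
          split_ifs <;> linarith
        · have h3 := mem_bdry hk he hek h2
          have h4 : k ∈ S := mem_filter.2 ⟨hk, e, h3, hek⟩
          rw [hs', if_pos h4, hpE e h2, ext, mrg_mem _ _ h3]
          have h5 := ab2_sub_le (q ⟨e, h3⟩) (dagger V β n e) (dagger V β n k)
          have h6 := hq ⟨e, h3⟩
          simp only at h6
          linarith) u
    refine h1.trans (mul_le_mul_of_nonneg_right ?_ (ab2_nonneg u))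
    change 6 * B * s' ≤ _
    have h2 : 6 * B ≤ G := by
      have : 6 * B * (1 + Λ * D) = 6 * B + 6 * B * (Λ * D) := by ring
      have : 0 ≤ 6 * B * (Λ * D) := by positivity
      linarith
    have h3 : 6 * B * (Λ * D) ≤ G := by
      have : 6 * B * (1 + Λ * D) = 6 * B + 6 * B * (Λ * D) := by ring
      have : 0 ≤ 6 * B := by positivity
      linarith
    have h4 : 6 * B * (Λ * D / n) ≤ G / n := by rw [← mul_div_assoc]; gcongr
    simp only [hs', hγdef]
    split_ifs
    · have := mul_le_mul_of_nonneg_right h2 hs0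
      linarith
    · linarith
  have hγsq : ∀ k, γ k ^ 2 ≤ (if k ∈ S then 2 * G ^ 2 * s ^ 2 else 0) + 2 * G ^ 2 / n ^ 2 := fun k => by
    simp only [hγdef]
    split_ifs
    · refine (add_sq_le_two_mul _ _).trans_eq ?_
      rw [div_pow, mul_pow]; ring
    · rw [zero_add, zero_add, div_pow, mul_div_assoc]
      have : 0 ≤ G ^ 2 / (n : ℝ) ^ 2 := by positivity
      linarith
  have hScard : S.card ≤ 2 * D := by
    have hsub : S ⊆ Ico l (l + D) ∪ Ioc (r - D) r := fun k hk => by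
      obtain ⟨hkI, e, heb, hek⟩ := mem_filter.1 hk
      have h1 := (mem_filter.1 heb).2.1
      rw [mem_Icc] at hkI h1
      rw [mem_union, mem_Ico, mem_Ioc]
      unfold nd at hek; omega
    refine (card_le_card hsub).trans ((card_union_le _ _).trans ?_)
    rw [Nat.card_Ico, Nat.card_Ioc]; omega
  have hcard : ((Icc l r).card : ℝ) ≤ n := by
    rw [Nat.card_Icc]
    have : r + 1 - l ≤ n := by omega
    exact_mod_cast this
  have hn1 : (1 : ℝ) ≤ n := mod_cast hn0
  have hl2 : ∑ k ∈ Icc l r, sq2 (mfull β q k - p k) ≤ Q := by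
    refine (sum_sq2_condMin_sub_le hc hV hl hr hco q hpE hppos hγ).trans ?_
    refine mul_le_mul_of_nonneg_left ?_ (by positivity)
    refine (sum_le_sum fun k _ => hγsq k).trans ?_
    rw [sum_add_distrib, sum_const, nsmul_eq_mul]
    have e1 := sum_ite_const_le (E := Icc l r) (x := 2 * G ^ 2 * s ^ 2) (by positivity) hScard
    push_cast at e1
    have e2 : s ^ 2 ≤ 1 := pow_le_one₀ hs0 (by linarith)
    have e3 : 2 * (D : ℝ) * (2 * G ^ 2 * s ^ 2) ≤ 2 * G ^ 2 * (2 * D) := by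
      have : 0 ≤ 2 * G ^ 2 * (2 * D) := by positivity
      calc 2 * (D : ℝ) * (2 * G ^ 2 * s ^ 2) = 2 * G ^ 2 * (2 * D) * s ^ 2 := by ring
        _ ≤ _ := mul_le_of_le_one_right this e2
    have e4 : ((Icc l r).card : ℝ) * (2 * G ^ 2 / n ^ 2) ≤ 2 * G ^ 2 := by
      calc _ ≤ (n : ℝ) * (2 * G ^ 2 / n ^ 2) := by gcongr
        _ = 2 * G ^ 2 / n := by field_simp
        _ ≤ 2 * G ^ 2 := div_le_self (by positivity) hn1
    linarith
  have hτp : ∀ k ∈ Icc 1 n, ab2 (p k) ≤ τ := fun k _ => by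
    have := sqrt_nonneg Q
    linarith [hpb k]
  have hτm : ∀ k ∈ Icc 1 n, ab2 (mfull β q k) ≤ τ := fun k hk1 => by
    by_cases hk : k ∈ Icc l r
    · have h1 := (single_le_sum (f := fun k => sq2 (mfull β q k - p k))
        (fun k _ => sq2_nonneg _) hk).trans hl2
      have h2 := ab2_le_sqrt h1
      have h3 := ab2_add_le (mfull β q k - p k) (p k)
      rw [sub_add_cancel] at h3
      linarith [hpb k]
    · have h1 : mfull β q k = p k := by rw [mfull, mrg_notMem _ _ hk, hpE k hk]
      rw [h1]
      exact hτp k hk1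
  have hw := sum_weighted_sq2_condMin_sub_le hc hV hl hr hco q hpE hppos hγ (τ := 3 * τ)
    (by positivity) (rowBdd_jac_of_ab2 hτ0.le hτm) (rowBdd_jac_of_ab2 hτ0.le hτp) (e := expw c₁ j)
    (fun k => (expw_pos _ _ _).le) hξ (he j) hsmall
  have h1 := (single_le_sum (f := fun k => expw c₁ j k ^ 2 * sq2 (mfull β q k - p k))
    (fun k _ => mul_nonneg (sq_nonneg _) (sq2_nonneg _)) hj).trans hw
  simp only [expw_self, one_pow, one_mul] at h1
  rw [hpI j hj] at h1
  set d := Metric.infDist j (bdry V n l r : Set ℕ)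
  have h2 : ∑ k ∈ Icc l r, expw c₁ j k ^ 2 * γ k ^ 2
      ≤ 2 * G ^ 2 * (2 * D * exp (2 * c₁ * D)) * (s * exp (-(c₁ * d))) ^ 2
        + 2 * G ^ 2 * C₀ * (1 / n) ^ 2 := by
    have h3 : ∀ k ∈ Icc l r, expw c₁ j k ^ 2 * γ k ^ 2
        ≤ (if k ∈ S then 2 * G ^ 2 * exp (2 * c₁ * D) * (s * exp (-(c₁ * d))) ^ 2 else 0)
          + expw (2 * c₁) j k * (2 * G ^ 2 / n ^ 2) := fun k hk => by
      refine (mul_le_mul_of_nonneg_left (hγsq k) (sq_nonneg _)).trans ?_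
      rw [mul_add, expw_sq]
      refine add_le_add_left ?_ _
      split_ifs with hkS
      · obtain ⟨-, e, heb, hek⟩ := mem_filter.1 hkS
        have h4 : d ≤ nd k j + D := by
          refine (Metric.infDist_le_dist_of_mem (Finset.mem_coe.2 heb)).trans ?_
          rw [Nat.dist_eq, abs_le]
          have h5 : e ≤ j + nd k j + D ∧ j ≤ e + nd k j + D := by
            have := Nat.div_le_self D 2
            unfold nd at hek ⊢; omega
          have h6 : (e : ℝ) ≤ j + nd k j + D := mod_cast h5.1
          have h7 : (j : ℝ) ≤ e + nd k j + D := mod_cast h5.2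
          constructor <;> linarith
        have h5 : expw (2 * c₁) j k ≤ exp (2 * c₁ * D) * exp (-(c₁ * d)) ^ 2 := by
          refine (expw_le_of_le (by positivity) (show d - D ≤ nd k j by linarith)).trans
            (le_of_eq ?_)
          rw [← exp_nat_mul, ← exp_add]
          congr 1
          push_cast; ring
        calc expw (2 * c₁) j k * (2 * G ^ 2 * s ^ 2)
            ≤ (exp (2 * c₁ * D) * exp (-(c₁ * d)) ^ 2) * (2 * G ^ 2 * s ^ 2) := by gcongr
          _ = _ := by ring
      · simp
    refine (sum_le_sum h3).trans ?_
    rw [sum_add_distrib, ← sum_mul]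
    have e1 := sum_ite_const_le (E := Icc l r)
      (x := 2 * G ^ 2 * exp (2 * c₁ * D) * (s * exp (-(c₁ * d))) ^ 2) (by positivity) hScard
    have e2 := mul_le_mul_of_nonneg_right (hsum (Icc l r) j)
      (show 0 ≤ 2 * G ^ 2 / (n : ℝ) ^ 2 by positivity)
    push_cast at e1
    refine (add_le_add e1 e2).trans_eq ?_
    rw [div_pow]; ring
  have h3 : ab2 (mfull β q j - dagger V β n j) ^ 2
      ≤ ((T + 1) * (s * exp (-(c₁ * d)) + 1 / n)) ^ 2 := by
    refine (ab2_sq_le _).trans ?_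
    have h4 := h1.trans (mul_le_mul_of_nonneg_left h2 (by positivity))
    set A := s * exp (-(c₁ * d))
    set b := 1 / (n : ℝ)
    have h5 : 2 * (8 / c ^ 2 * (2 * G ^ 2 * (2 * D * exp (2 * c₁ * D)) * A ^ 2
        + 2 * G ^ 2 * C₀ * b ^ 2)) ≤ T * (A + b) ^ 2 := by
      have h6 : T * (A + b) ^ 2 - 2 * (8 / c ^ 2 * (2 * G ^ 2 * (2 * D * exp (2 * c₁ * D)) * A ^ 2
          + 2 * G ^ 2 * C₀ * b ^ 2)) = 2 * (8 / c ^ 2 * (2 * G ^ 2 * (2 * D * exp (2 * c₁ * D))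
            * b ^ 2 + 2 * G ^ 2 * C₀ * A ^ 2)) + T * (2 * A * b) := by
        rw [hT]; ring
      have h7 : 0 ≤ 2 * (8 / c ^ 2 * (2 * G ^ 2 * (2 * D * exp (2 * c₁ * D))
            * b ^ 2 + 2 * G ^ 2 * C₀ * A ^ 2)) + T * (2 * A * b) := by positivity
      linarith
    have h8 : T * (A + b) ^ 2 ≤ ((T + 1) * (A + b)) ^ 2 := by
      rw [mul_pow]
      exact mul_le_mul_of_nonneg_right (le_add_one_sq hT0) (sq_nonneg _)
    linarith
  exact (sq_le_sq₀ (ab2_nonneg _) (by positivity)).1 h3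

/-! ### Continuity of the conditional minimizer -/

lemma abs_le_sqrt_sq2 (u : ℝ × ℝ) : |u.1| ≤ √(sq2 u) ∧ |u.2| ≤ √(sq2 u) := by
  unfold sq2
  exact ⟨abs_le_sqrt (by nlinarith [sq_nonneg u.2]),
    abs_le_sqrt (by nlinarith [sq_nonneg u.1])⟩

lemma tendsto_of_sq2 {α : Type*} {F : Filter α} {f : α → ℝ × ℝ} {y : ℝ × ℝ}
    (h : Tendsto (fun x => sq2 (f x - y)) F (𝓝 0)) : Tendsto f F (𝓝 y) := by
  have h1 : Tendsto (fun x => √(sq2 (f x - y))) F (𝓝 0) := by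
    have := (Real.continuous_sqrt.tendsto 0).comp h
    rw [Real.sqrt_zero] at this
    exact this
  refine Prod.tendsto_iff _ _ |>.2 ⟨?_, ?_⟩
  · refine tendsto_sub_nhds_zero_iff.1 (squeeze_zero_norm (fun x => ?_) h1)
    exact (abs_le_sqrt_sq2 (f x - y)).1
  · refine tendsto_sub_nhds_zero_iff.1 (squeeze_zero_norm (fun x => ?_) h1)
    exact (abs_le_sqrt_sq2 (f x - y)).2

lemma continuous_mrg {α : Type*} [TopologicalSpace α] {f : α → Config J}
    {g : α → ℕ → ℝ × ℝ} (hf : Continuous f) (hg : Continuous g) :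
    Continuous fun x => mrg J (f x) (g x) := by
  refine continuous_pi fun k => ?_
  unfold mrg
  split_ifs <;> fun_prop

lemma continuous_ext :
    Continuous (ext : Config (bdry V n l r) → ℕ → ℝ × ℝ) :=
  continuous_mrg continuous_id continuous_const

lemma continuous_aeval_jac (U : ℝ[X]) (n : ℕ) :
    Continuous fun v : ℕ → ℝ × ℝ => aeval (jac n v) U := by
  simp only [aeval_eq_sum]
  have := continuous_jac n
  fun_prop

include hc hV hl hr hco in
lemma continuous_condMin : Continuous (condMin V β n l r) := by
  refine continuous_iff_continuousAt.2 fun q' => tendsto_pi_nhds.2 fun k => tendsto_of_sq2 ?_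
  set p : Config (bdry V n l r) → ℕ → ℝ × ℝ := fun q => mrg _ (𝔪[β] q') (ext q) with hp
  set P : Config (bdry V n l r) → Matrix (Fin n) (Fin n) ℝ := fun q => aeval (jac n (p q)) Vᵈ
  have hPc : Continuous P :=
    (continuous_aeval_jac _ n).comp (continuous_mrg continuous_const continuous_ext)
  set γ : Config (bdry V n l r) → ℝ := fun q => 2 * ∑ i, ∑ j, |P q i j - P q' i j| with hγ
  have hγc : Continuous γ := by
    have : ∀ i j, Continuous fun q => P q i j := fun i j => hPc.matrix_elem i j
    fun_prop
  have hγ0 : γ q' = 0 := by simp [hγ]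
  have hpq' : p q' = mfull β q' := rfl
  have hgrad : ∀ q, ∀ e ∈ Icc l r, ∀ u, |grad V β n (p q) e u| ≤ γ q * ab2 u := fun q e he u => by
    have h0 := grad_mfull hc hV hl hr hco q' he u
    have hpe : p q e = p q' e := by simp only [hp]; rw [mrg_mem _ _ he, mrg_mem _ _ he]
    have h1 : grad V β n (p q) e u = ((P q - P q') * jac n (Pi.single e u)).trace := by
      rw [← sub_zero (grad V β n (p q) e u), ← h0, ← hpq', grad, grad, hpe, sub_mul, trace_sub]
      ring
    rw [h1]
    have h2 := abs_trace_mul_jac_single_le (Icc_subset_of_le hl hr he) (P := P q - P q')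
      (m := ∑ i, ∑ j, |P q i j - P q' i j|) (fun i j =>
        (single_le_sum (f := fun j => |P q i j - P q' i j|) (fun _ _ => abs_nonneg _)
          (mem_univ j)).trans (single_le_sum (f := fun i => ∑ j, |P q i j - P q' i j|)
            (fun _ _ => sum_nonneg fun _ _ => abs_nonneg _) (mem_univ i))) u
    refine h2.trans ?_
    have h3 : |u.1| + 2 * |u.2| ≤ 2 * ab2 u := by unfold ab2; linarith [abs_nonneg u.1]
    have h4 : 0 ≤ ∑ i, ∑ j, |P q i j - P q' i j| :=
      sum_nonneg fun _ _ => sum_nonneg fun _ _ => abs_nonneg _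
    have := mul_le_mul_of_nonneg_right h3 h4
    simp only [hγ]; linarith
  have hbound : ∀ q, sq2 (𝔪[β] q k - 𝔪[β] q' k)
      ≤ 4 / c ^ 2 * ∑ _e ∈ Icc l r, γ q ^ 2 := fun q => by
    have h1 := sum_sq2_condMin_sub_le hc hV hl hr hco q (p := p q) (γ := fun _ => γ q)
      (fun e he => mrg_notMem _ _ he)
      (fun e he => by
        have := mfull_pos hc hV hl hr hco q' he
        rw [mfull, mrg_mem _ _ he] at this
        change 0 < (mrg _ _ _ e).2
        rwa [mrg_mem _ _ he]) (hgrad q)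
    refine le_trans ?_ h1
    have h2 := single_le_sum (f := fun e => sq2 (mfull β q e - p q e))
      (fun e _ => sq2_nonneg _) k.2
    simp only [mfull, hp, mrg_coe] at h2
    exact h2
  refine squeeze_zero (fun q => sq2_nonneg _) hbound ?_
  have hcont : Continuous fun q => 4 / c ^ 2 * ∑ _e ∈ Icc l r, γ q ^ 2 := by fun_prop
  have := hcont.tendsto q'
  simpa [hγ0] using this

/-! ### The Hessian of the conditional Hamiltonian -/

lemma iteratedFDeriv_two_eq_of_line {E : Type*} [NormedAddCommGroup E] [NormedSpace ℝ E]
    {f : E → ℝ} {m y : E} (hf : ContDiffAt ℝ 2 f m) {g : ℝ → ℝ} {d : ℝ}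
    (hg : ∀ᶠ t in 𝓝 (0 : ℝ), HasDerivAt (fun t : ℝ => f (m + t • y)) (g t) t)
    (hd : HasDerivAt g d 0) : iteratedFDeriv ℝ 2 f m (fun _ => y) = d := by
  rw [iteratedFDeriv_two_apply]
  have hline : ∀ t : ℝ, HasDerivAt (fun t : ℝ => m + t • y) y t := fun t => by
    simpa using ((hasDerivAt_id t).smul_const y).const_add m
  have h0 : m + (0 : ℝ) • y = m := by simp
  have h1 : ∀ᶠ x in 𝓝 m, DifferentiableAt ℝ f x :=
    (hf.eventually (by simp)).mono fun x hx => hx.differentiableAt (by simp)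
  have hc : Tendsto (fun t : ℝ => m + t • y) (𝓝 0) (𝓝 m) := by
    have := (hline 0).continuousAt.tendsto
    rwa [h0] at this
  have h2 : ∀ᶠ t in 𝓝 (0 : ℝ), g t = fderiv ℝ f (m + t • y) y := by
    filter_upwards [hg, hc.eventually h1] with t ht ht'
    exact ht.unique (ht'.hasFDerivAt.comp_hasDerivAt t (hline t))
  have h3 : DifferentiableAt ℝ (fderiv ℝ f) (m + (0 : ℝ) • y) := by
    rw [h0]
    exact (hf.fderiv_right (m := 1) (by norm_num)).differentiableAt (by simp)
  have h4 : HasDerivAt (fun t : ℝ => fderiv ℝ f (m + t • y) y)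
      (fderiv ℝ (fderiv ℝ f) (m + (0 : ℝ) • y) y y) 0 := by
    generalize fderiv ℝ f = F at h3
    have h5 : HasDerivAt (fun t : ℝ => F (m + t • y)) (fderiv ℝ F (m + (0 : ℝ) • y) y) 0 :=
      HasFDerivAt.comp_hasDerivAt (0 : ℝ) h3.hasFDerivAt (hline 0)
    exact (ContinuousLinearMap.apply ℝ ℝ y).hasFDerivAt.comp_hasDerivAt (0 : ℝ) h5
  rw [h0] at h4
  exact h4.unique (hd.congr_of_eventuallyEq (h2.mono fun _ h => h.symm))

lemma hasDerivAt_trace_aeval_mul {ι : Type*} [Fintype ι] [DecidableEq ι] (U : ℝ[X])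
    (B Y : Matrix ι ι ℝ) :
    HasDerivAt (fun t : ℝ => (aeval (B + t • Y) U * Y).trace) (Y * ddMat U B B Y).trace 0 := by
  have hc : Continuous fun t : ℝ => (Y * ddMat U (B + t • Y) B Y).trace := by
    simp only [trace_mul_ddMat]
    fun_prop
  rw [hasDerivAt_iff_tendsto_slope_zero]
  have h0 : (Y * ddMat U B B Y).trace = (Y * ddMat U (B + (0 : ℝ) • Y) B Y).trace := by simp
  rw [h0]
  refine ((hc.tendsto 0).mono_left nhdsWithin_le_nhds).congr' ?_
  filter_upwards [self_mem_nhdsWithin] with t ht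
  have ht : t ≠ 0 := ht
  have h1 := aeval_sub_aeval U (B + t • Y) B
  rw [add_sub_cancel_left, ddMat_smul] at h1
  have h2 : (aeval (B + t • Y) U * Y).trace - (aeval B U * Y).trace
      = t * (Y * ddMat U (B + t • Y) B Y).trace := by
    rw [← trace_sub, ← sub_mul, h1, smul_mul, trace_smul, trace_mul_comm, smul_eq_mul]
  simp only [zero_add, zero_smul, add_zero, smul_eq_mul]
  rw [h2, inv_mul_cancel_left₀ ht]

lemma contDiff_jac_mrg (v : ℕ → ℝ × ℝ) (i j : Fin n) :
    ContDiff ℝ 2 fun x : Config J => jac n (mrg J x v) i j := by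
  have h : ∀ k, ContDiff ℝ 2 fun x : Config J => mrg J x v k := fun k => by
    unfold mrg
    split_ifs <;> fun_prop
  have h1 : ∀ k, ContDiff ℝ 2 fun x : Config J => (mrg J x v k).1 := fun k => (h k).fst
  have h2 : ∀ k, ContDiff ℝ 2 fun x : Config J => (mrg J x v k).2 := fun k => (h k).snd
  simp only [jac_apply]
  split_ifs <;> simp [h1, h2, contDiff_const]

lemma contDiff_trace_aeval_mrg (V : ℝ[X]) (v : ℕ → ℝ × ℝ) :
    ContDiff ℝ 2 fun x : Config J => (aeval (jac n (mrg J x v)) V).trace := by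
  have hpow : ∀ (s : ℕ) (i j : Fin n),
      ContDiff ℝ 2 fun x : Config J => (jac n (mrg J x v) ^ s) i j := fun s => by
    induction s with
    | zero => intro i j; simpa using contDiff_const
    | succ s ih =>
      intro i j
      simp only [pow_succ, Matrix.mul_apply]
      exact ContDiff.sum fun k _ => (ih i k).mul (contDiff_jac_mrg v k j)
  simp only [aeval_eq_sum, trace, diag, Matrix.sum_apply, Matrix.smul_apply, smul_eq_mul]
  exact ContDiff.sum fun i _ => ContDiff.sum fun s _ => contDiff_const.mul (hpow s i i)

/-- The Hessian of the conditional Hamiltonian at its minimizer. -/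
noncomputable def hessForm {V : ℝ[X]} (β : ℝ) {n l r : ℕ} (q : Config (bdry V n l r))
    (y : Config (Icc l r)) : ℝ :=
  (jac n (mrg _ y 0) * ddMat Vᵈ (jac n (mfull β q)) (jac n (mfull β q))
      (jac n (mrg _ y 0))).trace
    + ∑ k : Icc l r, logCoeff β n k * ((y k).2 ^ 2 / (𝔪[β] q k).2 ^ 2)

lemma mrg_add_smul (x y : Config J) (v : ℕ → ℝ × ℝ) (t : ℝ) :
    mrg J (x + t • y) v = mrg J x v + t • mrg J y 0 := by
  ext1 k
  by_cases hk : k ∈ J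
  · simp [mrg_mem _ _ hk]
  · simp [mrg_notMem _ _ hk]

lemma mrg_zero_of_notMem (y : Config J) : ∀ k ∉ J, mrg J y 0 k = 0 :=
  fun _ hk => mrg_notMem _ _ hk

section

include hc hV hl hr hco

lemma contDiffAt_condH (q : Config (bdry V n l r)) :
    ContDiffAt ℝ 2 (ℋ[β] q) (𝔪[β] q) := by
  have h : ℋ[β] q = fun x => (aeval (jac n (mrg _ x (ext q))) V).trace
      - ∑ k ∈ Icc 1 (n - 1), logCoeff β n k * log (mrg _ x (ext q) k).2 := rfl
  rw [h]
  refine (contDiff_trace_aeval_mrg V _).contDiffAt.sub (ContDiffAt.sum fun k _ =>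
    contDiffAt_const.mul ?_)
  by_cases hk : k ∈ Icc l r
  · simp only [mrg_mem _ _ hk]
    refine ContDiffAt.log (by fun_prop) ?_
    exact ((exists_condMin hc hV hl hr hco q).1 _).ne'
  · simp only [mrg_notMem _ _ hk]
    exact contDiffAt_const

lemma iteratedFDeriv_condH (q : Config (bdry V n l r)) (y : Config (Icc l r)) :
    iteratedFDeriv ℝ 2 (ℋ[β] q) (𝔪[β] q) (fun _ => y)
      = hessForm β q y := by
  set m := 𝔪[β] q with hm
  have hm0 : ∀ k, 0 < (m k).2 := (exists_condMin hc hV hl hr hco q).1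
  set Y := mrg _ y 0 with hY
  have hE := Icc_subset_of_le (l := l) (r := r) (n := n) hl hr
  have hmY : ∀ t : ℝ, mrg _ (m + t • y) (ext q) = mfull β q + t • Y := fun t =>
    mrg_add_smul _ _ _ _
  have hev : ∀ᶠ t : ℝ in 𝓝 0, ∀ k : Icc l r, 0 < ((m + t • y) k).2 := by
    refine eventually_all.2 fun k => ?_
    have hcont : Continuous fun t : ℝ => ((m + t • y) k).2 := by
      simp only [Pi.add_apply, Pi.smul_apply]; fun_prop
    exact hcont.tendsto 0 |>.eventually_const_lt (by simpa using hm0 k)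
  refine iteratedFDeriv_two_eq_of_line (contDiffAt_condH hc hV hl hr hco q)
    (g := fun t => (aeval (jac n (mfull β q) + t • jac n Y) Vᵈ * jac n Y).trace
      - ∑ k : Icc l r, logCoeff β n k * ((y k).2 / ((m k).2 + t * (y k).2))) ?_ ?_
  · filter_upwards [hev] with t ht
    have h1 := hasDerivAt_ham_line V β hE (mfull β q) (mrg_zero_of_notMem y) (t := t) (by
      intro k hk
      rw [← hmY, mrg_mem _ _ hk]
      exact ht _)
    have h2 : (fun t : ℝ => ℋ[β] q (m + t • y))
        = fun t : ℝ => ham V β n (mfull β q + t • Y) := by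
      funext t
      rw [condH_eq, ← hmY]; rfl
    rw [h2]
    convert h1 using 1
    rw [map_add, map_smul, ← sum_coe_sort (Icc l r)]
    congr 1
    refine sum_congr rfl fun k _ => ?_
    rw [← hmY, mrg_coe, mrg_coe]; simp
  · have h1 := hasDerivAt_trace_aeval_mul Vᵈ (jac n (mfull β q)) (jac n Y)
    have h2 : HasDerivAt (fun t : ℝ => ∑ k : Icc l r, logCoeff β n k *
        ((y k).2 / ((m k).2 + t * (y k).2)))
        (∑ k : Icc l r, logCoeff β n k * -((y k).2 ^ 2 / (m k).2 ^ 2)) 0 := by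
      refine HasDerivAt.fun_sum fun k _ => HasDerivAt.const_mul _ ?_
      have h3 : HasDerivAt (fun t : ℝ => (m k).2 + t * (y k).2) (y k).2 0 := by
        simpa using ((hasDerivAt_id (0 : ℝ)).mul_const (y k).2).const_add (m k).2
      have h4 := (hasDerivAt_const (0 : ℝ) (y k).2).fun_div h3 (by simpa using (hm0 k).ne')
      convert h4 using 1
      rw [zero_mul, zero_mul, add_zero, zero_sub, neg_div, sq (y k).2]
    have h3 : hessForm β q y = (jac n Y * ddMat Vᵈ (jac n (mfull β q))
        (jac n (mfull β q)) (jac n Y)).trace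
        - ∑ k : Icc l r, logCoeff β n k * -((y k).2 ^ 2 / (m k).2 ^ 2) := by
      simp only [hessForm, mul_neg, sum_neg_distrib, sub_neg_eq_add, hY, hm]
    rw [h3]
    exact h1.sub h2

lemma hessForm_ge (q : Config (bdry V n l r)) (y : Config (Icc l r)) :
    c * ∑ k, sq2 (y k) ≤ hessForm β q y := by
  have h1 := trace_mul_ddMat_self_ge hV (jac_isSymm n (mfull β q))
    (jac_isSymm n (mfull β q)) (jac_isSymm n (mrg _ y 0))
  have h2 := sum_sq2_le_trace (Icc_subset_of_le (l := l) hl hr) (mrg _ y 0)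
  rw [← sum_coe_sort] at h2
  simp only [mrg_coe] at h2
  have h3 : 0 ≤ ∑ k : Icc l r, logCoeff β n k * ((y k).2 ^ 2 / (𝔪[β] q k).2 ^ 2) :=
    sum_nonneg fun k _ => mul_nonneg (hco k k.2).le (by positivity)
  have h4 := mul_le_mul_of_nonneg_left h2 hc.le
  unfold hessForm; linarith

lemma continuous_hessForm : Continuous fun z : Config (bdry V n l r) × Config (Icc l r) =>
      hessForm β z.1 (z.2 - 𝔪[β] z.1) := by
  have hm : Continuous (condMin V β n l r) := continuous_condMin hc hV hl hr hco
  have hm' : Continuous fun z : Config (bdry V n l r) × Config (Icc l r) =>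
      𝔪[β] z.1 := hm.comp continuous_fst
  have hT : Continuous fun z : Config (bdry V n l r) × Config (Icc l r) =>
      jac n (mfull β z.1) :=
    (continuous_jac n).comp (continuous_mrg hm' (continuous_ext.comp continuous_fst))
  have hY : Continuous fun z : Config (bdry V n l r) × Config (Icc l r) =>
      jac n (mrg _ (z.2 - 𝔪[β] z.1) 0) :=
    (continuous_jac n).comp (continuous_mrg (continuous_snd.sub hm') continuous_const)
  unfold hessForm
  simp only [trace_mul_ddMat]
  refine Continuous.add (by fun_prop) (continuous_finsetSum _ fun k _ => continuous_const.mul ?_)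
  have hk : Continuous fun z : Config (bdry V n l r) × Config (Icc l r) =>
      𝔪[β] z.1 k := (continuous_apply k).comp hm'
  refine Continuous.div (by simp only [Pi.sub_apply]; fun_prop) (by fun_prop) fun z => ?_
  exact (pow_pos ((exists_condMin hc hV hl hr hco z.1).1 k) 2).ne'

/-! ### The Gaussian measure -/

lemma nuCond_eq (q : Config (bdry V n l r)) : γ[β] q = normalized fun x =>
    ofReal (exp (-(n * β / 2 * hessForm β q (x - 𝔪[β] q)))) := by
  unfold nuCond
  simp only [iteratedFDeriv_condH hc hV hl hr hco]

lemma measurable_gauss : Measurable fun z : Config (bdry V n l r) × Config (Icc l r) => ofReal (exp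
      (-(n * β / 2 * hessForm β z.1 (z.2 - 𝔪[β] z.1)))) :=
  (measurable_exp.comp
    ((continuous_hessForm hc hV hl hr hco).measurable.const_mul _).neg).ennreal_ofReal

lemma lintegral_gauss_ne_zero (q : Config (bdry V n l r)) : ∫⁻ x, ofReal (exp
      (-(n * β / 2 * hessForm β q (x - 𝔪[β] q)))) ≠ 0 := by
  have hm := (measurable_gauss hc hV hl hr hco).comp (measurable_const.prodMk measurable_id :
    Measurable fun x : Config (Icc l r) => (q, x))
  refine ((lintegral_pos_iff_support hm).2 ?_).ne'
  refine lt_of_lt_of_le (isOpen_univ.measure_pos volume ⟨fun _ => (0, 1), trivial⟩)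
    (measure_mono fun x _ => ?_)
  simpa using exp_pos _

lemma lintegral_hess_ne_top (hβ : 0 < β) (q : Config (bdry V n l r)) : ∫⁻ x, ofReal (exp
      (-(n * β / 2 * hessForm β q (x - 𝔪[β] q)))) ≠ ∞ := by
  have hn : (0 : ℝ) < n := by
    have : 0 < n := by omega
    exact_mod_cast this
  refine ne_top_of_le_ne_top (lintegral_gauss_ne_top (𝔪[β] q)
    (κ := n * β / 2 * c) (by positivity)) (lintegral_mono fun x => ?_)
  refine ofReal_le_ofReal (exp_le_exp.2 (neg_le_neg ?_))
  have := mul_le_mul_of_nonneg_left (hessForm_ge hc hV hl hr hco q (x - 𝔪[β] q))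
    (show 0 ≤ n * β / 2 by positivity)
  simp only [Pi.sub_apply] at this; linarith

lemma nuCond_univ (hβ : 0 < β) (q : Config (bdry V n l r)) : γ[β] q univ = 1 := by
  rw [nuCond_eq hc hV hl hr hco]
  exact normalized_univ (lintegral_gauss_ne_zero hc hV hl hr hco q)
    (lintegral_hess_ne_top hc hV hl hr hco hβ q)

lemma condLaw_univ (hβ : 0 < β) (q : Config (bdry V n l r)) : condLaw β q univ = 1 :=
  normalized_univ (lintegral_condDens_ne_zero β q)
    (lintegral_condDens_ne_top hc hV hβ hl hr hco q)

lemma measurable_nuCond_apply (hA : MeasurableSet A) :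
    Measurable fun q : Config (bdry V n l r) => γ[β] q A := by
  simp only [nuCond_eq hc hV hl hr hco, normalized_apply hA]
  have hm := measurable_gauss hc hV hl hr hco (β := β)
  exact hm.lintegral_prod_right'.inv.mul (hm.lintegral_prod_right' (ν := volume.restrict A))

lemma measurable_nuCond : Measurable (nuCond V β n l r) :=
  Measure.measurable_of_measurable_coe _ fun _ hA => measurable_nuCond_apply hc hV hl hr hco hA

/-! ### Concentration around the conditional minimizer -/

lemma hessForm_sub_shrink_ge (q : Config (bdry V n l r)) (z : Config (Icc l r))
    (hτ : 0 ≤ τ) (hA : RowBdd (jac n (mfull β q)) τ)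
    {e : ℕ → ℝ} (he0 : ∀ k, 0 ≤ e k) (hξ : 0 ≤ ξ)
    (he : ∀ k l, nd k l ≤ V.natDegree + 2 → (e k - e l) ^ 2 ≤ ξ * (e k * e l))
    (hsmall : 6 * ddBound Vᵈ τ * ξ * (2 * (V.natDegree + 2 : ℕ) + 1) ≤ c / 2) :
    c * ∑ k : Icc l r, e k ^ 2 * sq2 (z k)
      ≤ hessForm β q (fun k => (1 + e k ^ 2) • z k) - hessForm β q z := by
  have hE := Icc_subset_of_le (l := l) (r := r) (n := n) hl hr
  set T := jac n (mfull β q)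
  set w : Config (Icc l r) := fun k => e k ^ 2 • z k with hw
  have hsym : T.IsSymm := jac_isSymm _ _
  set Z := jac n (mrg _ z 0) with hZ
  set W := jac n (mrg _ w 0) with hW
  have h1 := sum_weighted_ddMat_ge hV hc.le hE (mfull β q) (mfull β q)
    (mrg _ z 0) hτ hA hA he0 hξ he hsmall
  have h2 : (W * ddMat Vᵈ T T Z).trace = ∑ k ∈ Icc l r, ∑ k' ∈ Icc l r, e k ^ 2 *
        (jac n (Pi.single k (mrg _ z 0 k)) * ddMat Vᵈ T T
          (jac n (Pi.single k' (mrg _ z 0 k')))).trace := by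
    rw [hW, hZ, jac_eq_sum_single (mrg_zero_of_notMem w), jac_eq_sum_single (mrg_zero_of_notMem z),
      ddMat_sum, sum_mul, trace_sum]
    refine sum_congr rfl fun k hk => ?_
    rw [mul_sum, trace_sum]
    refine sum_congr rfl fun k' hk' => ?_
    rw [mrg_mem _ _ hk, mrg_mem _ _ hk, hw]
    simp only
    rw [single_smul_site, map_smul, smul_mul, trace_smul, smul_eq_mul]
  rw [← h2, ← sum_coe_sort (Icc l r)] at h1
  simp only [mrg_coe] at h1
  have h3 : (fun k : Icc l r => (1 + e k ^ 2) • z k) = z + (1 : ℝ) • w := by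
    funext k; simp [hw, add_smul]
  have h4 : jac n (mrg _ (z + (1 : ℝ) • w) 0) = Z + W := by rw [mrg_add_smul, map_add, one_smul]
  have h5 : ((Z + W) * ddMat Vᵈ T T (Z + W)).trace
      = (Z * ddMat Vᵈ T T Z).trace + 2 * (W * ddMat Vᵈ T T Z).trace
        + (W * ddMat Vᵈ T T W).trace := by
    rw [ddMat_add, add_mul, mul_add, mul_add, trace_add, trace_add, trace_add,
      trace_mul_ddMat_comm Vᵈ hsym hsym (jac_isSymm n _ : Z.IsSymm) (jac_isSymm n _ : W.IsSymm)]
    ring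
  have h6 : 0 ≤ (W * ddMat Vᵈ T T W).trace := by
    have h7 := trace_mul_ddMat_self_ge hV hsym hsym (jac_isSymm n _ : W.IsSymm)
    have h8 := sum_sq2_le_trace hE (mrg _ w 0)
    have h9 : 0 ≤ ∑ k ∈ Icc l r, sq2 (mrg _ w 0 k) := sum_nonneg fun _ _ => sq2_nonneg _
    exact le_trans (mul_nonneg hc.le (h9.trans h8)) h7
  have h7 : ∑ k : Icc l r, logCoeff β n k * ((z k).2 ^ 2 / (𝔪[β] q k).2 ^ 2)
      ≤ ∑ k : Icc l r, logCoeff β n k *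
        (((z + (1 : ℝ) • w) k).2 ^ 2 / (𝔪[β] q k).2 ^ 2) := by
    refine sum_le_sum fun k _ => mul_le_mul_of_nonneg_left ?_ (hco k k.2).le
    refine div_le_div_of_nonneg_right ?_ (sq_nonneg _)
    have : ((z + (1 : ℝ) • w) k).2 = (1 + e k ^ 2) * (z k).2 := by simp [hw]; ring
    rw [this, mul_pow]
    exact le_mul_of_one_le_left (sq_nonneg _) (one_le_pow₀ (by linarith [sq_nonneg (e k)]))
  rw [h3]
  simp only [hessForm]
  rw [h4, h5]; linarith

end

/-! ### Concentration of the conditional law and of its Gaussian approximation -/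

section

include hc hV hβ hl hr hco

lemma condLaw_le_of_shrink (q : Config (bdry V n l r)) (hw : ∀ k, 0 ≤ w k)
    (hwI : ∀ k ∉ Icc l r, w k = 0)
    (hA : MeasurableSet A)
    (hmono : ∀ x ∈ A, (∀ k ∈ Icc l r, 0 < (shrink (mfull β q) w (mrg _ x (ext q)) k).2) →
      c / 2 * ∑ k ∈ Icc l r, w k * sq2 (shrink (mfull β q) w (mrg _ x (ext q)) k
        - mfull β q k)
      ≤ ∑ k ∈ Icc l r, w k * (grad V β n (shrink (mfull β q) w (mrg _ x (ext q))) k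
          (shrink (mfull β q) w (mrg _ x (ext q)) k - mfull β q k)
        - grad V β n (mfull β q) k
          (shrink (mfull β q) w (mrg _ x (ext q)) k - mfull β q k)))
    (hh : ∀ x ∈ A, h ≤ ∑ k : Icc l r, w k * ((1 + w k)⁻¹ ^ 2 * sq2 (x k - 𝔪[β] q k))) :
    condLaw β q A ≤ ofReal (exp (2 * ∑ k ∈ Icc l r, w k - n * β * (c / 4 * h))) := by
  have hE := Icc_subset_of_le (l := l) (r := r) (n := n) hl hr
  have hm := measurable_condDens_right β q
  rw [condLaw, normalized_apply hA]
  have hbound := setLIntegral_le_of_shrink (𝔪[β] q) (w := fun k => w k)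
    (fun k => hw k) hm hA (θ := n * β * (c / 4 * h)) ?_
  · refine (mul_le_mul_right hbound _).trans ?_
    rw [mul_left_comm, ENNReal.inv_mul_cancel (lintegral_condDens_ne_zero β q)
      (lintegral_condDens_ne_top hc hV hβ hl hr hco q), mul_one, sum_coe_Icc]
  · intro x hx
    set p := mfull β q with hp
    have hsh : mrg _ (fun k => 𝔪[β] q k + (1 + w k)⁻¹ • (x k - 𝔪[β] q k))
        (ext q) = shrink p w (mrg _ x (ext q)) := by
      ext1 k
      by_cases hk : k ∈ Icc l r
      · rw [mrg_mem _ _ hk, shrink, hp, mfull, mrg_mem _ _ hk, mrg_mem _ _ hk]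
      · rw [mrg_notMem _ _ hk, shrink_of_eq_zero _ _ (hwI k hk), mrg_notMem _ _ hk]
    by_cases hpos : ∀ k, 0 < (x k).2
    swap
    · rw [condDens, if_neg hpos]; exact zero_le
    have hpos' : ∀ k ∈ Icc l r, 0 < (mrg _ x (ext q) k).2 := fun k hk => by
      rw [mrg_mem _ _ hk]; exact hpos _
    have hppos : ∀ k ∈ Icc l r, 0 < (p k).2 := fun k hk => mfull_pos hc hV hl hr hco q hk
    have hspos : ∀ k ∈ Icc l r, 0 < (shrink p w (mrg _ x (ext q)) k).2 := fun k hk =>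
      shrink_pos (hw k) (hppos k hk) (hpos' k hk)
    have h1 := ham_sub_shrink_ge hV hc hE (fun k hk => (hco k hk).le) hw hwI hpos' hppos
      (pt := p) (γ := fun _ => 0)
      (fun k hk u => by rw [hp, grad_mfull hc hV hl hr hco q hk]; simp) (hmono x hx hspos)
    simp only [ne_eq, OfNat.ofNat_ne_zero, not_false_eq_true, zero_pow, mul_zero,
      Finset.sum_const_zero, sub_zero] at h1
    have h2 : ∑ k : Icc l r, w k * ((1 + w k)⁻¹ ^ 2 * sq2 (x k - 𝔪[β] q k))
        = ∑ k ∈ Icc l r, w k * sq2 (shrink p w (mrg _ x (ext q)) k - p k) := by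
      rw [← sum_coe_Icc]
      refine sum_congr rfl fun k _ => ?_
      rw [shrink_sub, sq2_smul, mrg_coe, hp, mfull, mrg_coe]
    have h3 := hh x hx
    rw [h2] at h3
    have h4 := mul_le_mul_of_nonneg_left h3 (show 0 ≤ c / 4 by positivity)
    rw [condDens, if_pos hpos, condDens, if_pos (fun k => by
      have := hspos k k.2
      rwa [← hsh, mrg_coe] at this), condH_eq, condH_eq]
    change ofReal (exp (-(n * β * ham V β n (mrg _ x (ext q))))) ≤
      _ * ofReal (exp (-(n * β * ham V β n (mrg _ _ (ext q)))))
    rw [hsh, ← ofReal_mul (exp_pos _).le, ← exp_add]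
    refine ofReal_le_ofReal (exp_le_exp.2 ?_)
    have h5 := mul_le_mul_of_nonneg_left (h4.trans h1) (show 0 ≤ (n : ℝ) * β by positivity)
    linarith

lemma condLaw_l2_le (q : Config (bdry V n l r)) (ρ : ℝ) :
    condLaw β q {x | ρ ≤ ∑ k, sq2 (x k - 𝔪[β] q k)}
      ≤ ofReal (exp (2 * n - n * β * (c / 16 * ρ))) := by
  have hE := Icc_subset_of_le (l := l) (r := r) (n := n) hl hr
  refine (condLaw_le_of_shrink hc hV hβ hl hr hco q
    (w := fun k => if k ∈ Icc l r then 1 else 0) (h := ρ / 4)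
    (fun k => by split_ifs <;> norm_num) (fun k hk => if_neg hk)
    (measurableSet_le measurable_const (measurable_sum_sq2 _)) ?_ ?_).trans ?_
  · intro x hx hpos
    have h1 := sum_grad_sub_ge (β := β) hV hc.le hE (fun k hk => (hco k hk).le)
      (v := shrink (mfull β q) (fun k => if k ∈ Icc l r then 1 else 0)
        (mrg _ x (ext q))) (v' := mfull β q)
      (fun k hk => by
        rw [shrink_of_eq_zero _ _ (if_neg hk), mfull, mrg_notMem _ _ hk, mrg_notMem _ _ hk]) hpos
      (fun k hk => mfull_pos hc hV hl hr hco q hk)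
    have h2 : ∀ f : ℕ → ℝ, ∑ k ∈ Icc l r, (if k ∈ Icc l r then (1 : ℝ) else 0) * f k
        = ∑ k ∈ Icc l r, f k := fun f =>
      sum_congr rfl fun k hk => by rw [if_pos hk, one_mul]
    rw [h2, h2]
    refine le_trans (mul_le_mul_of_nonneg_right (by linarith) ?_) h1
    exact sum_nonneg fun k _ => sq2_nonneg _
  · intro x hx
    have hx : ρ ≤ ∑ k, sq2 (x k - 𝔪[β] q k) := hx
    have h1 : ∑ k : Icc l r, (if (k : ℕ) ∈ Icc l r then (1 : ℝ) else 0) *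
        ((1 + (if (k : ℕ) ∈ Icc l r then (1 : ℝ) else 0))⁻¹ ^ 2
          * sq2 (x k - 𝔪[β] q k))
        = 1 / 4 * ∑ k : Icc l r, sq2 (x k - 𝔪[β] q k) := by
      rw [mul_sum]
      refine sum_congr rfl fun k _ => ?_
      rw [if_pos k.2]; ring
    rw [h1]; linarith
  · refine ofReal_le_ofReal (exp_le_exp.2 ?_)
    have h1 : ∑ k ∈ Icc l r, (if k ∈ Icc l r then (1 : ℝ) else 0) ≤ n := by
      rw [sum_congr rfl fun k hk => if_pos hk, sum_const, nsmul_eq_mul, mul_one, Nat.card_Icc]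
      have : r + 1 - l ≤ n := by omega
      exact_mod_cast this
    linarith

lemma condLaw_site_le (q : Config (bdry V n l r)) {τ ρ C₀ : ℝ} (hτ : 0 ≤ τ)
    (hm : ∀ k, ab2 (mfull β q k) ≤ τ)
    (hj : j ∈ Icc l r) (hξ : 0 ≤ ξ)
    (he : ∀ k k', nd k k' ≤ V.natDegree + 2 →
      (expw c₁ j k - expw c₁ j k') ^ 2 ≤ ξ * (expw c₁ j k * expw c₁ j k'))
    (hsmall : 6 * ddBound Vᵈ (3 * (τ + 2 * √ρ)) * ξ * (2 * (V.natDegree + 2 : ℕ) + 1) ≤ c / 2)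
    (hsum : ∑ k ∈ Icc l r, expw (2 * c₁) j k ≤ C₀) (s : ℝ) :
    condLaw β q ({x | ∑ k, sq2 (x k - 𝔪[β] q k) ≤ ρ} ∩
        {x | s ^ 2 < sq2 (x ⟨j, hj⟩ - 𝔪[β] q ⟨j, hj⟩)})
      ≤ ofReal (exp (2 * C₀ - n * β * (c / 16 * s ^ 2))) := by
  have hE := Icc_subset_of_le (l := l) (r := r) (n := n) hl hr
  set w : ℕ → ℝ := fun k => if k ∈ Icc l r then expw c₁ j k ^ 2 else 0 with hw
  have hw0 : ∀ k, 0 ≤ w k := fun k => by simp only [hw]; split_ifs <;> positivity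
  have hw1 : ∀ k ∈ Icc l r, w k = expw c₁ j k ^ 2 := fun k hk => by simp only [hw, if_pos hk]
  have hwI : ∀ k ∉ Icc l r, w k = 0 := fun k hk => by simp only [hw, if_neg hk]
  have hwj : w j = 1 := by rw [hw1 j hj, expw_self, one_pow]
  have hms : MeasurableSet {x : Config (Icc l r) |
      s ^ 2 < sq2 (x ⟨j, hj⟩ - 𝔪[β] q ⟨j, hj⟩)} := by
    refine measurableSet_lt measurable_const ?_
    unfold sq2
    fun_prop
  refine (condLaw_le_of_shrink hc hV hβ hl hr hco q (w := w) (h := s ^ 2 / 4) hw0 hwI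
    ((measurableSet_le (measurable_sum_sq2 _) measurable_const).inter hms) ?_ ?_).trans ?_
  · rintro x ⟨hx, -⟩ hpos
    have hx : ∑ k, sq2 (x k - 𝔪[β] q k) ≤ ρ := hx
    have hτ' : 0 ≤ τ + 2 * √ρ := by positivity
    have hB : RowBdd (jac n (mfull β q)) (3 * (τ + 2 * √ρ)) :=
      rowBdd_jac_of_ab2 hτ' fun k _ => by linarith [hm k, sqrt_nonneg ρ]
    have hA : RowBdd (jac n (shrink (mfull β q) w (mrg _ x (ext q)))) (3 * (τ + 2 * √ρ)) :=
      rowBdd_jac_of_ab2 hτ' fun k _ => by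
        by_cases hk : k ∈ Icc l r
        · have h1 := (single_le_sum (f := fun k => sq2 (x k - 𝔪[β] q k))
            (fun k _ => sq2_nonneg _) (mem_univ ⟨k, hk⟩)).trans hx
          have h2 := ab2_le_sqrt h1
          have h3 := ab2_add_le (shrink (mfull β q) w (mrg _ x (ext q)) k
            - mfull β q k) (mfull β q k)
          rw [sub_add_cancel, shrink_sub, ab2_smul, mfull, mrg_mem _ _ hk, mrg_mem _ _ hk] at h3
          have h4 : |(1 + w k)⁻¹| ≤ 1 := by
            rw [abs_of_nonneg (inv_nonneg.2 (by linarith [hw0 k]))]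
            exact inv_le_one_of_one_le₀ (by linarith [hw0 k])
          have h5 := mul_le_of_le_one_left (ab2_nonneg (x ⟨k, hk⟩ - 𝔪[β] q ⟨k, hk⟩)) h4
          have h6 := hm k
          rw [mfull, mrg_mem _ _ hk] at h6
          rw [mfull]; linarith
        · rw [shrink_of_eq_zero _ _ (hwI k hk), mrg_notMem _ _ hk]
          have h6 := hm k
          rw [mfull, mrg_notMem _ _ hk] at h6
          linarith [sqrt_nonneg ρ]
    have h1 := sum_weighted_grad_sub_ge (β := β) hV hc.le hE (fun k hk => (hco k hk).le)
      (v := shrink (mfull β q) w (mrg _ x (ext q))) (v' := mfull β q)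
      (fun k hk => by
        rw [shrink_of_eq_zero _ _ (hwI k hk), mfull, mrg_notMem _ _ hk, mrg_notMem _ _ hk]) hpos
      (fun k hk => mfull_pos hc hV hl hr hco q hk) (by positivity) hA hB (e := expw c₁ j)
      (fun k => (expw_pos _ _ _).le) hξ he hsmall
    have h2 : ∀ f : ℕ → ℝ, ∑ k ∈ Icc l r, w k * f k
        = ∑ k ∈ Icc l r, expw c₁ j k ^ 2 * f k := fun f =>
      sum_congr rfl fun k hk => by rw [hw1 k hk]
    rw [h2, h2]
    exact h1
  · rintro x ⟨-, hx⟩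
    have hx : s ^ 2 < sq2 (x ⟨j, hj⟩ - 𝔪[β] q ⟨j, hj⟩) := hx
    have h1 := single_le_sum (f := fun k : Icc l r => w k * ((1 + w k)⁻¹ ^ 2 *
      sq2 (x k - 𝔪[β] q k))) (fun k _ => mul_nonneg (hw0 k)
        (mul_nonneg (sq_nonneg _) (sq2_nonneg _))) (mem_univ ⟨j, hj⟩)
    simp only [hwj] at h1; linarith
  · refine ofReal_le_ofReal (exp_le_exp.2 ?_)
    have h1 : ∑ k ∈ Icc l r, w k ≤ C₀ := by
      rw [sum_congr rfl fun k hk => (hw1 k hk).trans (expw_sq _ _ _)]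
      exact hsum
    linarith

lemma nuCond_site_le (q : Config (bdry V n l r)) {τ C₀ : ℝ} (hτ : 0 ≤ τ)
    (hm : ∀ k, ab2 (mfull β q k) ≤ τ)
    (hj : j ∈ Icc l r) (hξ : 0 ≤ ξ)
    (he : ∀ k k', nd k k' ≤ V.natDegree + 2 →
      (expw c₁ j k - expw c₁ j k') ^ 2 ≤ ξ * (expw c₁ j k * expw c₁ j k'))
    (hsmall : 6 * ddBound Vᵈ (3 * τ) * ξ * (2 * (V.natDegree + 2 : ℕ) + 1) ≤ c / 2)
    (hsum : ∑ k ∈ Icc l r, expw (2 * c₁) j k ≤ C₀) (s : ℝ) :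
    γ[β] q {x | s ^ 2 < sq2 (x ⟨j, hj⟩ - 𝔪[β] q ⟨j, hj⟩)}
      ≤ ofReal (exp (2 * C₀ - n * β * (c / 16 * s ^ 2))) := by
  set w : ℕ → ℝ := fun k => expw c₁ j k ^ 2 with hw
  have hw0 : ∀ k, 0 ≤ w k := fun k => sq_nonneg _
  have hwj : w j = 1 := by simp only [hw]; rw [expw_self, one_pow]
  have hms : MeasurableSet {x : Config (Icc l r) |
      s ^ 2 < sq2 (x ⟨j, hj⟩ - 𝔪[β] q ⟨j, hj⟩)} := by
    refine measurableSet_lt measurable_const ?_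
    unfold sq2
    fun_prop
  rw [nuCond_eq hc hV hl hr hco, normalized_apply hms]
  have hmeas := (measurable_gauss hc hV hl hr hco (β := β)).comp (measurable_const.prodMk
    measurable_id : Measurable fun x : Config (Icc l r) => (q, x))
  have hbound := setLIntegral_le_of_shrink (𝔪[β] q) (w := fun k => w k)
    (fun k => hw0 k) hmeas hms (θ := n * β * (c / 16 * s ^ 2)) ?_
  · refine (mul_le_mul_right hbound _).trans ?_
    rw [mul_left_comm]
    refine (mul_le_mul_right (inv_mul_le_one _) _).trans ?_
    rw [mul_one]
    refine ofReal_le_ofReal (exp_le_exp.2 ?_)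
    have h1 : ∑ k : Icc l r, w k ≤ C₀ := by
      rw [sum_coe_Icc, sum_congr rfl fun k _ => expw_sq _ _ _]
      exact hsum
    linarith
  · intro x hx
    have hx : s ^ 2 < sq2 (x ⟨j, hj⟩ - 𝔪[β] q ⟨j, hj⟩) := hx
    set z : Config (Icc l r) := fun k => (1 + w k)⁻¹ • (x k - 𝔪[β] q k) with hz
    have h1 := hessForm_sub_shrink_ge hc hV hl hr hco q z (τ := 3 * τ) (by positivity)
      (rowBdd_jac_of_ab2 hτ fun k _ => hm k) (e := expw c₁ j) (fun k => (expw_pos _ _ _).le) hξ he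
      hsmall
    have h2 : (fun k : Icc l r => (1 + expw c₁ j k ^ 2) • z k) = x - 𝔪[β] q := by
      funext k
      have : (1 + w k) ≠ 0 := by have := hw0 k; positivity
      simp only [hz, smul_smul, Pi.sub_apply]
      rw [show 1 + expw c₁ j k ^ 2 = 1 + w k from rfl, mul_inv_cancel₀ this, one_smul]
    have h3 : (fun k : Icc l r => 𝔪[β] q k
        + (1 + w k)⁻¹ • (x k - 𝔪[β] q k)) - 𝔪[β] q = z := by
      funext k; simp [hz]
    rw [h2] at h1
    have h4 := single_le_sum (f := fun k : Icc l r => expw c₁ j k ^ 2 * sq2 (z k))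
      (fun k _ => mul_nonneg (sq_nonneg _) (sq2_nonneg _)) (mem_univ ⟨j, hj⟩)
    simp only [expw_self, one_pow, one_mul, hz] at h4
    rw [sq2_smul, hwj] at h4
    have h5 : c / 4 * s ^ 2 ≤ hessForm β q (x - 𝔪[β] q)
        - hessForm β q z := by
      have := mul_le_mul_of_nonneg_left h4 hc.le
      nlinarith
    simp only [Function.comp, h3]
    rw [← ofReal_mul (exp_pos _).le, ← exp_add]
    refine ofReal_le_ofReal (exp_le_exp.2 ?_)
    have h6 := mul_le_mul_of_nonneg_left h5 (show 0 ≤ (n : ℝ) * β / 2 by positivity)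
    have h7 : 0 ≤ (n : ℝ) * β * c * s ^ 2 := by positivity
    linarith

end

include hc hV hβ hε0 hε1 in
lemma exists_condMin_bounds :
    ∃ (τ b s₀ : ℝ) (N : ℕ), 0 < τ ∧ 0 < b ∧ 0 < s₀ ∧ 0 < N ∧ ∀ n : ℕ, N ≤ n → ∀ l r : ℕ,
      V.natDegree + 1 ≤ l → (r : ℝ) ≤ (1 - ε) * n →
      r + V.natDegree + 1 ≤ n ∧ (∀ k ∈ Icc l r, 0 < logCoeff β n k) ∧
      ∀ q : Config (bdry V n l r), (∀ e, ab2 (q e - dagger V β n e) ≤ s₀) →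
      (∀ k, ab2 (mfull β q k) ≤ τ) ∧
      ∀ k ∈ Icc l r, b ≤ (mfull β q k).2 := by
  obtain ⟨M, r₀, Λ, hM, hr₀, hΛ, hdag⟩ := exists_dagger_bounds hc hV hβ
    (show 0 < ε / 4 by positivity)
  obtain ⟨N₁, hN₁, hbulk⟩ := exists_bulk_bounds hβ hε0 hε1 0 V.natDegree
  obtain ⟨C, c₁, N₂, hC, hc₁, hN₂, hnear⟩ := exists_condMin_near hc hV hβ hε0 hε1
  set D := V.natDegree
  set s₀ := min (1 / 2) (r₀ / (4 * C))
  have hs₀0 : 0 < s₀ := by positivity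
  obtain ⟨N₃, hN₃⟩ := exists_nat_ge (4 * C / r₀)
  refine ⟨M + 1 + r₀, r₀ / 2, s₀, max N₁ (max N₂ N₃), by positivity, by positivity, hs₀0,
    lt_max_of_lt_left hN₁, fun n hn l r hlD hrε => ?_⟩
  obtain ⟨hb1, hb2, hb3, hb4⟩ := hbulk n (le_trans (le_max_left _ _) hn)
  have hn0 : 0 < n := by omega
  have hn0' : (0 : ℝ) < n := mod_cast hn0
  have hrb := add_add_one_le_bulk hb4 hrε
  have hIb : ∀ k ∈ Icc l r, k ≤ bulk ε n := fun k hk => by rw [mem_Icc] at hk; omega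
  refine ⟨by omega, fun k hk => ?_, fun q hq => ?_⟩
  · rw [logCoeff_eq]
    linarith [hb3 k (hIb k hk)]
  have hI : ∀ k ∈ Icc l r, ab2 (mfull β q k - dagger V β n k) ≤ r₀ / 2 := fun k hk => by
    have h1 := hnear n (le_trans (le_trans (le_max_left _ _) (le_max_right _ _)) hn) l r hlD hrε s₀
      hs₀0.le (min_le_left _ _) q hq k hk
    refine h1.trans ?_
    have h2 : s₀ * exp (-(c₁ * Metric.infDist k (bdry V n l r : Set ℕ))) ≤ r₀ / (4 * C) := by
      refine (mul_le_of_le_one_right hs₀0.le (exp_le_one_iff.2 ?_)).trans (min_le_right _ _)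
      have : 0 ≤ c₁ * Metric.infDist k (bdry V n l r : Set ℕ) :=
        mul_nonneg hc₁.le Metric.infDist_nonneg
      linarith
    have h3 : 1 / (n : ℝ) ≤ r₀ / (4 * C) := by
      rw [div_le_div_iff₀ hn0' (by positivity)]
      have : (N₃ : ℝ) ≤ n := by
        exact_mod_cast le_trans (le_trans (le_max_right _ _) (le_max_right _ _)) hn
      have := hN₃.trans this
      rw [div_le_iff₀ hr₀] at this; linarith
    calc C * (s₀ * exp (-(c₁ * Metric.infDist k (bdry V n l r : Set ℕ))) + 1 / n)
        ≤ C * (r₀ / (4 * C) + r₀ / (4 * C)) := by gcongr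
      _ = r₀ / 2 := by field_simp; ring
  constructor
  · intro k
    by_cases hk : k ∈ Icc l r
    · have h1 := ab2_add_le (mfull β q k - dagger V β n k) (dagger V β n k)
      rw [sub_add_cancel] at h1
      linarith [hI k hk, (hdag n k hn0 (hb3 k (hIb k hk))).1]
    · rw [mfull, mrg_notMem _ _ hk]
      have h4 : s₀ ≤ 1 / 2 := min_le_left _ _
      linarith [ab2_ext_le hM.le (by linarith) hq (fun e he => (hdag n e hn0
        (hb3 e (by have := (mem_filter.1 he).2.2.2; omega))).1) k]
  · intro k hk
    have h1 := (abs_snd_le_ab2 _).trans (hI k hk)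
    have h2 := (abs_le.1 h1).1
    rw [Prod.snd_sub] at h2
    linarith [(hdag n k hn0 (hb3 k (hIb k hk))).2.1]

include hc hV hβ hε0 hε1 in
lemma exists_cond_concentration :
    ∃ (C κ s₀ : ℝ) (N : ℕ), 0 < C ∧ 0 < κ ∧ 0 < s₀ ∧ 0 < N ∧ ∀ n : ℕ, N ≤ n → ∀ l r : ℕ,
      V.natDegree + 1 ≤ l → (r : ℝ) ≤ (1 - ε) * n →
      ∀ q : Config (bdry V n l r), (∀ e, ab2 (q e - dagger V β n e) ≤ s₀) →
      ∀ (j : Icc l r) (s : ℝ),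
      condLaw β q {x | s ^ 2 < sq2 (x j - 𝔪[β] q j)}
        ≤ ofReal (exp (-n) + C * exp (-(κ * n * s ^ 2))) ∧
      γ[β] q {x | s ^ 2 < sq2 (x j - 𝔪[β] q j)}
        ≤ ofReal (C * exp (-(κ * n * s ^ 2))) := by
  obtain ⟨τ, b, s₀, N, hτ, hb, hs₀, hN, hbd⟩ := exists_condMin_bounds hc hV hβ hε0 hε1
  set ρ := 48 / (β * c) with hρ
  obtain ⟨c₁, ξ, hc₁, hξ, he, hsmall⟩ := exists_weight_rate V hc (τ := 3 * (τ + 2 * √ρ))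
    (by positivity)
  obtain ⟨c₂, ξ', hc₂, hξ', he', hsmall'⟩ := exists_weight_rate V hc (τ := 3 * τ) (by positivity)
  obtain ⟨C₀, hC₀, hsum⟩ := exists_sum_expw_le (c₁ := 2 * c₁) (by positivity)
  obtain ⟨C₀', hC₀', hsum'⟩ := exists_sum_expw_le (c₁ := 2 * c₂) (by positivity)
  refine ⟨exp (2 * max C₀ C₀'), β * (c / 16), s₀, N, exp_pos _, by positivity, hs₀, hN,
    fun n hn l r hl hr q hq j s => ?_⟩
  obtain ⟨hrn, hco, hbd⟩ := hbd n hn l r hl hr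
  obtain ⟨hm, -⟩ := hbd q hq
  have hl1 : 1 ≤ l := by omega
  have hr1 : r + 1 ≤ n := by omega
  have hexp : ∀ C' ≤ max C₀ C₀', exp (2 * C' - n * β * (c / 16 * s ^ 2))
      ≤ exp (2 * max C₀ C₀') * exp (-(β * (c / 16) * n * s ^ 2)) := fun C' h => by
    rw [← exp_add]
    exact exp_le_exp.2 (by linarith)
  constructor
  · have h1 := condLaw_l2_le hc hV hβ hl1 hr1 hco q ρ
    have h2 := condLaw_site_le hc hV hβ hl1 hr1 hco q hτ.le hm j.2 hξ (he j) hsmall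
      (hsum _ j) s (ρ := ρ)
    have hsub : {x : Config (Icc l r) | s ^ 2 < sq2 (x j - 𝔪[β] q j)}
        ⊆ {x | ρ ≤ ∑ k, sq2 (x k - 𝔪[β] q k)} ∪
          ({x | ∑ k, sq2 (x k - 𝔪[β] q k) ≤ ρ} ∩
            {x | s ^ 2 < sq2 (x j - 𝔪[β] q j)}) := fun x hx => by
      rcases le_total ρ (∑ k, sq2 (x k - 𝔪[β] q k)) with h | h
      · exact Or.inl h
      · exact Or.inr ⟨h, hx⟩
    refine (measure_mono hsub).trans ((measure_union_le _ _).trans ((add_le_add h1 h2).trans ?_))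
    rw [← ofReal_add (exp_pos _).le (exp_pos _).le]
    refine ofReal_le_ofReal (add_le_add (exp_le_exp.2 (le_of_eq ?_)) (hexp _ (le_max_left _ _)))
    rw [hρ]; field_simp; ring
  · have h2 := nuCond_site_le hc hV hβ hl1 hr1 hco q hτ.le hm j.2 hξ' (he' j) hsmall' (hsum' _ j) s
    exact h2.trans (ofReal_le_ofReal (hexp _ (le_max_right _ _)))

/-! ### Comparison of the conditional law with the Gaussian measure -/

lemma abs_log_taylor_le {u : ℝ} (hu : |u| ≤ 1 / 2) :
    |log (1 + u) - u + u ^ 2 / 2| ≤ 2 * |u| ^ 3 := by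
  have h := Real.abs_log_sub_add_sum_range_le (x := -u) (by rw [abs_neg]; linarith) 2
  rw [abs_neg, sub_neg_eq_add] at h
  simp only [Finset.sum_range_succ, Finset.sum_range_zero] at h
  have e : log (1 + u) - u + u ^ 2 / 2 = 0 + (-u) ^ (0 + 1) / ((0 : ℕ) + 1)
      + (-u) ^ (1 + 1) / ((1 : ℕ) + 1) + log (1 + u) := by
    push_cast; ring
  rw [e]
  refine h.trans ?_
  rw [div_le_iff₀ (by linarith)]
  have : 0 ≤ |u| ^ 3 := by positivity
  norm_num
  nlinarith

lemma sum_abs_jac_mrg_le (hl : 1 ≤ l) (hr : r + 1 ≤ n) {y : Config (Icc l r)}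
    (hy : ∀ k, ab2 (y k) ≤ h) :
    ∑ i, ∑ j, |jac n (mrg _ y 0) i j| ≤ (Icc l r).card * (2 * h) := by
  refine (sum_abs_jac_le (Icc_subset_of_le hl hr) (mrg_zero_of_notMem y)).trans ?_
  rw [← nsmul_eq_mul]
  refine sum_le_card_nsmul _ _ _ fun k hk => ?_
  rw [mrg_mem _ _ hk]
  have := hy ⟨k, hk⟩
  unfold ab2 at this
  linarith [abs_nonneg (y ⟨k, hk⟩).1]

include hc hV hβ hl hr hco in
lemma condH_taylor_le (q : Config (bdry V n l r)) {τ b h : ℝ} (hτ : 0 ≤ τ) (hb : 0 < b)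
    (hm : ∀ k, ab2 (mfull β q k) ≤ τ) (hmb : ∀ k ∈ Icc l r, b ≤ (mfull β q k).2)
    (hh0 : 0 ≤ h) (hh1 : h ≤ 1) (hhb : h ≤ b / 2) {x : Config (Icc l r)}
    (hx : ∀ k, ab2 (x k - 𝔪[β] q k) ≤ h) :
    |ℋ[β] q x - ℋ[β] q (𝔪[β] q)
      - 1 / 2 * hessForm β q (x - 𝔪[β] q)|
      ≤ (18 * ddBound₂ Vᵈ (3 * (τ + 1)) + 2 / b ^ 3) * ((Icc l r).card * h ^ 3) := by
  set m := 𝔪[β] q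
  set y : Config (Icc l r) := x - m with hy
  set T := jac n (mfull β q)
  set Y := jac n (mrg _ y 0)
  have hE := Icc_subset_of_le (l := l) (r := r) (n := n) hl hr
  have hyh : ∀ k, ab2 (y k) ≤ h := hx
  have hmx : mrg _ x (ext q) = mfull β q + mrg _ y 0 := by
    have := mrg_add_smul m y (ext q) 1
    rw [one_smul, one_smul, hy, add_sub_cancel] at this
    exact this
  have hyk : ∀ k, ab2 (mrg _ y 0 k) ≤ h := fun k => by
    by_cases hk : k ∈ Icc l r
    · rw [mrg_mem _ _ hk]; exact hyh _
    · rw [mrg_notMem _ _ hk]; simpa [ab2] using hh0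
  have hTY : jac n (mrg _ x (ext q)) = T + Y := by rw [hmx, map_add]
  have htr := abs_trace_aeval_taylor_le V (B := T) (Y := Y) (c := 3 * (τ + 1)) (y := 3 * h)
    (σ := (Icc l r).card * (2 * h))
    (rowBdd_jac_of_ab2 (by positivity) fun k _ => by linarith [hm k])
    (by
      rw [← hTY]
      refine rowBdd_jac_of_ab2 (by positivity) fun k _ => ?_
      rw [hmx]
      exact (ab2_add_le _ _).trans (by linarith [hm k, hyk k]))
    (rowBdd_jac_of_ab2 hh0 fun k _ => hyk k) (sum_abs_jac_mrg_le hl hr hyh) (by positivity)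
    (by positivity)
  have hgrad := sum_grad_eq (n := n) V β (mfull β q) (mrg_zero_of_notMem y)
  rw [sum_eq_zero fun k hk => grad_mfull hc hV hl hr hco q hk _, ← sum_coe_sort (Icc l r)] at hgrad
  have hmk : ∀ k : Icc l r, mfull β q k = m k := fun k => mrg_coe _ _ _
  simp only [mrg_coe, hmk] at hgrad
  have hlogsum : ∀ x' : Config (Icc l r), ∑ k ∈ Icc 1 (n - 1),
      logCoeff β n k * log (mrg _ x' (ext q) k).2
      = ∑ k : Icc l r, logCoeff β n k * log (x' k).2
        + ∑ k ∈ Icc 1 (n - 1) \ Icc l r, logCoeff β n k * log (ext q k).2 := fun x' => by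
    rw [← sum_sdiff hE, add_comm, ← sum_coe_sort (Icc l r)]
    congr 1
    · exact sum_congr rfl fun k _ => by rw [mrg_coe]
    · exact sum_congr rfl fun k hk => by rw [mrg_notMem _ _ (Finset.mem_sdiff.1 hk).2]
  have hlog : |∑ k : Icc l r, logCoeff β n k * (log (x k).2 - log (m k).2
      - (y k).2 / (m k).2 + 1 / 2 * ((y k).2 ^ 2 / (m k).2 ^ 2))|
      ≤ (Icc l r).card * (2 / b ^ 3 * h ^ 3) := by
    refine (abs_sum_le_sum_abs _ _).trans ?_
    have h1 : ∀ k ∈ (Finset.univ : Finset (Icc l r)),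
        |logCoeff β n k * (log (x k).2 - log (m k).2
      - (y k).2 / (m k).2 + 1 / 2 * ((y k).2 ^ 2 / (m k).2 ^ 2))| ≤ 2 / b ^ 3 * h ^ 3 := fun k _ => by
      have hbk : b ≤ (m k).2 := by rw [← hmk]; exact hmb k k.2
      have hmk0 : 0 < (m k).2 := hb.trans_le hbk
      set u := (y k).2 / (m k).2 with hu
      have hu1 : |u| ≤ h / b := by
        rw [hu, abs_div, abs_of_pos hmk0]
        exact div_le_div₀ hh0 ((abs_snd_le_ab2 _).trans (hyh k)) hb hbk
      have hu2 : |u| ≤ 1 / 2 := hu1.trans (by rw [div_le_iff₀ hb]; linarith)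
      have hxk : (x k).2 = (m k).2 * (1 + u) := by
        rw [hu, mul_add, mul_one, mul_div_cancel₀ _ hmk0.ne', hy]; simp
      have hu3 : 0 < 1 + u := by linarith [(abs_le.1 hu2).1]
      have hlc : |logCoeff β n k| ≤ 1 := by
        rw [abs_of_pos (hco k k.2), logCoeff_eq]
        have : 0 ≤ ((k : ℕ) : ℝ) / n + 1 / (n * β) := by positivity
        linarith
      rw [abs_mul, hxk, log_mul hmk0.ne' hu3.ne', ← div_pow]
      have h2 := abs_log_taylor_le hu2
      have h3 : |u| ^ 3 ≤ (h / b) ^ 3 := by gcongr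
      have h4 : log (m k).2 + log (1 + u) - log (m k).2 - u + 1 / 2 * u ^ 2
          = log (1 + u) - u + u ^ 2 / 2 := by ring
      change _ * |log (m k).2 + log (1 + u) - log (m k).2 - u + 1 / 2 * u ^ 2| ≤ _
      rw [h4]
      calc _ ≤ 1 * (2 * (h / b) ^ 3) := by
            refine mul_le_mul hlc (h2.trans (by linarith)) (abs_nonneg _) zero_le_one
        _ = _ := by rw [div_pow]; ring
    refine (sum_le_card_nsmul _ _ _ h1).trans_eq ?_
    rw [nsmul_eq_mul, card_univ, Fintype.card_coe]
  have hmain : ℋ[β] q x - ℋ[β] q m - 1 / 2 * hessForm β q y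
      = ((aeval (T + Y) V).trace - (aeval T V).trace - (aeval T Vᵈ * Y).trace
        - 1 / 2 * (Y * ddMat Vᵈ T T Y).trace)
      - ∑ k : Icc l r, logCoeff β n k * (log (x k).2 - log (m k).2
      - (y k).2 / (m k).2 + 1 / 2 * ((y k).2 ^ 2 / (m k).2 ^ 2)) := by
    have e1 : ℋ[β] q x = (aeval (jac n (mrg _ x (ext q))) V).trace
      - ∑ k ∈ Icc 1 (n - 1), logCoeff β n k * log (mrg _ x (ext q) k).2 := rfl
    have e2 : ℋ[β] q m = (aeval T V).trace
      - ∑ k ∈ Icc 1 (n - 1), logCoeff β n k * log (mrg _ m (ext q) k).2 := rfl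
    have e3 : ∑ k : Icc l r, logCoeff β n k * (log (x k).2 - log (m k).2
      - (y k).2 / (m k).2 + 1 / 2 * ((y k).2 ^ 2 / (m k).2 ^ 2))
      = ∑ k : Icc l r, logCoeff β n k * log (x k).2 - ∑ k : Icc l r, logCoeff β n k * log (m k).2
        - ∑ k : Icc l r, logCoeff β n k * ((y k).2 / (m k).2)
        + 1 / 2 * ∑ k : Icc l r, logCoeff β n k * ((y k).2 ^ 2 / (m k).2 ^ 2) := by
      rw [mul_sum, ← sum_sub_distrib, ← sum_sub_distrib, ← sum_add_distrib]
      exact sum_congr rfl fun k _ => by ring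
    rw [e1, e2, hlogsum, hlogsum, hTY, e3]
    simp only [hessForm]
    change _ - 1 / 2 * ((Y * ddMat Vᵈ T T Y).trace
      + ∑ k : Icc l r, logCoeff β n k * ((y k).2 ^ 2 / (m k).2 ^ 2)) = _
    linarith
  rw [hmain]
  refine (abs_sub _ _).trans ((add_le_add htr hlog).trans_eq ?_)
  ring

lemma normalized_le_of_le {E : Type*} [MeasureSpace E] {f g : E → ℝ≥0∞} {U A : Set E}
    (hU : MeasurableSet U) (hA : MeasurableSet A) (hAU : A ⊆ U) (hg : Measurable g)
    {a b θ : ℝ≥0∞} (hfg : ∀ x ∈ U, f x ≤ a * g x) (hgf : ∀ x ∈ U, b * g x ≤ f x)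
    (hθ : θ ≤ normalized g U) (hf0 : ∫⁻ x, f x ≠ 0) (hf1 : ∫⁻ x, f x ≠ ∞)
    (hg0 : ∫⁻ x, g x ≠ 0) (hg1 : ∫⁻ x, g x ≠ ∞) :
    b * θ * normalized f A ≤ a * normalized g A := by
  rw [normalized_apply hU] at hθ
  rw [normalized_apply hA, normalized_apply hA]
  set Zf := ∫⁻ x, f x
  set Zg := ∫⁻ x, g x
  have h1 : ∫⁻ x in A, f x ≤ a * ∫⁻ x in A, g x := by
    rw [← lintegral_const_mul _ hg]
    exact setLIntegral_mono' hA fun x hx => hfg x (hAU hx)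
  have h2 : b * θ * Zg ≤ Zf := by
    have h3 : θ * Zg ≤ ∫⁻ x in U, g x := by
      refine (mul_le_mul_left hθ Zg).trans_eq ?_
      rw [mul_right_comm, ENNReal.inv_mul_cancel hg0 hg1, one_mul]
    calc b * θ * Zg = b * (θ * Zg) := mul_assoc _ _ _
      _ ≤ b * ∫⁻ x in U, g x := mul_le_mul_right h3 b
      _ = ∫⁻ x in U, b * g x := (lintegral_const_mul _ hg).symm
      _ ≤ ∫⁻ x in U, f x := setLIntegral_mono' hU hgf
      _ ≤ Zf := setLIntegral_le_lintegral _ _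
  have h4 : b * θ * Zf⁻¹ ≤ Zg⁻¹ := by
    calc b * θ * Zf⁻¹ = b * θ * (Zg * Zg⁻¹) * Zf⁻¹ := by rw [ENNReal.mul_inv_cancel hg0 hg1, mul_one]
      _ = b * θ * Zg * (Zf⁻¹ * Zg⁻¹) := by ring
      _ ≤ Zf * (Zf⁻¹ * Zg⁻¹) := mul_le_mul_left h2 _
      _ = Zg⁻¹ := by rw [← mul_assoc, ENNReal.mul_inv_cancel hf0 hf1, one_mul]
  calc b * θ * (Zf⁻¹ * ∫⁻ x in A, f x) = b * θ * Zf⁻¹ * ∫⁻ x in A, f x := by ring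
    _ ≤ Zg⁻¹ * (a * ∫⁻ x in A, g x) := mul_le_mul' h4 h1
    _ = a * (Zg⁻¹ * ∫⁻ x in A, g x) := by ring

lemma le_mul_of_ofReal_mul_le {x y : ℝ≥0∞} {a b d : ℝ} (hb : 0 < b)
    (h : ofReal b * x ≤ ofReal a * y) (hab : a ≤ d * b) : x ≤ ofReal d * y := by
  have hb0 : ofReal b ≠ 0 := by simpa using hb
  refine (ENNReal.mul_le_mul_iff_right hb0 ofReal_ne_top).1 (h.trans ?_)
  rw [← mul_assoc, ← ofReal_mul hb.le]
  exact mul_le_mul_left (ofReal_le_ofReal (by linarith)) _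

/-! ### Asymptotics -/

lemma tendsto_natCast_rpow_of_neg {s : ℝ} (hs : s < 0) :
    Tendsto (fun n : ℕ => (n : ℝ) ^ s) atTop (𝓝 0) := by
  have h := (tendsto_rpow_neg_atTop (neg_pos.2 hs)).comp tendsto_natCast_atTop_atTop
  simp only [neg_neg] at h
  exact h

lemma eventually_mul_rpow_le {s : ℝ} (hs : s < 0) (A : ℝ) {y : ℝ} (hy : 0 < y) :
    ∀ᶠ n : ℕ in atTop, A * (n : ℝ) ^ s ≤ y := by
  have h := (tendsto_natCast_rpow_of_neg hs).const_mul A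
  rw [mul_zero] at h
  exact h.eventually_le_const hy

lemma tendsto_mul_exp_neg_rpow {κ p : ℝ} (hκ : 0 < κ) (hp : 0 < p) :
    Tendsto (fun n : ℕ => (n : ℝ) * exp (-(κ * (n : ℝ) ^ p))) atTop (𝓝 0) := by
  have h := ((tendsto_rpow_mul_exp_neg_mul_atTop_nhds_zero (1 / p) κ hκ).comp
    (tendsto_rpow_atTop hp)).comp tendsto_natCast_atTop_atTop
  refine h.congr fun n => ?_
  simp only [Function.comp]
  rw [← rpow_mul (Nat.cast_nonneg n), mul_one_div, div_self hp.ne', rpow_one, neg_mul]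

lemma eventually_mul_exp_neg_rpow_le (A : ℝ) {κ p : ℝ} (hκ : 0 < κ) (hp : 0 < p) {y : ℝ}
    (hy : 0 < y) : ∀ᶠ n : ℕ in atTop, A * ((n : ℝ) * exp (-(κ * (n : ℝ) ^ p))) ≤ y := by
  have h := (tendsto_mul_exp_neg_rpow hκ hp).const_mul A
  rw [mul_zero] at h
  exact h.eventually_le_const hy

lemma natCast_mul_rpow_sq (hn : 0 < n) (δ : ℝ) :
    (n : ℝ) * ((n : ℝ) ^ (δ - 1 / 2)) ^ 2 = (n : ℝ) ^ (2 * δ) := by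
  have hn' : (0 : ℝ) < n := mod_cast hn
  rw [← Real.rpow_natCast, ← rpow_mul hn'.le]
  nth_rewrite 1 [← rpow_one (n : ℝ)]
  rw [← rpow_add hn']
  congr 1
  push_cast; ring

lemma natCast_mul_rpow_cube (hn : 0 < n) (δ ε : ℝ) :
    (n : ℝ) * ((n : ℝ) ^ (1 / 2 - ε) * ((n : ℝ) ^ (δ - 1 / 2)) ^ 3) = (n : ℝ) ^ (3 * δ - ε) := by
  have hn' : (0 : ℝ) < n := mod_cast hn
  rw [← Real.rpow_natCast, ← rpow_mul hn'.le, ← rpow_add hn']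
  nth_rewrite 1 [← rpow_one (n : ℝ)]
  rw [← rpow_add hn']
  congr 1
  push_cast; ring

lemma sq_lt_sq2_of_lt_ab2 {u : ℝ × ℝ} (hh : 0 ≤ h) (hu : h < ab2 u) : (h / 2) ^ 2 < sq2 u := by
  have h1 := ab2_sq_le u
  have h2 : h ^ 2 < ab2 u ^ 2 := by gcongr
  nlinarith [sq_nonneg h]

lemma measurable_ab2 : Measurable ab2 := by unfold ab2; fun_prop

lemma measurableSet_ab2_le (m : Config J) (h : ℝ) :
    MeasurableSet {x : Config J | ∀ k, ab2 (x k - m k) ≤ h} := by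
  simp only [ofPred_forall]
  exact MeasurableSet.iInter fun k =>
    measurableSet_le (measurable_ab2.comp (by fun_prop)) measurable_const

lemma measure_compl_ab2_le (P : Measure (Config J)) (m : Config J) {h y : ℝ}
    (hh : 0 ≤ h) (hy : ∀ j, P {x | (h / 2) ^ 2 < sq2 (x j - m j)} ≤ ofReal y) :
    P {x | ∀ k, ab2 (x k - m k) ≤ h}ᶜ ≤ ofReal (J.card * y) := by
  have hsub : {x : Config J | ∀ k, ab2 (x k - m k) ≤ h}ᶜ
      ⊆ ⋃ j, {x | (h / 2) ^ 2 < sq2 (x j - m j)} := fun x hx => by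
    have hx : ¬ ∀ k, ab2 (x k - m k) ≤ h := hx
    push Not at hx
    obtain ⟨j, hj⟩ := hx
    exact mem_iUnion.2 ⟨j, sq_lt_sq2_of_lt_ab2 hh hj⟩
  refine (measure_mono hsub).trans ((measure_iUnion_fintype_le _ _).trans
    ((sum_le_card_nsmul _ _ _ fun j _ => hy j).trans_eq ?_))
  rw [card_univ, Fintype.card_coe, nsmul_eq_mul, ofReal_mul (Nat.cast_nonneg _), ofReal_natCast]

set_option maxHeartbeats 1000000 in
include hc hV hβ hε0 hε1 in
/-- The conditional law and its Gaussian approximation are close near the conditional minimizer,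
and are concentrated there. -/
lemma exists_gauss_comparison (hδ0 : 0 < δ) (hδ : δ < ε / 3) {K L η : ℝ} (hL : 0 < L) (hη : 0 < η) :
    ∃ N : ℕ, 0 < N ∧ ∀ n : ℕ, N ≤ n → ∀ l r : ℕ, V.natDegree + 1 ≤ l → (r : ℝ) ≤ (1 - ε) * n →
      ((Icc l r).card : ℝ) ≤ (n : ℝ) ^ (1 / 2 - ε) →
      ∀ q ∈ goodBdry V β δ K n l r,
      condLaw β q {x | ∀ k, ab2 (x k - 𝔪[β] q k) ≤ L * (n : ℝ) ^ (δ - 1 / 2)}ᶜ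
        ≤ ofReal η ∧
      γ[β] q {x | ∀ k, ab2 (x k - 𝔪[β] q k) ≤ L * (n : ℝ) ^ (δ - 1 / 2)}ᶜ
        ≤ ofReal η ∧
      ∀ A, MeasurableSet A →
        A ⊆ {x | ∀ k, ab2 (x k - 𝔪[β] q k) ≤ L * (n : ℝ) ^ (δ - 1 / 2)} →
        condLaw β q A ≤ ofReal (1 + η) * γ[β] q A ∧
        γ[β] q A ≤ ofReal (1 + η) * condLaw β q A := by
  obtain ⟨C, κ, s₀, N₁, hC, hκ, hs₀, hN₁, hconc⟩ := exists_cond_concentration hc hV hβ hε0 hε1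
  obtain ⟨τ, b, s₁, N₂, hτ, hb, hs₁, hN₂, hbd⟩ := exists_condMin_bounds hc hV hβ hε0 hε1
  set η' := min η 1 / 8 with hη'
  have hη'0 : 0 < η' := by positivity
  have hη'1 : η' ≤ 1 / 8 := by rw [hη']; linarith [min_le_right η 1]
  have hη'2 : η' ≤ η / 8 := by rw [hη']; linarith [min_le_left η 1]
  set C₂ := 18 * ddBound₂ Vᵈ (3 * (τ + 1)) + 2 / b ^ 3
  have hC₂0 : 0 ≤ C₂ := by
    have := ddBound₂_nonneg Vᵈ (c := 3 * (τ + 1)) (by positivity)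
    positivity
  have e1 := eventually_mul_rpow_le (show δ - 1 / 2 < 0 by linarith) K (lt_min hs₀ hs₁)
  have e2 := eventually_mul_rpow_le (show δ - 1 / 2 < 0 by linarith) L
    (lt_min one_pos (show 0 < b / 2 by positivity))
  have e3 := eventually_mul_rpow_le (show 3 * δ - ε < 0 by linarith) (β * C₂ * L ^ 3) hη'0
  have e4 := (eventually_mul_exp_neg_rpow_le 1 one_pos one_pos (half_pos hη'0)).and
    (eventually_mul_exp_neg_rpow_le C (show 0 < κ * L ^ 2 / 4 by positivity)
      (show 0 < 2 * δ by positivity) (half_pos hη'0))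
  obtain ⟨N₃, hN₃⟩ := eventually_atTop.1 (e1.and (e2.and (e3.and e4)))
  refine ⟨max N₁ (max N₂ N₃), lt_max_of_lt_left hN₁, fun n hn l r hl hr hcard q hq => ?_⟩
  obtain ⟨e1, e2, e3, e4⟩ := hN₃ n (le_trans (le_trans (le_max_right _ _) (le_max_right _ _)) hn)
  have hn1 := le_trans (le_max_left _ _) hn
  have hn0 : 0 < n := by omega
  have hq' : ∀ e, ab2 (q e - dagger V β n e) ≤ min s₀ s₁ := fun e => (hq e).trans e1
  have hconc := hconc n hn1 l r hl hr q fun e => (hq' e).trans (min_le_left _ _)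
  obtain ⟨hrn, hco, hbd⟩ := hbd n (le_trans (le_trans (le_max_left _ _) (le_max_right _ _)) hn)
    l r hl hr
  obtain ⟨hm, hmb⟩ := hbd q fun e => (hq' e).trans (min_le_right _ _)
  have hl1 : 1 ≤ l := by omega
  have hr1 : r + 1 ≤ n := by omega
  have hrp := natCast_mul_rpow_sq hn0 δ
  have hrc := natCast_mul_rpow_cube hn0 δ ε
  set x₀ := (n : ℝ) ^ (δ - 1 / 2)
  have hh0 : 0 ≤ L * x₀ := by positivity
  set m := 𝔪[β] q
  set U := {x : Config (Icc l r) | ∀ k, ab2 (x k - m k) ≤ L * x₀}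
  have hUm : MeasurableSet U := measurableSet_ab2_le _ _
  have hcardn : ((Icc l r).card : ℝ) ≤ n := by
    rw [Nat.card_Icc]
    have : r + 1 - l ≤ n := by omega
    exact_mod_cast this
  have hexp : κ * n * (L * x₀ / 2) ^ 2 = κ * L ^ 2 / 4 * (n : ℝ) ^ (2 * δ) := by rw [← hrp]; ring
  have hc4 : C * exp (-(κ * n * (L * x₀ / 2) ^ 2))
      ≤ exp (-n) + C * exp (-(κ * n * (L * x₀ / 2) ^ 2)) := by
    linarith [exp_pos (-(n : ℝ))]
  have h4 : (Icc l r).card * (exp (-n) + C * exp (-(κ * n * (L * x₀ / 2) ^ 2))) ≤ η' := by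
    rw [rpow_one, one_mul, one_mul] at e4
    rw [hexp]
    have : 0 ≤ exp (-(n : ℝ)) + C * exp (-(κ * L ^ 2 / 4 * (n : ℝ) ^ (2 * δ))) := by positivity
    refine (mul_le_mul_of_nonneg_right hcardn this).trans ?_
    linarith [e4.1, e4.2]
  have hP : condLaw β q Uᶜ ≤ ofReal η' :=
    (measure_compl_ab2_le _ _ hh0 fun j => (hconc j _).1).trans (ofReal_le_ofReal h4)
  have hN : γ[β] q Uᶜ ≤ ofReal η' :=
    (measure_compl_ab2_le _ _ hh0 fun j => ((hconc j _).2).trans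
      (ofReal_le_ofReal hc4)).trans (ofReal_le_ofReal h4)
  have hone : ∀ P : Measure (Config (Icc l r)), P univ = 1 → P Uᶜ ≤ ofReal η' →
      ofReal (1 - η') ≤ P U := fun P h1 h2 => by
    rw [ENNReal.ofReal_sub _ hη'0.le, ofReal_one, tsub_le_iff_right, ← h1,
      ← measure_add_measure_compl hUm]
    exact add_le_add_right h2 _
  have hPU := hone _ (condLaw_univ hc hV hl1 hr1 hco hβ q) hP
  have hNU := hone _ (nuCond_univ hc hV hl1 hr1 hco hβ q) hN
  have hle : ofReal η' ≤ ofReal η := ofReal_le_ofReal (by linarith)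
  refine ⟨hP.trans hle, hN.trans hle, fun A hA hAU => ?_⟩
  set H := n * β * ℋ[β] q m with hH
  have htay : ∀ x ∈ U, |n * β * ℋ[β] q x - H
      - n * β / 2 * hessForm β q (x - m)| ≤ η' := fun x hx => by
    have h1 := condH_taylor_le hc hV hβ hl1 hr1 hco q hτ.le hb hm hmb hh0
      (e2.trans (min_le_left _ _)) (e2.trans (min_le_right _ _)) hx
    have h2 : n * β * ℋ[β] q x - H - n * β / 2 * hessForm β q (x - m)
        = n * β * (ℋ[β] q x - ℋ[β] q m
          - 1 / 2 * hessForm β q (x - m)) := by rw [hH]; ring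
    rw [h2, abs_mul, abs_of_nonneg (by positivity)]
    refine (mul_le_mul_of_nonneg_left h1 (by positivity)).trans (le_trans ?_ e3)
    rw [← hrc]
    calc (n : ℝ) * β * (C₂ * ((Icc l r).card * (L * x₀) ^ 3))
        ≤ n * β * (C₂ * ((n : ℝ) ^ (1 / 2 - ε) * (L * x₀) ^ 3)) := by gcongr
      _ = _ := by ring
  have hpos : ∀ x ∈ U, ∀ k, 0 < (x k).2 := fun x hx k => by
    have h1 := (abs_snd_le_ab2 _).trans (hx k)
    have h2 := (abs_le.1 h1).1
    have h3 := hmb k k.2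
    rw [mfull, mrg_coe] at h3
    have h4 := e2.trans (min_le_right _ _)
    rw [Prod.snd_sub] at h2
    change b ≤ (m k).2 at h3
    linarith
  have hfin : exp (2 * η') ≤ (1 + η) * (1 - η') := by
    have h1 : exp (2 * η') ≤ 1 / (1 - 2 * η') := by
      rw [le_div_iff₀ (by linarith)]
      have h2 := Real.one_sub_le_exp_neg (2 * η')
      have h3 := mul_le_mul_of_nonneg_left h2 (exp_pos (2 * η')).le
      rwa [← exp_add, add_neg_cancel, exp_zero] at h3
    refine h1.trans ?_
    rw [div_le_iff₀ (by linarith)]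
    nlinarith [mul_pos hη hη'0, mul_pos hη'0 hη'0, mul_nonneg hη.le (sq_nonneg η')]
  have hprod : ∀ x y : ℝ, x = y + 2 * η' → ofReal (exp y) * ofReal (1 - η')
      = ofReal (exp y * (1 - η')) ∧ 0 < exp y * (1 - η') ∧
        exp x ≤ (1 + η) * (exp y * (1 - η')) := fun x y h => by
    have h1 : 0 < 1 - η' := by linarith
    refine ⟨(ofReal_mul (exp_pos _).le).symm, by positivity, ?_⟩
    rw [h, exp_add]
    have := mul_le_mul_of_nonneg_left hfin (exp_pos y).le
    linarith
  have hgm := (measurable_gauss hc hV hl1 hr1 hco (β := β)).comp (measurable_const.prodMk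
    measurable_id : Measurable fun x : Config (Icc l r) => (q, x))
  have hfm := measurable_condDens_right β q
  have hf0 := lintegral_condDens_ne_zero β q
  have hf1 := lintegral_condDens_ne_top hc hV hβ hl1 hr1 hco q
  have hg0 := lintegral_gauss_ne_zero hc hV hl1 hr1 hco (β := β) q
  have hg1 := lintegral_hess_ne_top hc hV hl1 hr1 hco hβ q
  have hmulle : ∀ x y z : ℝ, x ≤ y + z → ofReal (exp x)
      ≤ ofReal (exp y) * ofReal (exp z) := fun x y z h => by
    rw [← ofReal_mul (exp_pos _).le, ← exp_add]
    exact ofReal_le_ofReal (exp_le_exp.2 h)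
  have hlemul : ∀ x y z : ℝ, y + z ≤ x → ofReal (exp y) * ofReal (exp z)
      ≤ ofReal (exp x) := fun x y z h => by
    rw [← ofReal_mul (exp_pos _).le, ← exp_add]
    exact ofReal_le_ofReal (exp_le_exp.2 h)
  rw [nuCond_eq hc hV hl1 hr1 hco] at hNU ⊢
  constructor
  · have h1 := normalized_le_of_le hUm hA hAU hgm
      (f := condDens β q) (a := ofReal (exp (-H + η')))
      (b := ofReal (exp (-H - η'))) (fun x hx => by
        rw [condDens, if_pos (hpos x hx)]
        exact hmulle _ _ _ (by linarith [(abs_le.1 (htay x hx)).1])) (fun x hx => by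
        rw [condDens, if_pos (hpos x hx)]
        exact hlemul _ _ _ (by linarith [(abs_le.1 (htay x hx)).2])) hNU hf0 hf1 hg0 hg1
    obtain ⟨h2, h3, h4⟩ := hprod (-H + η') (-H - η') (by ring)
    rw [h2] at h1
    exact le_mul_of_ofReal_mul_le h3 h1 h4
  · have h1 := normalized_le_of_le hUm hA hAU hfm
      (f := fun x => ofReal (exp (-(n * β / 2 * hessForm β q (x - m)))))
      (a := ofReal (exp (H + η')))
      (b := ofReal (exp (H - η'))) (fun x hx => by
        rw [condDens, if_pos (hpos x hx)]
        exact hmulle _ _ _ (by linarith [(abs_le.1 (htay x hx)).2])) (fun x hx => by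
        rw [condDens, if_pos (hpos x hx)]
        exact hlemul _ _ _ (by linarith [(abs_le.1 (htay x hx)).1])) hPU hg0 hg1 hf0 hf1
    obtain ⟨h2, h3, h4⟩ := hprod (H + η') (H - η') (by ring)
    rw [h2] at h1
    exact le_mul_of_ofReal_mul_le h3 h1 h4

/-! ### Marginals of the law -/

section

variable (hn : 0 < n)

include hc hV hβ hn in
lemma law_univ : law V β n univ = 1 := by
  rw [law_density_eq]
  refine normalized_univ ?_ ?_
  · rw [← Lam_univ]; exact Lam_univ_ne_zero V β n
  · rw [← Lam_univ]; exact Lam_univ_ne_top hc hV hβ hn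

lemma law_preimage_le {X Y : Set (ℕ → ℝ × ℝ)} (hX : MeasurableSet X) (hY : MeasurableSet Y)
    {κ : ℝ≥0∞} (h : Lam V β n Y ≤ κ * Lam V β n X) :
    law V β n (seq ⁻¹' Y) ≤ κ * law V β n (seq ⁻¹' X) := by
  rw [← Measure.map_apply measurable_seq hX, ← Measure.map_apply measurable_seq hY, law_map_seq,
    Measure.smul_apply, Measure.smul_apply, smul_eq_mul, smul_eq_mul, mul_left_comm]
  exact mul_le_mul_right h _

include hc hV hβ hn in
lemma law_preimage_le_of_univ {Y : Set (ℕ → ℝ × ℝ)} (hY : MeasurableSet Y)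
    {κ : ℝ≥0∞} (h : Lam V β n Y ≤ κ * Lam V β n univ) : law V β n (seq ⁻¹' Y) ≤ κ := by
  have := law_preimage_le MeasurableSet.univ hY h
  rwa [Set.preimage_univ, law_univ hc hV hβ hn, mul_one] at this

end

lemma measurableSet_goodBdry (V : ℝ[X]) (β δ K : ℝ) (n l r : ℕ) :
    MeasurableSet (goodBdry V β δ K n l r) := by
  unfold goodBdry
  simp only [ofPred_forall]
  exact MeasurableSet.iInter fun i => measurableSet_le (by fun_prop) measurable_const

section

include hc hV hl hr hco

include hβ in
lemma lintegral_law_condLaw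
    {F : Config (bdry V n l r) × Config (Icc l r) → ℝ≥0∞} (hF : Measurable F) :
    ∫⁻ ω, F (restr _ ω, restr _ ω) ∂(law V β n)
      = ∫⁻ ω, ∫⁻ x, F (restr _ ω, x) ∂(condLaw β (restr (bdry V n l r) ω)) ∂(law V β n) := by
  have hd : Measurable fun ω : Field n => dens V β n (seq ω) :=
    (measurable_dens V β n).comp measurable_seq
  have hG : Measurable fun q : Config (bdry V n l r) => ∫⁻ x, F (q, x) ∂(condLaw β q) := by
    have h1 : ∀ q, ∫⁻ x, F (q, x) ∂(condLaw β q)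
        = (∫⁻ x, condDens β q x)⁻¹ * ∫⁻ x, condDens β q x * F (q, x) := fun q =>
      lintegral_normalized (measurable_condDens_right β q)
        (hF.comp (measurable_const.prodMk measurable_id))
    simp only [h1]
    exact (measurable_condDens V β n l r).lintegral_prod_right'.inv.mul
      (((measurable_condDens V β n l r).mul hF).lintegral_prod_right')
  rw [law_density_eq]
  refine (lintegral_normalized hd (hF.comp ((measurable_restr _).prodMk
    (measurable_restr _)))).trans (Eq.trans ?_ (lintegral_normalized hd
      (hG.comp (measurable_restr _))).symm)
  exact congrArg _ (lintegral_dens_condLaw hc hV hβ hl hr hco hF)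

include hβ in
lemma law_inter_eq {B : Set (Config (bdry V n l r))} (hB : MeasurableSet B) (hA : MeasurableSet A) :
    law V β n (restr (bdry V n l r) ⁻¹' B ∩ restr (Icc l r) ⁻¹' A)
      = ∫⁻ ω in restr (bdry V n l r) ⁻¹' B, condLaw β (restr (bdry V n l r) ω) A ∂(law V β n) := by
  classical
  have hmB := measurable_restr (n := n) (bdry V n l r) hB
  have hmA := measurable_restr (n := n) (Icc l r) hA
  have h1 := lintegral_law_condLaw hc hV hβ hl hr hco
    (F := fun z => B.indicator 1 z.1 * A.indicator 1 z.2)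
    (((measurable_one.indicator hB).comp measurable_fst).mul
      ((measurable_one.indicator hA).comp measurable_snd))
  rw [← lintegral_indicator_one (hmB.inter hmA), ← lintegral_indicator hmB]
  refine Eq.trans (lintegral_congr fun ω => ?_) (h1.trans (lintegral_congr fun ω => ?_))
  · simp only [Set.indicator_apply, Set.mem_inter_iff, Set.mem_preimage, Pi.one_apply]
    split_ifs <;> simp_all
  · refine (lintegral_const_mul (B.indicator 1 (restr (bdry V n l r) ω))
      (measurable_one.indicator hA)).trans ?_
    rw [lintegral_indicator_one hA]
    simp only [Set.indicator_apply, Set.mem_preimage, Pi.one_apply]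
    split_ifs <;> simp

omit hc hV hl hr hco in
lemma muI_apply (hA : MeasurableSet A) :
    muI V β n l r A = law V β n (restr (Icc l r) ⁻¹' A) :=
  Measure.map_apply (measurable_restr _) hA

include hβ in
lemma muI_eq_add {B : Set (Config (bdry V n l r))} (hB : MeasurableSet B) (hA : MeasurableSet A) :
    muI V β n l r A
      = ∫⁻ ω in restr (bdry V n l r) ⁻¹' B, condLaw β (restr (bdry V n l r) ω) A ∂(law V β n)
        + law V β n (restr (bdry V n l r) ⁻¹' Bᶜ ∩ restr (Icc l r) ⁻¹' A) := by
  rw [← law_inter_eq hc hV hβ hl hr hco hB hA, muI_apply hA,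
    ← measure_inter_add_sdiff _ (measurable_restr (n := n) (bdry V n l r) hB), inter_comm,
    Set.sdiff_eq, inter_comm (restr _ ⁻¹' A), Set.preimage_compl]

lemma nuI_apply (δ K : ℝ) (q₀ : Config (bdry V n l r)) (hA : MeasurableSet A) :
    nuI V β δ K n l r q₀ A = ∫⁻ ω in restr (bdry V n l r) ⁻¹' (goodBdry V β δ K n l r),
          nuCond V β n l r (restr _ ω) A ∂(law V β n)
        + law V β n (restr (bdry V n l r) ⁻¹' (goodBdry V β δ K n l r)ᶜ) * γ[β] q₀ A := by
  classical
  have hG := measurableSet_goodBdry V β δ K n l r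
  have hm : Measurable fun q => nuCond V β n l r (if q ∈ goodBdry V β δ K n l r then q else q₀) :=
    (measurable_nuCond hc hV hl hr hco).comp (Measurable.ite hG measurable_id measurable_const)
  have hmG := measurable_restr (n := n) (bdry V n l r) hG
  unfold nuI
  rw [Measure.bind_apply hA hm.aemeasurable]
  refine (lintegral_map ((Measure.measurable_coe hA).comp hm) (measurable_restr _)).trans ?_
  rw [← lintegral_add_compl _ hmG]
  congr 1
  · refine setLIntegral_congr_fun hmG fun ω hω => ?_
    simp only [Function.comp]
    rw [if_pos (show restr (bdry V n l r) ω ∈ _ from hω)]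
  · rw [Set.preimage_compl, mul_comm, ← setLIntegral_const]
    refine setLIntegral_congr_fun hmG.compl fun ω hω => ?_
    simp only [Function.comp]
    rw [if_neg (show restr (bdry V n l r) ω ∉ goodBdry V β δ K n l r from hω)]

end

/-! ### Concentration of the boundary values -/

/-- Concentration of the entries, and of the boundary values given the values on `I`. -/
def Concentrated (V : ℝ[X]) (β ε c₀ C κ τ : ℝ) (n : ℕ) : Prop :=
  law V β n {ω | ∃ k ∈ Icc 1 n, τ < sq2 (seq ω k)} ≤ ofReal (C * exp (-(n / 2))) ∧
      (∀ j : ℕ, 1 ≤ j → c₀ * log n ≤ (j : ℝ) + V.natDegree →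
        (j : ℝ) ≤ (1 - ε) * n + V.natDegree + 1 → ∀ s : ℝ, 0 ≤ s →
        law V β n {ω | s ^ 2 < sq2 (seq ω j - dagger V β n j)}
          ≤ ofReal (C * exp (-(n / 2)) + C * exp (-(κ * n * s ^ 2)))) ∧
      ∀ l r : ℕ, c₀ * log n ≤ l → (r : ℝ) ≤ (1 - ε) * n → ∀ δ K : ℝ, 0 ≤ K →
      law V β n (restr (bdry V n l r) ⁻¹' (goodBdry V β δ K n l r)ᶜ)
        ≤ ofReal (C * exp (-(n / 2)) + C * exp (-(κ * K ^ 2 * n ^ (2 * δ)))) ∧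
      ∀ T : ℝ, 0 ≤ T → T * (n : ℝ) ^ (δ - 1 / 2) ≤ 1 / 2 →
      ∀ A : Set (Config (Icc l r)), MeasurableSet A →
        (∀ x ∈ A, ∀ k, ab2 (x k - dagger V β n k) ≤ T * (n : ℝ) ^ (δ - 1 / 2)) →
      law V β n (restr (bdry V n l r) ⁻¹' (goodBdry V β δ K n l r)ᶜ ∩ restr (Icc l r) ⁻¹' A)
        ≤ ofReal (C * exp (-(n / 2)) + C * exp (C * T ^ 2 * n ^ (2 * δ) - κ * K ^ 2 * n ^ (2 * δ)))
          * muI V β n l r A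

include hc hV hβ hε0 hε1 in
lemma exists_bdry_concentration :
    ∃ (c₀ C κ τ : ℝ) (N : ℕ), 0 < c₀ ∧ 0 < C ∧ 0 < κ ∧ 0 < τ ∧ 0 < N ∧ ∀ n : ℕ, N ≤ n →
      Concentrated V β ε c₀ C κ τ n := by
  obtain ⟨c₀, C, κ, τ, N, hc₀, hC, hκ, hτ, hN, hconc⟩ := exists_concentration hc hV hβ hε0 hε1
  set D := V.natDegree
  refine ⟨c₀, (2 * D + 1) * C, κ / 4, τ, N, hc₀, by positivity, by positivity, hτ, hN,
    fun n hn => ?_⟩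
  have hn0 : 0 < n := by omega
  have hn0' : (0 : ℝ) < n := mod_cast hn0
  have hCle : C ≤ (2 * D + 1) * C := by nlinarith
  have hunc := hconc n hn 1 0 (by
    have : 0 ≤ (1 - ε) * (n : ℝ) := mul_nonneg (by linarith) hn0'.le
    simpa using this) 0 le_rfl (by norm_num)
    univ MeasurableSet.univ (fun _ _ k hk => by simp at hk) (fun _ _ _ _ => trivial)
  simp only [Set.univ_inter] at hunc
  obtain ⟨hbox, hsite⟩ := hunc
  have hmS : ∀ (j : ℕ) (s : ℝ), MeasurableSet {v : ℕ → ℝ × ℝ | s ^ 2 < sq2 (v j - dagger V β n j)} :=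
    fun j s => measurableSet_lt measurable_const (measurable_sq2_sub j _)
  have hmono : ∀ x y : ℝ, x ≤ y → C * exp (-((n : ℝ) / 2)) + C * exp x
      ≤ (2 * D + 1) * C * exp (-((n : ℝ) / 2)) + (2 * D + 1) * C * exp y := fun x y h => by
    have := exp_le_exp.2 h
    gcongr
  refine ⟨?_, ?_, ?_⟩
  · have hm : MeasurableSet {v : ℕ → ℝ × ℝ | ∃ k ∈ Icc 1 n, τ < sq2 (v k)} := by
      have : {v : ℕ → ℝ × ℝ | ∃ k ∈ Icc 1 n, τ < sq2 (v k)}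
          = ⋃ k ∈ Icc 1 n, {v | τ < sq2 (v k)} := by
        ext v; simp
      rw [this]
      exact Finset.measurableSet_biUnion _ fun k _ =>
        measurableSet_lt measurable_const (measurable_sq2 k)
    refine (law_preimage_le_of_univ hc hV hβ hn0 hm hbox).trans (ofReal_le_ofReal ?_)
    gcongr
  · intro j hj1 hj2 hj3 s hs
    refine (law_preimage_le_of_univ hc hV hβ hn0 (hmS j s)
      (hsite j hj1 (by simp) hj2 hj3 s hs)).trans (ofReal_le_ofReal (hmono _ _ ?_))
    have : 0 ≤ κ * n * s ^ 2 := by positivity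
    linarith
  · intro l r hl hr δ K hK
    have hrp := natCast_mul_rpow_sq hn0 δ
    set h := (n : ℝ) ^ (δ - 1 / 2)
    set s := K * h / 2 with hs
    have hs0 : 0 ≤ s := by positivity
    have hbd : ∀ e ∈ bdry V n l r, 1 ≤ e ∧ e ∉ Icc l r ∧
        c₀ * log n ≤ (e : ℝ) + D ∧ (e : ℝ) ≤ (1 - ε) * n + D + 1 := fun e he => by
      obtain ⟨h1, h2, h3, h4⟩ := mem_filter.1 he
      have h5 : V.natDegree / 2 ≤ D := Nat.div_le_self _ _
      have h6 : (l : ℝ) ≤ e + D := mod_cast h3.trans (by omega)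
      have h7 : (e : ℝ) ≤ r + D := mod_cast h4.trans (by omega)
      exact ⟨(mem_Icc.1 h1).1, h2, by linarith, by linarith⟩
    have hcard : (bdry V n l r).card ≤ 2 * D := by
      refine le_trans (card_le_card fun e he => ?_) (card_near_le D l r)
      obtain ⟨h1, h2, h3, h4⟩ := mem_filter.1 he
      have h5 : V.natDegree / 2 ≤ D := Nat.div_le_self _ _
      rw [mem_Icc] at h1 h2
      rw [mem_union, mem_Ico, mem_Ioc]; omega
    have hcard' : ((bdry V n l r).card : ℝ) ≤ 2 * D + 1 := by
      have : ((bdry V n l r).card : ℝ) ≤ 2 * D := mod_cast hcard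
      linarith
    have hbad : ∀ ω : Field n, restr (bdry V n l r) ω ∈ (goodBdry V β δ K n l r)ᶜ →
        ∃ e : bdry V n l r, s ^ 2 < sq2 (seq ω e - dagger V β n e) := fun ω hω => by
      have hω : ¬ ∀ e : bdry V n l r, ab2 (seq ω e - dagger V β n e) ≤ K * h := hω
      push Not at hω
      obtain ⟨e, he⟩ := hω
      exact ⟨e, sq_lt_sq2_of_lt_ab2 (by positivity) he⟩
    have hsn : κ * n * s ^ 2 = κ / 4 * K ^ 2 * n ^ (2 * δ) := by rw [← hrp, hs]; ring
    have hfin : ∀ y : ℝ, 0 ≤ y → ((bdry V n l r).card : ℝ≥0∞) * ofReal y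
        ≤ ofReal ((2 * D + 1) * y) := fun y hy => by
      rw [← ofReal_natCast, ← ofReal_mul (Nat.cast_nonneg _)]
      exact ofReal_le_ofReal (mul_le_mul_of_nonneg_right hcard' hy)
    constructor
    · have hsub : restr (bdry V n l r) ⁻¹' (goodBdry V β δ K n l r)ᶜ
          ⊆ ⋃ e : bdry V n l r, {ω : Field n | s ^ 2 < sq2 (seq ω e - dagger V β n e)} :=
        fun ω hω => mem_iUnion.2 (hbad ω hω)
      refine (measure_mono hsub).trans ((measure_iUnion_fintype_le _ _).trans
        ((sum_le_card_nsmul _ _ (ofReal (C * exp (-((n : ℝ) / 2))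
          + C * exp (-(κ * n * s ^ 2)))) fun e _ => ?_).trans ((le_of_eq ?_).trans (hfin
          (C * exp (-((n : ℝ) / 2)) + C * exp (-(κ * n * s ^ 2))) (by positivity)))))
            |>.trans (ofReal_le_ofReal ?_)
      · obtain ⟨h1, h2, h3, h4⟩ := hbd e e.2
        refine (law_preimage_le_of_univ hc hV hβ hn0 (hmS e s)
          (hsite e h1 (by simp) h3 h4 s hs0)).trans (ofReal_le_ofReal (le_of_eq ?_))
        congr 3
        ring
      · rw [card_univ, Fintype.card_coe, nsmul_eq_mul]
      · rw [hsn]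
        exact le_of_eq (by ring)
    · intro T hT0 hT1 A hA hAT
      set X : Set (ℕ → ℝ × ℝ) := {v | (fun k : Icc l r => v k) ∈ A}
      have hXm : MeasurableSet X := (measurable_pi_lambda (fun (v : ℕ → ℝ × ℝ) (k : Icc l r) => v k)
          fun k => measurable_pi_apply _) hA
      have hcond := (hconc n hn l r hr (T * h) (by positivity) hT1 X hXm
        (fun v hv k hk => hAT _ hv ⟨k, hk⟩) (fun v hv v' hv' => by
          have : (fun k : Icc l r => v' k) = fun k : Icc l r => v k :=
            funext fun k => hv' k k.2
          change (fun k : Icc l r => v' k) ∈ A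
          rw [this]
          exact hv)).2
      have hsub : restr (bdry V n l r) ⁻¹' (goodBdry V β δ K n l r)ᶜ ∩ restr (Icc l r) ⁻¹' A
          ⊆ ⋃ e : bdry V n l r, seq (n := n) ⁻¹' (X ∩ {v | s ^ 2 < sq2 (v e - dagger V β n e)}) := by
        rintro ω ⟨h1, h2⟩
        obtain ⟨e, he⟩ := hbad ω h1
        exact mem_iUnion.2 ⟨e, h2, he⟩
      have hmu : muI V β n l r A = law V β n (seq ⁻¹' X) := muI_apply hA
      set y := C * exp (-((n : ℝ) / 2)) + C * exp (C * n * (T * h) ^ 2 - κ * n * s ^ 2) with hy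
      refine (measure_mono hsub).trans ((measure_iUnion_fintype_le _ _).trans
        ((sum_le_card_nsmul _ _ (ofReal y * muI V β n l r A) fun e _ => ?_).trans
          ((le_of_eq ?_).trans (mul_le_mul_left (hfin y (by positivity)) _)))) |>.trans
            (mul_le_mul_left (ofReal_le_ofReal ?_) _)
      · obtain ⟨h1, h2, h3, h4⟩ := hbd e e.2
        rw [hmu]
        exact law_preimage_le hXm (hXm.inter (hmS e s)) (hcond e h1 h2 h3 h4 s hs0)
      · rw [card_univ, Fintype.card_coe, nsmul_eq_mul, mul_assoc]
      · have h1 : C * n * (T * h) ^ 2 = C * T ^ 2 * n ^ (2 * δ) := by rw [← hrp]; ring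
        rw [hy, hsn, h1]
        have h2 : C * T ^ 2 * (n : ℝ) ^ (2 * δ) ≤ (2 * D + 1) * C * T ^ 2 * n ^ (2 * δ) := by gcongr
        have h3 := mul_le_mul_of_nonneg_left (exp_le_exp.2 (sub_le_sub_right h2
          (κ / 4 * K ^ 2 * (n : ℝ) ^ (2 * δ)))) (show 0 ≤ (2 * D + 1) * C by positivity)
        linarith

/-! ### Dependence of the conditional law on the boundary values -/

lemma abs_trace_aeval_mixed_diff_le {ι : Type*} [Fintype ι] [DecidableEq ι] (V : ℝ[X])
    {T Y Z : Matrix ι ι ℝ} {c z σ : ℝ} (hT : ∀ t ∈ Set.Icc (0 : ℝ) 1, RowBdd (T + t • Y) c)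
    (hTZ : ∀ t ∈ Set.Icc (0 : ℝ) 1, RowBdd (T + Z + t • Y) c) (hZ : RowBdd Z z)
    (hσ : ∑ i, ∑ j, |Y i j| ≤ σ) (hc : 0 ≤ c) (hz : 0 ≤ z) :
    |(aeval (T + Z + Y) V).trace - (aeval (T + Y) V).trace
      - ((aeval (T + Z) V).trace - (aeval T V).trace)| ≤ σ * (ddBound Vᵈ c * z) := by
  have h := norm_image_sub_le_of_norm_deriv_le_segment_01'
    (f := fun t : ℝ => (aeval (T + Z + t • Y) V).trace - (aeval (T + t • Y) V).trace)
    (C := σ * (ddBound Vᵈ c * z))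
    (fun t _ => ((hasDerivAt_trace_aeval V (T + Z) Y t).sub
      (hasDerivAt_trace_aeval V T Y t)).hasDerivWithinAt) (fun t ht => by
      have ht' := Set.Ico_subset_Icc_self ht
      rw [← trace_sub, ← sub_mul, aeval_sub_aeval, trace_mul_comm, norm_eq_abs]
      have e : T + Z + t • Y - (T + t • Y) = Z := by abel
      rw [e]
      exact abs_trace_mul_le hσ (fun i j => (rowBdd_ddMat _ (hTZ t ht') (hT t ht') hZ hc hz).abs_le i j)
        (mul_nonneg (ddBound_nonneg _ hc) hz))
  simpa using h

include hc hV hβ hε0 hε1 in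
lemma exists_condH_osc : ∃ (C : ℝ) (N : ℕ), 0 < C ∧ 0 < N ∧ ∀ n : ℕ, N ≤ n → ∀ l r : ℕ,
      V.natDegree + 1 ≤ l → (r : ℝ) ≤ (1 - ε) * n → ∀ s t : ℝ, 0 ≤ s → s ≤ 1 → 0 ≤ t → t ≤ 1 →
      ∀ q q' : Config (bdry V n l r), (∀ e, ab2 (q e - dagger V β n e) ≤ s) →
      (∀ e, ab2 (q' e - dagger V β n e) ≤ s) → ∀ x x' : Config (Icc l r),
      (∀ k, ab2 (x k - dagger V β n k) ≤ t) → (∀ k, ab2 (x' k - dagger V β n k) ≤ t) →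
      |ℋ[β] q' x - ℋ[β] q x
        - (ℋ[β] q' x' - ℋ[β] q x')| ≤ C * (s * t) := by
  obtain ⟨M, r₀, Λ, hM, hr₀, hΛ, hdag⟩ := exists_dagger_bounds hc hV hβ
    (show 0 < ε / 4 by positivity)
  obtain ⟨N₁, hN₁, hbulk⟩ := exists_bulk_bounds hβ hε0 hε1 0 V.natDegree
  set D := V.natDegree
  set B := ddBound Vᵈ (3 * (M + 5))
  have hB0 : 0 ≤ B := ddBound_nonneg _ (by positivity)
  refine ⟨2 * D * (2 * 2) * (B * (3 * 2)) + 1, N₁, by positivity, hN₁,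
    fun n hn l r hlD hrε s t hs0 hs1 ht0 ht1 q q' hq hq' x x' hx hx' => ?_⟩
  obtain ⟨hb1, hb2, hb3, hb4⟩ := hbulk n hn
  have hn0 : 0 < n := by omega
  have hrb := add_add_one_le_bulk hb4 hrε
  have hl : 1 ≤ l := by omega
  have hr : r + 1 ≤ n := by omega
  have hbd : ∀ e ∈ bdry V n l r, (1 ≤ e ∧ e ∉ Icc l r ∧ e ≤ bulk ε n) ∧
      e ∈ Ico (l - D) l ∪ Ioc r (r + D) := fun e he => by
    obtain ⟨h1, h2, h3, h4⟩ := mem_filter.1 he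
    have h5 : V.natDegree / 2 ≤ D := Nat.div_le_self _ _
    rw [mem_union, mem_Ico, mem_Ioc]
    rw [mem_Icc] at h1
    refine ⟨⟨h1.1, h2, by omega⟩, ?_⟩
    rw [mem_Icc] at h2; omega
  have hcard : ((bdry V n l r).card : ℝ) ≤ 2 * D := by
    have := (card_le_card fun e he => (hbd e he).2).trans (card_near_le D l r)
    exact_mod_cast this
  have hdagM : ∀ k, k ≤ bulk ε n → ab2 (dagger V β n k) ≤ M := fun k hk =>
    (hdag n k hn0 (hb3 k hk)).1
  set w : ℕ → ℝ × ℝ := mrg (bdry V n l r) (q' - q) 0 with hw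
  set z : ℕ → ℝ × ℝ := mrg (Icc l r) (x - x') 0 with hz
  set v : ℕ → ℝ × ℝ := mrg _ x' (ext q) with hv
  have hwk : ∀ k, ab2 (w k) ≤ 2 * s := fun k => by
    by_cases hk : k ∈ bdry V n l r
    · rw [hw, mrg_mem _ _ hk, Pi.sub_apply]
      have h1 := ab2_sub_le (q' ⟨k, hk⟩) (dagger V β n k) (q ⟨k, hk⟩)
      have h2 := hq' ⟨k, hk⟩
      have h3 := hq ⟨k, hk⟩
      rw [ab2_sub_comm] at h3
      simp only at h2 h3; linarith
    · rw [hw, mrg_notMem _ _ hk]; simpa [ab2] using hs0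
  have hzk : ∀ k, ab2 (z k) ≤ 2 * t := fun k => by
    by_cases hk : k ∈ Icc l r
    · rw [hz, mrg_mem _ _ hk, Pi.sub_apply]
      have h1 := ab2_sub_le (x ⟨k, hk⟩) (dagger V β n k) (x' ⟨k, hk⟩)
      have h2 := hx ⟨k, hk⟩
      have h3 := hx' ⟨k, hk⟩
      rw [ab2_sub_comm] at h3
      simp only at h2 h3; linarith
    · rw [hz, mrg_notMem _ _ hk]; simpa [ab2] using ht0
  have hvk : ∀ k, ab2 (v k) ≤ M + 1 := fun k => by
    by_cases hk : k ∈ Icc l r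
    · rw [hv, mrg_mem _ _ hk]
      have hk' := (mem_Icc.1 hk).2
      have h1 := ab2_add_le (x' ⟨k, hk⟩ - dagger V β n k) (dagger V β n k)
      rw [sub_add_cancel] at h1
      linarith [hdagM k (by omega), hx' ⟨k, hk⟩]
    · rw [hv, mrg_notMem _ _ hk]
      exact ab2_ext_le hM.le hs1 hq (fun e he => hdagM e (hbd e he).1.2.2) k
  have hextw : ext q' = ext q + w := by
    ext1 k
    by_cases hk : k ∈ bdry V n l r
    · simp [ext, hw, mrg_mem _ _ hk]
    · simp [ext, hw, mrg_notMem _ _ hk]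
  have hwI : ∀ k ∈ Icc l r, w k = 0 := fun k hk => mrg_notMem _ _ fun h => (hbd k h).1.2.1 hk
  have hmrg : ∀ y : Config (Icc l r), mrg _ y (ext q') = mrg _ y (ext q) + w := fun y => by
    ext1 k
    by_cases hk : k ∈ Icc l r
    · rw [mrg_mem _ _ hk, Pi.add_apply, mrg_mem _ _ hk, hwI k hk, add_zero]
    · rw [mrg_notMem _ _ hk, Pi.add_apply, mrg_notMem _ _ hk, hextw, Pi.add_apply]
  have hvz : mrg _ x (ext q) = v + z := by
    have := mrg_add_smul x' (x - x') (ext q) 1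
    rwa [one_smul, one_smul, add_sub_cancel] at this
  have hσ : ∑ i, ∑ j, |jac n w i j| ≤ 2 * D * (2 * (2 * s)) := by
    refine (sum_abs_jac_le (E := bdry V n l r) (fun e he => ?_) (mrg_zero_of_notMem _)).trans ?_
    · have := (hbd e he).1
      exact mem_Icc.2 ⟨this.1, by omega⟩
    · refine (sum_le_card_nsmul _ _ (2 * (2 * s)) fun k _ => ?_).trans ?_
      · have := hwk k
        unfold ab2 at this
        linarith [abs_nonneg (w k).1]
      · rw [nsmul_eq_mul]; gcongr
  have hmix := abs_trace_aeval_mixed_diff_le V (T := jac n v) (Y := jac n w) (Z := jac n z)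
    (c := 3 * (M + 5)) (z := 3 * (2 * t)) (fun u hu => by
      rw [← map_smul, ← map_add]
      refine rowBdd_jac_of_ab2 (by positivity) fun k _ => ?_
      have h1 := ab2_add_le (v k) (u • w k)
      rw [ab2_smul, abs_of_nonneg hu.1] at h1
      have h2 := mul_le_of_le_one_left (ab2_nonneg (w k)) hu.2
      exact h1.trans (by linarith [hvk k, hwk k])) (fun u hu => by
      rw [← map_smul, ← map_add, ← map_add]
      refine rowBdd_jac_of_ab2 (by positivity) fun k _ => ?_
      have h1 := ab2_add_le (v k + z k) (u • w k)
      have h3 := ab2_add_le (v k) (z k)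
      rw [ab2_smul, abs_of_nonneg hu.1] at h1
      have h2 := mul_le_of_le_one_left (ab2_nonneg (w k)) hu.2
      exact h1.trans (by linarith [hvk k, hwk k, hzk k]))
    (rowBdd_jac_of_ab2 (by positivity) fun k _ => hzk k) hσ (by positivity) (by positivity)
  have hlog : ∀ y : Config (Icc l r), ∑ k ∈ Icc 1 (n - 1),
      logCoeff β n k * log (mrg _ y (ext q') k).2
      - ∑ k ∈ Icc 1 (n - 1), logCoeff β n k * log (mrg _ y (ext q) k).2
      = ∑ k ∈ Icc 1 (n - 1) \ Icc l r,
        (logCoeff β n k * log (ext q' k).2 - logCoeff β n k * log (ext q k).2) := fun y => by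
    rw [← sum_sub_distrib, ← sum_sdiff (Icc_subset_of_le (l := l) hl hr)]
    rw [sum_eq_zero (s := Icc l r) fun k hk => by
      rw [mrg_mem _ _ hk, mrg_mem _ _ hk, sub_self], add_zero]
    refine sum_congr rfl fun k hk => ?_
    rw [mrg_notMem _ _ (Finset.mem_sdiff.1 hk).2, mrg_notMem _ _ (Finset.mem_sdiff.1 hk).2]
  have hdiff : ∀ y : Config (Icc l r), ℋ[β] q' y - ℋ[β] q y
      = (aeval (jac n (mrg _ y (ext q) + w)) V).trace - (aeval (jac n (mrg _ y (ext q))) V).trace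
        - ∑ k ∈ Icc 1 (n - 1) \ Icc l r,
        (logCoeff β n k * log (ext q' k).2 - logCoeff β n k * log (ext q k).2) := fun y => by
    rw [← hlog y, ← hmrg y]
    have e : ∀ p : Config (bdry V n l r), condH V β n l r p y
      = (aeval (jac n (mrg _ y (ext p))) V).trace - ∑ k ∈ Icc 1 (n - 1),
        logCoeff β n k * log (mrg _ y (ext p) k).2 := fun p => rfl
    rw [e, e]; ring
  rw [hdiff, hdiff, hvz]
  simp only [map_add]
  have e1 : ∀ a b a' b' L : ℝ, a - b - L - (a' - b' - L) = a - a' - (b - b') := fun a b a' b' L => by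
    ring
  rw [e1]
  refine hmix.trans ?_
  have : 0 ≤ s * t := by positivity
  calc 2 * (D : ℝ) * (2 * (2 * s)) * (B * (3 * (2 * t)))
      = 2 * D * (2 * 2) * (B * (3 * 2)) * (s * t) := by ring
    _ ≤ _ := by linarith

include hc hV hβ hε0 hε1 in
lemma exists_condLaw_le_of_near : ∃ (C : ℝ) (N : ℕ), 0 < C ∧ 0 < N ∧ ∀ n : ℕ, N ≤ n → ∀ l r : ℕ,
      V.natDegree + 1 ≤ l → (r : ℝ) ≤ (1 - ε) * n → ∀ s t : ℝ, 0 ≤ s → s ≤ 1 → 0 ≤ t → t ≤ 1 →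
      ∀ q q' : Config (bdry V n l r), (∀ e, ab2 (q e - dagger V β n e) ≤ s) →
      (∀ e, ab2 (q' e - dagger V β n e) ≤ s) →
      ofReal (1 / 2) ≤ condLaw β q {x | ∀ k, ab2 (x k - dagger V β n k) ≤ t} →
      ∀ A, MeasurableSet A → A ⊆ {x | ∀ k : Icc l r, ab2 (x k - dagger V β n k) ≤ t} →
      condLaw β q' A ≤ ofReal (2 * exp (C * (n * (s * t)))) * condLaw β q A := by
  obtain ⟨C, N₁, hC, hN₁, hosc⟩ := exists_condH_osc hc hV hβ hε0 hε1
  obtain ⟨τ, b, s₀, N₂, hτ, hb, hs₀, hN₂, hbd⟩ := exists_condMin_bounds hc hV hβ hε0 hε1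
  refine ⟨2 * β * C, max N₁ N₂, by positivity, lt_max_of_lt_left hN₁,
    fun n hn l r hl hr s t hs0 hs1 ht0 ht1 q q' hq hq' hhalf A hA hAU => ?_⟩
  have hosc := hosc n (le_trans (le_max_left _ _) hn) l r hl hr s t hs0 hs1 ht0 ht1 q q' hq hq'
  obtain ⟨hrn, hco, -⟩ := hbd n (le_trans (le_max_right _ _) hn) l r hl hr
  have hl1 : 1 ≤ l := by omega
  have hr1 : r + 1 ≤ n := by omega
  set x' : Config (Icc l r) := fun k => dagger V β n k with hx'
  set U := {x : Config (Icc l r) | ∀ k, ab2 (x k - x' k) ≤ t}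
  set H := n * β * (ℋ[β] q' x' - ℋ[β] q x') with hH
  set ω := n * β * (C * (s * t)) with hω
  have hbound : ∀ x ∈ U, |n * β * ℋ[β] q' x - n * β * ℋ[β] q x - H| ≤ ω := fun x hx => by
    have h1 := hosc x x' hx (fun k => by simpa [hx', ab2] using ht0)
    have h2 : n * β * ℋ[β] q' x - n * β * ℋ[β] q x - H
        = n * β * (ℋ[β] q' x - ℋ[β] q x
          - (ℋ[β] q' x' - ℋ[β] q x')) := by rw [hH]; ring
    rw [h2, abs_mul, abs_of_nonneg (by positivity)]
    exact mul_le_mul_of_nonneg_left h1 (by positivity)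
  have h1 := normalized_le_of_le (measurableSet_ab2_le x' t) hA hAU (measurable_condDens_right β q)
    (f := condDens β q') (a := ofReal (exp (-H + ω)))
    (b := ofReal (exp (-H - ω))) (fun x hx => by
      unfold condDens
      split_ifs
      · rw [← ofReal_mul (exp_pos _).le, ← exp_add]
        exact ofReal_le_ofReal (exp_le_exp.2 (by linarith [(abs_le.1 (hbound x hx)).1]))
      · exact zero_le) (fun x hx => by
      unfold condDens
      split_ifs
      · rw [← ofReal_mul (exp_pos _).le, ← exp_add]
        exact ofReal_le_ofReal (exp_le_exp.2 (by linarith [(abs_le.1 (hbound x hx)).2]))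
      · rw [mul_zero]) hhalf (lintegral_condDens_ne_zero β q')
    (lintegral_condDens_ne_top hc hV hβ hl1 hr1 hco q') (lintegral_condDens_ne_zero β q)
    (lintegral_condDens_ne_top hc hV hβ hl1 hr1 hco q)
  rw [← ofReal_mul (exp_pos _).le] at h1
  refine le_mul_of_ofReal_mul_le (by positivity) h1 (le_of_eq ?_)
  have : -H + ω = 2 * β * C * (n * (s * t)) + (-H - ω) := by rw [hω]; ring
  rw [this, exp_add]; ring

lemma eventually_exp_neg_rpow_le (A : ℝ) {κ p : ℝ} (hκ : 0 < κ) (hp : 0 < p) {y : ℝ}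
    (hy : 0 < y) : ∀ᶠ n : ℕ in atTop, A * exp (-(κ * (n : ℝ) ^ p)) ≤ y := by
  have h1 : Tendsto (fun n : ℕ => κ * (n : ℝ) ^ p) atTop atTop :=
    ((tendsto_rpow_atTop hp).comp tendsto_natCast_atTop_atTop).const_mul_atTop hκ
  have h := (Real.tendsto_exp_neg_atTop_nhds_zero.comp h1).const_mul A
  rw [mul_zero] at h
  exact h.eventually_le_const hy

lemma eventually_natDegree_lt (V : ℝ[X]) (hc₀ : 0 < c₀) : ∀ᶠ n : ℕ in atTop,
    ∀ l r : ℕ, ∀ ε, Admissible c₀ ε n l r → V.natDegree + 1 ≤ l := by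
  have h1 := ((Real.tendsto_log_atTop.comp tendsto_natCast_atTop_atTop).const_mul_atTop
    hc₀).eventually_ge_atTop (V.natDegree + 1 : ℝ)
  filter_upwards [h1] with n hn l r ε hA
  have : ((V.natDegree + 1 : ℕ) : ℝ) ≤ l := by
    push_cast
    exact le_trans hn hA.2.2.1
  exact_mod_cast this

lemma nuCond_univ_le (q : Config (bdry V n l r)) (D : Set (Config (Icc l r))) :
    γ[β] q D ≤ 1 :=
  (measure_mono (Set.subset_univ D)).trans (normalized_univ_le _)

lemma measure_le_add_of_compl {E : Type*} [MeasurableSpace E] {P R : Measure E} {U D : Set E}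
    (hU : MeasurableSet U) (hη : 0 ≤ η) (hR : R univ ≤ 1)
    (hP : P Uᶜ ≤ ofReal η)
    (h : P (D ∩ U) ≤ ofReal (1 + η) * R (D ∩ U)) : P D ≤ R D + ofReal (2 * η) := by
  rw [← measure_inter_add_sdiff D hU]
  have h1 : P (D \ U) ≤ ofReal η := (measure_mono fun x hx => hx.2).trans hP
  have h2 : ofReal (1 + η) * R (D ∩ U) ≤ R D + ofReal η := by
    rw [ofReal_add zero_le_one hη, ofReal_one, add_mul, one_mul]
    refine add_le_add (measure_mono inter_subset_left) (mul_le_of_le_one_right' ?_)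
    exact (measure_mono (Set.subset_univ _)).trans hR
  rw [two_mul, ofReal_add hη hη, ← add_assoc]
  exact add_le_add (h.trans h2) h1

lemma tvDist_le {E : Type*} [MeasurableSpace E] {μ ν : Measure E} (hη : 0 ≤ η)
    (hμ : μ univ ≠ ∞) (hν : ν univ ≠ ∞)
    (h1 : ∀ D, MeasurableSet D → μ D ≤ ν D + ofReal η)
    (h2 : ∀ D, MeasurableSet D → ν D ≤ μ D + ofReal η) : tvDist μ ν ≤ η := by
  have : Nonempty {D : Set E // MeasurableSet D} := ⟨⟨∅, MeasurableSet.empty⟩⟩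
  refine ciSup_le fun D => ?_
  have hf : ∀ ρ : Measure E, ρ univ ≠ ∞ → ρ D.1 ≠ ∞ := fun ρ h =>
    ne_top_of_le_ne_top h (measure_mono (Set.subset_univ _))
  have key : ∀ ρ ρ' : Measure E, ρ' univ ≠ ∞ → ρ D.1 ≤ ρ' D.1 + ofReal η →
      ρ.real D.1 ≤ ρ'.real D.1 + η := fun ρ ρ' h h' => by
    have := toReal_mono (add_ne_top.2 ⟨hf ρ' h, ofReal_ne_top⟩) h'
    rwa [ENNReal.toReal_add (hf ρ' h) ofReal_ne_top, toReal_ofReal hη] at this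
  rw [abs_le]
  constructor <;> linarith [key μ ν hν (h1 D.1 D.2), key ν μ hμ (h2 D.1 D.2)]

lemma eventually_bdry_tail (C : ℝ) {κ K δ y : ℝ} (hκ : 0 < κ) (hK : 0 < K) (hδ : 0 < δ)
    (hy : 0 < y) : ∀ᶠ n : ℕ in atTop,
    C * exp (-((n : ℝ) / 2)) + C * exp (-(κ * K ^ 2 * n ^ (2 * δ))) ≤ y := by
  filter_upwards [eventually_exp_neg_rpow_le C (show (0 : ℝ) < 1 / 2 by norm_num) one_pos
    (half_pos hy), eventually_exp_neg_rpow_le C (show 0 < κ * K ^ 2 by positivity)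
      (show 0 < 2 * δ by positivity) (half_pos hy)] with n h1 h2
  rw [rpow_one, one_div_mul_eq_div] at h1; linarith

section

include hc hV hβ hε0 hε1

lemma exists_condMin_near_rpow (hδ0 : 0 < δ) (hδ1 : δ < 1 / 2) :
    ∃ C : ℝ, 0 < C ∧ ∀ K : ℝ, 0 < K → ∀ᶠ n : ℕ in atTop, ∀ l r : ℕ,
      V.natDegree + 1 ≤ l → (r : ℝ) ≤ (1 - ε) * n → ∀ q ∈ goodBdry V β δ K n l r,
      ∀ j : Icc l r, ab2 (𝔪[β] q j - dagger V β n j)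
        ≤ C * (K + 1) * (n : ℝ) ^ (δ - 1 / 2) := by
  obtain ⟨C, c₁, N, hC, hc₁, hN, hnear⟩ := exists_condMin_near hc hV hβ hε0 hε1
  refine ⟨C, hC, fun K hK => ?_⟩
  filter_upwards [eventually_ge_atTop N, eventually_mul_rpow_le (show δ - 1 / 2 < 0 by linarith) K
    (show (0 : ℝ) < 1 / 2 by norm_num)] with n hn h1 l r hl hr q hq j
  have hn1 : (1 : ℝ) ≤ n := mod_cast hN.trans_le hn
  have h2 := hnear n hn l r hl hr _ (by positivity) h1 q hq j j.2
  rw [mfull, mrg_coe] at h2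
  have h3 : 1 / (n : ℝ) ≤ (n : ℝ) ^ (δ - 1 / 2) := by
    rw [one_div, ← Real.rpow_neg_one]
    exact Real.rpow_le_rpow_of_exponent_le hn1 (by linarith)
  have h4 : exp (-(c₁ * Metric.infDist (j : ℕ) (bdry V n l r : Set ℕ))) ≤ 1 := exp_le_one_iff.2 (by
      have := mul_nonneg hc₁.le (Metric.infDist_nonneg (x := (j : ℕ)) (s := (bdry V n l r : Set ℕ)))
      linarith)
  refine h2.trans ?_
  have h5 : K * (n : ℝ) ^ (δ - 1 / 2) * exp (-(c₁ * Metric.infDist (j : ℕ)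
      (bdry V n l r : Set ℕ))) ≤ K * (n : ℝ) ^ (δ - 1 / 2) := mul_le_of_le_one_right (by positivity) h4
  exact (mul_le_mul_of_nonneg_left (add_le_add h5 h3) hC.le).trans (le_of_eq (by ring))

/-- The total variation distance between the marginal law and the Gaussian mixture. -/
lemma eventually_tvDist_le (hc₀ : 0 < c₀) (hκ : 0 < κ)
    (hconc : ∀ n : ℕ, N ≤ n → Concentrated V β ε c₀ C κ τ n)
    (hδ0 : 0 < δ) (hK : 0 < K) (hη : 0 < η) :
    ∀ᶠ n : ℕ in atTop, ∀ l r : ℕ, Admissible c₀ ε n l r → ∀ q₀ : Config (bdry V n l r),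
      tvDist (muI V β n l r) (nuI V β δ K n l r q₀) ≤ η := by
  set δ' := min δ (ε / 4)
  have hδ'0 : 0 < δ' := by positivity
  obtain ⟨N₁, hN₁, hGC⟩ := exists_gauss_comparison hc hV hβ hε0 hε1 hδ'0
    ((min_le_right _ _).trans_lt (by linarith)) (K := K) one_pos (show 0 < η / 4 by positivity)
  obtain ⟨_, _, _, N₂, _, _, _, hN₂, hbd⟩ := exists_condMin_bounds hc hV hβ hε0 hε1
  filter_upwards [eventually_ge_atTop N, eventually_ge_atTop N₁, eventually_ge_atTop N₂,
    eventually_natDegree_lt V hc₀, eventually_bdry_tail C hκ hK hδ'0 (show 0 < η / 4 by positivity)]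
    with n hn hn1 hn2 hdeg htail l r hA q₀
  have hlD := hdeg l r ε hA
  obtain ⟨hl, hlr, hlog, hrε, hcard⟩ := hA
  obtain ⟨hrn, hco, -⟩ := hbd n hn2 l r hlD hrε
  have hr : r + 1 ≤ n := by omega
  have hn0 : 0 < n := by omega
  have hn1' : (1 : ℝ) ≤ n := mod_cast hn0
  have hGC := hGC n hn1 l r hlD hrε hcard
  set B := goodBdry V β δ' K n l r
  set G := goodBdry V β δ K n l r
  have hBG : B ⊆ G := fun q hq i => (hq i).trans (mul_le_mul_of_nonneg_left
    (Real.rpow_le_rpow_of_exponent_le hn1' (by linarith [min_le_left δ (ε / 4)])) hK.le)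
  have hBm : MeasurableSet B := measurableSet_goodBdry _ _ _ _ _ _ _
  have hmB := measurable_restr (n := n) (bdry V n l r) hBm
  have hPB : law V β n (restr (bdry V n l r) ⁻¹' Bᶜ) ≤ ofReal (η / 4) :=
    ((hconc n hn).2.2 l r hlog hrε δ' K hK.le).1.trans (ofReal_le_ofReal htail)
  have hPG : law V β n (restr (bdry V n l r) ⁻¹' Gᶜ) ≤ ofReal (η / 4) :=
    (measure_mono (Set.preimage_mono (Set.compl_subset_compl.2 hBG))).trans hPB
  have hlaw := law_univ hc hV hβ hn0
  have hcmp : ∀ q ∈ B, ∀ D, MeasurableSet D →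
      condLaw β q D ≤ γ[β] q D + ofReal (2 * (η / 4)) ∧
      γ[β] q D ≤ condLaw β q D + ofReal (2 * (η / 4)) := fun q hq D hD => by
    obtain ⟨h1, h2, h3⟩ := hGC q hq
    have hUm := measurableSet_ab2_le (𝔪[β] q) (1 * (n : ℝ) ^ (δ' - 1 / 2))
    have h4 := h3 (D ∩ _) (hD.inter hUm) Set.inter_subset_right
    exact ⟨measure_le_add_of_compl hUm (by positivity) (nuCond_univ_le q _) h1 h4.1,
      measure_le_add_of_compl hUm (by positivity) (condLaw_univ hc hV hl hr hco hβ q).le h2 h4.2⟩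
  have hint : ∀ f g : Field n → ℝ≥0∞, Measurable f → (∀ ω ∈ restr (bdry V n l r) ⁻¹' B,
      g ω ≤ f ω + ofReal (2 * (η / 4))) →
      ∫⁻ ω in restr (bdry V n l r) ⁻¹' B, g ω ∂(law V β n)
        ≤ ∫⁻ ω in restr (bdry V n l r) ⁻¹' B, f ω ∂(law V β n) + ofReal (2 * (η / 4)) := fun f g hf hfg => by
    refine (setLIntegral_mono' hmB hfg).trans ?_
    rw [lintegral_add_left hf, setLIntegral_const]
    refine add_le_add_right (mul_le_of_le_one_right' ?_) _
    exact (measure_mono (Set.subset_univ _)).trans hlaw.le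
  have hη4 : ofReal (2 * (η / 4)) + ofReal (η / 4) + ofReal (η / 4) = ofReal η := by
    rw [← ofReal_add (by positivity) (by positivity), ← ofReal_add (by positivity)
      (by positivity)]
    congr 1
    ring
  have hle1 : ∀ D, MeasurableSet D → muI V β n l r D ≤ nuI V β δ K n l r q₀ D + ofReal η := fun D hD => by
    rw [muI_eq_add hc hV hβ hl hr hco hBm hD, nuI_apply hc hV hl hr hco δ K q₀ hD, ← hη4]
    have h1 := hint _ _ ((measurable_nuCond_apply hc hV hl hr hco hD (β := β)).comp
      (measurable_restr (n := n) _)) fun ω hω => (hcmp _ hω D hD).1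
    have h2 := (measure_mono inter_subset_left : law V β n (restr (bdry V n l r) ⁻¹' Bᶜ
      ∩ restr (Icc l r) ⁻¹' D) ≤ _).trans hPB
    have h3 : ∫⁻ ω in restr (bdry V n l r) ⁻¹' B, nuCond V β n l r (restr _ ω) D ∂(law V β n)
        ≤ ∫⁻ ω in restr (bdry V n l r) ⁻¹' G, nuCond V β n l r (restr _ ω) D ∂(law V β n) :=
      lintegral_mono_set (Set.preimage_mono hBG)
    refine (add_le_add (h1.trans (add_le_add_left h3 _)) h2).trans ?_
    rw [add_assoc]
    refine add_le_add le_self_add ?_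
    exact le_self_add
  have hle2 : ∀ D, MeasurableSet D → nuI V β δ K n l r q₀ D ≤ muI V β n l r D + ofReal η := fun D hD => by
    rw [muI_eq_add hc hV hβ hl hr hco hBm hD, nuI_apply hc hV hl hr hco δ K q₀ hD, ← hη4]
    have h1 := hint _ _ ((measurable_condLaw_apply hD).comp (measurable_restr (n := n) _))
      fun ω hω => (hcmp _ hω D hD).2
    have h2 : law V β n (restr (bdry V n l r) ⁻¹' Gᶜ) * γ[β] q₀ D
        ≤ ofReal (η / 4) := (mul_le_of_le_one_right' (nuCond_univ_le q₀ D)).trans hPG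
    have h3 : ∫⁻ ω in restr (bdry V n l r) ⁻¹' G, nuCond V β n l r (restr _ ω) D ∂(law V β n)
        ≤ ∫⁻ ω in restr (bdry V n l r) ⁻¹' B, nuCond V β n l r (restr _ ω) D ∂(law V β n)
          + ofReal (η / 4) := by
      refine (setLIntegral_le_lintegral _ _).trans ?_
      rw [← lintegral_add_compl _ hmB]
      refine add_le_add_right ?_ _
      refine (setLIntegral_mono' hmB.compl fun ω _ => nuCond_univ_le _ D).trans ?_
      rw [setLIntegral_one]
      exact hPB
    refine (add_le_add (h3.trans (add_le_add_left h1 _)) h2).trans ?_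
    rw [add_assoc, add_assoc, add_assoc, ← add_assoc (ofReal (2 * (η / 4)))]
    exact add_le_add_right le_add_self _
  have hmu : muI V β n l r univ ≠ ∞ := by
    rw [muI_apply MeasurableSet.univ, Set.preimage_univ, hlaw]
    exact one_ne_top
  exact tvDist_le hη.le hmu (ne_top_of_le_ne_top (add_ne_top.2 ⟨hmu, ofReal_ne_top⟩)
    (hle2 _ MeasurableSet.univ)) hle1 hle2

end

lemma subset_near_of_near {p m : Config J} {s t : ℝ} (h : ∀ k, ab2 (m k - p k) ≤ s) :
    {x : Config J | ∀ k, ab2 (x k - p k) ≤ t} ⊆ {x | ∀ k, ab2 (x k - m k) ≤ t + s} := fun x hx k => by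
  have h1 := ab2_sub_le (x k) (p k) (m k)
  have h2 := h k
  rw [ab2_sub_comm] at h2
  exact h1.trans (add_le_add (hx k) h2)

section

include hc hV hβ hε0 hε1

/-- The conditional law given an atypical boundary value is dominated by the marginal law. -/
lemma exists_condLaw_le_muI (hc₀ : 0 < c₀) (hδ0 : 0 < δ) (hδ : δ < ε / 3) (hκ : 0 < κ)
    (hconc : ∀ n : ℕ, N ≤ n → Concentrated V β ε c₀ C κ τ n)
    {T : ℝ} (hT : 0 < T) :
    ∃ W : ℝ, 0 < W ∧ ∀ K : ℝ, 1 ≤ K → ∀ᶠ n : ℕ in atTop, ∀ l r : ℕ, Admissible c₀ ε n l r →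
      ∀ q₀ ∈ goodBdry V β δ K n l r, ∀ A : Set (Config (Icc l r)), MeasurableSet A →
      A ⊆ {x | ∀ k : Icc l r, ab2 (x k - dagger V β n k) ≤ T * (n : ℝ) ^ (δ - 1 / 2)} →
      condLaw β q₀ A ≤ ofReal (4 * exp (W * K * (n : ℝ) ^ (2 * δ))) * muI V β n l r A := by
  have hδ1 : δ - 1 / 2 < 0 := by linarith
  obtain ⟨Cn, hCn, hnear⟩ := exists_condMin_near_rpow hc hV hβ hε0 hε1 hδ0 (by linarith)
  obtain ⟨Co, N₁, hCo, hN₁, hosc⟩ := exists_condLaw_le_of_near hc hV hβ hε0 hε1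
  obtain ⟨N₃, hN₃, hGC⟩ := exists_gauss_comparison hc hV hβ hε0 hε1 hδ0 hδ (K := 1) one_pos
    (show (0 : ℝ) < 1 / 2 by norm_num)
  obtain ⟨_, _, _, N₂, _, _, _, hN₂, hbd⟩ := exists_condMin_bounds hc hV hβ hε0 hε1
  set T' := T + 1 + Cn * (1 + 1) with hT'
  refine ⟨Co * T', by positivity, fun K hK => ?_⟩
  filter_upwards [eventually_ge_atTop N, eventually_ge_atTop N₁, eventually_ge_atTop N₂,
    eventually_ge_atTop N₃, eventually_natDegree_lt V hc₀, hnear 1 one_pos,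
    eventually_mul_rpow_le hδ1 K one_pos, eventually_mul_rpow_le hδ1 T' one_pos,
    eventually_bdry_tail C hκ one_pos hδ0 (show (0 : ℝ) < 1 / 2 by norm_num)]
    with n hn hn1 hn2 hn3 hdeg hnear hs1 ht1 htail l r hA q₀ hq₀ A hAm hAT
  have hlD := hdeg l r ε hA
  obtain ⟨hl, hlr, hlog, hrε, hcard⟩ := hA
  obtain ⟨hrn, hco, -⟩ := hbd n hn2 l r hlD hrε
  have hr : r + 1 ≤ n := by omega
  have hn0 : 0 < n := by omega
  have hrp := natCast_mul_rpow_sq hn0 δ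
  set h := (n : ℝ) ^ (δ - 1 / 2)
  have hh0 : 0 < h := by positivity
  set G := goodBdry V β δ 1 n l r
  have hGm : MeasurableSet G := measurableSet_goodBdry _ _ _ _ _ _ _
  have hmG := measurable_restr (n := n) (bdry V n l r) hGm
  have hle : ∀ q ∈ G, condLaw β q₀ A
      ≤ ofReal (2 * exp (Co * T' * K * (n : ℝ) ^ (2 * δ))) * condLaw β q A := fun q hq => by
    have h1 := (hGC n hn3 l r hlD hrε hcard q hq).1
    have hUm := measurableSet_ab2_le (𝔪[β] q) (1 * h)
    have hsub : {x : Config (Icc l r) | ∀ k, ab2 (x k - 𝔪[β] q k) ≤ 1 * h}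
        ⊆ {x | ∀ k : Icc l r, ab2 (x k - dagger V β n k) ≤ T' * h} := by
      refine (subset_near_of_near (p := 𝔪[β] q) (m := fun k => dagger V β n k)
        (s := Cn * (1 + 1) * h) fun k => ?_).trans fun x hx k => (hx k).trans ?_
      · rw [ab2_sub_comm]
        exact hnear l r hlD hrε q hq k
      · rw [hT']
        have : 0 ≤ T * h := by positivity
        linarith
    have hhalf : ofReal (1 / 2)
        ≤ condLaw β q {x | ∀ k : Icc l r, ab2 (x k - dagger V β n k) ≤ T' * h} := by
      refine le_trans ?_ (measure_mono hsub)
      have h2 := condLaw_univ hc hV hl hr hco hβ q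
      rw [← measure_add_measure_compl hUm] at h2
      have h3 : ofReal (1 / 2) + ofReal (1 / 2) = 1 := by
        rw [← ofReal_add (by norm_num) (by norm_num)]; norm_num
      refine le_of_add_le_add_right (a := ofReal (1 / 2)) ofReal_ne_top ?_
      rw [h3, ← h2]
      exact add_le_add_right h1 _
    have hqs : ∀ e, ab2 (q e - dagger V β n e) ≤ K * h := fun e =>
      (hq e).trans (mul_le_mul_of_nonneg_right hK hh0.le)
    refine (hosc n hn1 l r hlD hrε (K * h) (T' * h) (by positivity) hs1 (by positivity) ht1 q q₀
      hqs hq₀ hhalf A hAm (hAT.trans fun x hx k => (hx k).trans ?_)).trans_eq ?_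
    · refine mul_le_mul_of_nonneg_right ?_ hh0.le
      rw [hT']; linarith
    · have : Co * (n * (K * h * (T' * h))) = Co * T' * K * (n : ℝ) ^ (2 * δ) := by rw [← hrp]; ring
      rw [this]
  have hPG : ofReal (1 / 2) ≤ law V β n (restr (bdry V n l r) ⁻¹' G) := by
    have h2 := law_univ hc hV hβ hn0
    rw [← measure_add_measure_compl hmG] at h2
    have h3 : ofReal (1 / 2) + ofReal (1 / 2) = 1 := by
      rw [← ofReal_add (by norm_num) (by norm_num)]; norm_num
    refine le_of_add_le_add_right (a := ofReal (1 / 2)) ofReal_ne_top ?_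
    rw [h3, ← h2]
    exact add_le_add_right (((hconc n hn).2.2 l r hlog hrε δ 1 zero_le_one).1.trans
      (ofReal_le_ofReal htail)) _
  set E := ofReal (2 * exp (Co * T' * K * (n : ℝ) ^ (2 * δ)))
  have h1 : law V β n (restr (bdry V n l r) ⁻¹' G) * condLaw β q₀ A
      ≤ E * muI V β n l r A := by
    rw [muI_eq_add hc hV hβ hl hr hco hGm hAm, mul_comm, ← setLIntegral_const, mul_add]
    refine le_trans ?_ le_self_add
    refine le_trans (setLIntegral_mono' hmG fun ω hω => hle _ hω) (le_of_eq ?_)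
    exact lintegral_const_mul E ((measurable_condLaw_apply hAm).comp (measurable_restr (n := n) _))
  have h2 := (mul_le_mul_left hPG (condLaw β q₀ A)).trans h1
  refine le_mul_of_ofReal_mul_le (b := 1 / 2) (by norm_num) h2 (le_of_eq (by ring))

/-- Two-sided comparison of the Gaussian mixture and the marginal law near the local minimizers. -/
lemma exists_density_bounds (hc₀ : 0 < c₀) (hδ0 : 0 < δ) (hδ : δ < ε / 3) (hC : 0 < C) (hκ : 0 < κ)
    (hconc : ∀ n : ℕ, N ≤ n → Concentrated V β ε c₀ C κ τ n)
    {T : ℝ} (hT : 0 < T) :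
    ∃ K₀ : ℝ, 0 < K₀ ∧ ∀ K : ℝ, K₀ ≤ K → ∀ η : ℝ, 0 < η → ∀ᶠ n : ℕ in atTop, ∀ l r : ℕ,
      Admissible c₀ ε n l r → ∀ q₀ ∈ goodBdry V β δ K n l r,
      ∀ A : Set (Config (Icc l r)), MeasurableSet A →
      A ⊆ {x | ∀ k : Icc l r, ab2 (x k - dagger V β n k) ≤ T * (n : ℝ) ^ (δ - 1 / 2)} →
      nuI V β δ K n l r q₀ A ≤ ofReal (1 + η) * muI V β n l r A ∧
      muI V β n l r A ≤ ofReal (1 + η) * nuI V β δ K n l r q₀ A := by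
  have hδ1 : δ - 1 / 2 < 0 := by linarith
  obtain ⟨Cn, hCn, hnear⟩ := exists_condMin_near_rpow hc hV hβ hε0 hε1 hδ0 (by linarith)
  obtain ⟨W, hW, hdom⟩ := exists_condLaw_le_muI hc hV hβ hε0 hε1 hc₀ hδ0 hδ hκ hconc hT
  obtain ⟨_, _, _, N₂, _, _, _, hN₂, hbd⟩ := exists_condMin_bounds hc hV hβ hε0 hε1
  refine ⟨max 1 ((W + C * T ^ 2 + 1) / κ), by positivity, fun K hK η hη => ?_⟩
  have hK1 : 1 ≤ K := (le_max_left _ _).trans hK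
  have hK0 : 0 < K := by linarith
  have hκK : W * K + 1 ≤ κ * K ^ 2 ∧ C * T ^ 2 + 1 ≤ κ * K ^ 2 := by
    have h1 := (le_max_right _ _).trans hK
    rw [div_le_iff₀ hκ] at h1
    have h2 := mul_le_mul_of_nonneg_right h1 hK0.le
    have h3 : C * T ^ 2 + 1 ≤ (C * T ^ 2 + 1) * K := le_mul_of_one_le_right (by positivity) hK1
    have h4 : 0 ≤ C * T ^ 2 := by positivity
    have h5 : 0 < W * K := by positivity
    constructor <;> linarith
  set η₀ := min η 1 / 4 with hη₀
  have hη₀0 : 0 < η₀ := by positivity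
  have hη₀1 : η₀ ≤ 1 / 4 := by rw [hη₀]; linarith [min_le_right η 1]
  have hη₀2 : η₀ ≤ η / 4 := by rw [hη₀]; linarith [min_le_left η 1]
  set L := T + Cn * (K + 1) with hL
  obtain ⟨N₃, hN₃, hGC⟩ := exists_gauss_comparison hc hV hβ hε0 hε1 hδ0 hδ (K := K)
    (show 0 < L by positivity) hη₀0
  filter_upwards [eventually_ge_atTop N, eventually_ge_atTop N₂, eventually_ge_atTop N₃,
    eventually_natDegree_lt V hc₀, hnear K hK0, hdom K hK1,
    eventually_mul_rpow_le hδ1 T (show (0 : ℝ) < 1 / 2 by norm_num),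
    eventually_mul_rpow_le (show 2 * δ - 1 < 0 by linarith) (W * K + 1)
      (show (0 : ℝ) < 1 / 2 by norm_num),
    eventually_exp_neg_rpow_le (16 * C) one_pos (show 0 < 2 * δ by positivity) hη₀0]
    with n hn hn2 hn3 hdeg hnear hdom hT1 hu htail l r hA q₀ hq₀ A hAm hAT
  have hlD := hdeg l r ε hA
  have hdomA := hdom l r hA q₀ hq₀ A hAm hAT
  obtain ⟨hl, hlr, hlog, hrε, hcard⟩ := hA
  obtain ⟨hrn, hco, -⟩ := hbd n hn2 l r hlD hrε
  have hr : r + 1 ≤ n := by omega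
  have hn0 : 0 < n := by omega
  have hn0' : (0 : ℝ) < n := mod_cast hn0
  obtain ⟨hG1, hG2⟩ := (hconc n hn).2.2 l r hlog hrε δ K hK0.le
  have hG2A := hG2 T hT.le hT1 A hAm hAT
  have hGC := hGC n hn3 l r hlD hrε hcard
  set h := (n : ℝ) ^ (δ - 1 / 2)
  have hcmp : ∀ q ∈ goodBdry V β δ K n l r, condLaw β q A
      ≤ ofReal (1 + η₀) * γ[β] q A ∧
      γ[β] q A ≤ ofReal (1 + η₀) * condLaw β q A := fun q hq => by
    refine (hGC q hq).2.2 A hAm (hAT.trans ((subset_near_of_near (m := 𝔪[β] q)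
      (s := Cn * (K + 1) * h) (hnear l r hlD hrε q hq)).trans fun x hx k => (hx k).trans ?_))
    rw [hL]
    exact le_of_eq (by ring)
  set u := (n : ℝ) ^ (2 * δ) with hudef
  have hu0 : 0 < u := by positivity
  have hun : (W * K + 1) * u ≤ n / 2 := by
    have h1 : u = (n : ℝ) ^ (2 * δ - 1) * n := by
      rw [hudef, Real.rpow_sub_one hn0'.ne', div_mul_cancel₀ _ hn0'.ne']
    rw [h1, ← mul_assoc]
    linarith [mul_le_mul_of_nonneg_right hu hn0'.le]
  rw [one_mul] at htail
  set G := goodBdry V β δ K n l r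
  have hGm : MeasurableSet G := measurableSet_goodBdry _ _ _ _ _ _ _
  have hmG := measurable_restr (n := n) (bdry V n l r) hGm
  have hmP := measurable_condLaw_apply (V := V) (β := β) (n := n) hAm
  have hmN := measurable_nuCond_apply hc hV hl hr hco hAm (β := β)
  have hmu := muI_eq_add hc hV hβ hl hr hco hGm hAm
  have hmutop : muI V β n l r A ≠ ∞ := by
    rw [muI_apply hAm]
    refine ne_top_of_le_ne_top one_ne_top ?_
    rw [← law_univ hc hV hβ hn0]
    exact measure_mono (Set.subset_univ _)
  rw [nuI_apply hc hV hl hr hco δ K q₀ hAm]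
  set P := ∫⁻ ω in restr (bdry V n l r) ⁻¹' G, condLaw β (restr (bdry V n l r) ω) A ∂(law V β n)
  set R := ∫⁻ ω in restr (bdry V n l r) ⁻¹' G, nuCond V β n l r (restr _ ω) A ∂(law V β n)
  have hPR : P ≤ ofReal (1 + η₀) * R :=
    (setLIntegral_mono' hmG fun ω hω => (hcmp _ hω).1).trans (le_of_eq
      (lintegral_const_mul (ofReal (1 + η₀)) (hmN.comp (measurable_restr (n := n) _))))
  have hRP : R ≤ ofReal (1 + η₀) * P :=
    (setLIntegral_mono' hmG fun ω hω => (hcmp _ hω).2).trans (le_of_eq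
      (lintegral_const_mul (ofReal (1 + η₀)) (hmP.comp (measurable_restr (n := n) _))))
  have hPmu : P ≤ muI V β n l r A := by rw [hmu]; exact le_self_add
  have hexp : ∀ y : ℝ, y ≤ -((W * K + 1) * u) → exp y ≤ exp (-(W * K * u)) * exp (-u) :=
    fun y hy => by
      rw [← exp_add]
      exact exp_le_exp.2 (by linarith)
  constructor
  · have h1 : law V β n (restr (bdry V n l r) ⁻¹' Gᶜ) * γ[β] q₀ A
        ≤ ofReal η₀ * muI V β n l r A := by
      have h2 : C * exp (-((n : ℝ) / 2)) + C * exp (-(κ * K ^ 2 * u))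
          ≤ 2 * C * (exp (-(W * K * u)) * exp (-u)) := by
        have e1 := mul_le_mul_of_nonneg_left (hexp _ (neg_le_neg hun)) hC.le
        have e2 := mul_le_mul_of_nonneg_left (hexp _ (neg_le_neg
          (mul_le_mul_of_nonneg_right hκK.1 hu0.le))) hC.le
        linarith
      refine (mul_le_mul' (hG1.trans (ofReal_le_ofReal h2)) ((hcmp q₀ hq₀).2.trans
        (mul_le_mul_right hdomA _))).trans ?_
      rw [← mul_assoc, ← mul_assoc, ← ofReal_mul (by positivity),
        ← ofReal_mul (by positivity)]
      refine mul_le_mul_left (ofReal_le_ofReal (le_trans ?_ htail)) _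
      have h3 : exp (-(W * K * u)) * exp (W * K * u) = 1 := by
        rw [← exp_add, neg_add_cancel, exp_zero]
      have h4 : 2 * C * (exp (-(W * K * u)) * exp (-u)) * (1 + η₀)
          * (4 * exp (W * K * u)) = 8 * (1 + η₀) * C * exp (-u)
            * (exp (-(W * K * u)) * exp (W * K * u)) := by ring
      rw [h4, h3, mul_one]
      have : 8 * (1 + η₀) ≤ 16 := by linarith
      gcongr
    refine (add_le_add (hRP.trans (mul_le_mul_right hPmu _)) h1).trans ?_
    rw [← add_mul, ← ofReal_add (by positivity) hη₀0.le]
    exact mul_le_mul_left (ofReal_le_ofReal (by linarith)) _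
  · have h1 : law V β n (restr (bdry V n l r) ⁻¹' Gᶜ ∩ restr (Icc l r) ⁻¹' A)
        ≤ ofReal η₀ * muI V β n l r A := by
      refine hG2A.trans (mul_le_mul_left (ofReal_le_ofReal (le_trans ?_ htail)) _)
      have e1 : exp (-((n : ℝ) / 2)) ≤ exp (-u) := by
        refine exp_le_exp.2 ?_
        have : 0 ≤ W * K * u := by positivity
        linarith
      have e2 : exp (C * T ^ 2 * u - κ * K ^ 2 * u) ≤ exp (-u) := by
        refine exp_le_exp.2 ?_
        linarith [mul_le_mul_of_nonneg_right hκK.2 hu0.le]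
      have e3 := mul_le_mul_of_nonneg_left e1 hC.le
      have e4 := mul_le_mul_of_nonneg_left e2 hC.le
      have e5 : 0 < C * exp (-u) := by positivity
      linarith
    have h2 : ofReal (1 - η₀) * muI V β n l r A
        ≤ ofReal (1 + η₀) * (R + law V β n (restr (bdry V n l r) ⁻¹' Gᶜ)
          * γ[β] q₀ A) := by
      refine le_of_add_le_add_right (a := ofReal η₀ * muI V β n l r A)
        (mul_ne_top ofReal_ne_top hmutop) ?_
      rw [← add_mul, ← ofReal_add (by linarith) hη₀0.le, sub_add_cancel,
        ofReal_one, one_mul]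
      conv_lhs => rw [hmu]
      exact add_le_add (hPR.trans (mul_le_mul_right le_self_add _)) h1
    refine le_mul_of_ofReal_mul_le (by linarith) h2 ?_
    nlinarith [mul_le_mul_of_nonneg_left hη₀1 hη.le]

end

lemma rnDeriv_near_one {X : Type*} [MeasurableSpace X] {μ ν : Measure X} [IsFiniteMeasure μ]
    [IsFiniteMeasure ν] {S : Set X} (hS : MeasurableSet S) (hη : 0 < η)
    (h : ∀ A, MeasurableSet A → A ⊆ S → ν A ≤ ofReal (1 + η) * μ A ∧ μ A ≤ ofReal (1 + η) * ν A) :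
    ν.restrict S ≪ μ ∧ ∀ᵐ x ∂μ, x ∈ S → |(ν.rnDeriv μ x).toReal - 1| ≤ η := by
  have hac : ν.restrict S ≪ μ := by
    refine Measure.AbsolutelyContinuous.mk fun s hs h0 => ?_
    rw [Measure.restrict_apply hs]
    refine le_antisymm ((h _ (hs.inter hS) Set.inter_subset_right).1.trans ?_) zero_le
    rw [measure_mono_null inter_subset_left h0, mul_zero]
  refine ⟨hac, ?_⟩
  have hg := Measure.measurable_rnDeriv (ν.restrict S) μ
  have h1 : (ν.restrict S).rnDeriv μ ≤ᵐ[μ] fun _ => ofReal (1 + η) :=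
    ae_le_of_forall_setLIntegral_le_of_sigmaFinite hg fun s hs _ => by
      rw [Measure.setLIntegral_rnDeriv hac, Measure.restrict_apply hs, setLIntegral_const]
      exact (h _ (hs.inter hS) Set.inter_subset_right).1.trans
        (mul_le_mul_right (measure_mono inter_subset_left) _)
  have h2 : S.indicator 1 ≤ᵐ[μ] fun x => ofReal (1 + η) * (ν.restrict S).rnDeriv μ x :=
    ae_le_of_forall_setLIntegral_le_of_sigmaFinite (measurable_one.indicator hS) fun s hs _ => by
      rw [lintegral_const_mul _ hg, Measure.setLIntegral_rnDeriv hac, Measure.restrict_apply hs,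
        lintegral_indicator_one hS, Measure.restrict_apply hS, inter_comm]
      exact (h _ (hs.inter hS) Set.inter_subset_right).2
  filter_upwards [h1, h2, Measure.rnDeriv_restrict ν μ hS] with x h1 h2 h3 hx
  rw [h3, indicator_of_mem hx] at h1 h2
  rw [indicator_of_mem hx, Pi.one_apply] at h2
  have htop := ne_top_of_le_ne_top ofReal_ne_top h1
  have h1' := toReal_mono ofReal_ne_top h1
  have h2' := toReal_mono (mul_ne_top ofReal_ne_top htop) h2
  rw [toReal_ofReal (by positivity)] at h1'
  rw [ENNReal.toReal_mul, toReal_ofReal (by positivity), ENNReal.toReal_one] at h2'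
  rw [abs_le]
  constructor <;> nlinarith

section

include hc hV hβ hε0 hε1

lemma eventually_law_compl_eventS_le (hc₀ : 0 < c₀) (hδ0 : 0 < δ) (hδ1 : δ < 1 / 2)
    (hC : 0 < C) (hκ : 0 < κ)
    (hconc : ∀ n : ℕ, N ≤ n → Concentrated V β ε c₀ C κ τ n) :
    ∃ cS κ' : ℝ, 0 < cS ∧ 0 < κ' ∧ ∀ c, cS ≤ c → ∀ᶠ n : ℕ in atTop, ∀ l r : ℕ,
      Admissible c₀ ε n l r → law V β n (eventS V β ε δ c n l r)ᶜ
        ≤ ofReal (exp (-(κ' * (n : ℝ) ^ (2 * δ)))) := by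
  obtain ⟨Cn, hCn, hnear⟩ := exists_condMin_near_rpow hc hV hβ hε0 hε1 hδ0 hδ1
  obtain ⟨r₀, C₂, κ₂, N₂, hr₀, hC₂, hκ₂, -, hoff⟩ := exists_offdiag_lower_bound hc hV hβ hε0 hε1
  set κ₁ := min (1 / 2) (min (κ / 4) κ₂)
  have hκ₁0 : 0 < κ₁ := by positivity
  have hκa : κ₁ ≤ 1 / 2 := min_le_left _ _
  have hκb : κ₁ ≤ κ / 4 := (min_le_right _ _).trans (min_le_left _ _)
  have hκc : κ₁ ≤ κ₂ := (min_le_right _ _).trans (min_le_right _ _)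
  refine ⟨2 * √τ + 1 / r₀ + 2 * Cn + 2, κ₁ / 2, by positivity, by positivity, fun cS hcS => ?_⟩
  have hτ0 := sqrt_nonneg τ
  have hr0' : 0 < 1 / r₀ := by positivity
  filter_upwards [eventually_ge_atTop N, eventually_ge_atTop N₂, eventually_ge_atTop 1,
    hnear 1 one_pos, eventually_natDegree_lt V hc₀,
    eventually_mul_exp_neg_rpow_le (5 * C + C₂) (half_pos hκ₁0) (show 0 < 2 * δ by positivity)
      one_pos] with n hn hn2 hn1 hnear hdeg htail l r hA
  have hlD := hdeg l r ε hA
  obtain ⟨hl, hlr, hlog, hrε, -⟩ := hA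
  obtain ⟨hbox, hsite, hb⟩ := hconc n hn
  have hn0 : 0 < n := hn1
  have hn0' : (0 : ℝ) < n := mod_cast hn0
  have hn1' : (1 : ℝ) ≤ n := mod_cast hn1
  have hrn : r ≤ n := by
    have : (r : ℝ) ≤ n := hrε.trans (by nlinarith)
    exact_mod_cast this
  set h := (n : ℝ) ^ (δ - 1 / 2)
  have hh0 : 0 < h := by positivity
  set u := (n : ℝ) ^ (2 * δ) with hu
  have hu0 : 0 < u := by positivity
  have hun : u ≤ n := by
    rw [hu]
    nth_rw 2 [← rpow_one (n : ℝ)]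
    exact Real.rpow_le_rpow_of_exponent_le hn1' (by linarith)
  have hexp : ∀ y, κ₁ * u ≤ y → exp (-y) ≤ exp (-(κ₁ * u)) := fun y hy =>
    exp_le_exp.2 (neg_le_neg hy)
  have hsub : (eventS V β ε δ cS n l r)ᶜ ⊆ {ω | ∃ k ∈ Icc 1 n, τ < sq2 (seq ω k)} ∪
      (⋃ k ∈ (Icc 1 n).filter fun k : ℕ => (k : ℝ) ≤ (1 - ε) * n, seq ⁻¹' {v | (v k).2 < r₀}) ∪
      restr (bdry V n l r) ⁻¹' (goodBdry V β δ 1 n l r)ᶜ ∪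
      ⋃ j ∈ Icc l r, {ω | (h / 2) ^ 2 < sq2 (seq ω j - dagger V β n j)} := fun ω hω => by
    contrapose! hω
    simp only [Set.mem_union, mem_iUnion, mem_filter, Set.mem_preimage,
      Set.mem_compl_iff, Set.mem_ofPred_eq, not_or, not_exists, not_lt, not_not, not_and,
      exists_prop] at hω
    obtain ⟨⟨⟨hω1, hω2⟩, hω3⟩, hω4⟩ := hω
    rw [Set.mem_compl_iff, not_not]
    refine ⟨fun i hi1 hi2 => ?_, fun i => (hω3 i).trans ?_, fun i => ?_⟩
    · have hin : i ∈ Icc 1 n := by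
        have : (i : ℝ) ≤ n := hi2.trans (by nlinarith)
        exact mem_Icc.2 ⟨hi1, mod_cast this⟩
      have h1 := ab2_le_sqrt (hω1 i hin)
      have h2 : r₀ ≤ entB ω i := hω2 i ⟨hin, hi2⟩
      have h3 := (abs_fst_le_ab2 (seq ω i)).trans h1
      have h4 := (le_abs_self _).trans ((abs_snd_le_ab2 (seq ω i)).trans h1)
      refine ⟨h3.trans (by linarith), le_trans ?_ h2, h4.trans (by linarith)⟩
      rw [one_div_le (by linarith) hr₀]; linarith
    · exact mul_le_mul_of_nonneg_right (by linarith) hh0.le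
    · have h1 := hnear l r hlD hrε _ hω3 i
      have h2 : ab2 (seq ω i - dagger V β n i) ≤ h := by
        by_contra hcon
        exact absurd (hω4 i i.2) (not_le.2 (sq_lt_sq2_of_lt_ab2 hh0.le (not_le.1 hcon)))
      have h3 := ab2_sub_le (seq ω i) (dagger V β n i)
        (𝔪[β] (restr (bdry V n l r) ω) i)
      rw [ab2_sub_comm (dagger V β n i)] at h3
      refine lt_of_le_of_lt h3 ?_
      have h4 : (2 * Cn + 1) * h < cS * h := mul_lt_mul_of_pos_right (by linarith) hh0
      linarith
  set E := exp (-(κ₁ * u)) with hE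
  have hEn : exp (-((n : ℝ) / 2)) ≤ E := hexp _ (by nlinarith)
  have b1 : law V β n {ω | ∃ k ∈ Icc 1 n, τ < sq2 (seq ω k)} ≤ ofReal (C * E) :=
    hbox.trans (ofReal_le_ofReal (by gcongr))
  have b2 : law V β n (⋃ k ∈ (Icc 1 n).filter fun k : ℕ => (k : ℝ) ≤ (1 - ε) * n,
      seq ⁻¹' {v | (v k).2 < r₀}) ≤ ofReal (n * (C₂ * E)) := by
    refine (measure_biUnion_finset_le _ _).trans ((sum_le_card_nsmul _ _
      (ofReal (C₂ * E)) fun k hk => ?_).trans ?_)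
    · rw [mem_filter, mem_Icc] at hk
      refine (law_preimage_le_of_univ hc hV hβ hn0 (measurableSet_lt (by fun_prop)
        measurable_const) (hoff n hn2 k hk.1.1 hk.2)).trans (ofReal_le_ofReal ?_)
      have := hexp (κ₂ * n) (by gcongr)
      gcongr
    · rw [nsmul_eq_mul, ofReal_mul hn0'.le, ofReal_natCast]
      refine mul_le_mul_left (Nat.cast_le.2 ((Finset.card_filter_le _ _).trans ?_)) _
      rw [Nat.card_Icc, Nat.add_sub_cancel]
  have b3 : law V β n (restr (bdry V n l r) ⁻¹' (goodBdry V β δ 1 n l r)ᶜ)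
      ≤ ofReal (2 * C * E) := by
    refine (hb l r hlog hrε δ 1 zero_le_one).1.trans (ofReal_le_ofReal ?_)
    rw [← hu, one_pow, mul_one]
    have e1 := mul_le_mul_of_nonneg_left (hexp (κ * u) (by nlinarith)) hC.le
    have e2 := mul_le_mul_of_nonneg_left hEn hC.le
    rw [mul_assoc, two_mul, add_comm]
    exact add_le_add e1 e2
  have b4 : law V β n (⋃ j ∈ Icc l r, {ω | (h / 2) ^ 2 < sq2 (seq ω j - dagger V β n j)})
      ≤ ofReal (n * (2 * C * E)) := by
    refine (measure_biUnion_finset_le _ _).trans ((sum_le_card_nsmul _ _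
      (ofReal (2 * C * E)) fun k hk => ?_).trans ?_)
    · rw [mem_Icc] at hk
      have h1 : (l : ℝ) ≤ k := mod_cast hk.1
      have h2 : (k : ℝ) ≤ r := mod_cast hk.2
      refine (hsite k (hl.trans hk.1) (by linarith) (by linarith) (h / 2) (by positivity)).trans
        (ofReal_le_ofReal ?_)
      have h3 : κ * n * (h / 2) ^ 2 = κ / 4 * u := by rw [hu, ← natCast_mul_rpow_sq hn0 δ]; ring
      have := hexp (κ * n * (h / 2) ^ 2) (by rw [h3]; gcongr)
      have e1 := mul_le_mul_of_nonneg_left this hC.le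
      have e2 := mul_le_mul_of_nonneg_left hEn hC.le
      linarith
    · rw [nsmul_eq_mul, ofReal_mul hn0'.le, ofReal_natCast, Nat.card_Icc]
      exact mul_le_mul_left (Nat.cast_le.2 (by omega)) _
  refine (measure_mono hsub).trans (((measure_union_le _ _).trans (add_le_add
    ((measure_union_le _ _).trans (add_le_add ((measure_union_le _ _).trans
      (add_le_add b1 b2)) b3)) b4)).trans ?_)
  rw [← ofReal_add (by positivity) (by positivity),
    ← ofReal_add (by positivity) (by positivity),
    ← ofReal_add (by positivity) (by positivity)]
  refine ofReal_le_ofReal ?_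
  have h1 : E = exp (-(κ₁ / 2 * u)) * exp (-(κ₁ / 2 * u)) := by rw [hE, ← exp_add]; ring_nf
  have h2 : C * E + 2 * C * E ≤ n * (3 * C * E) := by
    have := mul_le_mul_of_nonneg_right hn1' (show 0 ≤ 3 * C * E by positivity)
    linarith
  have h3 : n * (3 * C * E) + n * (C₂ * E) + n * (2 * C * E)
      = (5 * C + C₂) * (n * exp (-(κ₁ / 2 * u))) * exp (-(κ₁ / 2 * u)) := by
    rw [h1]; ring
  have h4 := mul_le_mul_of_nonneg_right htail (exp_pos (-(κ₁ / 2 * u))).le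
  linarith

lemma eventually_rnDeriv_nuI (hc₀ : 0 < c₀) (hδ0 : 0 < δ) (hδ1 : δ < 1 / 2) {cS : ℝ} (hcS : 0 < cS)
    (hdens : ∀ T : ℝ, 0 < T → ∃ K₀ : ℝ, 0 < K₀ ∧ ∀ K : ℝ, K₀ ≤ K → ∀ η : ℝ, 0 < η →
      ∀ᶠ n : ℕ in atTop, ∀ l r : ℕ, Admissible c₀ ε n l r → ∀ q₀ ∈ goodBdry V β δ K n l r,
      ∀ A : Set (Config (Icc l r)), MeasurableSet A →
      A ⊆ {x | ∀ k : Icc l r, ab2 (x k - dagger V β n k) ≤ T * (n : ℝ) ^ (δ - 1 / 2)} →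
      nuI V β δ K n l r q₀ A ≤ ofReal (1 + η) * muI V β n l r A ∧
      muI V β n l r A ≤ ofReal (1 + η) * nuI V β δ K n l r q₀ A) :
    ∃ K₀ : ℝ, 0 < K₀ ∧ ∀ K : ℝ, K₀ ≤ K → ∀ η : ℝ, 0 < η → ∀ᶠ n : ℕ in atTop, ∀ l r : ℕ,
      Admissible c₀ ε n l r → ∀ q₀ ∈ goodBdry V β δ K n l r,
        ((nuI V β δ K n l r q₀).restrict (restr (Icc l r) '' eventS V β ε δ cS n l r)
          ≪ muI V β n l r) ∧
        ∀ᵐ ω ∂(law V β n), ω ∈ eventS V β ε δ cS n l r →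
          |((nuI V β δ K n l r q₀).rnDeriv (muI V β n l r)
              (restr (Icc l r) ω)).toReal - 1| ≤ η := by
  obtain ⟨Cn, hCn, hnear⟩ := exists_condMin_near_rpow hc hV hβ hε0 hε1 hδ0 hδ1
  obtain ⟨_, _, _, N₂, _, _, _, hN₂, hbd⟩ := exists_condMin_bounds hc hV hβ hε0 hε1
  obtain ⟨K₀, hK₀, hK⟩ := hdens (cS + Cn * (cS + 1)) (by positivity)
  refine ⟨K₀, hK₀, fun K hKK η hη => ?_⟩
  filter_upwards [hK K hKK η hη, eventually_ge_atTop N₂, hnear cS hcS,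
    eventually_natDegree_lt V hc₀] with n hAll hn2 hnear hdeg l r hA q₀ hq₀
  have hlD := hdeg l r ε hA
  have hcmp := hAll l r hA q₀ hq₀
  obtain ⟨hl, hlr, hlog, hrε, -⟩ := hA
  obtain ⟨hrn, hco, -⟩ := hbd n hn2 l r hlD hrε
  have hr : r + 1 ≤ n := by omega
  have hlaw := law_univ hc hV hβ (show 0 < n by omega)
  have : IsFiniteMeasure (law V β n) := ⟨by rw [hlaw]; exact ENNReal.one_lt_top⟩
  have : IsFiniteMeasure (muI V β n l r) := by unfold muI; infer_instance
  have : IsFiniteMeasure (nuI V β δ K n l r q₀) := ⟨by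
    rw [nuI_apply hc hV hl hr hco δ K q₀ MeasurableSet.univ]
    simp only [nuCond_univ hc hV hl hr hco hβ, lintegral_const, one_mul, mul_one]
    exact ENNReal.add_lt_top.2 ⟨measure_lt_top _ _, measure_lt_top _ _⟩⟩
  have hX := measurableSet_ab2_le (fun k : Icc l r => dagger V β n k)
    ((cS + Cn * (cS + 1)) * (n : ℝ) ^ (δ - 1 / 2))
  obtain ⟨hac, hae⟩ := rnDeriv_near_one hX hη hcmp
  have hS : ∀ ω ∈ eventS V β ε δ cS n l r, restr (Icc l r) ω ∈
      {x : Config (Icc l r) | ∀ k, ab2 (x k - dagger V β n k)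
        ≤ (cS + Cn * (cS + 1)) * (n : ℝ) ^ (δ - 1 / 2)} := fun ω hω k => by
    have h1 := hnear l r hlD hrε _ hω.2.1 k
    have h2 := hω.2.2 k
    have h3 := ab2_sub_le (seq ω k) (𝔪[β] (restr (bdry V n l r) ω) k) (dagger V β n k)
    refine h3.trans ?_
    rw [add_mul]
    exact add_le_add h2.le h1
  refine ⟨(Measure.absolutelyContinuous_of_le (Measure.restrict_mono_set _ ?_)).trans hac, ?_⟩
  · rintro _ ⟨ω, hω, rfl⟩
    exact hS ω hω
  · filter_upwards [ae_of_ae_map (measurable_restr _).aemeasurable hae] with ω h hω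
    exact h (hS ω hω)

end

lemma two_le_of_admissible (hε0 : 0 < ε) (h : Admissible c₀ ε n l r) :
    2 ≤ n ∧ r < n := by
  obtain ⟨hl, hlr, -, hr, -⟩ := h
  have hr0 : (0 : ℝ) < r := mod_cast (by omega : 0 < r)
  have : r < n := by
    by_contra! hcon
    have h1 : (n : ℝ) ≤ r := mod_cast hcon
    have h2 := mul_nonneg hε0.le (Nat.cast_nonneg (α := ℝ) n)
    have h3 := mul_pos hε0 (show (0 : ℝ) < n by linarith)
    linarith
  omega

include hc hV hβ hε0 hε1 in
lemma exists_condMin_near_of_eventS (hc₀ : 0 < c₀) (hδ1 : δ < 1 / 2) {cS : ℝ} (hcS : 0 < cS) :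
    ∃ C c₁ : ℝ, 0 < C ∧ 0 < c₁ ∧ ∀ n l r : ℕ, Admissible c₀ ε n l r →
      ∀ ω ∈ eventS V β ε δ cS n l r, ∀ j : Icc l r,
        ab2 (𝔪[β] (restr (bdry V n l r) ω) j - dagger V β n j)
          ≤ C * max ((n : ℝ) ^ (δ - 1 / 2)
              * exp (-(c₁ * Metric.infDist (j : ℕ) (bdry V n l r : Set ℕ))))
            ((log n) ^ 2 / n) := by
  obtain ⟨C, c₁, N, hC, hc₁, hN, hnear⟩ := exists_condMin_near hc hV hβ hε0 hε1
  obtain ⟨N₂, hN₂⟩ := eventually_atTop.1 ((eventually_ge_atTop N).and ((eventually_ge_atTop 3).and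
    ((eventually_natDegree_lt V hc₀).and (eventually_mul_rpow_le (show δ - 1 / 2 < 0 by linarith) cS
      (show (0 : ℝ) < 1 / 2 by norm_num)))))
  set B := ∑ n ∈ range N₂, ∑ j ∈ range N₂, ab2 (dagger V β n j)
  have hB0 : 0 ≤ B := sum_nonneg fun _ _ => sum_nonneg fun _ _ => ab2_nonneg _
  set C' := (3 * cS + B) * N₂ / log 2 ^ 2 with hC'
  have hC'0 : 0 ≤ C' := by positivity
  refine ⟨C * (cS + 1) + C', c₁, by positivity, hc₁, fun n l r hA ω hω j => ?_⟩
  obtain ⟨hn2, hrn⟩ := two_le_of_admissible hε0 hA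
  have hn0 : (0 : ℝ) < n := mod_cast (by omega : 0 < n)
  set h := (n : ℝ) ^ (δ - 1 / 2)
  set E := exp (-(c₁ * Metric.infDist (j : ℕ) (bdry V n l r : Set ℕ)))
  have hM1 := le_max_left (h * E) ((log n) ^ 2 / n)
  have hM2 := le_max_right (h * E) ((log n) ^ 2 / n)
  set M := max (h * E) ((log n) ^ 2 / n)
  have hM0 : 0 ≤ M := le_trans (by positivity) hM1
  by_cases hn : N₂ ≤ n
  · obtain ⟨h1, h3, hlD, hs⟩ := hN₂ n hn
    have h4 := hnear n h1 l r (hlD l r ε hA) hA.2.2.2.1 _ (by positivity) hs _ hω.2.1 j j.2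
    rw [mfull, mrg_coe] at h4
    have h5 : 1 / (n : ℝ) ≤ M := by
      refine le_trans ?_ hM2
      have h6 : (1 : ℝ) ≤ log n := by
        rw [Real.le_log_iff_exp_le hn0]
        have : (3 : ℝ) ≤ n := mod_cast h3
        linarith [Real.exp_one_lt_d9]
      have : (1 : ℝ) ≤ log n ^ 2 := by nlinarith
      gcongr
    have h6 : cS * h * E + 1 / n ≤ (cS + 1) * M := by
      have := mul_le_mul_of_nonneg_left hM1 hcS.le
      linarith
    have h7 := mul_le_mul_of_nonneg_left h6 hC.le
    have h8 := mul_nonneg hC'0 hM0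
    refine h4.trans ?_
    linarith
  · have hj := mem_Icc.1 j.2
    have h1 : ab2 (dagger V β n j) ≤ B := (single_le_sum
      (f := fun j => ab2 (dagger V β n j)) (fun _ _ => ab2_nonneg _)
        (mem_range.2 (by omega))).trans (single_le_sum
      (f := fun n => ∑ j ∈ range N₂, ab2 (dagger V β n j))
        (fun _ _ => sum_nonneg fun _ _ => ab2_nonneg _) (mem_range.2 (by omega)))
    have hjr : ((j : ℕ) : ℝ) ≤ (1 - ε) * n := le_trans (mod_cast hj.2) hA.2.2.2.1
    obtain ⟨h2, h3, h4⟩ := hω.1 j (hA.1.trans hj.1) hjr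
    have hB' : |entB ω j| ≤ cS := abs_le.2 ⟨by linarith [show 0 < 1 / cS by positivity], h4⟩
    have hh1 : h ≤ 1 := Real.rpow_le_one_of_one_le_of_nonpos (mod_cast (by omega : 1 ≤ n))
      (by linarith)
    have h5 : ab2 (seq ω j - 𝔪[β] (restr (bdry V n l r) ω) j) ≤ cS * 1 :=
      (hω.2.2 j).le.trans (mul_le_mul_of_nonneg_left hh1 hcS.le)
    have h6 : ab2 (seq ω j) ≤ 2 * cS := by
      have : ab2 (seq ω j) = |entA ω j| + |entB ω j| := rfl
      linarith
    have h7 := ab2_sub_le (𝔪[β] (restr (bdry V n l r) ω) j) (seq ω j) (dagger V β n j)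
    rw [ab2_sub_comm (𝔪[β] (restr (bdry V n l r) ω) j) (seq ω j)] at h7
    have h8 := ab2_sub_le (seq ω j) 0 (dagger V β n j)
    rw [sub_zero, zero_sub, ab2_neg] at h8
    have h9 : 3 * cS + B ≤ C' * M := by
      have e1 : log 2 ^ 2 / N₂ ≤ M := by
        refine le_trans ?_ hM2
        have : log 2 ≤ log n := Real.log_le_log (by norm_num) (mod_cast hn2)
        have : (n : ℝ) ≤ N₂ := mod_cast (by omega : n ≤ N₂)
        gcongr
      refine le_of_eq_of_le ?_ (mul_le_mul_of_nonneg_left e1 hC'0)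
      have : (N₂ : ℝ) ≠ 0 := by
        have : 0 < N₂ := by omega
        positivity
      rw [hC']; field_simp
    have h10 : 0 ≤ C * (cS + 1) * M := by positivity
    rw [add_mul]; linarith

/-- A stretched exponential tail bound for large `n` extends to all `n` after enlarging the
constant. -/
lemma exists_one_sub_le {ι : ℕ → Type*} {P : ∀ n, ι n → Prop} {p : ∀ n, ι n → ℝ} {κ s : ℝ}
    (hκ : 0 < κ) (hs1 : s ≤ 1) (hp : ∀ n i, P n i → 0 ≤ p n i ∧ 0 < n)
    (h : ∀ᶠ n : ℕ in atTop, ∀ i, P n i → 1 - exp (-(κ * (n : ℝ) ^ s)) ≤ p n i) :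
    ∃ C₀ : ℝ, 0 < C₀ ∧ ∀ C, C₀ ≤ C → ∀ n i, P n i → 1 - C * exp (-((n : ℝ) ^ s / C)) ≤ p n i := by
  obtain ⟨N, hN⟩ := eventually_atTop.1 h
  refine ⟨1 / κ + 3 + N, by positivity, fun C hC n i hi => ?_⟩
  have hκ' : 0 < 1 / κ := by positivity
  have hC0 : 0 < C := by linarith
  obtain ⟨hp0, hn0⟩ := hp n i hi
  by_cases hn : N ≤ n
  · refine le_trans ?_ (hN n hn i hi)
    have h1 : (n : ℝ) ^ s / C ≤ κ * (n : ℝ) ^ s := by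
      rw [div_le_iff₀ hC0, mul_right_comm]
      refine le_mul_of_one_le_left (by positivity) ?_
      rw [← div_le_iff₀' hκ]; linarith
    have h2 := exp_le_exp.2 (neg_le_neg h1)
    have h3 : exp (-((n : ℝ) ^ s / C)) ≤ C * exp (-((n : ℝ) ^ s / C)) :=
      le_mul_of_one_le_left (exp_pos _).le (by linarith)
    linarith
  · have h1 : (n : ℝ) ^ s ≤ C := by
      have h2 : (n : ℝ) ^ s ≤ (n : ℝ) ^ (1 : ℝ) :=
        Real.rpow_le_rpow_of_exponent_le (mod_cast hn0) hs1
      have h3 : (n : ℝ) ≤ N := mod_cast (not_le.1 hn).le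
      rw [rpow_one] at h2; linarith
    have h2 : exp (-1) ≤ exp (-((n : ℝ) ^ s / C)) :=
      exp_le_exp.2 (neg_le_neg ((div_le_one hC0).2 h1))
    have h3 : exp (-1) * exp 1 = 1 := by rw [← exp_add]; simp
    have h4 : exp 1 < 3 := by linarith [Real.exp_one_lt_d9]
    have h5 := exp_pos (-1)
    have h6 : 1 ≤ C * exp (-1) := by nlinarith
    have h7 := mul_le_mul_of_nonneg_left h2 hC0.le
    linarith

end DysonBeta

theorem propositionp (V : ℝ[X]) (cu : ℝ) (hcu : 0 < cu)
    (hV : ∀ x : ℝ, cu ≤ (derivative (derivative V)).eval x)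
    (β : ℝ) (hβ : 0 < β) (ε : ℝ) (hε0 : 0 < ε) (hε1 : ε < 1)
    (δ : ℝ) (hδ0 : 0 < δ) (hδ1 : δ < 1 / 2) :
    ∃ c₀ : ℝ, 0 < c₀ ∧
      -- total variation distance tends to zero, uniformly in the interval
      (∀ K : ℝ, 0 < K → ∀ η : ℝ, 0 < η → ∀ᶠ n : ℕ in atTop, ∀ l r : ℕ,
        DysonBeta.Admissible c₀ ε n l r → ∀ q₀ ∈ DysonBeta.goodBdry V β δ K n l r,
          DysonBeta.tvDist (DysonBeta.muI V β n l r) (DysonBeta.nuI V β δ K n l r q₀) ≤ η) ∧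
      -- the more precise comparison on the event `S`
      (δ < ε / 3 → ∃ c C c₁ δ' : ℝ, 0 < c ∧ 0 < C ∧ 0 < c₁ ∧ 0 < δ' ∧
        (∀ n l r : ℕ, DysonBeta.Admissible c₀ ε n l r →
          1 - C * Real.exp (-((n : ℝ) ^ δ' / C))
            ≤ (DysonBeta.law V β n).real (DysonBeta.eventS V β ε δ c n l r) ∧
          ∀ ω ∈ DysonBeta.eventS V β ε δ c n l r, ∀ j : Finset.Icc l r,
            |(DysonBeta.condMin V β n l r
                  (DysonBeta.restr (DysonBeta.bdry V n l r) ω) j).1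
                - (DysonBeta.dagger V β n j).1|
              + |(DysonBeta.condMin V β n l r
                  (DysonBeta.restr (DysonBeta.bdry V n l r) ω) j).2
                - (DysonBeta.dagger V β n j).2|
              ≤ C * max ((n : ℝ) ^ (δ - 1 / 2) *
                  Real.exp (-(c₁ * Metric.infDist (j : ℕ)
                    (DysonBeta.bdry V n l r : Set ℕ))))
                ((Real.log n) ^ 2 / n)) ∧
        ∃ K₀ : ℝ, 0 < K₀ ∧ ∀ K : ℝ, K₀ ≤ K → ∀ η : ℝ, 0 < η → ∀ᶠ n : ℕ in atTop, ∀ l r : ℕ,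
          DysonBeta.Admissible c₀ ε n l r → ∀ q₀ ∈ DysonBeta.goodBdry V β δ K n l r,
            ((DysonBeta.nuI V β δ K n l r q₀).restrict
                (DysonBeta.restr (Finset.Icc l r) '' DysonBeta.eventS V β ε δ c n l r)
              ≪ DysonBeta.muI V β n l r) ∧
            ∀ᵐ ω ∂(DysonBeta.law V β n), ω ∈ DysonBeta.eventS V β ε δ c n l r →
              |((DysonBeta.nuI V β δ K n l r q₀).rnDeriv (DysonBeta.muI V β n l r)
                  (DysonBeta.restr (Finset.Icc l r) ω)).toReal - 1| ≤ η) := by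
  open DysonBeta in
  obtain ⟨c₀, C, κ, τ, N, hc₀, hC, hκ, hτ, -, hconc⟩ :=
    exists_bdry_concentration hcu hV hβ hε0 hε1
  refine ⟨c₀, hc₀, fun K hK η hη => ?_, fun hδ => ?_⟩
  · filter_upwards [eventually_tvDist_le hcu hV hβ hε0 hε1 hc₀ hκ hconc
      hδ0 hK hη] with n h l r hA q₀ _
    exact h l r hA q₀
  · obtain ⟨cS, κ', hcS, hκ', hprob⟩ := eventually_law_compl_eventS_le hcu hV hβ hε0 hε1
      hc₀ hδ0 hδ1 hC hκ hconc
    obtain ⟨C₁, c₁, hC₁, hc₁, hmin⟩ :=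
      exists_condMin_near_of_eventS hcu hV hβ hε0 hε1 hc₀ hδ1 hcS
    have hfin : ∀ n : ℕ, 0 < n → IsProbabilityMeasure (law V β n) := fun n hn =>
      ⟨law_univ hcu hV hβ hn⟩
    obtain ⟨C₂, hC₂, htail⟩ := exists_one_sub_le (ι := fun _ => ℕ × ℕ)
      (P := fun n i => Admissible c₀ ε n i.1 i.2)
      (p := fun n i => (law V β n).real (eventS V β ε δ cS n i.1 i.2)) (s := 2 * δ) hκ'
      (by linarith) (fun n i hi => ⟨measureReal_nonneg, by
        have := two_le_of_admissible hε0 hi; omega⟩) (by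
        filter_upwards [hprob cS le_rfl] with n hn i hi
        have := hfin n (by have := two_le_of_admissible hε0 hi; omega)
        have h1 := ENNReal.toReal_mono ENNReal.ofReal_ne_top (hn i.1 i.2 hi)
        rw [ENNReal.toReal_ofReal (Real.exp_pos _).le] at h1
        have h2 := measureReal_union_le (μ := law V β n)
          (eventS V β ε δ cS n i.1 i.2) (eventS V β ε δ cS n i.1 i.2)ᶜ
        rw [Set.union_compl_self, probReal_univ] at h2
        have h3 : (law V β n).real (eventS V β ε δ cS n i.1 i.2)ᶜ
          ≤ Real.exp (-(κ' * (n : ℝ) ^ (2 * δ))) := h1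
        linarith)
    refine ⟨cS, max C₁ C₂, c₁, 2 * δ, hcS, lt_max_of_lt_left hC₁, hc₁, by positivity,
      fun n l r hA => ⟨htail _ (le_max_right _ _) n (l, r) hA, fun ω hω j =>
        (hmin n l r hA ω hω j).trans (mul_le_mul_of_nonneg_right (le_max_left _ _)
          ((by positivity : (0:ℝ) ≤ _).trans (le_max_right _ _)))⟩, ?_⟩
    exact eventually_rnDeriv_nuI hcu hV hβ hε0 hε1 hc₀ hδ0 hδ1 hcS fun T hT =>
      exists_density_bounds hcu hV hβ hε0 hε1 hc₀ hδ0 hδ hC hκ hconc hT
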